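/- **Setting.** Let $V:\mathbb Z\to\mathbb R$ satisfy $|V(n)|\le C\langle n\rangle^{-\beta}$ for some $C$ and some $\beta>0$, where $\langle n\rangle=(1+n^2)^{1/2}$. Put $(\Delta\phi)(n)=\phi(n+1)+\phi(n-1)-2\phi(n)$ and $H=\Delta^2+V$. For $\sigma\in\mathbb R$ let $W_\sigma=\bigcap_{s>\sigma}\ell^{2,-s}(\mathbb Z)$, where $\ell^{2,s}(\mathbb Z)$ is the space of $\phi:\mathbb Z\to\mathbb C$ with $\sum_n\langle n\rangle^{2s}|\phi(n)|^2<\infty$. * $0$ is a *regular point* of $H$ if $H\phi=0$ has no nonzero solution in $W_{3/2}$; a *first kind resonance* if it has one in $W_{3/2}$ but none in $W_{1/2}$; a *second kind resonance* if it has one in $W_{1/2}$ but none in $\ell^2(\mathbb Z)$. * $16$ is a *regular point* of $H$ if $H\phi=16\phi$ has no nonzero solution in $W_{1/2}$; a *resonance* if it has one in $W_{1/2}$ but none in $\ell^2(\mathbb Z)$; an *eigenvalue* if it has one in $\ell^2(\mathbb Z)$. Let $R_0(z)=(\Delta^2-z)^{-1}$ on $\ell^2(\mathbb Z)$ and let $R_0^\pm(\lambda)=\lim_{\varepsilon\downarrow0}R_0(\lambda\pm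 i\varepsilon)$, $\lambda\in(0,16)$, be its boundary values (as integral operators, their kernels being the limits of the kernels of $R_0(\lambda\pm i\varepsilon)$). Let $v(n)=|V(n)|^{1/2}$, let $U$ be multiplication by $\operatorname{sign}V(n)$, with the value $1$ where $V(n)=0$, and for $0<\mu<2$ put $$M^\pm(\mu)=U+vR_0^\pm(\mu^4)v .$$ Let $v_k(n)=n^kv(n)$, $\tilde v_k(n)=(-1)^nv_k(n)$, $\tilde v=\tilde v_0$, and $$T_0=U+vG_0v,\quad G_0(n,m)=\tfrac1{12}\big(|n-m|^3-|n-m|\big),$$ $$\widetilde T_0=U+\tilde v\widetilde G_0\tilde v,\quad \widetilde G_0(n,m)=\tfrac1{32\sqrt2}\big(2\sqrt2|n-m|-(2\sqrt2-3)^{|n-m|}\big).$$ Let $Q,S_0,S_1,S_2,\widetilde Q,\widetilde S_0,\widetilde S_1$ be the orthogonal projections of $\ell^2(\mathbb Z)$ onto, respectively, $\{v\}^\perp$; $\{v,v_1\}^\perp$; $\{f\perp v,v_1:\ S_0T_0f=0\}$; $\{f\perp v,v_1,v_2:\ QT_0f=0\}$; $\{\tilde v\}^\perp$; $\{f\perp\tilde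 v:\ \widetilde Q\widetilde T_0f=0\}$; $\{f\perp\tilde v,\tilde v_1:\ \widetilde T_0f=0\}$. **Theorem.** There is $\mu_0\in(0,1)$ such that for all $0<\mu<\mu_0$ and both signs $\pm$ the operators below are invertible on $\ell^2(\mathbb Z)$ and the following expansions hold. (i) If $0$ is a regular point of $H$ and $\beta>15$, then $$(M^\pm(\mu))^{-1}=S_0A_{01}S_0+\mu QA^{\pm,0}_{11}Q+\mu^2\big(QA^{\pm,0}_{21}Q+S_0A^{\pm,0}_{22}+A^{\pm,0}_{23}S_0\big)+\mu^3A^{\pm,0}_3+\Gamma^0_4(\mu).$$ (ii) If $0$ is a first kind resonance of $H$ and $\beta>19$, then $$(M^\pm(\mu))^{-1}=\mu^{-1}S_1A^\pm_{-1}S_1+\big(S_0A^{\pm,1}_{01}Q+QA^{\pm,1}_{02}S_0\big)+\mu\big(S_0A^{\pm,1}_{11}+A^{\pm,1}_{12}S_0+QA^{\pm,1}_{13}Q\big)+\mu^2\big(QA^{\pm,1}_{21}+A^{\pm,1}_{22}Q\big)+\mu^3A^{\pm,1}_3+\Gamma^1_4(\mu).$$ (iii) If $0$ is a second kind resonance of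 $H$ and $\beta>27$, then $$\begin{aligned}(M^\pm(\mu))^{-1}&=\mu^{-3}S_2A^\pm_{-3}S_2+\mu^{-2}\big(S_2A^\pm_{-2,1}S_0+S_0A^\pm_{-2,2}S_2\big)+\mu^{-1}\big(S_2A^\pm_{-1,1}Q+QA^\pm_{-1,2}S_2+S_0A^\pm_{-1,3}S_0\big)\\&\quad+\big(S_2A^{\pm,2}_{01}+A^{\pm,2}_{02}S_2+QA^{\pm,2}_{03}S_0+S_0A^{\pm,2}_{04}Q\big)+\mu\big(S_0A^{\pm,2}_{11}+A^{\pm,2}_{12}S_0+QA^{\pm,2}_{13}Q\big)\\&\quad+\mu^2\big(QA^{\pm,2}_{21}+A^{\pm,2}_{22}Q\big)+\mu^3A^{\pm,2}_3+\Gamma^2_4(\mu).\end{aligned}$$ (iv) If $16$ is a regular point of $H$ and $\beta>7$, then $$(M^\pm(2-\mu))^{-1}=\widetilde QB_{01}\widetilde Q+\mu^{1/2}B^{\pm,0}_1+\Gamma^0_1(\mu).$$ (v) If $16$ is a resonance of $H$ and $\beta>11$, then $$(M^\pm(2-\mu))^{-1}=\mu^{-1/2}\widetilde S_0B^\pm_{-1}\widetilde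 S_0+\big(\widetilde S_0B^{\pm,1}_{01}+B^{\pm,1}_{02}\widetilde S_0+\widetilde QB^{\pm,1}_{03}\widetilde Q\big)+\mu^{1/2}B^{\pm,1}_1+\Gamma^1_1(\mu).$$ (vi) If $16$ is an eigenvalue of $H$ and $\beta>15$, then $$(M^\pm(2-\mu))^{-1}=\mu^{-1}\widetilde S_1B_{-2}\widetilde S_1+\mu^{-1/2}\big(\widetilde S_0B^\pm_{-1,1}\widetilde Q+\widetilde QB^\pm_{-1,2}\widetilde S_0\big)+\big(\widetilde QB^{\pm,2}_{01}+B^{\pm,2}_{02}\widetilde Q\big)+\mu^{1/2}B^{\pm,2}_1+\Gamma^2_1(\mu).$$ Here all $A$'s and $B$'s are bounded operators on $\ell^2(\mathbb Z)$ that do not depend on $\mu$ (and $A_{01}$ in (i), $B_{01}$ in (iv) and $B_{-2}$ in (vi) do not depend on the sign), and each remainder $\Gamma^i_\ell(\mu)$ (which may depend on the sign) is differentiable in $\mu$ in the operator norm and satisfies, with a constant $C$ independent of $\mu$, $$\|\Gamma^i_\ell(\mu)\|_{\ell^2\to\ell^2}+\mu\,\|\partial_\mu\Gamma^i_\ell(\mu)\|_{\ell^2\to\ell^2}\le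 C\mu^\ell,\qquad 0<\mu<\mu_0 .$$ -/

import Mathlib

open scoped Topology
open Filter

noncomputable section

namespace BiLap

/-- The Hilbert space `ℓ²(ℤ)` of complex sequences. -/
abbrev L2 : Type := lp (fun _ : ℤ => ℂ) 2

/-- Bounded operators on `ℓ²(ℤ)`, with the operator norm. -/
abbrev Op : Type := L2 →L[ℂ] L2

/-! ### The discrete bi-Laplacian and the threshold equations -/

/-- `(Δφ)(n) = φ(n+1) + φ(n-1) - 2φ(n)` on arbitrary sequences. -/
def lap (φ : ℤ → ℂ) (n : ℤ) : ℂ := φ (n + 1) + φ (n - 1) - 2 * φ n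

/-- `φ` solves the difference equation `Hφ = λφ` with `H = Δ² + V`. -/
def Solves (V : ℤ → ℝ) (lam : ℝ) (φ : ℤ → ℂ) : Prop :=
  ∀ n, lap (lap φ) n + (V n : ℂ) * φ n = (lam : ℂ) * φ n

/-- The Japanese bracket `⟨n⟩ = (1 + n²)^{1/2}`. -/
def bracket (n : ℤ) : ℝ := Real.sqrt (1 + (n : ℝ) ^ 2)

/-- `φ ∈ ℓ^{2,s}(ℤ)`. -/
def MemWeighted (s : ℝ) (φ : ℤ → ℂ) : Prop :=
  Summable fun n : ℤ => bracket n ^ (2 * s) * ‖φ n‖ ^ 2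

/-- `φ ∈ W_σ(ℤ) = ⋂_{s > σ} ℓ^{2,-s}(ℤ)`. -/
def MemW (σ : ℝ) (φ : ℤ → ℂ) : Prop := ∀ s : ℝ, σ < s → MemWeighted (-s) φ

/-- `Hφ = λφ` has a nonzero solution in `W_σ(ℤ)`. -/
def HasSolW (V : ℤ → ℝ) (lam σ : ℝ) : Prop := ∃ φ : ℤ → ℂ, φ ≠ 0 ∧ MemW σ φ ∧ Solves V lam φ

/-- `Hφ = λφ` has a nonzero solution in `ℓ²(ℤ)`. -/
def HasSolL2 (V : ℤ → ℝ) (lam : ℝ) : Prop := ∃ φ : ℤ → ℂ, φ ≠ 0 ∧ Memℓp φ 2 ∧ Solves V lam φ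

def ZeroRegular (V : ℤ → ℝ) : Prop := ¬ HasSolW V 0 (3 / 2)

def ZeroFirstKind (V : ℤ → ℝ) : Prop := HasSolW V 0 (3 / 2) ∧ ¬ HasSolW V 0 (1 / 2)

def ZeroSecondKind (V : ℤ → ℝ) : Prop := HasSolW V 0 (1 / 2) ∧ ¬ HasSolL2 V 0

def SixteenRegular (V : ℤ → ℝ) : Prop := ¬ HasSolW V 16 (1 / 2)

def SixteenResonance (V : ℤ → ℝ) : Prop := HasSolW V 16 (1 / 2) ∧ ¬ HasSolL2 V 16

def SixteenEigenvalue (V : ℤ → ℝ) : Prop := HasSolL2 V 16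

/-! ### The free resolvent and its boundary values -/

theorem memℓp_shift (k : ℤ) (f : L2) : Memℓp (fun n : ℤ => f (n + k)) 2 := by
  have h : (0 : ℝ) < (2 : ENNReal).toReal := by norm_num
  have hf := (memℓp_gen_iff h).1 (lp.memℓp f)
  exact (memℓp_gen_iff h).2 ((Equiv.addRight k).summable_iff.2 hf)

/-- The translation `(f(n))ₙ ↦ (f(n+k))ₙ` on `ℓ²(ℤ)`. -/
def shift (k : ℤ) : L2 →ₗᵢ[ℂ] L2 where
  toFun f := ⟨fun n => f (n + k), memℓp_shift k f⟩
  map_add' _ _ := rfl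
  map_smul' _ _ := rfl
  norm_map' f := by
    have h : (0 : ℝ) < (2 : ENNReal).toReal := by norm_num
    rw [lp.norm_eq_tsum_rpow h, lp.norm_eq_tsum_rpow h]
    congr 1
    exact (Equiv.addRight k).tsum_eq (fun n => ‖f n‖ ^ (2 : ENNReal).toReal)

/-- The discrete Laplacian as a bounded operator on `ℓ²(ℤ)`. -/
def lapOp : Op :=
  (shift 1).toContinuousLinearMap + (shift (-1)).toContinuousLinearMap - (2 : ℂ) • (1 : Op)

/-- `R₀(z) = (Δ² - z)⁻¹` on `ℓ²(ℤ)`. -/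
def freeResolvent (z : ℂ) : Op := Ring.inverse (lapOp * lapOp - z • (1 : Op))

/-- The kernel of the boundary value `R₀^±(λ) = lim_{ε ↓ 0} R₀(λ ± iε)`; the sign is `σ ∈ {1, -1}`. -/
def freeBoundary (σ : ℤˣ) (lam : ℝ) (n m : ℤ) : ℂ :=
  limUnder (𝓝[>] (0 : ℝ)) fun ε : ℝ =>
    freeResolvent ((lam : ℂ) + ((σ : ℤ) : ℂ) * (ε : ℂ) * Complex.I) (lp.single 2 m 1) n

/-! ### Operators given by kernels -/

/-- `T` is the operator with kernel `K`: `(Tf)(n) = ∑ₘ K(n,m) f(m)`. -/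
def HasKernel (K : ℤ → ℤ → ℂ) (T : Op) : Prop :=
  ∀ (f : L2) (n : ℤ), HasSum (fun m => K n m * f m) (T f n)

open Classical in
/-- The bounded operator on `ℓ²(ℤ)` with kernel `K` (it is unique; `0` if there is none). -/
def kernelOp (K : ℤ → ℤ → ℂ) : Op :=
  if h : ∃ T : Op, HasKernel K T then h.choose else 0

/-- `U(n) = sign V(n)`, with the value `1` where `V` vanishes, so that `U² = 1`. -/
def signV (V : ℤ → ℝ) (n : ℤ) : ℂ := if 0 ≤ V n then 1 else -1

theorem norm_signV_mul (V : ℤ → ℝ) (n : ℤ) (z : ℂ) : ‖signV V n * z‖ = ‖z‖ := by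
  unfold signV
  split <;> simp

theorem memℓp_signV (V : ℤ → ℝ) (f : L2) : Memℓp (fun n : ℤ => signV V n * f n) 2 := by
  have h : (0 : ℝ) < (2 : ENNReal).toReal := by norm_num
  have hf := (memℓp_gen_iff h).1 (lp.memℓp f)
  refine (memℓp_gen_iff h).2 ?_
  simpa only [norm_signV_mul] using hf

/-- Multiplication by `U`. -/
def signOp (V : ℤ → ℝ) : L2 →ₗᵢ[ℂ] L2 where
  toFun f := ⟨fun n => signV V n * f n, memℓp_signV V f⟩
  map_add' f g := by
    ext n
    exact mul_add _ _ _
  map_smul' c f := by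
    ext n
    exact mul_left_comm _ _ _
  norm_map' f := by
    have h : (0 : ℝ) < (2 : ENNReal).toReal := by norm_num
    rw [lp.norm_eq_tsum_rpow h, lp.norm_eq_tsum_rpow h]
    congr 1
    refine tsum_congr fun n => ?_
    exact congrArg (fun x : ℝ => x ^ (2 : ENNReal).toReal) (norm_signV_mul V n (f n))

/-- The operator `U + wKw`, where `w` acts by multiplication and `K` is the operator with the
given kernel. -/
def sandwich (V w : ℤ → ℝ) (K : ℤ → ℤ → ℂ) : Op :=
  (signOp V).toContinuousLinearMap + kernelOp fun n m => (w n : ℂ) * K n m * (w m : ℂ)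

/-- `v_k(n) = n^k |V(n)|^{1/2}`. -/
def vk (V : ℤ → ℝ) (k : ℕ) (n : ℤ) : ℝ := (n : ℝ) ^ k * Real.sqrt |V n|

/-- `ṽ_k(n) = (-1)^n v_k(n)`. -/
def vkt (V : ℤ → ℝ) (k : ℕ) (n : ℤ) : ℝ := (-1 : ℝ) ^ n * vk V k n

/-- `M^±(μ) = U + v R₀^±(μ⁴) v`. -/
def M (V : ℤ → ℝ) (σ : ℤˣ) (μ : ℝ) : Op := sandwich V (vk V 0) (freeBoundary σ (μ ^ 4))

/-- `G₀(n,m) = (|n-m|³ - |n-m|)/12`. -/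
def G0 (n m : ℤ) : ℂ := (((|n - m| : ℤ) : ℂ) ^ 3 - ((|n - m| : ℤ) : ℂ)) / 12

/-- `G̃₀(n,m) = (2√2 |n-m| - (2√2 - 3)^{|n-m|}) / (32√2)`. -/
def G0t (n m : ℤ) : ℂ :=
  (((2 * Real.sqrt 2 * ((|n - m| : ℤ) : ℝ) - (2 * Real.sqrt 2 - 3) ^ (n - m).natAbs) /
    (32 * Real.sqrt 2) : ℝ) : ℂ)

/-- `T₀ = U + v G₀ v`. -/
def T0 (V : ℤ → ℝ) : Op := sandwich V (vk V 0) G0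

/-- `T̃₀ = U + ṽ G̃₀ ṽ`. -/
def T0t (V : ℤ → ℝ) : Op := sandwich V (vkt V 0) G0t

/-! ### The projections -/

open Classical in
/-- A square-summable real sequence as an element of `ℓ²(ℤ)` (`0` for other sequences). -/
def toL2 (w : ℤ → ℝ) : L2 :=
  if h : Memℓp (fun n => (w n : ℂ)) 2 then ⟨fun n => (w n : ℂ), h⟩ else 0

/-- `{f : ⟨f, w_k⟩ = 0 for all k < N}`. -/
def perp (w : ℕ → ℤ → ℝ) (N : ℕ) : Submodule ℂ L2 :=
  (Submodule.span ℂ ((fun k => toL2 (w k)) '' Set.Iio N))ᗮ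

/-- `{f : ⟨f, w_k⟩ = 0 for all k < N, and T f = 0}`. -/
def perpKer (w : ℕ → ℤ → ℝ) (N : ℕ) (T : Op) : Submodule ℂ L2 :=
  perp w N ⊓ LinearMap.ker (T : L2 →ₗ[ℂ] L2)

instance (w : ℕ → ℤ → ℝ) (N : ℕ) : CompleteSpace (perp w N) := by
  unfold perp
  infer_instance

instance (w : ℕ → ℤ → ℝ) (N : ℕ) (T : Op) : CompleteSpace (perpKer w N T) := by
  have h : IsClosed (perpKer w N T : Set L2) := by
    unfold perpKer perp
    rw [Submodule.coe_inf]
    exact (Submodule.isClosed_orthogonal _).inter (T.isClosed_ker)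
  exact h.completeSpace_coe

/-- `Q`, the orthogonal projection onto `(span {v})^⊥`. -/
def Q (V : ℤ → ℝ) : Op := (perp (vk V) 1).starProjection

/-- `S₀`, the orthogonal projection onto `(span {v, v₁})^⊥`. -/
def S0 (V : ℤ → ℝ) : Op := (perp (vk V) 2).starProjection

/-- `S₁`, the orthogonal projection onto `{f : ⟨f, v_k⟩ = 0, k = 0, 1, S₀T₀f = 0}`. -/
def S1 (V : ℤ → ℝ) : Op := (perpKer (vk V) 2 (S0 V * T0 V)).starProjection

/-- `S₂`, the orthogonal projection onto `{f : ⟨f, v_k⟩ = 0, k = 0, 1, 2, QT₀f = 0}`. -/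
def S2 (V : ℤ → ℝ) : Op := (perpKer (vk V) 3 (Q V * T0 V)).starProjection

/-- `Q̃`, the orthogonal projection onto `(span {ṽ})^⊥`. -/
def Qt (V : ℤ → ℝ) : Op := (perp (vkt V) 1).starProjection

/-- `S̃₀`, the orthogonal projection onto `{f : ⟨f, ṽ⟩ = 0, Q̃T̃₀f = 0}`. -/
def S0t (V : ℤ → ℝ) : Op := (perpKer (vkt V) 1 (Qt V * T0t V)).starProjection

/-- `S̃₁`, the orthogonal projection onto `{f : ⟨f, ṽ_k⟩ = 0, k = 0, 1, T̃₀f = 0}`. -/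
def S1t (V : ℤ → ℝ) : Op := (perpKer (vkt V) 2 (T0t V)).starProjection

/-! ### Expansions -/

/-- On `(0, μ₀)` the operator `N(μ)` is invertible, and its inverse is `E(μ) + Γ(μ)` with
`Γ` differentiable in operator norm and `‖Γ(μ)‖ + μ ‖∂_μ Γ(μ)‖ ≤ C μ^ℓ`. -/
def InverseExpansion (μ₀ : ℝ) (N E : ℝ → Op) (ℓ : ℕ) : Prop :=
  ∃ (Γ Γ' : ℝ → Op) (C : ℝ), ∀ μ ∈ Set.Ioo 0 μ₀,
    IsUnit (N μ) ∧ Ring.inverse (N μ) = E μ + Γ μ ∧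
    HasDerivAt Γ (Γ' μ) μ ∧ ‖Γ μ‖ + μ * ‖Γ' μ‖ ≤ C * μ ^ ℓ

end BiLap

end

open BiLap

/-! Near the threshold 0 put μ = 2y. The free resolvent kernel is an explicit combination of two
exponentials in N = |n-m|, namely (±i (c ± iy)^{2N}/c - (a - y)^{2N}/a) / (32 y³) with c² = 1 - y²
and a² = 1 + y². Taylor expansion in y gives M = ∑_{l ≥ -3} y^l M_l, where M_0 = T_0, M_{-2} = M_2 =
0, and M_{2k-3} for k ≤ 3 has kernel v(n) p(n-m) v(m) with p an even polynomial of degree 2k.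
Expanding p shows that M_{2k-3} has finite rank. Compressed between a subspace with i vanishing
moments and one with j vanishing moments it is zero if i + j > 2k and of rank at most one if i + j =
2k.

All singularities of the inverse are resolved by a single scaling. Split ℓ² by the orthogonal blocks
1-Q, Q-S₀, S₀-S₁, S₁-S₂, S₂ and give them the degrees d = 3, 1, 0, -1, -3. With y = t² and D(t) = ∑
t^{d_i} X_i, the vanishing moments and the kernel conditions on T_0 cancel every negative power of t
in D M D, so D M D = L + O(t). Once L is invertible, (D M D)⁻¹ has an expansion in t and M⁻¹ = D (D
M D)⁻¹ D. The block (i,j) of M⁻¹ starts at t^{d_i + d_j}; reading off which blocks can occur at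
order μ^e gives exactly the asserted shapes. Conjugation by J = ∑ (-1)^{d_i} X_i attaches a parity
to each coefficient and removes the odd powers of t, so only integer powers of y survive
(`graded_inverse`).

L is U plus a compact operator, so it is enough that L be injective. If Lx = 0, pairing the block
equations with x gives a small scalar system in the leading moments of x. The imaginary parts form a
sum of squares and the real parts finish the job, so these moments vanish (`zero_scalar_system`).
Then every block of x falls into a smaller space of the flag and is therefore zero, except for the
last one, an f with four vanishing moments and T_0 f = 0. By the Birman-Schwinger correspondence f =
U v φ with φ = a + bn - G_0 v f, elements of the spaces defining S₁ and S₂, and such f, yield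
solutions of Hφ = 0, and each vanishing moment lowers the growth of φ by one power. The spectral
hypotheses exclude precisely these solutions.

At 16 one writes y = 1 - 2s² with s = √μ/2, conjugates by (-1)^n, and works with y³M, which has an
expansion starting at s^{-1}. The blocks 1-Q̃, Q̃-S̃₀, S̃₀-S̃₁, S̃₁ get degrees 1, 0, -1, -2. The
new ingredient is that on the range of S̃₁ the quadratic form of the s² coefficient is -128‖u‖² with
u = G̃₀ ṽ f, hence definite (`sixteen_positivity`).

The main supports are `freeBoundary_eq`, `zero_expansion`, `sixteen_expansion`, `graded_inverse`,
`isUnit_zero_leading` and `isUnit_sixteen_leading`. -/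

open scoped Topology InnerProductSpace ComplexConjugate
open Filter

noncomputable section

namespace BiLap

/-! ### Calculus of remainders at 0+ that control the function and its scale-invariant derivative.
-/

section Remainder

variable {E : Type*} [NormedAddCommGroup E] [NormedSpace ℝ E]
variable {E' : Type*} [NormedAddCommGroup E'] [NormedSpace ℝ E']
variable {G : Type*} [NormedAddCommGroup G] [NormedSpace ℝ G]

/-- `F` is differentiable near `0+`, with `‖F(t)‖ + t ‖F'(t)‖ = O(t^N)`. -/
def Rem (N : ℤ) (F : ℝ → E) : Prop :=
  ∃ C : ℝ, ∀ᶠ t in 𝓝[>] (0 : ℝ),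
    DifferentiableAt ℝ F t ∧ ‖F t‖ ≤ C * t ^ N ∧ t * ‖deriv F t‖ ≤ C * t ^ N

theorem eventually_pos : ∀ᶠ t in 𝓝[>] (0 : ℝ), 0 < t := eventually_mem_nhdsWithin

theorem eventually_lt {a : ℝ} (ha : 0 < a) : ∀ᶠ t in 𝓝[>] (0 : ℝ), t < a :=
  (eventually_lt_nhds ha).filter_mono nhdsWithin_le_nhds

theorem Rem.of_hasDerivAt {N : ℤ} {F F' : ℝ → E} {C : ℝ}
    (h : ∀ᶠ t in 𝓝[>] (0 : ℝ), HasDerivAt F (F' t) t ∧ ‖F t‖ ≤ C * t ^ N ∧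
      t * ‖F' t‖ ≤ C * t ^ N) : Rem N F := by
  refine ⟨C, h.mono fun t ht => ⟨ht.1.differentiableAt, ht.2.1, ?_⟩⟩
  rw [ht.1.deriv]
  exact ht.2.2

/-- Eventual equality at 0+ is local equality around each small t > 0; this is what allows
derivatives to be compared. -/
theorem eventuallyEq_nhds_of_nhdsGT {α : Type*} {F H : ℝ → α} (h : F =ᶠ[𝓝[>] (0 : ℝ)] H) :
    ∀ᶠ t in 𝓝[>] (0 : ℝ), F =ᶠ[𝓝 t] H := by
  have := eventually_eventually_nhdsWithin.2 h
  filter_upwards [this, eventually_pos] with t ht h0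
  rwa [IsOpen.nhdsWithin_eq isOpen_Ioi h0] at ht

theorem Rem.congr {N : ℤ} {F H : ℝ → E} (hF : Rem N F) (h : F =ᶠ[𝓝[>] (0 : ℝ)] H) : Rem N H := by
  obtain ⟨C, hC⟩ := hF
  refine ⟨C, ?_⟩
  filter_upwards [hC, eventuallyEq_nhds_of_nhdsGT h] with t ht he
  rw [← he.deriv_eq, ← he.eq_of_nhds]
  exact ⟨(he.differentiableAt_iff).1 ht.1, ht.2⟩

theorem Rem.add {N : ℤ} {F H : ℝ → E} (hF : Rem N F) (hH : Rem N H) :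
    Rem N (fun t => F t + H t) := by
  obtain ⟨C, hC⟩ := hF
  obtain ⟨D, hD⟩ := hH
  refine Rem.of_hasDerivAt (F' := fun t => deriv F t + deriv H t) (C := C + D) ?_
  filter_upwards [hC, hD, eventually_pos] with t h1 h2 h0
  refine ⟨h1.1.hasDerivAt.add h2.1.hasDerivAt, ?_, ?_⟩
  · rw [add_mul]
    exact (norm_add_le _ _).trans (add_le_add h1.2.1 h2.2.1)
  · rw [add_mul]
    refine le_trans ?_ (add_le_add h1.2.2 h2.2.2)
    rw [← mul_add]
    exact mul_le_mul_of_nonneg_left (norm_add_le _ _) h0.le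

theorem Rem.clm {N : ℤ} {F : ℝ → E} (L : E →L[ℝ] E') (hF : Rem N F) :
    Rem N (fun t => L (F t)) := by
  obtain ⟨C, hC⟩ := hF
  refine Rem.of_hasDerivAt (F' := fun t => L (deriv F t)) (C := ‖L‖ * C) ?_
  filter_upwards [hC, eventually_pos] with t h1 h0
  refine ⟨L.hasFDerivAt.comp_hasDerivAt t h1.1.hasDerivAt, ?_, ?_⟩
  · refine (L.le_opNorm _).trans ?_
    rw [mul_assoc]
    exact mul_le_mul_of_nonneg_left h1.2.1 (norm_nonneg _)
  · calc t * ‖L (deriv F t)‖ ≤ t * (‖L‖ * ‖deriv F t‖) :=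
          mul_le_mul_of_nonneg_left (L.le_opNorm _) h0.le
      _ = ‖L‖ * (t * ‖deriv F t‖) := by ring
      _ ≤ ‖L‖ * (C * t ^ N) := mul_le_mul_of_nonneg_left h1.2.2 (norm_nonneg _)
      _ = _ := by ring

theorem Rem.neg {N : ℤ} {F : ℝ → E} (hF : Rem N F) : Rem N (fun t => -F t) := by
  simpa using hF.clm (-ContinuousLinearMap.id ℝ E)

theorem Rem.sub {N : ℤ} {F H : ℝ → E} (hF : Rem N F) (hH : Rem N H) :
    Rem N (fun t => F t - H t) := by
  simpa only [sub_eq_add_neg] using hF.add hH.neg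

theorem Rem.zero (N : ℤ) : Rem N (fun _ : ℝ => (0 : E)) := by
  refine Rem.of_hasDerivAt (F' := fun _ => 0) (C := 0) (Eventually.of_forall fun t => ?_)
  exact ⟨hasDerivAt_const _ _, by simp, by simp⟩

theorem Rem.const (c : E) : Rem 0 (fun _ : ℝ => c) := by
  refine Rem.of_hasDerivAt (F' := fun _ => 0) (C := ‖c‖) (Eventually.of_forall fun t => ?_)
  exact ⟨hasDerivAt_const _ _, by simp, by simp⟩

theorem Rem.sum {ι : Type*} {N : ℤ} (s : Finset ι) {F : ι → ℝ → E} (h : ∀ i ∈ s, Rem N (F i)) :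
    Rem N (fun t => ∑ i ∈ s, F i t) := by
  classical
  induction s using Finset.induction_on with
  | empty => simpa using Rem.zero N
  | insert a s ha ih =>
    simp only [Finset.sum_insert ha]
    exact (h a (by simp)).add (ih fun i hi => h i (by simp [hi]))

theorem Rem.mono {N N' : ℤ} {F : ℝ → E} (hF : Rem N F) (h : N' ≤ N) : Rem N' F := by
  obtain ⟨C, hC⟩ := hF
  refine ⟨|C|, ?_⟩
  filter_upwards [hC, eventually_pos, eventually_lt one_pos] with t h1 h0 hlt
  have hp : C * t ^ N ≤ |C| * t ^ N' := by
    have h2 : t ^ N ≤ t ^ N' := zpow_le_zpow_right_of_le_one₀ h0 hlt.le h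
    calc C * t ^ N ≤ |C| * t ^ N := mul_le_mul_of_nonneg_right (le_abs_self _) (by positivity)
      _ ≤ _ := mul_le_mul_of_nonneg_left h2 (abs_nonneg _)
  exact ⟨h1.1, h1.2.1.trans hp, h1.2.2.trans hp⟩

theorem Rem.bilin {N N' : ℤ} {F : ℝ → E} {H : ℝ → E'} (B : E →L[ℝ] E' →L[ℝ] G)
    (hF : Rem N F) (hH : Rem N' H) : Rem (N + N') (fun t => B (F t) (H t)) := by
  obtain ⟨C, hC⟩ := hF
  obtain ⟨D, hD⟩ := hH
  refine Rem.of_hasDerivAt (F' := fun t => B (F t) (deriv H t) + B (deriv F t) (H t))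
    (C := 2 * ‖B‖ * C * D) ?_
  filter_upwards [hC, hD, eventually_pos] with t h1 h2 h0
  have hB : ∀ x y, ‖B x y‖ ≤ ‖B‖ * ‖x‖ * ‖y‖ := B.le_opNorm₂
  have e : t ^ (N + N') = t ^ N * t ^ N' := zpow_add₀ h0.ne' _ _
  have p1 : 0 ≤ C * t ^ N := (norm_nonneg _).trans h1.2.1
  have p2 : 0 ≤ D * t ^ N' := (norm_nonneg _).trans h2.2.1
  have key : ‖B‖ * (C * t ^ N) * (D * t ^ N') = ‖B‖ * C * D * t ^ (N + N') := by rw [e]; ring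
  have b1 : ‖B‖ * ‖F t‖ * ‖H t‖ ≤ ‖B‖ * (C * t ^ N) * (D * t ^ N') := by
    gcongr
    exacts [h1.2.1, h2.2.1]
  have pk : 0 ≤ ‖B‖ * (C * t ^ N) * (D * t ^ N') := by positivity
  refine ⟨B.hasDerivAt_of_bilinear (fun _ => h1.1.hasDerivAt) (fun _ => h2.1.hasDerivAt), ?_, ?_⟩
  · have := hB (F t) (H t)
    linarith
  · have b2 : ‖B‖ * ‖F t‖ * (t * ‖deriv H t‖) ≤ ‖B‖ * (C * t ^ N) * (D * t ^ N') := by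
      exact mul_le_mul (mul_le_mul_of_nonneg_left h1.2.1 (by positivity)) h2.2.2
        (by positivity) (by positivity)
    have b3 : ‖B‖ * (t * ‖deriv F t‖) * ‖H t‖ ≤ ‖B‖ * (C * t ^ N) * (D * t ^ N') := by
      exact mul_le_mul (mul_le_mul_of_nonneg_left h1.2.2 (by positivity)) h2.2.1
        (by positivity) (by positivity)
    have b4 := norm_add_le (B (F t) (deriv H t)) (B (deriv F t) (H t))
    have b5 := hB (F t) (deriv H t)
    have b6 := hB (deriv F t) (H t)
    have b7 : t * ‖B (F t) (deriv H t) + B (deriv F t) (H t)‖ ≤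
        t * (‖B‖ * ‖F t‖ * ‖deriv H t‖ + ‖B‖ * ‖deriv F t‖ * ‖H t‖) :=
      mul_le_mul_of_nonneg_left (by linarith) h0.le
    linarith

theorem Rem.mul {R : Type*} [NormedRing R] [NormedAlgebra ℝ R] {N N' : ℤ} {F H : ℝ → R}
    (hF : Rem N F) (hH : Rem N' H) : Rem (N + N') (fun t => F t * H t) := by
  simpa using Rem.bilin (ContinuousLinearMap.mul ℝ R) hF hH

theorem Rem.smul {N N' : ℤ} {f : ℝ → ℝ} {H : ℝ → E} (hf : Rem N f) (hH : Rem N' H) :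
    Rem (N + N') (fun t => f t • H t) := by
  simpa using Rem.bilin (ContinuousLinearMap.lsmul ℝ ℝ) hf hH

theorem Rem.zpow (k : ℤ) : Rem k (fun t : ℝ => t ^ k) := by
  refine Rem.of_hasDerivAt (F' := fun t => k * t ^ (k - 1)) (C := 1 + |(k : ℝ)|) ?_
  filter_upwards [eventually_pos] with t h0
  have hp : 0 < t ^ k := by positivity
  refine ⟨hasDerivAt_zpow _ _ (Or.inl h0.ne'), ?_, ?_⟩
  · rw [Real.norm_eq_abs, abs_of_pos hp]
    nlinarith [abs_nonneg (k : ℝ)]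
  · rw [norm_mul, Real.norm_eq_abs, Real.norm_eq_abs, abs_of_pos (by positivity : 0 < t ^ (k - 1))]
    have : t * (|(k : ℝ)| * t ^ (k - 1)) = |(k : ℝ)| * t ^ k := by
      rw [zpow_sub_one₀ h0.ne']
      field_simp
    rw [this]
    nlinarith [abs_nonneg (k : ℝ)]

theorem Rem.zpow_smul {N : ℤ} {F : ℝ → E} (k : ℤ) (hF : Rem N F) :
    Rem (k + N) (fun t => t ^ k • F t) := (Rem.zpow k).smul hF

theorem Rem.zpow_smul_const (k : ℤ) (c : E) : Rem k (fun t : ℝ => t ^ k • c) := by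
  simpa using Rem.zpow_smul k (Rem.const c)

theorem Rem.const_smul {𝕜 : Type*} [NormedField 𝕜] [NormedSpace 𝕜 E]
    [SMulCommClass ℝ 𝕜 E] {N : ℤ} {F : ℝ → E} (c : 𝕜) (hF : Rem N F) :
    Rem N (fun t => c • F t) :=
  hF.clm (c • ContinuousLinearMap.id ℝ E)

theorem tendsto_nhdsGT_of_pos {g : ℝ → ℝ} (hg : Tendsto g (𝓝 0) (𝓝 0))
    (hpos : ∀ t, 0 < t → 0 < g t) : Tendsto g (𝓝[>] 0) (𝓝[>] 0) :=
  tendsto_nhdsWithin_iff.2 ⟨hg.mono_left nhdsWithin_le_nhds,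
    eventually_pos.mono fun t ht => hpos t ht⟩

theorem tendsto_sq_nhdsGT : Tendsto (fun t : ℝ => t ^ 2) (𝓝[>] 0) (𝓝[>] 0) := by
  refine tendsto_nhdsGT_of_pos ?_ fun t ht => by positivity
  have : Continuous fun t : ℝ => t ^ 2 := by fun_prop
  simpa using this.tendsto 0

theorem tendsto_sqrt_nhdsGT : Tendsto Real.sqrt (𝓝[>] 0) (𝓝[>] 0) := by
  refine tendsto_nhdsGT_of_pos ?_ fun t ht => Real.sqrt_pos.2 ht
  simpa using Real.continuous_sqrt.tendsto 0

theorem tendsto_const_mul_nhdsGT {c : ℝ} (hc : 0 < c) :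
    Tendsto (fun t : ℝ => c * t) (𝓝[>] 0) (𝓝[>] 0) := by
  refine tendsto_nhdsGT_of_pos ?_ fun t ht => by positivity
  have : Continuous fun t : ℝ => c * t := by fun_prop
  simpa using this.tendsto 0

/-- The operator t d/dt is invariant under t ↦ t^α up to the factor α, so power substitutions
preserve the class of remainders and only multiply the order. The same holds for `Rem.comp_sqrt`. -/
theorem Rem.comp_sq {N : ℤ} {F : ℝ → E} (hF : Rem N F) : Rem (2 * N) (fun t => F (t ^ 2)) := by
  obtain ⟨C, hC⟩ := hF
  refine Rem.of_hasDerivAt (F' := fun t => (2 * t) • deriv F (t ^ 2)) (C := 2 * C) ?_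
  filter_upwards [tendsto_sq_nhdsGT.eventually hC, eventually_pos] with t h1 h0
  have e : (t ^ 2) ^ N = t ^ (2 * N) := by rw [zpow_mul]; norm_cast
  rw [e] at h1
  have hC0 : 0 ≤ C * t ^ (2 * N) := (norm_nonneg _).trans h1.2.1
  refine ⟨?_, by linarith [h1.2.1], ?_⟩
  · have h2 : HasDerivAt (fun t : ℝ => t ^ 2) (2 * t) t := by simpa using hasDerivAt_pow 2 t
    exact HasDerivAt.scomp t h1.1.hasDerivAt h2
  · rw [norm_smul, Real.norm_eq_abs, abs_of_pos (by positivity)]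
    nlinarith [h1.2.2]

theorem Rem.comp_sqrt {N : ℤ} {F : ℝ → E} (hF : Rem (2 * N) F) :
    Rem N (fun t => F (Real.sqrt t)) := by
  obtain ⟨C, hC⟩ := hF
  refine Rem.of_hasDerivAt (F' := fun t => (1 / (2 * Real.sqrt t)) • deriv F (Real.sqrt t))
    (C := C) ?_
  filter_upwards [tendsto_sqrt_nhdsGT.eventually hC, eventually_pos] with t h1 h0
  have e : Real.sqrt t ^ (2 * N) = t ^ N := by
    rw [zpow_mul]
    norm_cast
    rw [Real.sq_sqrt h0.le]
  rw [e] at h1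
  have hs := Real.sqrt_pos.2 h0
  refine ⟨HasDerivAt.scomp t h1.1.hasDerivAt (Real.hasDerivAt_sqrt h0.ne'), h1.2.1, ?_⟩
  rw [norm_smul, Real.norm_eq_abs, abs_of_pos (by positivity)]
  have e2 : t * (1 / (2 * Real.sqrt t) * ‖deriv F (Real.sqrt t)‖) =
      (1 / 2) * (Real.sqrt t * ‖deriv F (Real.sqrt t)‖) := by
    have : t = Real.sqrt t * Real.sqrt t := (Real.mul_self_sqrt h0.le).symm
    nth_rewrite 1 [this]
    field_simp
  rw [e2]
  have : 0 ≤ Real.sqrt t * ‖deriv F (Real.sqrt t)‖ := by positivity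
  linarith [h1.2.2]

theorem Rem.comp_mul {N : ℤ} {F : ℝ → E} (hF : Rem N F) {c : ℝ} (hc : 0 < c) :
    Rem N (fun t => F (c * t)) := by
  obtain ⟨C, hC⟩ := hF
  refine Rem.of_hasDerivAt (F' := fun t => c • deriv F (c * t)) (C := C * c ^ N) ?_
  filter_upwards [(tendsto_const_mul_nhdsGT hc).eventually hC, eventually_pos] with t h1 h0
  rw [mul_zpow] at h1
  refine ⟨?_, by linarith [h1.2.1], ?_⟩
  · have h2 : HasDerivAt (fun t : ℝ => c * t) c t := by simpa using (hasDerivAt_id t).const_mul c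
    exact HasDerivAt.scomp t h1.1.hasDerivAt h2
  · rw [norm_smul, Real.norm_eq_abs, abs_of_pos hc]
    nlinarith [h1.2.2]

end Remainder

/-! ### Finite expansions in t with coefficients of alternating parity, stable under products and
inverses. -/

section Expansion

variable {R : Type*} [NormedRing R] [NormedAlgebra ℝ R]

/-- `F` has an expansion in powers of `t` up to order `k` whose coefficients have alternating
parity, starting from `ε`, with respect to conjugation by `J`. -/
def Exp (J : R) : ℕ → ℝ → (ℝ → R) → Prop
  | 0, _, F => Rem 0 F
  | k + 1, ε, F => ∃ (c : R) (H : ℝ → R), J * c = ε • (c * J) ∧ Exp J k (-ε) H ∧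
      F =ᶠ[𝓝[>] (0 : ℝ)] fun t => c + t • H t

/-- An even expansion with leading coefficient `c`. -/
def ExpLead (J : R) (k : ℕ) (c : R) (F : ℝ → R) : Prop :=
  J * c = c * J ∧ ∃ H : ℝ → R, Exp J k (-1) H ∧ F =ᶠ[𝓝[>] (0 : ℝ)] fun t => c + t • H t

variable {J : R}

theorem ExpLead.exp {k : ℕ} {c : R} {F : ℝ → R} (h : ExpLead J k c F) : Exp J (k + 1) 1 F := by
  obtain ⟨h1, H, h2, h3⟩ := h
  exact ⟨c, H, by simpa using h1, h2, h3⟩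

theorem Exp.congr {k : ℕ} {ε : ℝ} {F H : ℝ → R} (hF : Exp J k ε F)
    (h : F =ᶠ[𝓝[>] (0 : ℝ)] H) : Exp J k ε H := by
  cases k with
  | zero => exact Rem.congr hF h
  | succ k =>
    obtain ⟨c, F', h1, h2, h3⟩ := hF
    exact ⟨c, F', h1, h2, h.symm.trans h3⟩

theorem Rem.id_smul {E : Type*} [NormedAddCommGroup E] [NormedSpace ℝ E] {N : ℤ} {F : ℝ → E}
    (hF : Rem N F) : Rem (1 + N) (fun t => t • F t) := by
  simpa using Rem.zpow_smul 1 hF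

theorem Exp.rem {k : ℕ} {ε : ℝ} {F : ℝ → R} (hF : Exp J k ε F) : Rem 0 F := by
  induction k generalizing ε F with
  | zero => exact hF
  | succ k ih =>
    obtain ⟨c, F', h1, h2, h3⟩ := hF
    exact ((Rem.const c).add ((ih h2).id_smul.mono (by norm_num))).congr h3.symm

theorem Exp.of_succ {k : ℕ} {ε : ℝ} {F : ℝ → R} (hF : Exp J (k + 1) ε F) : Exp J k ε F := by
  induction k generalizing ε F with
  | zero => exact hF.rem
  | succ k ih =>
    obtain ⟨c, F', h1, h2, h3⟩ := hF
    exact ⟨c, F', h1, ih h2, h3⟩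

theorem Exp.add {k : ℕ} {ε : ℝ} {F H : ℝ → R} (hF : Exp J k ε F) (hH : Exp J k ε H) :
    Exp J k ε (fun t => F t + H t) := by
  induction k generalizing ε F H with
  | zero => exact Rem.add hF hH
  | succ k ih =>
    obtain ⟨c, F', h1, h2, h3⟩ := hF
    obtain ⟨c', H', h1', h2', h3'⟩ := hH
    refine ⟨c + c', fun t => F' t + H' t, ?_, ih h2 h2', ?_⟩
    · rw [mul_add, add_mul, smul_add, h1, h1']
    · filter_upwards [h3, h3'] with t e e'
      rw [e, e', smul_add]
      abel

theorem Exp.zero (k : ℕ) (ε : ℝ) : Exp J k ε (fun _ => 0) := by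
  induction k generalizing ε with
  | zero => exact Rem.zero 0
  | succ k ih => exact ⟨0, fun _ => 0, by simp, ih _, by simp⟩

theorem Exp.const {c : R} {ε : ℝ} (k : ℕ) (h : J * c = ε • (c * J)) :
    Exp J k ε (fun _ => c) := by
  cases k with
  | zero => exact Rem.const c
  | succ k => exact ⟨c, fun _ => 0, h, Exp.zero _ _, by simp⟩

theorem Exp.id_smul {k : ℕ} {ε : ℝ} {F : ℝ → R} (hF : Exp J k (-ε) F) :
    Exp J (k + 1) ε (fun t => t • F t) :=
  ⟨0, F, by simp, hF, by simp⟩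

/-- Peeling one term off each factor, (c + tF')(c' + tH') = cc' + t(cH' + F'H). The second summand
keeps the whole of H, truncated by one order, so the induction closes. -/
theorem Exp.mul {k : ℕ} {ε δ : ℝ} {F H : ℝ → R} (hF : Exp J k ε F) (hH : Exp J k δ H) :
    Exp J k (ε * δ) (fun t => F t * H t) := by
  induction k generalizing ε δ F H with
  | zero => simpa using! Rem.mul hF hH
  | succ k ih =>
    have hH0 := hH
    obtain ⟨c, F', h1, h2, h3⟩ := hF
    obtain ⟨c', H', h1', h2', h3'⟩ := hH
    refine ⟨c * c', fun t => c * H' t + F' t * H t, ?_, ?_, ?_⟩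
    · rw [← mul_assoc, h1, smul_mul_assoc, mul_assoc c J, h1', mul_smul_comm, smul_smul,
        mul_assoc]
    · have a1 := ih (Exp.const k h1) h2'
      have a2 := ih h2 hH0.of_succ
      have e1 : ε * -δ = -(ε * δ) := by ring
      have e2 : -ε * δ = -(ε * δ) := by ring
      rw [e1] at a1
      rw [e2] at a2
      exact a1.add a2
    · filter_upwards [h3, h3'] with t e e'
      rw [e, add_mul]
      nth_rewrite 1 [e']
      simp only [mul_add, smul_add, smul_mul_assoc, mul_smul_comm]
      abel

/-- A remainder of order at least k can be divided by t up to k times, so it counts as an expansion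
with zero coefficients, of either parity. -/
theorem Exp.of_rem {k : ℕ} {ε : ℝ} {F : ℝ → R} {N : ℤ} (hN : (k : ℤ) ≤ N) (hF : Rem N F) :
    Exp J k ε F := by
  induction k generalizing ε N F with
  | zero => exact hF.mono hN
  | succ k ih =>
    refine ⟨0, fun t => t ^ (-1 : ℤ) • F t, by simp, ?_, ?_⟩
    · exact ih (N := -1 + N) (by push_cast at hN; omega) (Rem.zpow_smul (-1) hF)
    · filter_upwards [eventually_pos] with t ht
      simp [smul_smul, ht.ne']

theorem Exp.pow_smul {c : R} {ε : ℝ} (k j : ℕ) (h : J * c = (ε * (-1) ^ j) • (c * J)) :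
    Exp J k ε (fun t => t ^ j • c) := by
  induction j generalizing k ε with
  | zero => simpa using Exp.const k (by simpa using h)
  | succ j ih =>
    have := (ih (ε := -ε) (k + 1) (by rw [h, pow_succ]; ring_nf)).of_succ
    refine (this.id_smul).of_succ.congr (Eventually.of_forall fun t => ?_)
    simp only [smul_smul, pow_succ']

theorem ExpLead.add {k : ℕ} {c d : R} {F H : ℝ → R} (hF : ExpLead J k c F)
    (hH : ExpLead J k d H) : ExpLead J k (c + d) (fun t => F t + H t) := by
  obtain ⟨h1, F', h2, h3⟩ := hF
  obtain ⟨h1', H', h2', h3'⟩ := hH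
  refine ⟨by rw [mul_add, add_mul, h1, h1'], fun t => F' t + H' t, h2.add h2', ?_⟩
  filter_upwards [h3, h3'] with t e e'
  rw [e, e', smul_add]
  abel

theorem ExpLead.zero (k : ℕ) : ExpLead J k 0 (fun _ => 0) :=
  ⟨by simp, fun _ => 0, Exp.zero _ _, by simp⟩

theorem ExpLead.sum {ι : Type*} {k : ℕ} (s : Finset ι) {c : ι → R} {F : ι → ℝ → R}
    (h : ∀ i ∈ s, ExpLead J k (c i) (F i)) :
    ExpLead J k (∑ i ∈ s, c i) (fun t => ∑ i ∈ s, F i t) := by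
  classical
  induction s using Finset.induction_on with
  | empty => simpa using ExpLead.zero k
  | insert a s ha ih =>
    simp only [Finset.sum_insert ha]
    exact (h a (by simp)).add (ih fun i hi => h i (by simp [hi]))

theorem ExpLead.congr {k : ℕ} {c : R} {F H : ℝ → R} (hF : ExpLead J k c F)
    (h : F =ᶠ[𝓝[>] (0 : ℝ)] H) : ExpLead J k c H := by
  obtain ⟨h1, F', h2, h3⟩ := hF
  exact ⟨h1, F', h2, h.symm.trans h3⟩

theorem ExpLead.const {c : R} (k : ℕ) (h : J * c = c * J) : ExpLead J k c (fun _ => c) :=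
  ⟨h, fun _ => 0, Exp.zero _ _, by simp⟩

theorem ExpLead.id_smul {k : ℕ} {F : ℝ → R} (hF : Exp J k (-1) F) :
    ExpLead J k 0 (fun t => t • F t) :=
  ⟨by simp, F, hF, by simp⟩

theorem ExpLead.of_rem {k : ℕ} {F : ℝ → R} {N : ℤ} (hN : (k : ℤ) + 1 ≤ N) (hF : Rem N F) :
    ExpLead J k 0 F := by
  have h1 : Exp J k (-1) (fun t => t ^ (-1 : ℤ) • F t) :=
    Exp.of_rem (N := -1 + N) (by omega) (Rem.zpow_smul (-1) hF)
  refine (ExpLead.id_smul h1).congr ?_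
  filter_upwards [eventually_pos] with t ht
  simp [smul_smul, ht.ne']

theorem ExpLead.zpow_smul {c : R} (k : ℕ) {j : ℤ} (hj : 0 < j)
    (h : J * c = (-1 : ℝ) ^ j • (c * J)) : ExpLead J k 0 (fun t => t ^ j • c) := by
  obtain ⟨i, rfl⟩ : ∃ i : ℕ, j = i + 1 := ⟨(j - 1).toNat, by omega⟩
  have h1 : Exp J k (-1) (fun t => t ^ i • c) := by
    refine Exp.pow_smul k i ?_
    rw [h]
    congr 1
    rw [zpow_add₀ (by norm_num)]
    simp
  refine (ExpLead.id_smul h1).congr (Eventually.of_forall fun t => ?_)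
  simp only [smul_smul]
  congr 1
  norm_cast
  rw [pow_succ']

theorem ExpLead.mul {k : ℕ} {c d : R} {F H : ℝ → R} (hF : ExpLead J k c F)
    (hH : ExpLead J k d H) : ExpLead J k (c * d) (fun t => F t * H t) := by
  have hH' := hH.exp.of_succ
  obtain ⟨h1, F', h2, h3⟩ := hF
  obtain ⟨h1', H', h2', h3'⟩ := hH
  refine ⟨by rw [← mul_assoc, h1, mul_assoc, h1', mul_assoc], fun t => c * H' t + F' t * H t,
    ?_, ?_⟩
  · have a1 := Exp.mul (Exp.const (ε := 1) k (by simpa using h1)) h2'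
    have a2 := Exp.mul h2 hH'
    rw [one_mul] at a1
    rw [mul_one] at a2
    exact a1.add a2
  · filter_upwards [h3, h3'] with t e e'
    rw [e, add_mul]
    nth_rewrite 1 [e']
    simp only [mul_add, smul_add, smul_mul_assoc, mul_smul_comm]
    abel

theorem Exp.coeffs {k : ℕ} {ε : ℝ} {F : ℝ → R} (hF : Exp J k ε F) :
    ∃ c : ℕ → R, (∀ j, J * c j = (ε * (-1) ^ j) • (c j * J)) ∧
      Rem k (fun t => F t - ∑ j ∈ Finset.range k, t ^ j • c j) := by
  induction k generalizing ε F with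
  | zero => exact ⟨fun _ => 0, by simp, by simpa using! hF⟩
  | succ k ih =>
    obtain ⟨c0, H, h1, h2, h3⟩ := hF
    obtain ⟨c, hc, hr⟩ := ih h2
    refine ⟨fun j => Nat.casesOn j c0 c, fun j => ?_, ?_⟩
    · cases j with
      | zero => simpa using h1
      | succ j =>
        have := hc j
        rw [pow_succ]
        simpa using this
    · have := hr.id_smul
      rw [add_comm] at this
      refine Rem.congr (by exact_mod_cast this) ?_
      filter_upwards [h3] with t e
      rw [e, Finset.sum_range_succ']
      simp only [pow_succ', mul_smul, ← Finset.smul_sum, smul_sub, pow_zero, one_smul, Nat.rec_zero]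
      abel

theorem ExpLead.coeffs {k : ℕ} {c₀ : R} {F : ℝ → R} (hF : ExpLead J k c₀ F) :
    ∃ c : ℕ → R, c 0 = c₀ ∧ (∀ j, J * c j = ((-1 : ℝ) ^ j) • (c j * J)) ∧
      Rem (k + 1) (fun t => F t - ∑ j ∈ Finset.range (k + 1), t ^ j • c j) := by
  obtain ⟨h1, H, h2, h3⟩ := hF
  obtain ⟨c, hc, hr⟩ := h2.coeffs
  refine ⟨fun j => Nat.casesOn j c₀ c, rfl, fun j => ?_, ?_⟩
  · cases j with
    | zero => simpa using h1
    | succ j =>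
      have := hc j
      rw [pow_succ]
      simpa using this
  · have := hr.id_smul
    rw [add_comm] at this
    refine Rem.congr this ?_
    filter_upwards [h3] with t e
    rw [e, Finset.sum_range_succ']
    simp only [pow_succ', mul_smul, ← Finset.smul_sum, smul_sub, pow_zero, one_smul, Nat.rec_zero]
    abel

theorem Rem.tendsto_zero {E : Type*} [NormedAddCommGroup E] [NormedSpace ℝ E] {F : ℝ → E}
    (hF : Rem 1 F) : Tendsto F (𝓝[>] 0) (𝓝 0) := by
  obtain ⟨C, hC⟩ := hF
  refine squeeze_zero_norm' (hC.mono fun t h => h.2.1) ?_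
  have : Continuous fun t : ℝ => C * t ^ (1 : ℤ) := by simpa using! continuous_const.mul continuous_id
  simpa using (this.tendsto 0).mono_left nhdsWithin_le_nhds

variable [CompleteSpace R]

/-- F tends to the unit c, and units form an open set on which inversion is continuous, so the
inverses stay bounded; the derivative -F⁻¹F'F⁻¹ then inherits the bound on F'. -/
theorem Rem.inverse {c : R} (hc : IsUnit c) {F H : ℝ → R} (hH : Rem 0 H)
    (hF : F =ᶠ[𝓝[>] (0 : ℝ)] fun t => c + t • H t) :
    (∀ᶠ t in 𝓝[>] (0 : ℝ), IsUnit (F t)) ∧ Rem 0 (fun t => Ring.inverse (F t)) := by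
  have hF0 : Rem 0 F := ((Rem.const c).add (hH.id_smul.mono (by norm_num))).congr hF.symm
  have hlim : Tendsto F (𝓝[>] 0) (𝓝 c) := by
    have h1 : Rem 1 (fun t => t • H t) := by simpa using hH.id_smul
    have := h1.tendsto_zero.const_add c
    rw [add_zero] at this
    exact this.congr' hF.symm
  obtain ⟨u, rfl⟩ := hc
  have hunit : ∀ᶠ t in 𝓝[>] (0 : ℝ), IsUnit (F t) := hlim.eventually (Units.nhds u)
  refine ⟨hunit, ?_⟩
  have hinv : Tendsto (fun t => Ring.inverse (F t)) (𝓝[>] 0) (𝓝 (Ring.inverse (u : R))) :=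
    (NormedRing.inverse_continuousAt u).tendsto.comp hlim
  have hbd : ∀ᶠ t in 𝓝[>] (0 : ℝ), ‖Ring.inverse (F t)‖ < ‖Ring.inverse (u : R)‖ + 1 :=
    hinv.norm.eventually (gt_mem_nhds (by linarith))
  obtain ⟨C, hC⟩ := hF0
  set B := ‖Ring.inverse (u : R)‖ + 1 with hB
  have hB0 : 0 ≤ B := by positivity
  refine Rem.of_hasDerivAt
    (F' := fun t => -(Ring.inverse (F t) * deriv F t * Ring.inverse (F t)))
    (C := B + B * B * C) ?_
  filter_upwards [hC, hunit, hbd, eventually_pos] with t h1 h2 h3 h0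
  simp only [zpow_zero, mul_one] at h1 ⊢
  have hC0 : 0 ≤ C := (norm_nonneg _).trans h1.2.1
  refine ⟨?_, by nlinarith [mul_nonneg (mul_nonneg hB0 hB0) hC0], ?_⟩
  · obtain ⟨w, hw⟩ := h2
    have hd := hasFDerivAt_ringInverse (𝕜 := ℝ) w
    rw [hw] at hd
    have := hd.comp_hasDerivAt t h1.1.hasDerivAt
    rw [← hw, Ring.inverse_unit]
    simpa using! this
  · rw [norm_neg]
    have k1 : ‖Ring.inverse (F t) * deriv F t * Ring.inverse (F t)‖ ≤ B * ‖deriv F t‖ * B := by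
      refine (norm_mul_le _ _).trans ?_
      refine mul_le_mul ((norm_mul_le _ _).trans ?_) h3.le (norm_nonneg _) (by positivity)
      exact mul_le_mul_of_nonneg_right h3.le (norm_nonneg _)
    calc _ ≤ t * (B * ‖deriv F t‖ * B) := mul_le_mul_of_nonneg_left k1 h0.le
      _ = B * B * (t * ‖deriv F t‖) := by ring
      _ ≤ B * B * C := mul_le_mul_of_nonneg_left h1.2.2 (by positivity)
      _ ≤ _ := by linarith

theorem ringInverse_comm {A : Type*} [Ring A] {c J : A} (hc : IsUnit c) (h : J * c = c * J) :
    J * Ring.inverse c = Ring.inverse c * J := by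
  obtain ⟨u, rfl⟩ := hc
  rw [Ring.inverse_unit]
  have : Commute J (u : A) := h
  exact this.units_inv_right

/-- The identity F⁻¹ = c⁻¹ + t(-c⁻¹ H F⁻¹) expresses the order j+1 expansion of F⁻¹ through its
order j expansion, starting from the bare boundedness given by `Rem.inverse`. -/
theorem ExpLead.inverse {k : ℕ} {c : R} (hc : IsUnit c) {F : ℝ → R} (hF : ExpLead J k c F) :
    (∀ᶠ t in 𝓝[>] (0 : ℝ), IsUnit (F t)) ∧
      ExpLead J k (Ring.inverse c) (fun t => Ring.inverse (F t)) := by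
  obtain ⟨h1, H, h2, h3⟩ := hF
  obtain ⟨hu, hr⟩ := Rem.inverse hc h2.rem h3
  have hJ := ringInverse_comm hc h1
  have key : (fun t => Ring.inverse (F t)) =ᶠ[𝓝[>] (0 : ℝ)] fun t => Ring.inverse c +
      t • (((fun _ => -Ring.inverse c) t * H t) * Ring.inverse (F t)) := by
    filter_upwards [hu, h3] with t ht e
    have e1 : Ring.inverse c * F t * Ring.inverse (F t) = Ring.inverse c := by
      rw [mul_assoc, Ring.mul_inverse_cancel _ ht, mul_one]
    have e2 : Ring.inverse c * F t = 1 + t • (Ring.inverse c * H t) := by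
      rw [e, mul_add, Ring.inverse_mul_cancel _ hc, mul_smul_comm]
    rw [e2, add_mul, one_mul] at e1
    simp only [neg_mul, smul_neg]
    rw [← smul_mul_assoc, ← sub_eq_add_neg, eq_sub_iff_add_eq]
    exact e1
  have hneg : J * (-Ring.inverse c) = (1 : ℝ) • (-Ring.inverse c * J) := by
    rw [mul_neg, hJ, one_smul, neg_mul]
  -- Bootstrap: each pass through `key` gains one order.
  have main : ∀ j ≤ k, Exp J j (-1) H → Exp J j 1 (fun t => Ring.inverse (F t)) := by
    intro j
    induction j with
    | zero => exact fun _ _ => hr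
    | succ j ih =>
      intro hj hH
      have a := ((Exp.const j hneg).mul hH.of_succ).mul (ih (by omega) hH.of_succ)
      exact ⟨Ring.inverse c, _, by simpa using hJ, by simpa using! a, key⟩
  refine ⟨hu, hJ, _, ?_, key⟩
  have a := ((Exp.const k hneg).mul h2).mul (main k le_rfl h2)
  simpa using! a

end Expansion

/-! ### Block scalings, their parity, and inversion of families that degenerate along the blocks. -/

section Graded

variable {R : Type*} [NormedRing R] [NormedAlgebra ℝ R]
variable {ι : Type*} [Fintype ι]

/-- The scaling `∑ᵢ t^{dᵢ} Xᵢ`. -/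
def scaling (X : ι → R) (d : ι → ℤ) (t : ℝ) : R := ∑ i, t ^ d i • X i

theorem scaling_mul_scaling [DecidableEq ι] {X : ι → R} (hX : ∀ i j, X i * X j = if i = j then X i else 0)
    (d d' : ι → ℤ) {t : ℝ} (ht : 0 < t) :
    scaling X d t * scaling X d' t = scaling X (fun i => d i + d' i) t := by
  simp only [scaling, Finset.sum_mul, Finset.mul_sum, smul_mul_assoc, mul_smul_comm, hX]
  refine Finset.sum_congr rfl fun i _ => ?_
  rw [Finset.sum_eq_single i]
  · simp [smul_smul, zpow_add₀ ht.ne', mul_comm]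
  · intro j _ hj
    simp [hj]
  · simp

theorem scaling_mul_mul_scaling (X : ι → R) (d : ι → ℤ) {t : ℝ} (ht : 0 < t) (A : R) :
    scaling X d t * A * scaling X d t =
      ∑ i, ∑ j, t ^ (d i + d j) • (X i * A * X j) := by
  simp only [scaling, Finset.sum_mul, Finset.mul_sum, smul_mul_assoc, mul_smul_comm, Finset.smul_sum,
    smul_smul]
  rw [Finset.sum_comm]
  refine Finset.sum_congr rfl fun i _ => Finset.sum_congr rfl fun j _ => ?_
  rw [zpow_add₀ ht.ne', mul_comm]

/-- The leading coefficient of `∑ᵢⱼ t^{dᵢ + dⱼ} Xᵢ M Xⱼ`, where `M = ∑ₗ t^{2l} Mₗ`. -/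
def leading (X : ι → R) (d : ι → ℤ) (Mc : ℤ → R) : R :=
  ∑ i, ∑ j, if Even (d i + d j) then X i * Mc (-(d i + d j) / 2) * X j else 0

/-- The coefficient of `t^{2e}` in `∑ᵢⱼ t^{dᵢ + dⱼ} Xᵢ N Xⱼ`, where `N = ∑ₖ t^k cₖ`. -/
def gradedCoeff (X : ι → R) (d : ι → ℤ) (c : ℤ → R) (e : ℤ) : R :=
  ∑ i, ∑ j, X i * c (2 * e - d i - d j) * X j

variable [DecidableEq ι]

/-- The scaling evaluated at t = -1 is the parity operator J = ∑ (-1)^{d_i} X_i. -/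
theorem grading_mul {X : ι → R} (hX : ∀ i j, X i * X j = if i = j then X i else 0)
    (d : ι → ℤ) (i : ι) :
    scaling X d (-1) * X i = (-1 : ℝ) ^ d i • X i := by
  simp only [scaling, Finset.sum_mul, smul_mul_assoc, hX]
  rw [Finset.sum_eq_single i] <;> simp +contextual

theorem mul_grading {X : ι → R} (hX : ∀ i j, X i * X j = if i = j then X i else 0)
    (d : ι → ℤ) (i : ι) :
    X i * scaling X d (-1) = (-1 : ℝ) ^ d i • X i := by
  simp only [scaling, Finset.mul_sum, mul_smul_comm, hX]
  rw [Finset.sum_eq_single i]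
  · simp
  · intro j _ hj
    simp [hj.symm]
  · simp

theorem grading_block {X : ι → R} (hX : ∀ i j, X i * X j = if i = j then X i else 0)
    (d : ι → ℤ) (i j : ι) (A : R) :
    scaling X d (-1) * (X i * A * X j) =
      ((-1 : ℝ) ^ (d i + d j)) • (X i * A * X j * scaling X d (-1)) := by
  rw [mul_assoc (X i * A), mul_grading hX, mul_assoc (X i), ← mul_assoc, grading_mul hX,
    smul_mul_assoc, mul_smul_comm, smul_smul, zpow_add₀ (by norm_num),
    mul_assoc ((-1 : ℝ) ^ d i), ← zpow_add₀ (by norm_num), Even.neg_one_zpow ⟨d j, rfl⟩, mul_one,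
    mul_assoc (X i)]

/-- Comparing the two ways of moving J past a coefficient of parity k multiplies the (i,j) block by
(-1)^{d_i + d_j + k}. When this is -1 the block equals its own negative. This is what removes the
odd powers of t from the inverse. -/
theorem block_eq_zero_of_odd {X : ι → R} (hX : ∀ i j, X i * X j = if i = j then X i else 0)
    (d : ι → ℤ) {i j : ι} {A : R} {k : ℤ}
    (hA : scaling X d (-1) * A = (-1 : ℝ) ^ k • (A * scaling X d (-1)))
    (hodd : Odd (d i + d j + k)) : X i * A * X j = 0 := by
  have h1 : X i * (scaling X d (-1) * A) * X j = (-1 : ℝ) ^ d i • (X i * A * X j) := by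
    rw [← mul_assoc, mul_grading hX, smul_mul_assoc, smul_mul_assoc]
  have h2 : X i * (scaling X d (-1) * A) * X j = (-1 : ℝ) ^ (k + d j) • (X i * A * X j) := by
    rw [hA, mul_smul_comm, smul_mul_assoc, ← mul_assoc, mul_assoc (X i * A), grading_mul hX,
      mul_smul_comm, smul_smul, zpow_add₀ (by norm_num)]
  rw [h1] at h2
  have h3 : (-1 : ℝ) ^ (k + d j) = -(-1 : ℝ) ^ d i := by
    rcases Int.even_or_odd (d i) with h | h
    · have : Odd (k + d j) := by
        rcases hodd with ⟨a, ha⟩; rcases h with ⟨b, hb⟩; exact ⟨a - b, by omega⟩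
      rw [h.neg_one_zpow, this.neg_one_zpow]
    · have : Even (k + d j) := by
        rcases hodd with ⟨a, ha⟩; rcases h with ⟨b, hb⟩; exact ⟨a - b, by omega⟩
      rw [h.neg_one_zpow, this.neg_one_zpow]
      norm_num
  rw [h3, neg_smul] at h2
  have h4 : (2 * (-1 : ℝ) ^ d i) • (X i * A * X j) = 0 := by
    rw [mul_smul, two_smul]
    nth_rewrite 1 [h2]
    simp
  exact (smul_eq_zero.1 h4).resolve_left (by
    have : (-1 : ℝ) ^ d i ≠ 0 := zpow_ne_zero _ (by norm_num)
    positivity)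

/-- In the (i,j) block the term M_l appears with the power t^{2l + d_i + d_j}: negative powers
vanish by `hvan`, the zeroth gives the leading coefficient, and positive ones have the parity of d_i
+ d_j, which is also the parity of the block. The remainder is multiplied by at worst t^{-2δ},
leaving order 2K - 2δ = k + 1. -/
theorem expLead_scaled {X : ι → R} (hX : ∀ i j, X i * X j = if i = j then X i else 0)
    {d : ι → ℤ} {M : ℝ → R} {Mc : ℤ → R} {a K δ : ℤ} {k : ℕ}
    (hM : Rem (2 * K) (fun t => M t - ∑ l ∈ Finset.Ico a K, t ^ (2 * l) • Mc l))
    (hvan : ∀ i j, ∀ l ∈ Finset.Ico a K, 2 * l + d i + d j < 0 → X i * Mc l * X j = 0)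
    (ha : ∀ i, d i ≤ -a) (hδ : ∀ i, X i = 0 ∨ -δ ≤ d i) (hk : 2 * K - 2 * δ = k + 1) :
    ExpLead (scaling X d (-1)) k (leading X d Mc)
      (fun t => scaling X d t * M t * scaling X d t) := by
  have h1 : ∀ i j, ExpLead (scaling X d (-1)) k
      (if Even (d i + d j) then X i * Mc (-(d i + d j) / 2) * X j else 0)
      (fun t => t ^ (d i + d j) • (X i * M t * X j)) := by
    intro i j
    by_cases hz : X i = 0 ∨ X j = 0
    · have : ∀ A, X i * A * X j = 0 := by rcases hz with h | h <;> simp [h]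
      simpa [this] using ExpLead.zero k
    have hi : -δ ≤ d i := (hδ i).resolve_left fun h => hz (Or.inl h)
    have hj : -δ ≤ d j := (hδ j).resolve_left fun h => hz (Or.inr h)
    have hr : Rem (d i + d j + 2 * K) (fun t => t ^ (d i + d j) •
        (X i * (M t - ∑ l ∈ Finset.Ico a K, t ^ (2 * l) • Mc l) * X j)) := by
      refine Rem.zpow_smul _ ?_
      have := ((Rem.const (X i)).mul hM).mul (Rem.const (X j))
      simpa using this
    have h2 := ExpLead.of_rem (J := scaling X d (-1)) (k := k) (by omega) hr
    have h3 : ∀ l ∈ Finset.Ico a K, ExpLead (scaling X d (-1)) k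
        (if d i + d j + 2 * l = 0 then X i * Mc l * X j else 0)
        (fun t => t ^ (d i + d j + 2 * l) • (X i * Mc l * X j)) := by
      intro l hl
      rcases lt_trichotomy (d i + d j + 2 * l) 0 with h | h | h
      · have := hvan i j l hl (by omega)
        simpa [this] using ExpLead.zero k
      · simp only [h, if_true, zpow_zero, one_smul]
        refine ExpLead.const k ?_
        rw [grading_block hX, Even.neg_one_zpow ⟨-l, by omega⟩, one_smul]
      · rw [if_neg h.ne']
        refine ExpLead.zpow_smul k h ?_
        rw [grading_block hX, zpow_add₀ (by norm_num) (d i + d j), zpow_mul]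
        norm_num
    have h4 := h2.add (ExpLead.sum _ h3)
    rw [zero_add] at h4
    have e : (∑ l ∈ Finset.Ico a K, if d i + d j + 2 * l = 0 then X i * Mc l * X j else 0) =
        if Even (d i + d j) then X i * Mc (-(d i + d j) / 2) * X j else 0 := by
      by_cases he : Even (d i + d j)
      · rw [if_pos he]
        obtain ⟨b, hb⟩ := he
        have hb' : -(d i + d j) / 2 = -b := by omega
        rw [hb', Finset.sum_eq_single (-b)]
        · rw [if_pos (by omega)]
        · intro l _ hl
          rw [if_neg (by omega)]
        -- The index -b always lies in the range of summation: d ≤ -a on both blocks gives a ≤ -b,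
        -- and -δ ≤ d together with δ < K gives -b < K.
        · intro hl
          exfalso
          have h5 := ha i
          have h6 := ha j
          exact hl (Finset.mem_Ico.2 ⟨by omega, by omega⟩)
      · rw [if_neg he]
        refine Finset.sum_eq_zero fun l _ => if_neg fun h => he ⟨-l, by omega⟩
    rw [e] at h4
    refine h4.congr ?_
    filter_upwards [eventually_pos] with t ht
    simp only [mul_sub, sub_mul, smul_sub, Finset.mul_sum, Finset.sum_mul, Finset.smul_sum,
      mul_smul_comm, smul_mul_assoc, smul_smul, ← zpow_add₀ ht.ne']
    abel
  have h5 := ExpLead.sum Finset.univ fun i _ => ExpLead.sum Finset.univ fun j _ => h1 i j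
  refine h5.congr ?_
  filter_upwards [eventually_pos] with t ht
  rw [scaling_mul_mul_scaling X d ht]

/-- After multiplication by t^{d_i + d_j} the odd powers vanish by parity, and the powers from 2K -
4δ on go into the remainder. The second scaling costs another 2δ, whence the order 2K - 4δ. -/
theorem rem_block {X : ι → R} (hX : ∀ i j, X i * X j = if i = j then X i else 0)
    {d : ι → ℤ} {K δ : ℤ} {k : ℕ} (hk : 2 * K - 2 * δ = k + 1) {i j : ι} (hi : -δ ≤ d i)
    (hj : -δ ≤ d j) {c : ℕ → R}
    (hc : ∀ m, scaling X d (-1) * c m = (-1 : ℝ) ^ m • (c m * scaling X d (-1))) :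
    Rem (2 * K - 4 * δ) (fun t =>
      t ^ (d i + d j) • (X i * (∑ m ∈ Finset.range (k + 1), t ^ m • c m) * X j) -
        ∑ e ∈ Finset.Ico (-δ) (K - 2 * δ), t ^ (2 * e) •
          (X i * (if 0 ≤ 2 * e - d i - d j then c (2 * e - d i - d j).toNat else 0) * X j)) := by
  set D := d i + d j with hD
  -- The part of the block proportional to t^n, extended by zero below the lowest power D, so that
  -- all three sums run over intervals of integers.
  let f : ℝ → ℤ → R := fun t n =>
    t ^ n • (X i * (if 0 ≤ n - D then c (n - D).toNat else 0) * X j)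
  have hf0 : ∀ t n, n < D → f t n = 0 := by
    intro t n hn
    simp [f, not_le.2 hn]
  have hfodd : ∀ t n, Odd n → f t n = 0 := by
    intro t n hn
    by_cases h : 0 ≤ n - D
    · simp only [f, if_pos h]
      rw [block_eq_zero_of_odd hX d (k := n - D), smul_zero]
      · rw [hc]
        congr 1
        conv_rhs => rw [← Int.toNat_of_nonneg h]
        rw [zpow_natCast]
      · rw [← hD]
        simpa using hn
    · exact hf0 t n (by omega)
  have h1 : ∀ t, 0 < t → t ^ D • (X i * (∑ m ∈ Finset.range (k + 1), t ^ m • c m) * X j) =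
      ∑ n ∈ Finset.Ico (-2 * δ) (D + k + 1), f t n := by
    intro t ht
    have : ∑ n ∈ Finset.Ico (-2 * δ) (D + k + 1), f t n =
        ∑ n ∈ Finset.Ico D (D + k + 1), f t n := by
      symm
      refine Finset.sum_subset (Finset.Ico_subset_Ico (by omega) le_rfl) fun n hn hn' => ?_
      refine hf0 t n ?_
      simp only [Finset.mem_Ico] at hn hn'
      omega
    rw [this, Finset.mul_sum, Finset.sum_mul, Finset.smul_sum]
    refine Finset.sum_bij (fun m _ => D + (m : ℤ)) ?_ ?_ ?_ ?_
    · intro m hm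
      simp only [Finset.mem_range, Finset.mem_Ico] at *
      omega
    · intro m _ m' _ h
      omega
    · intro n hn
      simp only [Finset.mem_Ico] at hn
      exact ⟨(n - D).toNat, by simp only [Finset.mem_range]; omega, by omega⟩
    · intro m _
      simp [f, smul_smul, zpow_add₀ ht.ne']
  have h2 : ∀ t, (∑ e ∈ Finset.Ico (-δ) (K - 2 * δ), t ^ (2 * e) •
          (X i * (if 0 ≤ 2 * e - d i - d j then c (2 * e - d i - d j).toNat else 0) * X j)) =
      ∑ n ∈ Finset.Ico (-2 * δ) (2 * K - 4 * δ), f t n := by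
    intro t
    have : ∀ e : ℤ, 2 * e - d i - d j = 2 * e - D := fun e => by omega
    simp only [this]
    have hs : (Finset.Ico (-δ) (K - 2 * δ)).image (fun e => 2 * e) ⊆
        Finset.Ico (-2 * δ) (2 * K - 4 * δ) := by
      intro n hn
      simp only [Finset.mem_image, Finset.mem_Ico] at *
      omega
    rw [← Finset.sum_subset hs, Finset.sum_image (by intro a _ b _ h; simpa using h)]
    intro n hn hn'
    refine hfodd t n ?_
    by_contra hodd
    rw [Int.not_odd_iff_even] at hodd
    obtain ⟨b, hb⟩ := hodd
    refine hn' (Finset.mem_image.2 ⟨b, ?_, by omega⟩)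
    simp only [Finset.mem_Ico] at *
    omega
  have h3 : Rem (2 * K - 4 * δ)
      (fun t => ∑ n ∈ Finset.Ico (2 * K - 4 * δ) (D + k + 1), f t n) := by
    refine Rem.sum _ fun n hn => ?_
    exact (Rem.zpow_smul_const n _).mono (Finset.mem_Ico.1 hn).1
  refine h3.congr ?_
  filter_upwards [eventually_pos] with t ht
  rw [h1 t ht, h2 t, ← Finset.Ico_union_Ico_eq_Ico (a := -2 * δ) (b := 2 * K - 4 * δ)
    (c := D + k + 1) (by omega) (by omega), Finset.sum_union]
  · abel
  · exact Finset.Ico_disjoint_Ico_consecutive _ _ _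

/-- Inversion of an operator family with a graded degeneration. -/
theorem graded_inverse [CompleteSpace R] {X : ι → R} (hX : ∀ i j, X i * X j = if i = j then X i else 0)
    (hsum : ∑ i, X i = 1)
    {d : ι → ℤ} {M : ℝ → R} {Mc : ℤ → R} {a K δ : ℤ} {k : ℕ}
    (hM : Rem (2 * K) (fun t => M t - ∑ l ∈ Finset.Ico a K, t ^ (2 * l) • Mc l))
    (hvan : ∀ i j, ∀ l ∈ Finset.Ico a K, 2 * l + d i + d j < 0 → X i * Mc l * X j = 0)
    (ha : ∀ i, d i ≤ -a) (hδ : ∀ i, X i = 0 ∨ -δ ≤ d i) (hk : 2 * K - 2 * δ = k + 1)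
    (hL : IsUnit (leading X d Mc)) {ρ : ℝ → ℝ}
    (hρ : ExpLead (scaling X d (-1)) k 1 (fun t => ρ t • (1 : R))) :
    ∃ c : ℤ → R, (∀ m < 0, c m = 0) ∧ c 0 = Ring.inverse (leading X d Mc) ∧
      (∀ᶠ t in 𝓝[>] (0 : ℝ), IsUnit (M t)) ∧
      Rem (2 * K - 4 * δ) (fun t => ρ t • Ring.inverse (M t) -
        ∑ e ∈ Finset.Ico (-δ) (K - 2 * δ), t ^ (2 * e) • gradedCoeff X d c e) := by
  have hN := expLead_scaled hX hM hvan ha hδ hk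
  obtain ⟨hu, hinv⟩ := hN.inverse hL
  -- The scalar ρ allows the inverse to be taken of a rescaled family: at 16 the family is y³M and ρ
  -- = y³ undoes the rescaling, while at 0 one has ρ = 1.
  have hinv' := hρ.mul hinv
  rw [one_mul] at hinv'
  obtain ⟨c, hc0, hcJ, hcr⟩ := hinv'.coeffs
  have hDD : ∀ t : ℝ, 0 < t → scaling X d t * scaling X (fun i => -d i) t = 1 := by
    intro t ht
    rw [scaling_mul_scaling hX _ _ ht]
    simp [scaling, hsum]
  have hDD' : ∀ t : ℝ, 0 < t → scaling X (fun i => -d i) t * scaling X d t = 1 := by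
    intro t ht
    rw [scaling_mul_scaling hX _ _ ht]
    simp [scaling, hsum]
  -- For t > 0 the scaling is invertible, with inverse the scaling of opposite degrees, so M is a
  -- unit as soon as D M D is, and M⁻¹ = D (D M D)⁻¹ D.
  have hfac : ∀ t : ℝ, 0 < t → IsUnit (scaling X d t * M t * scaling X d t) →
      IsUnit (M t) ∧ Ring.inverse (M t) = scaling X d t *
        Ring.inverse (scaling X d t * M t * scaling X d t) * scaling X d t := by
    intro t ht hut
    set D := scaling X d t
    set D' := scaling X (fun i => -d i) t
    have e1 : D * D' = 1 := hDD t ht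
    have e2 : D' * D = 1 := hDD' t ht
    set N := D * M t * D with hNdef
    have eM : M t = D' * N * D' := by
      rw [hNdef]
      calc M t = (D' * D) * M t * (D * D') := by rw [e1, e2, one_mul, mul_one]
        _ = _ := by noncomm_ring
    let U : Rˣ := ⟨D, D', e1, e2⟩
    obtain ⟨n, hn⟩ := hut
    have eu : M t = ((U⁻¹ * n * U⁻¹ : Rˣ) : R) := by
      rw [eM, ← hn]
      simp [U]
    refine ⟨⟨_, eu.symm⟩, ?_⟩
    rw [eu, Ring.inverse_unit, ← hn, Ring.inverse_unit]
    simp [U, mul_assoc]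
  refine ⟨fun m => if 0 ≤ m then c m.toNat else 0, fun m hm => if_neg (by omega), by simpa using hc0,
    ?_, ?_⟩
  · filter_upwards [hu, eventually_pos] with t h1 h0
    exact (hfac t h0 h1).1
  · have hblk : ∀ i j, Rem (2 * K - 4 * δ) (fun t =>
        t ^ (d i + d j) • (X i * (ρ t • (1 : R) *
          Ring.inverse (scaling X d t * M t * scaling X d t)) * X j) -
        ∑ e ∈ Finset.Ico (-δ) (K - 2 * δ), t ^ (2 * e) •
          (X i * (if 0 ≤ 2 * e - d i - d j then c (2 * e - d i - d j).toNat else 0) * X j)) := by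
      intro i j
      by_cases hz : X i = 0 ∨ X j = 0
      · have : ∀ A, X i * A * X j = 0 := by rcases hz with h | h <;> simp [h]
        simpa [this] using Rem.zero _
      have hi : -δ ≤ d i := (hδ i).resolve_left fun h => hz (Or.inl h)
      have hj : -δ ≤ d j := (hδ j).resolve_left fun h => hz (Or.inr h)
      have h1 := rem_block hX hk hi hj hcJ
      have h2 := Rem.zpow_smul (d i + d j) (((Rem.const (X i)).mul hcr).mul (Rem.const (X j)))
      have h3 := h1.add (h2.mono (N' := 2 * K - 4 * δ) (by omega))
      refine h3.congr (Eventually.of_forall fun t => ?_)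
      simp only [mul_sub, sub_mul, smul_sub]
      abel
    have := Rem.sum Finset.univ fun i _ => Rem.sum Finset.univ fun j _ => hblk i j
    refine this.congr ?_
    filter_upwards [hu, eventually_pos] with t h1 h0
    rw [(hfac t h0 h1).2]
    have e1 : ρ t • (scaling X d t * Ring.inverse (scaling X d t * M t * scaling X d t) *
        scaling X d t) = scaling X d t * (ρ t • (1 : R) *
          Ring.inverse (scaling X d t * M t * scaling X d t)) * scaling X d t := by
      simp only [smul_mul_assoc, mul_smul_comm, one_mul]
    rw [e1]
    generalize ρ t • (1 : R) * Ring.inverse (scaling X d t * M t * scaling X d t) = Z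
    rw [scaling_mul_mul_scaling X d h0]
    simp only [Finset.sum_sub_distrib, gradedCoeff, Finset.smul_sum]
    congr 1
    rw [Finset.sum_comm (s := Finset.Ico (-δ) (K - 2 * δ))]
    refine Finset.sum_congr rfl fun i _ => ?_
    exact Finset.sum_comm

end Graded

/-! ### Hilbert–Schmidt operators on `ℓ²(ℤ)` -/

section LTwo

variable {α : Type*}

theorem memℓp_two_iff {f : α → ℂ} : Memℓp f 2 ↔ Summable fun i => ‖f i‖ ^ 2 := by
  rw [memℓp_gen_iff (by norm_num)]
  norm_num

theorem l2_norm_sq (f : lp (fun _ : α => ℂ) 2) : ‖f‖ ^ 2 = ∑' i, ‖f i‖ ^ 2 := by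
  have := lp.norm_rpow_eq_tsum (p := 2) (by norm_num) f
  norm_num at this
  exact this

theorem l2_summable (f : lp (fun _ : α => ℂ) 2) : Summable fun i => ‖f i‖ ^ 2 :=
  memℓp_two_iff.1 (lp.memℓp f)

theorem l2_summable_mul (f g : lp (fun _ : α => ℂ) 2) : Summable fun i => ‖f i‖ * ‖g i‖ := by
  refine Summable.of_nonneg_of_le (fun i => by positivity) (fun i => ?_)
    ((l2_summable f).add (l2_summable g))
  nlinarith [sq_nonneg (‖f i‖ - ‖g i‖), sq_nonneg (‖f i‖ + ‖g i‖)]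

theorem l2_summable_mul' (f g : lp (fun _ : α => ℂ) 2) : Summable fun i => f i * g i :=
  Summable.of_norm (by simpa only [norm_mul] using l2_summable_mul f g)

theorem l2_norm_tsum_mul_le (f g : lp (fun _ : α => ℂ) 2) :
    ‖∑' i, f i * g i‖ ≤ ‖f‖ * ‖g‖ := by
  have h := lp.tsum_mul_le_mul_norm' (p := 2) (q := 2)
    (by norm_num; exact Real.HolderConjugate.two_two) f g
  refine (norm_tsum_le_tsum_norm ?_).trans ?_
  · simpa only [norm_mul] using l2_summable_mul f g
  · simpa only [norm_mul] using h

/-- Dominated convergence in ℓ²; it is applied to Hilbert-Schmidt kernels to differentiate operator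
families in norm. -/
theorem l2_tendsto_zero {β : Type*} {l : Filter β} {F : β → lp (fun _ : α => ℂ) 2} {W : α → ℝ}
    (hW : Summable fun i => W i ^ 2) (hb : ∀ᶠ t in l, ∀ i, ‖F t i‖ ≤ W i)
    (hF : ∀ i, Tendsto (fun t => F t i) l (𝓝 0)) : Tendsto F l (𝓝 0) := by
  rw [tendsto_zero_iff_norm_tendsto_zero]
  have h1 : Tendsto (fun t => ‖F t‖ ^ 2) l (𝓝 0) := by
    simp only [l2_norm_sq]
    have := tendsto_tsum_of_dominated_convergence (𝓕 := l) (f := fun t i => ‖F t i‖ ^ 2)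
      (g := fun _ => (0 : ℝ)) hW (fun i => by simpa using (hF i).norm.pow 2) ?_
    · simpa using this
    · filter_upwards [hb] with t ht i
      rw [Real.norm_eq_abs, abs_of_nonneg (by positivity)]
      exact pow_le_pow_left₀ (norm_nonneg _) (ht i) 2
  have h2 := (Real.continuous_sqrt.tendsto 0).comp h1
  simpa [Function.comp_def, Real.sqrt_sq (norm_nonneg _)] using h2

end LTwo

/-- Square-summable kernels on `ℤ × ℤ`. -/
abbrev HS : Type := lp (fun _ : ℤ × ℤ => ℂ) 2

theorem HS.memℓp_row (K : HS) (n : ℤ) : Memℓp (fun m => K (n, m)) 2 :=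
  memℓp_two_iff.2 ((l2_summable K).prod_factor n)

/-- The `n`-th row of a kernel. -/
def HS.row (K : HS) (n : ℤ) : L2 := ⟨fun m => K (n, m), K.memℓp_row n⟩

theorem HS.row_apply (K : HS) (n m : ℤ) : K.row n m = K (n, m) := rfl

theorem HS.hasSum_row_sq (K : HS) : HasSum (fun n => ‖K.row n‖ ^ 2) (‖K‖ ^ 2) := by
  have h := l2_summable K
  have h1 : ∀ n, ‖K.row n‖ ^ 2 = ∑' m, ‖K (n, m)‖ ^ 2 := fun n => l2_norm_sq _
  simp only [h1, l2_norm_sq K]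
  rw [h.tsum_prod]
  exact h.prod.hasSum

theorem HS.norm_apply_sq_le (K : HS) (f : L2) (n : ℤ) :
    ‖∑' m, K (n, m) * f m‖ ^ 2 ≤ ‖K.row n‖ ^ 2 * ‖f‖ ^ 2 := by
  rw [← mul_pow]
  exact pow_le_pow_left₀ (norm_nonneg _) (l2_norm_tsum_mul_le (K.row n) f) 2

theorem HS.memℓp_apply (K : HS) (f : L2) : Memℓp (fun n => ∑' m, K (n, m) * f m) 2 :=
  memℓp_two_iff.2 (Summable.of_nonneg_of_le (fun _ => by positivity) (K.norm_apply_sq_le f)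
    (K.hasSum_row_sq.summable.mul_right _))

/-- The operator with a square-summable kernel, as a function of the kernel. -/
def hsOp : HS →L[ℂ] Op :=
  LinearMap.mkContinuous₂
    (LinearMap.mk₂ ℂ (fun (K : HS) (f : L2) => (⟨_, K.memℓp_apply f⟩ : L2))
      (fun K K' f => by
        ext n
        have h1 := l2_summable_mul' (K.row n) f
        have h2 := l2_summable_mul' (K'.row n) f
        simp only [HS.row_apply] at h1 h2
        change ∑' m, (K (n, m) + K' (n, m)) * f m = ∑' m, K (n, m) * f m + ∑' m, K' (n, m) * f m
        rw [← h1.tsum_add h2]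
        simp only [add_mul])
      (fun c K f => by
        ext n
        change ∑' m, (c * K (n, m)) * f m = c * ∑' m, K (n, m) * f m
        rw [← tsum_mul_left]
        simp only [mul_assoc])
      (fun K f f' => by
        ext n
        have h1 := l2_summable_mul' (K.row n) f
        have h2 := l2_summable_mul' (K.row n) f'
        simp only [HS.row_apply] at h1 h2
        change ∑' m, K (n, m) * (f m + f' m) = ∑' m, K (n, m) * f m + ∑' m, K (n, m) * f' m
        rw [← h1.tsum_add h2]
        simp only [mul_add])
      (fun c K f => by
        ext n
        change ∑' m, K (n, m) * (c * f m) = c * ∑' m, K (n, m) * f m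
        rw [← tsum_mul_left]
        simp only [mul_left_comm]))
    1 (fun K f => by
      rw [one_mul]
      refine (sq_le_sq₀ (norm_nonneg _) (by positivity)).1 ?_
      rw [l2_norm_sq, mul_pow]
      have h1 := K.hasSum_row_sq.mul_right (‖f‖ ^ 2)
      rw [← h1.tsum_eq]
      exact (memℓp_two_iff.1 (K.memℓp_apply f)).tsum_le_tsum (K.norm_apply_sq_le f) h1.summable)

theorem hsOp_apply (K : HS) (f : L2) (n : ℤ) : hsOp K f n = ∑' m, K (n, m) * f m := rfl

theorem hsOp_hasKernel (K : HS) : HasKernel (fun n m => K (n, m)) (hsOp K) := fun f n =>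
  (l2_summable_mul' (K.row n) f).hasSum

theorem norm_hsOp_le (K : HS) : ‖hsOp K‖ ≤ ‖K‖ := by
  have h : ‖hsOp‖ ≤ 1 := LinearMap.mkContinuous₂_norm_le _ zero_le_one _
  calc ‖hsOp K‖ ≤ ‖hsOp‖ * ‖K‖ := hsOp.le_opNorm K
    _ ≤ 1 * ‖K‖ := mul_le_mul_of_nonneg_right h (norm_nonneg _)
    _ = ‖K‖ := one_mul _

theorem kernelOp_eq {K : ℤ → ℤ → ℂ} {T : Op} (h : HasKernel K T) : kernelOp K = T := by
  have he : ∃ T : Op, HasKernel K T := ⟨T, h⟩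
  rw [kernelOp, dif_pos he]
  ext f n
  exact (he.choose_spec f n).unique (h f n)

theorem HasKernel.add {K K' : ℤ → ℤ → ℂ} {T T' : Op} (h : HasKernel K T) (h' : HasKernel K' T') :
    HasKernel (fun n m => K n m + K' n m) (T + T') := fun f n => by
  simpa only [add_mul] using! (h f n).add (h' f n)

theorem HasKernel.smul {K : ℤ → ℤ → ℂ} {T : Op} (c : ℂ) (h : HasKernel K T) :
    HasKernel (fun n m => c * K n m) (c • T) := fun f n => by
  simpa only [mul_assoc] using! (h f n).mul_left c

/-- The kernel is the ℓ² limit of its finite partial sums, each of which gives a finite-rank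
operator, and the operator norm is bounded by the ℓ² norm of the kernel. -/
theorem isCompactOperator_hsOp (K : HS) : IsCompactOperator (hsOp K) := by
  classical
  have h1 := (lp.hasSum_single (by norm_num : (2 : ENNReal) ≠ ⊤) K).mapL hsOp
  refine isCompactOperator_of_tendsto h1 (Eventually.of_forall fun s => ?_)
  induction s using Finset.induction_on with
  | empty => simpa using isCompactOperator_zero
  | insert p s hp ih =>
    rw [Finset.sum_insert hp]
    refine IsCompactOperator.add ?_ ih
    have hr : hsOp (lp.single 2 p (K p)) =
        (ContinuousLinearMap.toSpanSingleton ℂ (lp.single 2 p.1 (K p) : L2)).comp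
          (innerSL ℂ (lp.single 2 p.2 1 : L2)) := by
      ext f n
      rw [hsOp_apply, tsum_eq_single p.2]
      · simp only [ContinuousLinearMap.coe_comp, Function.comp_apply, innerSL_apply_apply,
          ContinuousLinearMap.toSpanSingleton_apply, lp.inner_single_left, lp.coeFn_smul,
          Pi.smul_apply, smul_eq_mul, lp.single_apply]
        by_cases hn : n = p.1
        · subst hn
          simp [mul_comm]
        · have : (n, p.2) ≠ p := fun h => hn (by rw [← h])
          simp [hn, this]
      · intro m hm
        have : (n, m) ≠ p := fun h => hm (by rw [← h])
        simp [lp.single_apply, this]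
    rw [hr]
    exact (isCompactOperator_of_locallyCompactSpace_rng
      (ContinuousLinearMap.toSpanSingleton ℂ (lp.single 2 p.1 (K p) : L2))).comp_clm _

/-- Fredholm alternative: U + K = U(1 + UK) with UK compact, so -1 is either an eigenvalue of UK,
contradicting injectivity, or in its resolvent set. -/
theorem isUnit_of_injective {U K : Op} (hU : U * U = 1) (hK : IsCompactOperator K)
    (hinj : ∀ f, (U + K) f = 0 → f = 0) : IsUnit (U + K) := by
  have hUu : IsUnit U := ⟨⟨U, U, hU, hU⟩, rfl⟩
  have hUK : IsCompactOperator (U * K) := hK.clm_comp U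
  have e : U + K = U * (1 + U * K) := by rw [mul_add, ← mul_assoc, hU, one_mul, mul_one]
  rw [e]
  refine hUu.mul ?_
  rcases hUK.hasEigenvalue_or_mem_resolventSet (μ := (-1 : ℂ)) (by norm_num) with h | h
  · exfalso
    obtain ⟨f, hf⟩ := h.exists_hasEigenvector
    refine hf.2 (hinj f ?_)
    have h1 : U (K f) = -f := by simpa using! hf.apply_eq_smul
    rw [e]
    change U (f + U (K f)) = 0
    rw [h1, add_neg_cancel, map_zero]
  · rw [spectrum.mem_resolventSet_iff] at h
    rw [← IsUnit.neg_iff]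
    convert h using 1
    rw [neg_add, map_neg, map_one, sub_eq_add_neg]

/-! ### Weighted convolution operators -/

/-- The polynomial weights up to order `p` are admissible for `w`. -/
def WSum (w : ℤ → ℝ) (p : ℕ) : Prop :=
  Summable fun n : ℤ => (1 + |(n : ℝ)|) ^ (2 * p) * w n ^ 2

theorem WSum.mono {w : ℤ → ℝ} {p q : ℕ} (h : WSum w q) (hpq : p ≤ q) : WSum w p := by
  refine Summable.of_nonneg_of_le (fun n => by positivity) (fun n => ?_) h
  gcongr
  linarith [abs_nonneg (n : ℝ)]

/-- The kernel `w(n) g(|n-m|) w(m)`. -/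
def convKernel (w : ℤ → ℝ) (g : ℕ → ℂ) (n m : ℤ) : ℂ := (w n : ℂ) * g (n - m).natAbs * (w m : ℂ)

/-- The operator with kernel `w(n) g(|n-m|) w(m)`. -/
def convOp (w : ℤ → ℝ) (g : ℕ → ℂ) : Op := kernelOp (convKernel w g)

/-- The dominating kernel. -/
def weightKernel (w : ℤ → ℝ) (p : ℕ) (x : ℤ × ℤ) : ℝ :=
  ((1 + |(x.1 : ℝ)|) ^ p * |w x.1|) * ((1 + |(x.2 : ℝ)|) ^ p * |w x.2|)

theorem WSum.summable_weightKernel {w : ℤ → ℝ} {p : ℕ} (h : WSum w p) :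
    Summable fun x => weightKernel w p x ^ 2 := by
  have h1 : Summable fun n : ℤ => ((1 + |(n : ℝ)|) ^ p * |w n|) ^ 2 := by
    refine h.congr fun n => ?_
    rw [mul_pow, sq_abs, ← pow_mul, mul_comm p]
  refine (h1.mul_of_nonneg h1 (fun n => by positivity) (fun n => by positivity)).congr fun x => ?_
  rw [weightKernel]
  ring

/-- Polynomial growth in |n-m| splits into a weight in n times a weight in m; each can be paid for
by the decay of w, which makes the kernels Hilbert-Schmidt. -/
theorem one_add_natAbs_sub_le (n m : ℤ) :
    (1 + ((n - m).natAbs : ℝ)) ≤ (1 + |(n : ℝ)|) * (1 + |(m : ℝ)|) := by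
  have h : ((n - m).natAbs : ℝ) = |(n : ℝ) - m| := by
    rw [Nat.cast_natAbs]
    push_cast
    rfl
  rw [h]
  nlinarith [abs_sub (n : ℝ) m, mul_nonneg (abs_nonneg (n : ℝ)) (abs_nonneg (m : ℝ))]

theorem norm_convKernel_le {w : ℤ → ℝ} {g : ℕ → ℂ} {p : ℕ} {C : ℝ} (hC : 0 ≤ C)
    (hg : ∀ N, ‖g N‖ ≤ C * (1 + N) ^ p) (x : ℤ × ℤ) :
    ‖convKernel w g x.1 x.2‖ ≤ C * weightKernel w p x := by
  rw [convKernel, norm_mul, norm_mul, Complex.norm_real, Complex.norm_real, Real.norm_eq_abs,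
    Real.norm_eq_abs]
  have h1 : ‖g (x.1 - x.2).natAbs‖ ≤ C * ((1 + |(x.1 : ℝ)|) ^ p * (1 + |(x.2 : ℝ)|) ^ p) := by
    refine (hg _).trans (mul_le_mul_of_nonneg_left ?_ hC)
    rw [← mul_pow]
    exact pow_le_pow_left₀ (by positivity) (one_add_natAbs_sub_le _ _) p
  calc |w x.1| * ‖g (x.1 - x.2).natAbs‖ * |w x.2|
      ≤ |w x.1| * (C * ((1 + |(x.1 : ℝ)|) ^ p * (1 + |(x.2 : ℝ)|) ^ p)) * |w x.2| := by gcongr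
    _ = _ := by rw [weightKernel]; ring

/-- `‖g(N)‖ = O((1+N)^p)`. -/
def PolyBdd (g : ℕ → ℂ) (p : ℕ) : Prop := ∃ C : ℝ, 0 ≤ C ∧ ∀ N : ℕ, ‖g N‖ ≤ C * (1 + N) ^ p

theorem memℓp_convKernel {w : ℤ → ℝ} {g : ℕ → ℂ} {p : ℕ} (hw : WSum w p) (hg : PolyBdd g p) :
    Memℓp (fun x : ℤ × ℤ => convKernel w g x.1 x.2) 2 := by
  obtain ⟨C, hC, hg⟩ := hg
  refine memℓp_two_iff.2 (Summable.of_nonneg_of_le (fun _ => by positivity) (fun x => ?_)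
    (hw.summable_weightKernel.mul_left (C ^ 2)))
  rw [← mul_pow]
  exact pow_le_pow_left₀ (norm_nonneg _) (norm_convKernel_le hC hg x) 2

/-- The square-summable kernel of `convOp`. -/
def convHS {w : ℤ → ℝ} {g : ℕ → ℂ} {p : ℕ} (hw : WSum w p) (hg : PolyBdd g p) : HS :=
  ⟨fun x => convKernel w g x.1 x.2, memℓp_convKernel hw hg⟩

theorem convOp_eq {w : ℤ → ℝ} {g : ℕ → ℂ} {p : ℕ} (hw : WSum w p) (hg : PolyBdd g p) :
    convOp w g = hsOp (convHS hw hg) :=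
  kernelOp_eq (hsOp_hasKernel (convHS hw hg))

theorem convOp_hasKernel {w : ℤ → ℝ} {g : ℕ → ℂ} {p : ℕ} (hw : WSum w p) (hg : PolyBdd g p) :
    HasKernel (convKernel w g) (convOp w g) := by
  rw [convOp_eq hw hg]
  exact hsOp_hasKernel (convHS hw hg)

theorem isCompactOperator_convOp {w : ℤ → ℝ} {g : ℕ → ℂ} {p : ℕ} (hw : WSum w p)
    (hg : PolyBdd g p) : IsCompactOperator (convOp w g) := by
  rw [convOp_eq hw hg]
  exact isCompactOperator_hsOp _

theorem PolyBdd.add {g h : ℕ → ℂ} {p : ℕ} (hg : PolyBdd g p) (hh : PolyBdd h p) :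
    PolyBdd (fun N => g N + h N) p := by
  obtain ⟨C, hC, h1⟩ := hg
  obtain ⟨D, hD, h2⟩ := hh
  refine ⟨C + D, by positivity, fun N => (norm_add_le _ _).trans ?_⟩
  rw [add_mul]
  exact add_le_add (h1 N) (h2 N)

theorem PolyBdd.smul {g : ℕ → ℂ} {p : ℕ} (c : ℂ) (hg : PolyBdd g p) :
    PolyBdd (fun N => c * g N) p := by
  obtain ⟨C, hC, h1⟩ := hg
  refine ⟨‖c‖ * C, by positivity, fun N => ?_⟩
  rw [norm_mul, mul_assoc]
  exact mul_le_mul_of_nonneg_left (h1 N) (norm_nonneg _)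

theorem PolyBdd.mono {g : ℕ → ℂ} {p q : ℕ} (hg : PolyBdd g p) (h : p ≤ q) : PolyBdd g q := by
  obtain ⟨C, hC, h1⟩ := hg
  refine ⟨C, hC, fun N => (h1 N).trans ?_⟩
  gcongr
  linarith [(Nat.cast_nonneg N : (0 : ℝ) ≤ N)]

theorem convOp_add {w : ℤ → ℝ} {g h : ℕ → ℂ} {p : ℕ} (hw : WSum w p) (hg : PolyBdd g p)
    (hh : PolyBdd h p) : convOp w (fun N => g N + h N) = convOp w g + convOp w h := by
  refine kernelOp_eq ?_
  convert (convOp_hasKernel hw hg).add (convOp_hasKernel hw hh) using 3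
  simp only [convKernel]
  ring

theorem convOp_smul {w : ℤ → ℝ} {g : ℕ → ℂ} {p : ℕ} (hw : WSum w p) (c : ℂ) (hg : PolyBdd g p) :
    convOp w (fun N => c * g N) = c • convOp w g := by
  refine kernelOp_eq ?_
  convert (convOp_hasKernel hw hg).smul c using 3
  simp only [convKernel]
  ring

theorem PolyBdd.sub {g h : ℕ → ℂ} {p : ℕ} (hg : PolyBdd g p) (hh : PolyBdd h p) :
    PolyBdd (fun N => g N - h N) p := by
  simpa [sub_eq_add_neg] using hg.add (hh.smul (-1))

theorem convOp_sub {w : ℤ → ℝ} {g h : ℕ → ℂ} {p : ℕ} (hw : WSum w p) (hg : PolyBdd g p)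
    (hh : PolyBdd h p) : convOp w (fun N => g N - h N) = convOp w g - convOp w h := by
  have e : (fun N => g N - h N) = fun N => g N + (-1) * h N := by
    funext N
    ring
  rw [e, convOp_add hw hg (hh.smul (-1)), convOp_smul hw (-1) hh, neg_one_smul, sub_eq_add_neg]

theorem PolyBdd.zero (p : ℕ) : PolyBdd (fun _ => 0) p :=
  ⟨0, le_rfl, fun N => by simp⟩

theorem PolyBdd.sum {ι : Type*} {g : ι → ℕ → ℂ} {p : ℕ} (s : Finset ι)
    (hg : ∀ i ∈ s, PolyBdd (g i) p) : PolyBdd (fun N => ∑ i ∈ s, g i N) p := by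
  classical
  induction s using Finset.induction_on with
  | empty => simpa using PolyBdd.zero p
  | insert a s ha ih =>
    simp only [Finset.sum_insert ha]
    exact (hg a (by simp)).add (ih fun i hi => hg i (by simp [hi]))

theorem convOp_zero (w : ℤ → ℝ) : convOp w (fun _ => 0) = 0 := by
  refine kernelOp_eq fun f n => ?_
  simp [convKernel]

theorem convOp_sum {ι : Type*} {w : ℤ → ℝ} {g : ι → ℕ → ℂ} {p : ℕ} (hw : WSum w p) (s : Finset ι)
    (hg : ∀ i ∈ s, PolyBdd (g i) p) :
    convOp w (fun N => ∑ i ∈ s, g i N) = ∑ i ∈ s, convOp w (g i) := by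
  classical
  induction s using Finset.induction_on with
  | empty => simpa using convOp_zero w
  | insert a s ha ih =>
    simp only [Finset.sum_insert ha]
    rw [convOp_add hw (hg a (by simp)) (PolyBdd.sum s fun i hi => hg i (by simp [hi])),
      ih fun i hi => hg i (by simp [hi])]

/-- The constant S depends on the weight only, so bounds on g that are uniform in a parameter become
uniform operator bounds. -/
theorem norm_convOp_le {w : ℤ → ℝ} {p : ℕ} (hw : WSum w p) :
    ∃ S : ℝ, 0 ≤ S ∧ ∀ (g : ℕ → ℂ) (C : ℝ), 0 ≤ C → (∀ N : ℕ, ‖g N‖ ≤ C * (1 + N) ^ p) →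
      ‖convOp w g‖ ≤ C * S := by
  refine ⟨Real.sqrt (∑' x, weightKernel w p x ^ 2), Real.sqrt_nonneg _, fun g C hC hg => ?_⟩
  rw [convOp_eq hw ⟨C, hC, hg⟩]
  refine (norm_hsOp_le _).trans ((sq_le_sq₀ (norm_nonneg _) (by positivity)).1 ?_)
  rw [l2_norm_sq, mul_pow, Real.sq_sqrt (tsum_nonneg fun x => by positivity), ← tsum_mul_left]
  refine (l2_summable _).tsum_le_tsum (fun x => ?_) (hw.summable_weightKernel.mul_left _)
  rw [← mul_pow]
  exact pow_le_pow_left₀ (norm_nonneg _) (norm_convKernel_le hC hg x) 2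

/-- The difference quotients of the kernel converge entrywise and, by the mean value inequality, are
dominated by a fixed square-summable kernel; hence they converge in the Hilbert-Schmidt norm and so
in the operator norm. -/
theorem hasDerivAt_convOp {w : ℤ → ℝ} {p : ℕ} (hw : WSum w p) {r r' : ℝ → ℕ → ℂ} {t₀ C : ℝ}
    (hC : 0 ≤ C) {ε : ℝ} (hε : 0 < ε)
    (hd : ∀ t ∈ Metric.ball t₀ ε, ∀ N, HasDerivAt (fun s => r s N) (r' t N) t)
    (hb : ∀ t ∈ Metric.ball t₀ ε, ∀ N : ℕ, ‖r t N‖ ≤ C * (1 + N) ^ p)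
    (hb' : ∀ t ∈ Metric.ball t₀ ε, ∀ N : ℕ, ‖r' t N‖ ≤ C * (1 + N) ^ p) :
    HasDerivAt (fun t => convOp w (r t)) (convOp w (r' t₀)) t₀ := by
  classical
  rw [hasDerivAt_iff_tendsto_slope]
  have ht0 : t₀ ∈ Metric.ball t₀ ε := Metric.mem_ball_self hε
  have hev : ∀ᶠ t in 𝓝[≠] t₀, t ∈ Metric.ball t₀ ε ∧ t ≠ t₀ :=
    (Eventually.filter_mono nhdsWithin_le_nhds
      (show ∀ᶠ t in 𝓝 t₀, t ∈ Metric.ball t₀ ε from Metric.ball_mem_nhds t₀ hε)).and eventually_mem_nhdsWithin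
  let q : ℝ → ℕ → ℂ := fun t N => slope (fun s => r s N) t₀ t - r' t₀ N
  have hq0 : ∀ N, Tendsto (fun t => q t N) (𝓝[≠] t₀) (𝓝 0) := by
    intro N
    have h1 := (hasDerivAt_iff_tendsto_slope.1 (hd t₀ ht0 N)).sub_const (r' t₀ N)
    rwa [sub_self] at h1
  have hqb : ∀ t ∈ Metric.ball t₀ ε, t ≠ t₀ → ∀ N : ℕ, ‖q t N‖ ≤ (2 * C) * (1 + N) ^ p := by
    intro t ht hne N
    have h1 : ‖r t N - r t₀ N‖ ≤ C * (1 + N) ^ p * ‖t - t₀‖ :=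
      (convex_ball t₀ ε).norm_image_sub_le_of_norm_hasDerivWithin_le
        (fun s hs => (hd s hs N).hasDerivWithinAt) (fun s hs => hb' s hs N) ht0 ht
    have h2 : ‖slope (fun s => r s N) t₀ t‖ ≤ C * (1 + N) ^ p := by
      rw [slope_def_module, norm_smul, norm_inv, inv_mul_le_iff₀ (norm_pos_iff.2 (sub_ne_zero.2 hne))]
      linarith
    calc ‖q t N‖ ≤ _ := norm_sub_le _ _
      _ ≤ C * (1 + N) ^ p + C * (1 + N) ^ p := add_le_add h2 (hb' t₀ ht0 N)
      _ = _ := by ring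
  have hPr : ∀ t ∈ Metric.ball t₀ ε, PolyBdd (r t) p := fun t ht => ⟨C, hC, hb t ht⟩
  -- The quotient is controlled only inside the ball and off t₀; setting it to zero elsewhere makes
  -- the family of kernels total without changing the limit.
  have hPq : ∀ t, PolyBdd (fun N => if t ∈ Metric.ball t₀ ε ∧ t ≠ t₀ then q t N else 0) p := by
    intro t
    by_cases h : t ∈ Metric.ball t₀ ε ∧ t ≠ t₀
    · simp only [if_pos h]
      exact ⟨2 * C, by positivity, hqb t h.1 h.2⟩
    · simp only [if_neg h]
      exact PolyBdd.zero p
  have hlim : Tendsto (fun t => hsOp (convHS hw (hPq t))) (𝓝[≠] t₀) (𝓝 (hsOp 0)) := by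
    refine (hsOp.continuous.tendsto 0).comp
      (l2_tendsto_zero (W := fun x => (2 * C) * weightKernel w p x) ?_ ?_ ?_)
    · simp only [mul_pow]
      exact hw.summable_weightKernel.mul_left _
    · filter_upwards [hev] with t ht x
      refine norm_convKernel_le (by positivity) (fun N => ?_) x
      simp only [if_pos ht]
      exact hqb t ht.1 ht.2 N
    · intro x
      have h1 : Tendsto (fun t => (w x.1 : ℂ) * q t (x.1 - x.2).natAbs * (w x.2 : ℂ)) (𝓝[≠] t₀)
          (𝓝 0) := by
        simpa using ((hq0 (x.1 - x.2).natAbs).const_mul (w x.1 : ℂ)).mul_const (w x.2 : ℂ)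
      refine h1.congr' ?_
      filter_upwards [hev] with t ht
      change _ = convKernel w
        (fun N => if t ∈ Metric.ball t₀ ε ∧ t ≠ t₀ then q t N else 0) x.1 x.2
      simp only [convKernel, if_pos ht]
  rw [map_zero] at hlim
  rw [← tendsto_sub_nhds_zero_iff]
  refine hlim.congr' ?_
  filter_upwards [hev] with t ht
  rw [← convOp_eq hw (hPq t)]
  simp only [if_pos ht]
  have e : (q t) = fun N => ((t - t₀)⁻¹ : ℂ) * (r t N - r t₀ N) - r' t₀ N := by
    funext N
    simp only [q, slope_def_module]
    rw [Complex.real_smul]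
    push_cast
    rfl
  change convOp w (q t) = _
  rw [e, convOp_sub hw (((hPr t ht.1).sub (hPr t₀ ht0)).smul _) ⟨C, hC, hb' t₀ ht0⟩,
    convOp_smul hw _ ((hPr t ht.1).sub (hPr t₀ ht0)), convOp_sub hw (hPr t ht.1) (hPr t₀ ht0),
    slope_def_module]
  congr 1
  rw [← Complex.ofReal_sub, ← Complex.ofReal_inv, Complex.coe_smul]
  rfl

/-! ### Taylor expansion of convolution operators -/

/-- `G k N` is the `k`-th derivative of `G 0 N` on `[0, δ]`, of size `O((1+N)^k)`. -/
structure PolyChain (G : ℕ → ℕ → ℝ → ℂ) (δ : ℝ) : Prop where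
  hasDerivAt : ∀ k N, ∀ z ∈ Set.Icc 0 δ, HasDerivAt (G k N) (G (k + 1) N z) z
  bdd : ∀ k, ∃ C : ℝ, 0 ≤ C ∧ ∀ (N : ℕ), ∀ z ∈ Set.Icc 0 δ, ‖G k N z‖ ≤ C * (1 + N) ^ k

/-- The Taylor polynomial of order `K` of `G k N` at `0`. -/
def chainTaylor (G : ℕ → ℕ → ℝ → ℂ) (K k N : ℕ) (z : ℝ) : ℂ :=
  ∑ j ∈ Finset.range K, (z : ℂ) ^ j * (G (k + j) N 0 / (j.factorial : ℂ))

theorem hasDerivAt_chainTaylor (G : ℕ → ℕ → ℝ → ℂ) (K k N : ℕ) (z : ℝ) :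
    HasDerivAt (chainTaylor G (K + 1) k N) (chainTaylor G K (k + 1) N z) z := by
  have h : ∀ j : ℕ, HasDerivAt (fun z : ℝ => (z : ℂ) ^ (j + 1) *
      (G (k + (j + 1)) N 0 / ((j + 1).factorial : ℂ)))
      ((z : ℂ) ^ j * (G (k + 1 + j) N 0 / (j.factorial : ℂ))) z := by
    intro j
    have h1 : HasDerivAt (fun z : ℝ => (z : ℂ) ^ (j + 1)) ((j + 1 : ℕ) * (z : ℂ) ^ j) z := by
      simpa using (hasDerivAt_pow (j + 1) (z : ℂ)).comp_ofReal
    refine (h1.mul_const _).congr_deriv ?_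
    have e : k + 1 + j = k + (j + 1) := by ring
    have hf : (j.factorial : ℂ) ≠ 0 := by exact_mod_cast j.factorial_ne_zero
    have hj : ((j : ℂ) + 1) ≠ 0 := by exact_mod_cast j.succ_ne_zero
    rw [e, Nat.factorial_succ]
    push_cast
    field_simp
  have h2 := HasDerivAt.fun_sum (u := Finset.range K) fun j _ => h j
  have h3 := h2.add_const ((z : ℂ) ^ 0 * (G (k + 0) N 0 / ((0 : ℕ).factorial : ℂ)))
  refine h3.congr_of_eventuallyEq (Eventually.of_forall fun x => ?_)
  simp only [chainTaylor]
  rw [Finset.sum_range_succ']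
  simp

/-- Taylor's formula by repeated integration: differentiating the remainder of G k of length K + 1
gives the remainder of G (k+1) of length K. The bound is always that of the top derivative, of size
(1+N)^m. -/
theorem PolyChain.norm_sub_chainTaylor_le {G : ℕ → ℕ → ℝ → ℂ} {δ : ℝ} (hG : PolyChain G δ)
    {m : ℕ} {C : ℝ} (hC : ∀ (N : ℕ), ∀ z ∈ Set.Icc 0 δ, ‖G m N z‖ ≤ C * (1 + N) ^ m)
    (K k N : ℕ) (hm : k + K = m) {z : ℝ} (hz : z ∈ Set.Icc 0 δ) :
    ‖G k N z - chainTaylor G K k N z‖ ≤ C * (1 + N) ^ m * z ^ K := by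
  induction K generalizing k z with
  | zero =>
    have : k = m := by omega
    subst this
    simpa [chainTaylor] using hC N z hz
  | succ K ih =>
    have hB : 0 ≤ C * (1 + (N : ℝ)) ^ m := (norm_nonneg _).trans (hC N z hz)
    let f : ℝ → ℂ := fun z => G k N z - chainTaylor G (K + 1) k N z
    have hf0 : f 0 = 0 := by
      simp only [f, chainTaylor]
      rw [Finset.sum_range_succ']
      simp
    have hsub : Set.Icc 0 z ⊆ Set.Icc 0 δ := Set.Icc_subset_Icc le_rfl hz.2
    have h1 : ∀ x ∈ Set.Icc 0 z, HasDerivWithinAt f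
        (G (k + 1) N x - chainTaylor G K (k + 1) N x) (Set.Icc 0 z) x := fun x hx =>
      ((hG.hasDerivAt k N x (hsub hx)).sub (hasDerivAt_chainTaylor G K k N x)).hasDerivWithinAt
    have h2 : ∀ x ∈ Set.Icc 0 z, ‖G (k + 1) N x - chainTaylor G K (k + 1) N x‖ ≤
        C * (1 + N) ^ m * z ^ K := by
      intro x hx
      refine (ih (k + 1) (by omega) (hsub hx)).trans ?_
      exact mul_le_mul_of_nonneg_left (pow_le_pow_left₀ hx.1 hx.2 K) hB
    have h3 := (convex_Icc 0 z).norm_image_sub_le_of_norm_hasDerivWithin_le h1 h2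
      (Set.left_mem_Icc.2 hz.1) (Set.right_mem_Icc.2 hz.1)
    rw [hf0, sub_zero, sub_zero, Real.norm_eq_abs, abs_of_nonneg hz.1] at h3
    rw [pow_succ, ← mul_assoc]
    exact h3

theorem PolyChain.polyBdd {G : ℕ → ℕ → ℝ → ℂ} {δ : ℝ} (hG : PolyChain G δ) (k : ℕ) {z : ℝ}
    (hz : z ∈ Set.Icc 0 δ) : PolyBdd (fun N => G k N z) k := by
  obtain ⟨C, hC, h⟩ := hG.bdd k
  exact ⟨C, hC, fun N => h N z hz⟩

/-- An expansion to order K costs K powers of N, hence K powers of the weight on each side. This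
exchange rate determines the decay required of the potential. -/
theorem PolyChain.rem_convOp {G : ℕ → ℕ → ℝ → ℂ} {δ : ℝ} (hG : PolyChain G δ) (hδ : 0 < δ)
    {w : ℤ → ℝ} {K : ℕ} (hw : WSum w K) (hK : 1 ≤ K) :
    Rem K (fun t => convOp w (fun N => G 0 N t) -
      ∑ j ∈ Finset.range K, t ^ j • convOp w (fun N => G j N 0 / (j.factorial : ℂ))) := by
  obtain ⟨k, rfl⟩ : ∃ k, K = k + 1 := ⟨K - 1, by omega⟩
  obtain ⟨C, hC0, hC⟩ := hG.bdd (k + 1)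
  obtain ⟨S, hS0, hS⟩ := norm_convOp_le hw
  have h0 : (0 : ℝ) ∈ Set.Icc 0 δ := Set.left_mem_Icc.2 hδ.le
  have hB : ∀ z ∈ Set.Icc 0 δ, ∀ N : ℕ, ‖G 0 N z - chainTaylor G (k + 1) 0 N z‖ ≤
      (C * z ^ (k + 1)) * (1 + N) ^ (k + 1) := fun z hz N => by
    have := hG.norm_sub_chainTaylor_le hC (k + 1) 0 N (by omega) hz
    linarith
  have hB' : ∀ z ∈ Set.Icc 0 δ, ∀ N : ℕ, ‖G 1 N z - chainTaylor G k 1 N z‖ ≤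
      (C * z ^ k) * (1 + N) ^ (k + 1) := fun z hz N => by
    have := hG.norm_sub_chainTaylor_le hC k 1 N (by omega) hz
    linarith
  -- The derivative of the remainder of length k + 1 is the remainder of length k for G 1, and the
  -- same bound on G (k+1) controls both; the weighted derivative therefore has the full order k +
  -- 1.
  have hmain : Rem ((k + 1 : ℕ) : ℤ)
      (fun t => convOp w (fun N => G 0 N t - chainTaylor G (k + 1) 0 N t)) := by
    refine Rem.of_hasDerivAt
      (F' := fun t => convOp w (fun N => G 1 N t - chainTaylor G k 1 N t)) (C := C * S) ?_
    filter_upwards [eventually_pos, eventually_lt hδ] with t ht0 htδ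
    have htI : t ∈ Set.Icc 0 δ := ⟨ht0.le, htδ.le⟩
    refine ⟨?_, ?_, ?_⟩
    · have hsub : Metric.ball t (min t (δ - t)) ⊆ Set.Icc 0 δ := by
        intro x hx
        rw [Metric.mem_ball, Real.dist_eq, lt_min_iff, abs_lt, abs_lt] at hx
        exact ⟨by linarith, by linarith⟩
      have hpos : 0 ≤ C * δ ^ (k + 1) + C * δ ^ k := by positivity
      refine hasDerivAt_convOp (r := fun t N => G 0 N t - chainTaylor G (k + 1) 0 N t)
        (r' := fun t N => G 1 N t - chainTaylor G k 1 N t) hw hpos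
        (lt_min ht0 (sub_pos.2 htδ)) ?_ ?_ ?_
      · intro x hx N
        exact (hG.hasDerivAt 0 N x (hsub hx)).sub (hasDerivAt_chainTaylor G k 0 N x)
      · intro x hx N
        refine (hB x (hsub hx) N).trans ?_
        have : x ^ (k + 1) ≤ δ ^ (k + 1) := pow_le_pow_left₀ (hsub hx).1 (hsub hx).2 _
        have h1 : C * x ^ (k + 1) ≤ C * δ ^ (k + 1) + C * δ ^ k := by
          nlinarith [mul_nonneg hC0 (pow_nonneg hδ.le k), mul_le_mul_of_nonneg_left this hC0]
        exact mul_le_mul_of_nonneg_right h1 (by positivity)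
      · intro x hx N
        refine (hB' x (hsub hx) N).trans ?_
        have : x ^ k ≤ δ ^ k := pow_le_pow_left₀ (hsub hx).1 (hsub hx).2 _
        have h1 : C * x ^ k ≤ C * δ ^ (k + 1) + C * δ ^ k := by
          nlinarith [mul_nonneg hC0 (pow_nonneg hδ.le (k + 1)), mul_le_mul_of_nonneg_left this hC0]
        exact mul_le_mul_of_nonneg_right h1 (by positivity)
    · have := hS _ _ (by positivity) (hB t htI)
      rw [zpow_natCast]
      linarith
    · have := hS _ _ (by positivity) (hB' t htI)
      rw [zpow_natCast, pow_succ]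
      calc _ ≤ t * (C * t ^ k * S) := mul_le_mul_of_nonneg_left this ht0.le
        _ = _ := by ring
  refine hmain.congr ?_
  filter_upwards [eventually_pos, eventually_lt hδ] with t ht0 htδ
  have htI : t ∈ Set.Icc 0 δ := ⟨ht0.le, htδ.le⟩
  have hc : ∀ j ∈ Finset.range (k + 1), PolyBdd (fun N => G j N 0 / (j.factorial : ℂ)) (k + 1) := by
    intro j hj
    have h1 := ((hG.polyBdd j h0).smul ((j.factorial : ℂ)⁻¹)).mono
      (Finset.mem_range.1 hj).le
    simpa [div_eq_inv_mul] using h1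
  have hc' : ∀ j ∈ Finset.range (k + 1),
      PolyBdd (fun N => (t : ℂ) ^ j * (G j N 0 / (j.factorial : ℂ))) (k + 1) :=
    fun j hj => (hc j hj).smul _
  have e : ∀ N, chainTaylor G (k + 1) 0 N t =
      ∑ j ∈ Finset.range (k + 1), (t : ℂ) ^ j * (G j N 0 / (j.factorial : ℂ)) := by
    intro N
    simp [chainTaylor]
  simp only [e]
  rw [convOp_sub hw ((hG.polyBdd 0 htI).mono (by omega)) (PolyBdd.sum _ hc'),
    convOp_sum hw _ hc']
  congr 1
  refine Finset.sum_congr rfl fun j hj => ?_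
  rw [convOp_smul hw _ (hc j hj), ← Complex.ofReal_pow, Complex.coe_smul]
  rfl

/-! ### The elementary factors of the free resolvent -/

/-- The derivatives in `y` of `(c + ωy)^{2N} / c`, where `c = (1 - e y²)^{1/2}` and `ω² = -e`. -/
def hChain (e : ℝ) (ω : ℂ) : ℕ → ℕ → ℝ → ℂ
  | 0, N, y => ((Real.sqrt (1 - e * y ^ 2) : ℂ) + ω * y) ^ (2 * N) / (Real.sqrt (1 - e * y ^ 2) : ℂ)
  | 1, N, y => ((Real.sqrt (1 - e * y ^ 2) : ℂ) + ω * y) ^ (2 * N) *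
      (2 * N * ω / (Real.sqrt (1 - e * y ^ 2) : ℂ) ^ 2 +
        e * y / (Real.sqrt (1 - e * y ^ 2) : ℂ) ^ 3)
  | k + 2, N, y => ((2 * k + 3) * e * y * hChain e ω (k + 1) N y +
      e * ((k + 1) ^ 2 - 4 * N ^ 2) * hChain e ω k N y) / (1 - e * y ^ 2)

/-- h = (c + ωy)^{2N}/c satisfies (1 - ey²)h'' = 3ey h' + e(1 - 4N²)h. Differentiating this equation
k times gives the recursion in the definition, so only the first two derivatives need a direct
computation. -/
theorem hasDerivAt_hChain {e : ℝ} {ω : ℂ} (hω : ω ^ 2 = -e) (k N : ℕ) {y : ℝ}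
    (hy : 0 < 1 - e * y ^ 2) : HasDerivAt (hChain e ω k N) (hChain e ω (k + 1) N y) y := by
  have hs : 0 < Real.sqrt (1 - e * y ^ 2) := Real.sqrt_pos.2 hy
  have hs2 : Real.sqrt (1 - e * y ^ 2) ^ 2 = 1 - e * y ^ 2 := Real.sq_sqrt hy.le
  have hsc : (Real.sqrt (1 - e * y ^ 2) : ℂ) ≠ 0 := by exact_mod_cast hs.ne'
  have hs2c : (Real.sqrt (1 - e * y ^ 2) : ℂ) ^ 2 = 1 - e * y ^ 2 := by exact_mod_cast hs2
  have hyc : (1 - e * y ^ 2 : ℂ) ≠ 0 := by exact_mod_cast hy.ne'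
  have hq : HasDerivAt (fun y : ℝ => 1 - e * y ^ 2) (-(2 * e * y)) y := by
    refine (((hasDerivAt_pow 2 y).const_mul e).const_sub 1).congr_deriv ?_
    simp
    ring
  have hqc : HasDerivAt (fun y : ℝ => (1 - e * y ^ 2 : ℂ)) (-(2 * e * y)) y := by
    have := hq.ofReal_comp
    simpa using this
  have hc : HasDerivAt (fun y : ℝ => (Real.sqrt (1 - e * y ^ 2) : ℂ))
      (-(e * y) / (Real.sqrt (1 - e * y ^ 2) : ℂ)) y := by
    refine (hq.sqrt hy.ne').ofReal_comp.congr_deriv ?_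
    push_cast
    field_simp
  have hid : HasDerivAt (fun y : ℝ => (y : ℂ)) 1 y := (hasDerivAt_id (y : ℂ)).comp_ofReal
  -- Since cc' = -ey and ω² = -e, one has (c + ωy)' = ω(c + ωy)/c.
  have hE : HasDerivAt (fun y : ℝ => ((Real.sqrt (1 - e * y ^ 2) : ℂ) + ω * y) ^ (2 * N))
      (2 * N * ω / (Real.sqrt (1 - e * y ^ 2) : ℂ) *
        ((Real.sqrt (1 - e * y ^ 2) : ℂ) + ω * y) ^ (2 * N)) y := by
    refine ((hc.add (hid.const_mul ω)).pow (2 * N)).congr_deriv ?_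
    rcases Nat.eq_zero_or_pos N with rfl | hN
    · simp
    · obtain ⟨m, hm⟩ : ∃ m, 2 * N = m + 1 := ⟨2 * N - 1, by omega⟩
      have h2 : (2 * N : ℂ) = m + 1 := by exact_mod_cast hm
      simp only [Pi.add_apply, hm, Nat.add_sub_cancel, pow_succ]
      rw [h2]
      push_cast
      have he : (e : ℂ) = -ω ^ 2 := by rw [hω]; ring
      rw [he]
      field_simp
      ring
  have h0 : HasDerivAt (hChain e ω 0 N) (hChain e ω 1 N y) y := by
    refine (hE.div hc hsc).congr_deriv ?_
    simp only [hChain]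
    field_simp
    ring
  have h1 : HasDerivAt (hChain e ω 1 N) (hChain e ω 2 N y) y := by
    have ha : HasDerivAt (fun y : ℝ => 2 * N * ω / (Real.sqrt (1 - e * y ^ 2) : ℂ) ^ 2 +
        e * y / (Real.sqrt (1 - e * y ^ 2) : ℂ) ^ 3)
        (2 * N * ω * (2 * e * y) / (Real.sqrt (1 - e * y ^ 2) : ℂ) ^ 4 +
          (e / (Real.sqrt (1 - e * y ^ 2) : ℂ) ^ 3 +
            3 * e ^ 2 * y ^ 2 / (Real.sqrt (1 - e * y ^ 2) : ℂ) ^ 5)) y := by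
      refine (((hasDerivAt_const y (2 * N * ω)).div (hc.pow 2) (pow_ne_zero 2 hsc)).add
        ((hid.const_mul (e : ℂ)).div (hc.pow 3) (pow_ne_zero 3 hsc))).congr_deriv ?_
      simp only [Pi.pow_apply]
      field_simp
      push_cast
      ring
    refine (hE.mul ha).congr_deriv ?_
    simp only [hChain]
    rw [← hs2c]
    generalize (Real.sqrt (1 - e * y ^ 2) : ℂ) = c at *
    have he : (e : ℂ) = -ω ^ 2 := by rw [hω]; ring
    rw [he]
    field_simp
    push_cast
    ring
  -- The quotient rule applied to the recursion at k reproduces the recursion at k + 1.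
  have key : ∀ k, HasDerivAt (hChain e ω k N) (hChain e ω (k + 1) N y) y →
      HasDerivAt (hChain e ω (k + 1) N) (hChain e ω (k + 2) N y) y →
      HasDerivAt (hChain e ω (k + 2) N) (hChain e ω (k + 3) N y) y := by
    intro k hk hk1
    have h2 : hChain e ω (k + 2) N = fun y => ((2 * k + 3) * e * y * hChain e ω (k + 1) N y +
      e * ((k + 1) ^ 2 - 4 * N ^ 2) * hChain e ω k N y) / (1 - e * y ^ 2) := by
      funext x
      rw [hChain]
    have h3 : hChain e ω (k + 3) N y = ((2 * (k + 1 : ℕ) + 3) * e * y * hChain e ω (k + 2) N y +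
      e * (((k + 1 : ℕ) + 1) ^ 2 - 4 * N ^ 2) * hChain e ω (k + 1) N y) / (1 - e * y ^ 2) := by
      rw [hChain]
    have h4 : hChain e ω (k + 2) N y * (1 - e * y ^ 2) =
        ((2 * k + 3) * e * y * hChain e ω (k + 1) N y +
          e * ((k + 1) ^ 2 - 4 * N ^ 2) * hChain e ω k N y) := by
      rw [h2]
      field_simp
    have hd := ((((hid.const_mul ((2 * k + 3 : ℂ) * e)).mul hk1).add
      (hk.const_mul (e * ((k + 1 : ℂ) ^ 2 - 4 * N ^ 2)))).div hqc hyc)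
    rw [h2]
    refine hd.congr_deriv ?_
    rw [h3]
    simp only [Pi.add_apply, Pi.mul_apply]
    rw [← h4]
    push_cast
    field_simp
    ring
  have : ∀ k, HasDerivAt (hChain e ω k N) (hChain e ω (k + 1) N y) y ∧
      HasDerivAt (hChain e ω (k + 1) N) (hChain e ω (k + 2) N y) y := by
    intro k
    induction k with
    | zero => exact ⟨h0, h1⟩
    | succ k ih => exact ⟨ih.2, key k ih.1 ih.2⟩
  exact (this k).1

/-- The base c + ωy has modulus at most one and 1 - ey² stays away from zero, so N enters only
through the recursion, which gains N² in two steps. -/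
theorem norm_hChain_le {e : ℝ} {ω : ℂ} (he : |e| ≤ 1) (hω : ‖ω‖ ≤ 1) {S : Set ℝ}
    (hS : ∀ y ∈ S, |y| ≤ 1 ∧ 3 / 4 ≤ 1 - e * y ^ 2 ∧
      ‖(Real.sqrt (1 - e * y ^ 2) : ℂ) + ω * y‖ ≤ 1) (k : ℕ) :
    ∃ C : ℝ, 0 ≤ C ∧ ∀ N : ℕ, ∀ y ∈ S, ‖hChain e ω k N y‖ ≤ C * (1 + N) ^ k := by
  have hE : ∀ N : ℕ, ∀ y ∈ S,
      ‖((Real.sqrt (1 - e * y ^ 2) : ℂ) + ω * y) ^ (2 * N)‖ ≤ 1 := by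
    intro N y hy
    rw [norm_pow]
    exact pow_le_one₀ (norm_nonneg _) (hS y hy).2.2
  have hc : ∀ y ∈ S, 1 / 2 ≤ ‖(Real.sqrt (1 - e * y ^ 2) : ℂ)‖ := by
    intro y hy
    rw [Complex.norm_real, Real.norm_eq_abs, abs_of_nonneg (Real.sqrt_nonneg _)]
    refine Real.le_sqrt_of_sq_le ?_
    linarith [(hS y hy).2.1]
  have hci : ∀ y ∈ S, ‖(Real.sqrt (1 - e * y ^ 2) : ℂ)‖⁻¹ ≤ 2 := by
    intro y hy
    rw [inv_le_comm₀ (by linarith [hc y hy]) (by norm_num)]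
    linarith [hc y hy]
  have h0 : ∀ N : ℕ, ∀ y ∈ S, ‖hChain e ω 0 N y‖ ≤ 2 * (1 + N) ^ 0 := by
    intro N y hy
    rw [hChain, norm_div, div_eq_mul_inv, pow_zero]
    nlinarith [hE N y hy, hci y hy, norm_nonneg (((Real.sqrt (1 - e * y ^ 2) : ℂ) + ω * y) ^ (2 * N)),
      inv_nonneg.2 (norm_nonneg (Real.sqrt (1 - e * y ^ 2) : ℂ))]
  have h1 : ∀ N : ℕ, ∀ y ∈ S, ‖hChain e ω 1 N y‖ ≤ 16 * (1 + N) ^ 1 := by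
    intro N y hy
    rw [hChain, norm_mul, pow_one]
    set r := ‖(Real.sqrt (1 - e * y ^ 2) : ℂ)‖ with hr
    have hr2 : r⁻¹ ≤ 2 := hci y hy
    have hr0 : 0 ≤ r⁻¹ := inv_nonneg.2 (norm_nonneg _)
    have a1 : ‖2 * (N : ℂ) * ω / (Real.sqrt (1 - e * y ^ 2) : ℂ) ^ 2‖ ≤ 8 * N := by
      rw [norm_div, norm_mul, norm_mul, norm_pow, ← hr, div_eq_mul_inv, ← inv_pow]
      simp only [Complex.norm_ofNat, Complex.norm_natCast]
      have : r⁻¹ ^ 2 ≤ 2 ^ 2 := pow_le_pow_left₀ hr0 hr2 2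
      calc 2 * (N : ℝ) * ‖ω‖ * r⁻¹ ^ 2 ≤ 2 * (N : ℝ) * 1 * 2 ^ 2 := by gcongr
        _ = _ := by ring
    have a2 : ‖(e : ℂ) * y / (Real.sqrt (1 - e * y ^ 2) : ℂ) ^ 3‖ ≤ 8 := by
      rw [norm_div, norm_mul, norm_pow, ← hr, div_eq_mul_inv, ← inv_pow]
      simp only [Complex.norm_real, Real.norm_eq_abs]
      have : r⁻¹ ^ 3 ≤ 2 ^ 3 := pow_le_pow_left₀ hr0 hr2 3
      calc |e| * |y| * r⁻¹ ^ 3 ≤ 1 * 1 * 2 ^ 3 := by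
            gcongr
            exact (hS y hy).1
        _ = _ := by norm_num
    have a3 := (norm_add_le _ _).trans (add_le_add a1 a2)
    have := mul_le_mul (hE N y hy) a3 (norm_nonneg _) zero_le_one
    have hN : (0 : ℝ) ≤ N := Nat.cast_nonneg N
    linarith
  have key : ∀ k, (∃ C : ℝ, 0 ≤ C ∧ ∀ N : ℕ, ∀ y ∈ S, ‖hChain e ω k N y‖ ≤ C * (1 + N) ^ k) →
      (∃ C : ℝ, 0 ≤ C ∧ ∀ N : ℕ, ∀ y ∈ S, ‖hChain e ω (k + 1) N y‖ ≤ C * (1 + N) ^ (k + 1)) →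
      ∃ C : ℝ, 0 ≤ C ∧ ∀ N : ℕ, ∀ y ∈ S, ‖hChain e ω (k + 2) N y‖ ≤ C * (1 + N) ^ (k + 2) := by
    rintro k ⟨C, hC, h⟩ ⟨D, hD, h'⟩
    refine ⟨2 * ((2 * k + 3) * D + ((k + 1) ^ 2 + 4) * C), by positivity, fun N y hy => ?_⟩
    have hN : (0 : ℝ) ≤ N := Nat.cast_nonneg N
    have hd : ‖(1 - e * y ^ 2 : ℂ)‖⁻¹ ≤ 2 := by
      have : (1 - e * y ^ 2 : ℂ) = ((1 - e * y ^ 2 : ℝ) : ℂ) := by push_cast; ring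
      rw [this, Complex.norm_real, Real.norm_eq_abs, abs_of_nonneg (by linarith [(hS y hy).2.1]),
        inv_le_comm₀ (by linarith [(hS y hy).2.1]) (by norm_num)]
      linarith [(hS y hy).2.1]
    rw [hChain, norm_div, div_eq_mul_inv]
    have b1 : ‖(2 * (k : ℂ) + 3) * e * y * hChain e ω (k + 1) N y‖ ≤
        (2 * k + 3) * D * (1 + N) ^ (k + 2) := by
      have e1 : ‖(2 * (k : ℂ) + 3)‖ = 2 * k + 3 := by
        have : (2 * (k : ℂ) + 3) = ((2 * k + 3 : ℕ) : ℂ) := by push_cast; ring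
        rw [this, Complex.norm_natCast]
        push_cast
        ring
      rw [norm_mul, norm_mul, norm_mul, e1, Complex.norm_real, Complex.norm_real, Real.norm_eq_abs,
        Real.norm_eq_abs]
      calc (2 * (k : ℝ) + 3) * |e| * |y| * ‖hChain e ω (k + 1) N y‖
          ≤ (2 * (k : ℝ) + 3) * 1 * 1 * (D * (1 + N) ^ (k + 1)) := by
            gcongr
            exacts [(hS y hy).1, h' N y hy]
        _ = (2 * k + 3) * D * (1 + N) ^ (k + 1) := by ring
        _ ≤ _ := by
            gcongr
            · linarith
            · norm_num
    have b2 : ‖(e : ℂ) * ((k + 1) ^ 2 - 4 * N ^ 2) * hChain e ω k N y‖ ≤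
        ((k + 1) ^ 2 + 4) * C * (1 + N) ^ (k + 2) := by
      have e2 : ‖((k : ℂ) + 1) ^ 2 - 4 * N ^ 2‖ ≤ ((k + 1) ^ 2 + 4) * (1 + N) ^ 2 := by
        have : ((k : ℂ) + 1) ^ 2 - 4 * N ^ 2 = (((k + 1 : ℝ) ^ 2 - 4 * N ^ 2 : ℝ) : ℂ) := by
          push_cast; ring
        rw [this, Complex.norm_real, Real.norm_eq_abs, abs_le]
        constructor <;> nlinarith [sq_nonneg ((k : ℝ) + 1), mul_nonneg (sq_nonneg ((k : ℝ) + 1)) hN,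
          mul_nonneg (sq_nonneg ((k : ℝ) + 1)) (mul_nonneg hN hN)]
      rw [norm_mul, norm_mul, Complex.norm_real, Real.norm_eq_abs]
      calc |e| * ‖((k : ℂ) + 1) ^ 2 - 4 * N ^ 2‖ * ‖hChain e ω k N y‖
          ≤ 1 * (((k + 1) ^ 2 + 4) * (1 + N) ^ 2) * (C * (1 + N) ^ k) := by
            gcongr
            exact h N y hy
        _ = _ := by ring
    have b3 := (norm_add_le _ _).trans (add_le_add b1 b2)
    have b4 := mul_le_mul b3 hd (inv_nonneg.2 (norm_nonneg _)) (by positivity)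
    linarith
  have : ∀ k, (∃ C : ℝ, 0 ≤ C ∧ ∀ N : ℕ, ∀ y ∈ S, ‖hChain e ω k N y‖ ≤ C * (1 + N) ^ k) ∧
      (∃ C : ℝ, 0 ≤ C ∧ ∀ N : ℕ, ∀ y ∈ S, ‖hChain e ω (k + 1) N y‖ ≤ C * (1 + N) ^ (k + 1)) := by
    intro k
    induction k with
    | zero => exact ⟨⟨2, by norm_num, h0⟩, ⟨16, by norm_num, h1⟩⟩
    | succ k ih => exact ⟨ih.2, key k ih.1 ih.2⟩
  exact (this k).1

theorem hChain_zero_zero (e : ℝ) (ω : ℂ) (N : ℕ) : hChain e ω 0 N 0 = 1 := by simp [hChain]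

theorem hChain_one_zero (e : ℝ) (ω : ℂ) (N : ℕ) : hChain e ω 1 N 0 = 2 * N * ω := by simp [hChain]

/-- At y = 0 the recursion decouples by parity: the even derivatives are even polynomials in N, and
the odd ones are ω times odd polynomials. -/
theorem hChain_add_two_zero (e : ℝ) (ω : ℂ) (k N : ℕ) :
    hChain e ω (k + 2) N 0 = e * ((k + 1) ^ 2 - 4 * N ^ 2) * hChain e ω k N 0 := by
  rw [hChain]
  simp

/-! ### The kernel of the free resolvent -/

theorem lapOp_apply (f : L2) (n : ℤ) : lapOp f n = lap f n := by
  change f (n + 1) + f (n + -1) - 2 * f n = _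
  rw [lap, ← sub_eq_add_neg]

theorem inner_shift (k : ℤ) (f g : L2) : inner ℂ (shift k f) g = inner ℂ f (shift (-k) g) := by
  rw [lp.inner_eq_tsum, lp.inner_eq_tsum, ← (Equiv.addRight k).tsum_eq (fun n => inner ℂ (f n) _)]
  refine tsum_congr fun n => ?_
  change inner ℂ (f (n + k)) (g n) = inner ℂ (f (n + k)) (g (n + k + -k))
  rw [add_neg_cancel_right]

theorem isSelfAdjoint_lapOp : IsSelfAdjoint lapOp := by
  rw [ContinuousLinearMap.isSelfAdjoint_iff_isSymmetric]
  intro f g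
  have h1 := inner_shift 1 f g
  have h2 := inner_shift (-1) f g
  rw [neg_neg] at h2
  change inner ℂ (shift 1 f + shift (-1) f - (2 : ℂ) • f) g =
    inner ℂ f (shift 1 g + shift (-1) g - (2 : ℂ) • g)
  rw [inner_sub_left, inner_add_left, inner_sub_right, inner_add_right, h1, h2, inner_smul_left,
    inner_smul_right]
  simp only [map_ofNat]
  ring

/-- Δ² is self-adjoint, so its spectrum is real. -/
theorem isUnit_lapOp_sq_sub {z : ℂ} (hz : z.im ≠ 0) : IsUnit (lapOp * lapOp - z • (1 : Op)) := by
  have hs : IsSelfAdjoint (lapOp * lapOp) := by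
    have := isSelfAdjoint_lapOp
    rw [IsSelfAdjoint, star_mul, this.star_eq]
  by_contra h
  have hmem : z ∈ spectrum ℂ (lapOp * lapOp) := by
    rw [spectrum.mem_iff, Algebra.algebraMap_eq_smul_one]
    intro h'
    exact h (by simpa using h'.neg)
  exact hz (hs.im_eq_zero_of_mem_spectrum hmem)

theorem summable_norm_pow_natAbs {x : ℂ} (hx : ‖x‖ < 1) (m : ℤ) :
    Summable fun n : ℤ => ‖x ^ (n - m).natAbs‖ ^ 2 := by
  have h1 : Summable fun k : ℕ => (‖x‖ ^ 2) ^ k :=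
    summable_geometric_of_lt_one (by positivity) (by nlinarith [norm_nonneg x])
  have h2 : Summable fun n : ℤ => ‖x ^ n.natAbs‖ ^ 2 := by
    refine Summable.of_nat_of_neg ?_ ?_ <;>
    · refine h1.congr fun k => ?_
      simp only [Int.natAbs_neg, Int.natAbs_natCast, norm_pow]
      ring
  exact (Equiv.subRight m).summable_iff.2 h2

/-- The sequence `n ↦ x^{|n-m|}`. -/
def expSeq {x : ℂ} (hx : ‖x‖ < 1) (m : ℤ) : L2 :=
  ⟨fun n => x ^ (n - m).natAbs, memℓp_two_iff.2 (summable_norm_pow_natAbs hx m)⟩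

theorem expSeq_apply {x : ℂ} (hx : ‖x‖ < 1) (m n : ℤ) : expSeq hx m n = x ^ (n - m).natAbs := rfl

/-- Away from m the sequence is an eigenfunction of the difference operator; the kink at m
contributes the multiple of the delta sequence. -/
theorem lapOp_expSeq {x : ℂ} (hx : ‖x‖ < 1) (hx0 : x ≠ 0) (m : ℤ) :
    lapOp (expSeq hx m) = (x + x⁻¹ - 2) • expSeq hx m + (x - x⁻¹) • lp.single 2 m 1 := by
  ext n
  rw [lapOp_apply]
  simp only [lap, lp.coeFn_add, lp.coeFn_smul, Pi.add_apply, Pi.smul_apply, smul_eq_mul,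
    expSeq_apply]
  rcases lt_trichotomy (n - m) 0 with h | h | h
  · have hne : n ≠ m := by omega
    rw [lp.single_apply_ne _ _ _ hne]
    obtain ⟨k, hk⟩ : ∃ k : ℕ, n - m = -(k + 1 : ℕ) := ⟨(m - n - 1).toNat, by omega⟩
    have e1 : (n - m).natAbs = k + 1 := by omega
    have e2 : (n + 1 - m).natAbs = k := by omega
    have e3 : (n - 1 - m).natAbs = k + 2 := by omega
    rw [e1, e2, e3]
    field_simp
    ring
  · have hne : n = m := by omega
    subst hne
    rw [lp.single_apply_self]
    have e1 : (n - n).natAbs = 0 := by omega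
    have e2 : (n + 1 - n).natAbs = 1 := by omega
    have e3 : (n - 1 - n).natAbs = 1 := by omega
    rw [e1, e2, e3]
    ring
  · have hne : n ≠ m := by omega
    rw [lp.single_apply_ne _ _ _ hne]
    obtain ⟨k, hk⟩ : ∃ k : ℕ, n - m = (k + 1 : ℕ) := ⟨(n - m - 1).toNat, by omega⟩
    have e1 : (n - m).natAbs = k + 1 := by omega
    have e2 : (n + 1 - m).natAbs = k + 2 := by omega
    have e3 : (n - 1 - m).natAbs = k := by omega
    rw [e1, e2, e3]
    field_simp
    ring

/-- The free resolvent kernel in terms of `c² = 1 - y²`, `a² = 1 + y²`. -/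
def resKernel (σ : ℤˣ) (y c a : ℂ) (N : ℕ) : ℂ :=
  1 / (32 * y ^ 3) * (((σ : ℤ) : ℂ) * Complex.I * (c + ((σ : ℤ) : ℂ) * Complex.I * y) ^ (2 * N) / c -
    (a - y) ^ (2 * N) / a)

theorem units_cast_sq (σ : ℤˣ) : (((σ : ℤ) : ℂ)) ^ 2 = 1 := by
  rcases Int.units_eq_one_or σ with rfl | rfl <;> simp

/-- Δ² - 16y⁴ = (Δ + 4y²)(Δ - 4y²). The decaying exponentials with ratios (c + σiy)² and (a - y)²
are annihilated by the two factors away from m, and a suitable combination of them has the delta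
sequence as image. -/
theorem freeResolvent_single {σ : ℤˣ} {z y c a : ℂ} (hz : z.im ≠ 0) (hzy : z = 16 * y ^ 4)
    (hc : c ^ 2 = 1 - y ^ 2) (ha : a ^ 2 = 1 + y ^ 2) (hy0 : y ≠ 0) (hc0 : c ≠ 0) (ha0 : a ≠ 0)
    (h1 : ‖c + ((σ : ℤ) : ℂ) * Complex.I * y‖ < 1) (h2 : ‖a - y‖ < 1) (n m : ℤ) :
    freeResolvent z (lp.single 2 m 1) n = resKernel σ y c a (n - m).natAbs := by
  set s : ℂ := ((σ : ℤ) : ℂ) with hs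
  have hs2 : s ^ 2 = 1 := units_cast_sq σ
  have hI : Complex.I ^ 2 = -1 := Complex.I_sq
  set x₁ := (c + s * Complex.I * y) ^ 2 with hx1
  set x₂ := (a - y) ^ 2 with hx2
  have p1 : (c + s * Complex.I * y) * (c - s * Complex.I * y) = 1 := by
    linear_combination hc - y ^ 2 * Complex.I ^ 2 * hs2 - y ^ 2 * hI
  have p2 : (a - y) * (a + y) = 1 := by linear_combination ha
  have i1 : x₁⁻¹ = (c - s * Complex.I * y) ^ 2 := by
    refine inv_eq_of_mul_eq_one_right ?_
    rw [hx1, ← mul_pow, p1, one_pow]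
  have i2 : x₂⁻¹ = (a + y) ^ 2 := by
    refine inv_eq_of_mul_eq_one_right ?_
    rw [hx2, ← mul_pow, p2, one_pow]
  have n1 : x₁ ≠ 0 := pow_ne_zero 2 (left_ne_zero_of_mul_eq_one p1)
  have n2 : x₂ ≠ 0 := pow_ne_zero 2 (left_ne_zero_of_mul_eq_one p2)
  have b1 : ‖x₁‖ < 1 := by
    rw [hx1, norm_pow]
    exact pow_lt_one₀ (norm_nonneg _) h1 two_ne_zero
  have b2 : ‖x₂‖ < 1 := by
    rw [hx2, norm_pow]
    exact pow_lt_one₀ (norm_nonneg _) h2 two_ne_zero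
  have w1 : x₁ + x₁⁻¹ - 2 = -(4 * y ^ 2) := by
    rw [i1, hx1]
    linear_combination 2 * hc + 2 * y ^ 2 * Complex.I ^ 2 * hs2 + 2 * y ^ 2 * hI
  have w2 : x₂ + x₂⁻¹ - 2 = 4 * y ^ 2 := by
    rw [i2, hx2]
    linear_combination 2 * ha
  have k1 : x₁ - x₁⁻¹ = 4 * s * Complex.I * c * y := by
    rw [i1, hx1]
    ring
  have k2 : x₂ - x₂⁻¹ = -(4 * a * y) := by
    rw [i2, hx2]
    ring
  have L1 := lapOp_expSeq b1 n1 m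
  have L2' := lapOp_expSeq b2 n2 m
  rw [w1, k1] at L1
  rw [w2, k2] at L2'
  have hs0 : s ≠ 0 := fun h => by rw [h] at hs2; norm_num at hs2
  have hI0 : Complex.I ≠ 0 := Complex.I_ne_zero
  -- These coefficients make the two multiples of Δδ cancel and the multiples of δ add up to one.
  set A₁ : ℂ := s * Complex.I / (32 * y ^ 3 * c) with hA1
  set A₂ : ℂ := -1 / (32 * y ^ 3 * a) with hA2
  have c1 : A₁ * (4 * s * Complex.I * c * y) = -1 / (8 * y ^ 2) := by
    rw [hA1]
    field_simp
    linear_combination 32 * Complex.I ^ 2 * hs2 + 32 * hI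
  have c2 : A₂ * (-(4 * a * y)) = 1 / (8 * y ^ 2) := by
    rw [hA2]
    field_simp
    norm_num
  have hE : (lapOp * lapOp - z • (1 : Op)) (A₁ • expSeq b1 m + A₂ • expSeq b2 m) =
      lp.single 2 m 1 := by
    set e₁ := expSeq b1 m
    set e₂ := expSeq b2 m
    set δ : L2 := lp.single 2 m 1
    have q1 : lapOp (lapOp e₁) = (16 * y ^ 4) • e₁ +
        ((4 * s * Complex.I * c * y) * (-(4 * y ^ 2))) • δ +
        (4 * s * Complex.I * c * y) • lapOp δ := by
      rw [L1, map_add, map_smul, map_smul, L1]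
      module
    have q2 : lapOp (lapOp e₂) = (16 * y ^ 4) • e₂ +
        ((-(4 * a * y)) * (4 * y ^ 2)) • δ + (-(4 * a * y)) • lapOp δ := by
      rw [L2', map_add, map_smul, map_smul, L2']
      module
    change lapOp (lapOp (A₁ • e₁ + A₂ • e₂)) - z • (A₁ • e₁ + A₂ • e₂) = δ
    rw [map_add, map_add, map_smul, map_smul, map_smul, map_smul, q1, q2, hzy]
    have r : A₁ • ((16 * y ^ 4) • e₁ + ((4 * s * Complex.I * c * y) * (-(4 * y ^ 2))) • δ +
        (4 * s * Complex.I * c * y) • lapOp δ) + A₂ • ((16 * y ^ 4) • e₂ +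
        ((-(4 * a * y)) * (4 * y ^ 2)) • δ + (-(4 * a * y)) • lapOp δ) -
        (16 * y ^ 4) • (A₁ • e₁ + A₂ • e₂) =
        ((A₁ * (4 * s * Complex.I * c * y)) * (-(4 * y ^ 2)) +
          (A₂ * (-(4 * a * y))) * (4 * y ^ 2)) • δ +
        (A₁ * (4 * s * Complex.I * c * y) + A₂ * (-(4 * a * y))) • lapOp δ := by module
    rw [r, c1, c2]
    have t1 : -1 / (8 * y ^ 2) * -(4 * y ^ 2) + 1 / (8 * y ^ 2) * (4 * y ^ 2) = 1 := by
      field_simp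
      norm_num
    have t2 : -1 / (8 * y ^ 2) + 1 / (8 * y ^ 2) = 0 := by ring
    rw [t1, t2, one_smul, zero_smul, add_zero]
  have hu := isUnit_lapOp_sq_sub hz
  have hres : freeResolvent z (lp.single 2 m 1) = A₁ • expSeq b1 m + A₂ • expSeq b2 m := by
    rw [← hE, freeResolvent]
    change (Ring.inverse (lapOp * lapOp - z • (1 : Op)) * (lapOp * lapOp - z • (1 : Op))) _ = _
    rw [Ring.inverse_mul_cancel _ hu]
    rfl
  rw [hres]
  change A₁ * x₁ ^ (n - m).natAbs + A₂ * x₂ ^ (n - m).natAbs = _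
  rw [resKernel, hx1, hx2, hA1, hA2, ← pow_mul, ← pow_mul, ← hs]
  field_simp
  ring

theorem csqrt_sq (u : ℂ) : (u ^ (1 / 2 : ℂ)) ^ 2 = u := by
  simp

theorem csqrt_re_pos {u : ℂ} (hu : u ∈ Complex.slitPlane) : 0 < (u ^ (1 / 2 : ℂ)).re := by
  rw [Complex.cpow_def_of_ne_zero (Complex.slitPlane_ne_zero hu), Complex.exp_re]
  refine mul_pos (Real.exp_pos _) (Real.cos_pos_of_mem_Ioo ?_)
  have h1 := Complex.neg_pi_lt_arg u
  have h2 := (Complex.mem_slitPlane_iff_arg.1 hu).1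
  have h3 := lt_of_le_of_ne (Complex.arg_le_pi u) h2
  have e : (Complex.log u * (1 / 2)).im = u.arg / 2 := by
    simp [Complex.mul_im, Complex.log_im]
    ring
  rw [e]
  constructor <;> linarith

theorem csqrt_im (u : ℂ) :
    u.im = 2 * (u ^ (1 / 2 : ℂ)).re * (u ^ (1 / 2 : ℂ)).im := by
  have := congrArg Complex.im (csqrt_sq u)
  rw [pow_two, Complex.mul_im] at this
  linarith

theorem csqrt_ofReal_sq {x : ℝ} (hx : 0 ≤ x) : ((x : ℂ) ^ 2) ^ (1 / 2 : ℂ) = x := by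
  have h : ((x ^ 2 : ℝ) : ℂ) ^ ((1 / 2 : ℝ) : ℂ) = (((x ^ 2) ^ (1 / 2 : ℝ) : ℝ) : ℂ) :=
    (Complex.ofReal_cpow (by positivity) _).symm
  rw [← Real.sqrt_eq_rpow, Real.sqrt_sq hx] at h
  push_cast at h
  exact h

theorem csqrt_ofReal {x : ℝ} (hx : 0 ≤ x) : (x : ℂ) ^ (1 / 2 : ℂ) = Real.sqrt x := by
  rw [← csqrt_ofReal_sq (Real.sqrt_nonneg x)]
  norm_cast
  rw [Real.sq_sqrt hx]

/-- Transports the sign of an imaginary part through a square root with positive real part. -/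
theorem pos_mul_of_eq {s v r i k : ℝ} (hr : 0 < r) (hk : 0 < k) (h : v = k * r * i)
    (hv : 0 < s * v) : 0 < s * i := by
  have e : s * v = (k * r) * (s * i) := by rw [h]; ring
  rw [e] at hv
  exact (pos_iff_pos_of_mul_pos hv).1 (by positivity)

/-- The boundary values of the free resolvent kernel. -/
theorem freeBoundary_eq (σ : ℤˣ) {y : ℝ} (hy0 : 0 < y) (hy1 : y < 1) (n m : ℤ) :
    freeBoundary σ ((2 * y) ^ 4) n m =
      resKernel σ y (Real.sqrt (1 - y ^ 2)) (Real.sqrt (1 + y ^ 2)) (n - m).natAbs := by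
  set s : ℂ := ((σ : ℤ) : ℂ) with hs
  set sr : ℝ := ((σ : ℤ) : ℝ) with hsr
  have hsrs : (sr : ℂ) = s := by simp [hsr, hs]
  -- Nested principal square roots give Y with 16Y⁴ = Z and Re Y > 0; c and a are principal roots as
  -- well, so at ε = 0 all of them return the real values in the statement.
  let Z : ℝ → ℂ := fun ε => (((2 * y) ^ 4 : ℝ) : ℂ) + s * (ε : ℂ) * Complex.I
  let u : ℝ → ℂ := fun ε => (Z ε) ^ (1 / 2 : ℂ)
  let Y : ℝ → ℂ := fun ε => (u ε) ^ (1 / 2 : ℂ) / 2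
  let c : ℝ → ℂ := fun ε => (1 - Y ε ^ 2) ^ (1 / 2 : ℂ)
  let a : ℝ → ℂ := fun ε => (1 + Y ε ^ 2) ^ (1 / 2 : ℂ)
  have hZ0 : Z 0 = ((2 * y : ℂ) ^ 2) ^ 2 := by simp [Z]; ring
  have hu0 : u 0 = (2 * y : ℂ) ^ 2 := by
    have := csqrt_ofReal_sq (x := (2 * y) ^ 2) (by positivity)
    push_cast at this
    simp only [u, hZ0, this]
  have hY0 : Y 0 = y := by
    have := csqrt_ofReal_sq (x := 2 * y) (by positivity)
    push_cast at this
    simp only [Y, hu0, this]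
    ring
  have hc0 : c 0 = Real.sqrt (1 - y ^ 2) := by
    have := csqrt_ofReal (x := 1 - y ^ 2) (by nlinarith)
    push_cast at this
    simp only [c, hY0, this]
  have ha0 : a 0 = Real.sqrt (1 + y ^ 2) := by
    have := csqrt_ofReal (x := 1 + y ^ 2) (by nlinarith)
    push_cast at this
    simp only [a, hY0, this]
  have hZre : ∀ ε, (Z ε).re = (2 * y) ^ 4 := by
    intro ε
    simp only [Z, ← hsrs, Complex.add_re, Complex.ofReal_re, Complex.mul_re, Complex.mul_im,
      Complex.ofReal_im, Complex.I_re, Complex.I_im]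
    ring
  have hZim : ∀ ε, (Z ε).im = sr * ε := by
    intro ε
    simp only [Z, ← hsrs, Complex.add_im, Complex.ofReal_re, Complex.mul_re, Complex.mul_im,
      Complex.ofReal_im, Complex.I_re, Complex.I_im]
    ring
  have hZs : ∀ ε, Z ε ∈ Complex.slitPlane := fun ε => Or.inl (by rw [hZre]; positivity)
  have hus : ∀ ε, u ε ∈ Complex.slitPlane := fun ε => Or.inl (csqrt_re_pos (hZs ε))
  have hZc : Continuous Z := by
    simp only [Z]
    fun_prop
  have huc : Continuous u := hZc.cpow continuous_const hZs
  have hYc : Continuous Y := (huc.cpow continuous_const hus).div_const 2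
  have hY2 : ∀ ε, Y ε ^ 2 = u ε / 4 := by
    intro ε
    simp only [Y, div_pow, csqrt_sq]
    norm_num
  have hY4 : ∀ ε, Z ε = 16 * Y ε ^ 4 := by
    intro ε
    have h1 : Y ε ^ 4 = (Y ε ^ 2) ^ 2 := by ring
    rw [h1, hY2, div_pow]
    simp only [u, csqrt_sq]
    norm_num
    ring
  have hap : ∀ ε, 1 + Y ε ^ 2 ∈ Complex.slitPlane := by
    intro ε
    refine Or.inl ?_
    rw [hY2]
    have := csqrt_re_pos (hZs ε)
    have e : (1 + u ε / 4).re = 1 + (u ε).re / 4 := by simp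
    rw [e]
    have : 0 < (u ε).re := this
    linarith
  have hac : Continuous a := (continuous_const.add (hYc.pow 2)).cpow continuous_const hap
  have hcp0 : (1 - Y 0 ^ 2) ∈ Complex.slitPlane := by
    refine Or.inl ?_
    rw [hY0]
    have e : (1 - (y : ℂ) ^ 2).re = 1 - y ^ 2 := by
      rw [← Complex.ofReal_pow, Complex.sub_re, Complex.ofReal_re, Complex.one_re]
    rw [e]
    nlinarith
  -- 1 - Y² stays in the slit plane for small ε because 0 < y < 1; for 1 + Y² this holds for every
  -- ε.
  have hcp : ∀ᶠ ε in 𝓝[>] (0 : ℝ), 1 - Y ε ^ 2 ∈ Complex.slitPlane := by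
    have hcont : Continuous fun ε => 1 - Y ε ^ 2 := continuous_const.sub (hYc.pow 2)
    have := hcont.tendsto 0 (Complex.isOpen_slitPlane.mem_nhds hcp0)
    exact Eventually.filter_mono nhdsWithin_le_nhds this
  have hcc : ContinuousAt c 0 :=
    ContinuousAt.cpow (continuous_const.sub (hYc.pow 2)).continuousAt continuousAt_const hcp0
  have hsr2 : sr * sr = 1 := by
    rcases Int.units_eq_one_or σ with h | h <;> simp [hsr, h]
  have hlim : Tendsto (fun ε => resKernel σ (Y ε) (c ε) (a ε) (n - m).natAbs) (𝓝[>] 0)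
      (𝓝 (resKernel σ y (Real.sqrt (1 - y ^ 2)) (Real.sqrt (1 + y ^ 2)) (n - m).natAbs)) := by
    have hyc : (y : ℂ) ≠ 0 := by exact_mod_cast hy0.ne'
    have hcne : c 0 ≠ 0 := by
      rw [hc0]
      exact_mod_cast (Real.sqrt_pos.2 (by nlinarith : 0 < 1 - y ^ 2)).ne'
    have hane : a 0 ≠ 0 := by
      rw [ha0]
      exact_mod_cast (Real.sqrt_pos.2 (by nlinarith : 0 < 1 + y ^ 2)).ne'
    have hcont : ContinuousAt (fun ε => resKernel σ (Y ε) (c ε) (a ε) (n - m).natAbs) 0 := by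
      have hYa := hYc.continuousAt (x := 0)
      have haa := hac.continuousAt (x := 0)
      simp only [resKernel]
      refine ContinuousAt.mul (ContinuousAt.div continuousAt_const
        (continuousAt_const.mul (hYa.pow 3)) (by rw [hY0]; simp [hyc])) (ContinuousAt.sub ?_ ?_)
      · exact ContinuousAt.div (continuousAt_const.mul
          ((hcc.add (continuousAt_const.mul hYa)).pow _)) hcc hcne
      · exact ContinuousAt.div ((haa.sub hYa).pow _) haa hane
    have := hcont.tendsto.mono_left (nhdsWithin_le_nhds (s := Set.Ioi 0))
    rwa [hY0, hc0, ha0] at this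
  refine Tendsto.limUnder_eq (hlim.congr' ?_)
  filter_upwards [eventually_pos, hcp] with ε hε hcε
  have hur : 0 < (u ε).re := csqrt_re_pos (hZs ε)
  have hYr : 0 < (Y ε).re := by
    have := csqrt_re_pos (hus ε)
    have e : (Y ε).re = ((u ε) ^ (1 / 2 : ℂ)).re / 2 := by simp [Y]
    rw [e]
    linarith
  have hui : 0 < sr * (u ε).im := by
    have h1 := csqrt_im (Z ε)
    rw [hZim] at h1
    have h2 : ε = 2 * (u ε).re * (sr * (u ε).im) := by
      have : sr * (sr * ε) = sr * (2 * (u ε).re * (u ε).im) := by rw [h1]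
      rw [← mul_assoc, hsr2] at this
      linarith
    by_contra hneg
    nlinarith
  have hYi2 : (Y ε ^ 2).im = 2 * (Y ε).re * (Y ε).im := by
    rw [pow_two, Complex.mul_im]
    ring
  have hYi2' : (Y ε ^ 2).im = (u ε).im / 4 := by
    rw [hY2]
    simp
  have hYi : 0 < sr * (Y ε).im := by
    exact pos_mul_of_eq hYr (k := 8) (by norm_num) (by linarith) hui
  have hcr : 0 < (c ε).re := csqrt_re_pos hcε
  have har : 0 < (a ε).re := csqrt_re_pos (hap ε)
  have hci : sr * (c ε).im < 0 := by
    have h1 := csqrt_im (1 - Y ε ^ 2)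
    have h2 : (1 - Y ε ^ 2).im = -((u ε).im / 4) := by rw [Complex.sub_im, hYi2']; simp
    rw [h2] at h1
    have h3 : -((u ε).im / 4) = 2 * (c ε).re * (c ε).im := h1
    have h4 : 0 < sr * -(c ε).im := pos_mul_of_eq hcr (k := 8) (by norm_num) (by linarith) hui
    linarith
  have hai : 0 < sr * (a ε).im := by
    have h1 := csqrt_im (1 + Y ε ^ 2)
    have h2 : (1 + Y ε ^ 2).im = (u ε).im / 4 := by rw [Complex.add_im, hYi2']; simp
    rw [h2] at h1
    have h3 : (u ε).im / 4 = 2 * (a ε).re * (a ε).im := h1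
    exact pos_mul_of_eq har (k := 8) (by norm_num) (by linarith) hui
  have hne : ∀ w : ℂ, 0 < w.re → w ≠ 0 := fun w hw h => by rw [h] at hw; simp at hw
  -- Both ratios come with an explicit inverse, so |p| < 1 reduces to |p| < |q|. That comparison
  -- depends only on the signs of real and imaginary parts: σ Im Y and σ Im a are positive and σ Im
  -- c is negative. This selects the boundary value of sign σ.
  have hlt : ∀ p q : ℂ, p * q = 1 → Complex.normSq p < Complex.normSq q → ‖p‖ < 1 := by
    intro p q h1 h2
    rw [Complex.normSq_eq_norm_sq, Complex.normSq_eq_norm_sq] at h2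
    have h3 : ‖p‖ * ‖q‖ = 1 := by rw [← norm_mul, h1, norm_one]
    have h4 : ‖p‖ < ‖q‖ := lt_of_pow_lt_pow_left₀ 2 (norm_nonneg _) h2
    nlinarith [norm_nonneg p, norm_nonneg q]
  have hc2 : c ε ^ 2 = 1 - Y ε ^ 2 := csqrt_sq _
  have ha2 : a ε ^ 2 = 1 + Y ε ^ 2 := csqrt_sq _
  refine (freeResolvent_single (σ := σ) ?_ (hY4 ε) hc2 ha2 (hne _ hYr) (hne _ hcr) (hne _ har)
    ?_ ?_ n m).symm
  · rw [hZim]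
    intro h
    have : sr * (sr * ε) = 0 := by rw [h, mul_zero]
    rw [← mul_assoc, hsr2] at this
    linarith
  · refine hlt _ (c ε - s * Complex.I * Y ε) ?_ ?_
    · linear_combination hc2 - Y ε ^ 2 * Complex.I ^ 2 * units_cast_sq σ - Y ε ^ 2 * Complex.I_sq
    · change Complex.normSq (c ε + s * Complex.I * Y ε) < _
      rw [← hsrs]
      simp only [Complex.normSq_apply, Complex.add_re, Complex.add_im, Complex.sub_re,
        Complex.sub_im, Complex.mul_re, Complex.mul_im, Complex.ofReal_re, Complex.ofReal_im,
        Complex.I_re, Complex.I_im]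
      nlinarith [mul_pos hcr hYi, mul_neg_of_neg_of_pos hci hYr]
  · refine hlt _ (a ε + Y ε) ?_ ?_
    · linear_combination ha2
    · simp only [Complex.normSq_apply, Complex.add_re, Complex.add_im, Complex.sub_re,
        Complex.sub_im]
      have : 0 < (a ε).im * (Y ε).im := by
        have h5 : (a ε).im * (Y ε).im = (sr * (a ε).im) * (sr * (Y ε).im) := by
          linear_combination -(a ε).im * (Y ε).im * hsr2
        rw [h5]
        exact mul_pos hai hYi
      nlinarith [mul_pos har hYr]

/-! ### Decay of the potential -/

theorem one_le_bracket (n : ℤ) : 1 ≤ bracket n := by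
  rw [bracket]
  exact Real.one_le_sqrt.2 (by nlinarith [sq_nonneg (n : ℝ)])

theorem abs_le_bracket (n : ℤ) : |(n : ℝ)| ≤ bracket n := by
  rw [bracket]
  refine Real.le_sqrt_of_sq_le ?_
  rw [sq_abs]
  linarith

theorem bracket_le (n : ℤ) : bracket n ≤ 1 + |(n : ℝ)| := by
  rw [bracket]
  refine (Real.sqrt_le_left (by positivity)).2 ?_
  nlinarith [abs_nonneg (n : ℝ), sq_abs (n : ℝ)]

theorem summable_bracket_rpow {b : ℝ} (hb : 1 < b) : Summable fun n : ℤ => bracket n ^ (-b) := by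
  refine Summable.of_norm_bounded_eventually (Real.summable_abs_int_rpow hb) ?_
  have : {n : ℤ | ¬ ‖bracket n ^ (-b)‖ ≤ |(n : ℝ)| ^ (-b)} ⊆ {0} := by
    intro n hn
    by_contra h0
    refine hn ?_
    have hpos : 0 < |(n : ℝ)| := abs_pos.2 (by exact_mod_cast h0)
    rw [Real.norm_eq_abs, abs_of_nonneg (Real.rpow_nonneg (by linarith [one_le_bracket n]) _)]
    exact Real.rpow_le_rpow_of_nonpos hpos (abs_le_bracket n) (by linarith)
  exact (Set.finite_singleton 0).subset this

theorem vk_zero_sq (V : ℤ → ℝ) (n : ℤ) : vk V 0 n ^ 2 = |V n| := by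
  simp [vk, Real.sq_sqrt (abs_nonneg _)]

theorem neg_one_zpow_sq (n : ℤ) : ((-1 : ℝ) ^ n) ^ 2 = 1 := by
  rw [← zpow_natCast, ← zpow_mul, mul_comm, zpow_mul]
  norm_num

/-- The sum is dominated by that of ⟨n⟩^{2p - β}, so p powers of weight need β > 2p + 1. The
thresholds 15, 19, 27 and 7, 11, 15 are 2p + 1 for the numbers p of powers used in the six cases. -/
theorem wSum_vk {V : ℤ → ℝ} {β : ℝ} (hV : ∃ C : ℝ, ∀ n : ℤ, |V n| ≤ C * bracket n ^ (-β))
    {p : ℕ} (hp : 2 * (p : ℝ) + 1 < β) : WSum (vk V 0) p := by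
  obtain ⟨C, hC⟩ := hV
  have h1 := (summable_bracket_rpow (b := β - 2 * p) (by linarith)).mul_left (2 ^ (2 * p) * C)
  refine Summable.of_nonneg_of_le (fun n => by positivity) (fun n => ?_) h1
  rw [vk_zero_sq]
  have hb := one_le_bracket n
  have h2 : 1 + |(n : ℝ)| ≤ 2 * bracket n := by linarith [abs_le_bracket n]
  have h3 : (1 + |(n : ℝ)|) ^ (2 * p) ≤ 2 ^ (2 * p) * bracket n ^ (2 * p) := by
    rw [← mul_pow]
    exact pow_le_pow_left₀ (by positivity) h2 _
  have h4 : bracket n ^ (-(β - 2 * p)) = bracket n ^ (2 * p) * bracket n ^ (-β) := by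
    rw [← Real.rpow_natCast, ← Real.rpow_add (by linarith)]
    congr 1
    push_cast
    ring
  rw [h4]
  calc (1 + |(n : ℝ)|) ^ (2 * p) * |V n|
      ≤ (2 ^ (2 * p) * bracket n ^ (2 * p)) * (C * bracket n ^ (-β)) :=
        mul_le_mul h3 (hC n) (abs_nonneg _) (by positivity)
    _ = _ := by ring

theorem WSum.vkt {V : ℤ → ℝ} {p : ℕ} (h : WSum (vk V 0) p) : WSum (vkt V 0) p := by
  refine h.congr fun n => ?_
  simp only [BiLap.vkt, mul_pow, neg_one_zpow_sq, one_mul]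

/-! ### Chains for the free resolvent -/

theorem norm_sqrt_add_I_mul {r y : ℝ} (hr : r ^ 2 = 1) (hy : y ^ 2 ≤ 1) :
    ‖(Real.sqrt (1 - 1 * y ^ 2) : ℂ) + ((r : ℂ) * Complex.I) * y‖ = 1 := by
  have e : (Real.sqrt (1 - 1 * y ^ 2) : ℂ) + ((r : ℂ) * Complex.I) * y =
      (Real.sqrt (1 - 1 * y ^ 2) : ℂ) + ((r * y : ℝ) : ℂ) * Complex.I := by
    push_cast
    ring
  have hs := Real.sq_sqrt (show 0 ≤ 1 - 1 * y ^ 2 by linarith)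
  rw [e, Complex.norm_add_mul_I, hs]
  have : 1 - 1 * y ^ 2 + (r * y) ^ 2 = 1 := by
    rw [mul_pow, hr]
    ring
  rw [this, Real.sqrt_one]

/-- For real y the base lies on the unit circle. The factor a multiplies the exponent: a = 1 serves
at 0, and a = 2 at 16, where a half-angle substitution doubles N. -/
theorem polyChain_osc {r : ℝ} (hr : r ^ 2 = 1) (a : ℕ) :
    PolyChain (fun k N => hChain 1 ((r : ℂ) * Complex.I) k (a * N)) (1 / 2) := by
  have hω : ((r : ℂ) * Complex.I) ^ 2 = -((1 : ℝ) : ℂ) := by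
    rw [mul_pow, Complex.I_sq, ← Complex.ofReal_pow, hr]
    simp
  have hn : ‖(r : ℂ) * Complex.I‖ ≤ 1 := by
    rw [norm_mul, Complex.norm_I, mul_one, Complex.norm_real, Real.norm_eq_abs]
    exact abs_le_one_iff_mul_self_le_one.2 (by nlinarith)
  refine ⟨fun k N z hz => hasDerivAt_hChain hω k (a * N) ?_, fun k => ?_⟩
  · nlinarith [hz.1, hz.2]
  · obtain ⟨C, hC, h⟩ := norm_hChain_le (e := 1) (S := Set.Icc (0 : ℝ) (1 / 2)) (by simp) hn
      (fun y hy => ⟨by rw [abs_of_nonneg hy.1]; linarith [hy.2], by nlinarith [hy.1, hy.2],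
        (norm_sqrt_add_I_mul hr (by nlinarith [hy.1, hy.2])).le⟩) k
    refine ⟨C * (1 + a) ^ k, by positivity, fun N z hz => (h (a * N) z hz).trans ?_⟩
    rw [mul_assoc, ← mul_pow]
    refine mul_le_mul_of_nonneg_left (pow_le_pow_left₀ (by positivity) ?_ k) hC
    push_cast
    nlinarith [(Nat.cast_nonneg N : (0 : ℝ) ≤ N), (Nat.cast_nonneg a : (0 : ℝ) ≤ a)]

theorem norm_sqrt_sub_le {y : ℝ} (hy : 0 ≤ y) :
    ‖(Real.sqrt (1 - (-1) * y ^ 2) : ℂ) + (-1 : ℂ) * y‖ ≤ 1 := by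
  have e : (Real.sqrt (1 - (-1) * y ^ 2) : ℂ) + (-1 : ℂ) * y =
      ((Real.sqrt (1 - (-1) * y ^ 2) - y : ℝ) : ℂ) := by
    push_cast
    ring
  rw [e, Complex.norm_real, Real.norm_eq_abs, abs_le]
  have h1 : y ≤ Real.sqrt (1 - (-1) * y ^ 2) := Real.le_sqrt_of_sq_le (by linarith)
  have h2 : Real.sqrt (1 - (-1) * y ^ 2) ≤ 1 + y :=
    (Real.sqrt_le_left (by linarith)).2 (by nlinarith)
  constructor <;> linarith

theorem norm_hChain_exp_le (k : ℕ) : ∃ C : ℝ, 0 ≤ C ∧ ∀ N : ℕ, ∀ y ∈ Set.Icc (0 : ℝ) 1,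
    ‖hChain (-1) (-1) k N y‖ ≤ C * (1 + N) ^ k :=
  norm_hChain_le (e := -1) (S := Set.Icc (0 : ℝ) 1) (by simp) (by simp)
    (fun y hy => ⟨by rw [abs_of_nonneg hy.1]; exact hy.2, by nlinarith [hy.1, hy.2], by
      simpa using norm_sqrt_sub_le hy.1⟩) k

theorem polyChain_exp : PolyChain (fun k N => hChain (-1) (-1) k N) (1 / 2) := by
  refine ⟨fun k N z hz => hasDerivAt_hChain (by simp) k N (by nlinarith [hz.1]), fun k => ?_⟩
  obtain ⟨C, hC, h⟩ := norm_hChain_exp_le k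
  exact ⟨C, hC, fun N z hz => h N z ⟨hz.1, by linarith [hz.2]⟩⟩

/-- Expansion about y = 1 in z = 1 - y: the chain rule gives (-1)^k, while (-1)^N is the sign later
absorbed into the weight ṽ. -/
theorem polyChain_exp_alt :
    PolyChain (fun k N z => (-1) ^ N * (-1) ^ k * hChain (-1) (-1) k N (1 - z)) (1 / 2) := by
  refine ⟨fun k N z hz => ?_, fun k => ?_⟩
  · have h1 : HasDerivAt (hChain (-1) (-1) k N) (hChain (-1) (-1) (k + 1) N (1 - z)) (1 - z) :=
      hasDerivAt_hChain (by simp) k N (by nlinarith [sq_nonneg (1 - z)])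
    have h2 := h1.scomp z ((hasDerivAt_id z).const_sub 1)
    refine (h2.const_mul ((-1 : ℂ) ^ N * (-1) ^ k)).congr_deriv ?_
    rw [neg_one_smul, pow_succ]
    ring
  · obtain ⟨C, hC, h⟩ := norm_hChain_exp_le k
    refine ⟨C, hC, fun N z hz => ?_⟩
    rw [norm_mul, norm_mul, norm_pow, norm_pow, norm_neg, norm_one, one_pow, one_pow, one_mul,
      one_mul]
    exact h N (1 - z) ⟨by linarith [hz.2], by linarith [hz.1]⟩

theorem units_cast_real_sq (σ : ℤˣ) : (((σ : ℤ) : ℝ)) ^ 2 = 1 := by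
  rcases Int.units_eq_one_or σ with rfl | rfl <;> simp

/-- `σ i`. -/
def sI (σ : ℤˣ) : ℂ := (((σ : ℤ) : ℝ) : ℂ) * Complex.I

theorem sI_sq (σ : ℤˣ) : sI σ ^ 2 = -1 := by
  rw [sI, mul_pow, Complex.I_sq, ← Complex.ofReal_pow, units_cast_real_sq]
  simp

/-- Both factors are instances of one chain: (e, ω) = (1, σi) for the oscillating exponential and
(-1, -1) for the decaying one. -/
theorem resKernel_eq (σ : ℤˣ) (y : ℝ) (N : ℕ) :
    resKernel σ y (Real.sqrt (1 - y ^ 2)) (Real.sqrt (1 + y ^ 2)) N =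
      (1 / (32 * (y : ℂ) ^ 3)) * (sI σ * hChain 1 (sI σ) 0 N y - hChain (-1) (-1) 0 N y) := by
  have e1 : 1 - 1 * y ^ 2 = 1 - y ^ 2 := by ring
  have e2 : 1 - (-1) * y ^ 2 = 1 + y ^ 2 := by ring
  simp only [resKernel, hChain, e1, e2, sI]
  push_cast
  ring

theorem M_eq_convOp (V : ℤ → ℝ) (σ : ℤˣ) {y : ℝ} (hy0 : 0 < y) (hy1 : y < 1) :
    M V σ (2 * y) = (signOp V).toContinuousLinearMap +
      convOp (vk V 0) (resKernel σ y (Real.sqrt (1 - y ^ 2)) (Real.sqrt (1 + y ^ 2))) := by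
  rw [M, sandwich, convOp]
  congr 2
  funext n m
  rw [freeBoundary_eq σ hy0 hy1, convKernel]

/-! ### Expansion at the threshold `0` -/

/-- The coefficient functions of the free resolvent kernel at `0`. -/
def zeroFn (σ : ℤˣ) (k N : ℕ) : ℂ :=
  (1 / 32) * (sI σ * (hChain 1 (sI σ) k N 0 / (k.factorial : ℂ)) -
    hChain (-1) (-1) k N 0 / (k.factorial : ℂ))

/-- The coefficient of `y^l` in the expansion of `M(2y)` at `y = 0`. -/
def zeroCoeff (V : ℤ → ℝ) (σ : ℤˣ) (l : ℤ) : Op :=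
  convOp (vk V 0) (zeroFn σ (l + 3).toNat) +
    if l = 0 then (signOp V).toContinuousLinearMap else 0

theorem polyChain_sI (σ : ℤˣ) : PolyChain (fun k N => hChain 1 (sI σ) k N) (1 / 2) := by
  simpa [sI] using polyChain_osc (units_cast_real_sq σ) 1

theorem polyBdd_coeff {G : ℕ → ℕ → ℝ → ℂ} {δ : ℝ} (hG : PolyChain G δ) (hδ : 0 < δ) (k : ℕ) :
    PolyBdd (fun N => G k N 0 / (k.factorial : ℂ)) k := by
  have := (hG.polyBdd k (Set.left_mem_Icc.2 hδ.le)).smul ((k.factorial : ℂ)⁻¹)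
  simpa [div_eq_inv_mul] using this

theorem polyBdd_zeroFn (σ : ℤˣ) (k : ℕ) : PolyBdd (zeroFn σ k) k :=
  (((polyBdd_coeff (polyChain_sI σ) (by norm_num) k).smul (sI σ)).sub
    (polyBdd_coeff polyChain_exp (by norm_num) k)).smul (1 / 32)

theorem sum_Ico_int {E : Type*} [AddCommMonoid E] (a K : ℕ) (f : ℤ → E) :
    ∑ l ∈ Finset.Ico (-(a : ℤ)) K, f l = ∑ j ∈ Finset.range (K + a), f ((j : ℤ) - a) := by
  symm
  refine Finset.sum_bij (fun j _ => (j : ℤ) - a) ?_ ?_ ?_ (fun _ _ => rfl)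
  · intro j hj
    simp only [Finset.mem_range, Finset.mem_Ico] at *
    omega
  · intro i _ j _ h
    omega
  · intro l hl
    simp only [Finset.mem_Ico] at hl
    exact ⟨(l + a).toNat, by simp only [Finset.mem_range]; omega, by omega⟩

theorem coe_smul_op (x : ℝ) (A : Op) : (x : ℂ) • A = x • A :=
  Complex.coe_smul x A

/-- The prefactor y^{-3} costs three orders, so K + 3 Taylor terms and as many powers of the weight
are needed. The operator U contributes to l = 0 only. -/
theorem zero_expansion {V : ℤ → ℝ} (σ : ℤˣ) {K : ℕ} (hw : WSum (vk V 0) (K + 3)) (hK : 1 ≤ K) :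
    Rem K (fun y => M V σ (2 * y) - ∑ l ∈ Finset.Ico (-3) (K : ℤ), y ^ l • zeroCoeff V σ l) := by
  have h1 := (polyChain_sI σ).rem_convOp (by norm_num) hw (by omega)
  have h2 := polyChain_exp.rem_convOp (by norm_num) hw (by omega)
  have h3 := ((h1.const_smul (sI σ)).sub h2).const_smul (1 / 32 : ℂ)
  have h4 := Rem.zpow_smul (-3) h3
  have e0 : (-3 : ℤ) + ((K + 3 : ℕ) : ℤ) = K := by push_cast; ring
  rw [e0] at h4
  refine h4.congr ?_
  filter_upwards [eventually_pos, eventually_lt (show (0 : ℝ) < 1 / 2 by norm_num)] with y hy0 hy1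
  have hyI : y ∈ Set.Icc (0 : ℝ) (1 / 2) := ⟨hy0.le, hy1.le⟩
  have b1 : PolyBdd (fun N => hChain 1 (sI σ) 0 N y) (K + 3) :=
    ((polyChain_sI σ).polyBdd 0 hyI).mono (by omega)
  have b2 : PolyBdd (fun N => hChain (-1) (-1) 0 N y) (K + 3) :=
    (polyChain_exp.polyBdd 0 hyI).mono (by omega)
  have hM : M V σ (2 * y) = (signOp V).toContinuousLinearMap +
      y ^ (-3 : ℤ) • ((1 / 32 : ℂ) • (sI σ • convOp (vk V 0) (fun N => hChain 1 (sI σ) 0 N y) -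
        convOp (vk V 0) (fun N => hChain (-1) (-1) 0 N y))) := by
    rw [M_eq_convOp V σ hy0 (by linarith)]
    congr 1
    have : (resKernel σ y (Real.sqrt (1 - y ^ 2)) (Real.sqrt (1 + y ^ 2))) = fun N =>
        (1 / (32 * (y : ℂ) ^ 3)) * (sI σ * hChain 1 (sI σ) 0 N y - hChain (-1) (-1) 0 N y) := by
      funext N
      exact resKernel_eq σ y N
    rw [this, convOp_smul hw _ ((b1.smul (sI σ)).sub b2), convOp_sub hw (b1.smul (sI σ)) b2,
      convOp_smul hw _ b1, ← coe_smul_op, smul_smul]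
    congr 1
    have hyc : (y : ℂ) ≠ 0 := by exact_mod_cast hy0.ne'
    push_cast
    rw [zpow_neg]
    norm_cast
    push_cast
    field_simp
  have hC : ∀ j ∈ Finset.range (K + 3), zeroCoeff V σ ((j : ℤ) - 3) =
      (1 / 32 : ℂ) • (sI σ • convOp (vk V 0) (fun N => hChain 1 (sI σ) j N 0 / (j.factorial : ℂ)) -
        convOp (vk V 0) (fun N => hChain (-1) (-1) j N 0 / (j.factorial : ℂ))) +
      if (j : ℤ) - 3 = 0 then (signOp V).toContinuousLinearMap else 0 := by
    intro j hj
    have hj' := (Finset.mem_range.1 hj).le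
    have c1 := (polyBdd_coeff (polyChain_sI σ) (by norm_num) j).mono hj'
    have c2 := (polyBdd_coeff polyChain_exp (by norm_num) j).mono hj'
    rw [zeroCoeff]
    congr 1
    have : ((j : ℤ) - 3 + 3).toNat = j := by omega
    rw [this]
    have e : zeroFn σ j = fun N => (1 / 32 : ℂ) * (sI σ * (hChain 1 (sI σ) j N 0 / (j.factorial : ℂ)) -
        hChain (-1) (-1) j N 0 / (j.factorial : ℂ)) := rfl
    rw [e, convOp_smul hw _ ((c1.smul (sI σ)).sub c2), convOp_sub hw (c1.smul (sI σ)) c2,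
      convOp_smul hw _ c1]
  have hS : ∑ l ∈ Finset.Ico (-3) (K : ℤ), y ^ l • zeroCoeff V σ l =
      (signOp V).toContinuousLinearMap + y ^ (-3 : ℤ) • ((1 / 32 : ℂ) • (sI σ •
        (∑ j ∈ Finset.range (K + 3), y ^ j •
          convOp (vk V 0) (fun N => hChain 1 (sI σ) j N 0 / (j.factorial : ℂ))) -
        ∑ j ∈ Finset.range (K + 3), y ^ j •
          convOp (vk V 0) (fun N => hChain (-1) (-1) j N 0 / (j.factorial : ℂ)))) := by
    have := sum_Ico_int 3 K (fun l => y ^ l • zeroCoeff V σ l)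
    push_cast at this
    rw [this, Finset.sum_congr rfl fun j hj => by rw [hC j hj]]
    simp only [smul_add, Finset.sum_add_distrib]
    rw [add_comm]
    congr 1
    · rw [Finset.sum_eq_single 3]
      · simp
      · intro j _ hj
        rw [if_neg (by omega), smul_zero]
      · intro h
        simp at h
        omega
    · rw [Finset.smul_sum, ← Finset.sum_sub_distrib, Finset.smul_sum, Finset.smul_sum]
      refine Finset.sum_congr rfl fun j _ => ?_
      have hz : y ^ ((j : ℤ) - 3) = y ^ (-3 : ℤ) * y ^ j := by
        rw [sub_eq_add_neg, add_comm, zpow_add₀ hy0.ne', zpow_natCast]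
      rw [hz]
      simp only [← coe_smul_op]
      push_cast
      module
  rw [hM, hS, add_sub_add_left_eq_sub]
  simp only [smul_sub]
  abel

/-! ### Expansion at the threshold `16` -/

theorem sI_neg (σ : ℤˣ) : sI (-σ) = -sI σ := by
  simp [sI]

theorem polyChain_sI_double (σ : ℤˣ) : PolyChain (fun k N => hChain 1 (sI σ) k (2 * N)) (1 / 2) :=
  polyChain_osc (units_cast_real_sq σ) 2

/-- The part of the coefficients at `16` coming from the oscillating exponential. -/
def sixteenOsc (V : ℤ → ℝ) (σ : ℤˣ) (j : ℕ) : Op :=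
  (sI σ / 64) • convOp (vkt V 0) (fun N => hChain 1 (sI (-σ)) j (2 * N) 0 / (j.factorial : ℂ))

/-- The derivatives of `(-1)^N (a - y)^{2N} / a` with respect to `z = 1 - y`. -/
def altChain (k N : ℕ) (z : ℝ) : ℂ := (-1) ^ N * (-1) ^ k * hChain (-1) (-1) k N (1 - z)

/-- The part of the coefficients at `16` that is smooth in the energy. -/
def sixteenSmooth (V : ℤ → ℝ) (i : ℕ) : Op :=
  ((-1) ^ i * (Nat.choose 3 i : ℂ)) • (signOp V).toContinuousLinearMap -
    (1 / 32 : ℂ) • convOp (vkt V 0) (fun N => altChain i N 0 / (i.factorial : ℂ))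

/-- The coefficient of `s^l` in the expansion of `y³ M(2y)`, `y = 1 - 2s²`, at `s = 0`. -/
def sixteenCoeff (V : ℤ → ℝ) (σ : ℤˣ) (l : ℤ) : Op :=
  sixteenOsc V σ (l + 1).toNat +
    if Odd (l + 1).toNat then (2 : ℝ) ^ (l / 2).toNat • sixteenSmooth V (l / 2).toNat else 0

/-- Half-angle formula: for y = 1 - 2s² one has √(1 - y²) = 2s√(1 - s²) and c + σiy = σi(√(1 - s²) -
σis)². Raising to the power 2N produces (σi)^{2N} = (-1)^N, doubles the exponent and flips the sign
of σ. -/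
theorem hChain_near_one (σ : ℤˣ) (N : ℕ) {s : ℝ} (hs : 0 < s) (hs1 : s < 1) :
    hChain 1 (sI σ) 0 N (1 - 2 * s ^ 2) = (-1) ^ N * hChain 1 (sI (-σ)) 0 (2 * N) s / (2 * s) := by
  have hs2 : 0 < 1 - s ^ 2 := by nlinarith
  have e1 : Real.sqrt (1 - (1 - 2 * s ^ 2) ^ 2) = 2 * s * Real.sqrt (1 - s ^ 2) := by
    rw [show 1 - (1 - 2 * s ^ 2) ^ 2 = (2 * s) ^ 2 * (1 - s ^ 2) by ring,
      Real.sqrt_mul (by positivity), Real.sqrt_sq (by positivity)]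
  have e2 : (Real.sqrt (1 - s ^ 2) : ℂ) ^ 2 = 1 - (s : ℂ) ^ 2 := by
    exact_mod_cast Real.sq_sqrt hs2.le
  have hr : (Real.sqrt (1 - s ^ 2) : ℂ) ≠ 0 := by
    exact_mod_cast (Real.sqrt_pos.2 hs2).ne'
  have hsc : (s : ℂ) ≠ 0 := by exact_mod_cast hs.ne'
  have hσ := sI_sq σ
  simp only [hChain, sI_neg, one_mul, e1]
  push_cast
  have e3 : 2 * (s : ℂ) * (Real.sqrt (1 - s ^ 2) : ℂ) + sI σ * (1 - 2 * (s : ℂ) ^ 2) =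
      sI σ * ((Real.sqrt (1 - s ^ 2) : ℂ) + -sI σ * s) ^ 2 := by
    have : sI σ * ((Real.sqrt (1 - s ^ 2) : ℂ) + -sI σ * s) ^ 2 =
        sI σ * (Real.sqrt (1 - s ^ 2) : ℂ) ^ 2 - 2 * sI σ ^ 2 * s * (Real.sqrt (1 - s ^ 2) : ℂ) +
          sI σ * sI σ ^ 2 * s ^ 2 := by ring
    rw [this, e2, hσ]
    ring
  rw [e3, mul_pow, pow_mul (sI σ), hσ, ← pow_mul]
  field_simp

/-- (-1)^{|n-m|} = (-1)^n (-1)^m can be moved into the two weights. -/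
theorem convOp_alternate (V : ℤ → ℝ) (g : ℕ → ℂ) :
    convOp (vk V 0) (fun N => (-1) ^ N * g N) = convOp (vkt V 0) g := by
  rw [convOp, convOp]
  congr 1
  funext n m
  simp only [convKernel, vkt]
  push_cast
  have h : ((-1 : ℂ)) ^ (n - m).natAbs = (-1) ^ n * (-1) ^ m := by
    rw [← zpow_natCast, Int.natCast_natAbs, ← zpow_add₀ (by norm_num)]
    rcases abs_choice (n - m) with h | h
    · rw [h, show n + m = (n - m) + (m + m) by ring, zpow_add₀ (by norm_num),
        Even.neg_one_zpow ⟨m, rfl⟩, mul_one]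
    · rw [h, show n + m = -(n - m) + (n + n) by ring, zpow_add₀ (by norm_num),
        Even.neg_one_zpow ⟨n, rfl⟩, mul_one]
  rw [h]
  ring

/-- The part depending on z = 2s² contributes only even powers of s; after the index shift by one
caused by the leading s^{-1} these are the odd indices. -/
theorem sum_range_odd {E : Type*} [AddCommMonoid E] (κ : ℕ) (f : ℕ → E) :
    ∑ j ∈ Finset.range (2 * κ + 1), (if Odd j then f ((j - 1) / 2) else 0) =
      ∑ i ∈ Finset.range κ, f i := by
  induction κ with
  | zero => simp
  | succ κ ih =>
    rw [show 2 * (κ + 1) + 1 = 2 * κ + 1 + 1 + 1 by ring, Finset.sum_range_succ,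
      Finset.sum_range_succ, ih, Finset.sum_range_succ, if_pos (odd_two_mul_add_one κ), if_neg]
    · simp
    · rw [Nat.not_odd_iff_even]
      exact ⟨κ + 1, by ring⟩

/-- Expansion of the scalar y³ = (1 - z)³ multiplying U; the terms beyond order κ are absorbed in
the remainder. -/
theorem rem_cube {κ : ℕ} (hκ : κ ≤ 4) (A : Op) :
    Rem κ (fun z : ℝ => (1 - z) ^ 3 • A -
      ∑ i ∈ Finset.range κ, z ^ i • (((-1) ^ i * (Nat.choose 3 i : ℂ)) • A)) := by
  have h : ∀ i ∈ Finset.Ico κ 4, Rem κ (fun z : ℝ => z ^ i • (((-1) ^ i * (Nat.choose 3 i : ℂ)) • A)) := by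
    intro i hi
    have := (Rem.zpow_smul_const (i : ℤ) (((-1) ^ i * (Nat.choose 3 i : ℂ)) • A)).mono
      (show (κ : ℤ) ≤ i by exact_mod_cast (Finset.mem_Ico.1 hi).1)
    simpa only [zpow_natCast] using this
  refine (Rem.sum _ h).congr (Eventually.of_forall fun z => ?_)
  beta_reduce
  rw [Finset.sum_Ico_eq_sub _ hκ]
  congr 1
  simp only [Finset.sum_range_succ, Finset.sum_range_zero]
  norm_num [Nat.choose]
  simp only [← coe_smul_op]
  push_cast
  module

theorem polyChain_altChain : PolyChain altChain (1 / 2) := polyChain_exp_alt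

/-- `y³ M(2y)` with `y = 1 - 2s²`. -/
theorem scaled_M_eq {V : ℤ → ℝ} (σ : ℤˣ) {p : ℕ} (hw : WSum (vkt V 0) p) {s : ℝ} (hs : 0 < s)
    (hs1 : s < 1 / 2) :
    (1 - 2 * s ^ 2) ^ 3 • M V σ (2 - 4 * s ^ 2) =
      s ^ (-1 : ℤ) • (sI σ / 64) • convOp (vkt V 0) (fun N => hChain 1 (sI (-σ)) 0 (2 * N) s) +
      ((1 - 2 * s ^ 2) ^ 3 • (signOp V).toContinuousLinearMap -
        (1 / 32 : ℂ) • convOp (vkt V 0) (fun N => altChain 0 N (2 * s ^ 2))) := by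
  have hw0 := hw.mono (Nat.zero_le p)
  have hy : 0 < 1 - 2 * s ^ 2 := by nlinarith
  have hyc : (1 - 2 * (s : ℂ) ^ 2) ≠ 0 := by exact_mod_cast hy.ne'
  have hsc : (s : ℂ) ≠ 0 := by exact_mod_cast hs.ne'
  have hsI : s ∈ Set.Icc (0 : ℝ) (1 / 2) := ⟨hs.le, hs1.le⟩
  have b1 := (polyChain_sI_double (-σ)).polyBdd 0 hsI
  have b2 := polyChain_altChain.polyBdd 0 (z := 2 * s ^ 2) ⟨by positivity, by nlinarith⟩
  rw [show 2 - 4 * s ^ 2 = 2 * (1 - 2 * s ^ 2) by ring, M_eq_convOp V σ hy (by nlinarith)]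
  have e : (resKernel σ ((1 - 2 * s ^ 2 : ℝ) : ℂ) (Real.sqrt (1 - (1 - 2 * s ^ 2) ^ 2))
      (Real.sqrt (1 + (1 - 2 * s ^ 2) ^ 2))) = fun N => (-1) ^ N *
        ((1 / ((1 - 2 * (s : ℂ) ^ 2) ^ 3)) * ((sI σ / 64 / s) * hChain 1 (sI (-σ)) 0 (2 * N) s -
          (1 / 32) * altChain 0 N (2 * s ^ 2))) := by
    funext N
    rw [resKernel_eq, hChain_near_one σ N hs (by linarith), altChain]
    have h1 : ((-1 : ℂ) ^ N) * (-1) ^ N = 1 := by rw [← mul_pow]; simp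
    push_cast
    generalize (1 - 2 * (s : ℂ) ^ 2) = Y
    linear_combination (1 / Y ^ 3 * (1 / 32) * hChain (-1) (-1) 0 N (1 - 2 * s ^ 2)) * h1
  rw [e, convOp_alternate, convOp_smul hw0 _ ((b1.smul _).sub (b2.smul _)),
    convOp_sub hw0 (b1.smul _) (b2.smul _), convOp_smul hw0 _ b1, convOp_smul hw0 _ b2, smul_add,
    ← coe_smul_op _ (_ • (_ - _)), smul_smul, ← coe_smul_op (s ^ (-1 : ℤ)), smul_smul]
  have e1 : (((1 - 2 * s ^ 2) ^ 3 : ℝ) : ℂ) * (1 / (1 - 2 * (s : ℂ) ^ 2) ^ 3) = 1 := by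
    push_cast
    field_simp
  have e2 : ((s ^ (-1 : ℤ) : ℝ) : ℂ) * (sI σ / 64) = sI σ / 64 / s := by
    push_cast
    rw [zpow_neg_one]
    field_simp
  rw [e1, e2, one_smul]
  abel

/-- The oscillating part is expanded in s to 2κ + 1 terms, one being lost to s^{-1}, and the smooth
part in z = 2s² to κ terms. The factor y³ cancels the prefactor of the resolvent kernel, so that no
further expansion in s is required. -/
theorem sixteen_expansion {V : ℤ → ℝ} (σ : ℤˣ) {κ : ℕ} (hw : WSum (vkt V 0) (2 * κ + 1))
    (hκ : 1 ≤ κ) (hκ4 : κ ≤ 4) :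
    Rem (2 * κ) (fun s => (1 - 2 * s ^ 2) ^ 3 • M V σ (2 - 4 * s ^ 2) -
      ∑ l ∈ Finset.Ico (-1) (2 * κ : ℤ), s ^ l • sixteenCoeff V σ l) := by
  have h1 := ((polyChain_sI_double (-σ)).rem_convOp (by norm_num) hw (by omega)).const_smul
    (sI σ / 64)
  have h1' := Rem.zpow_smul (-1) h1
  rw [show (-1 : ℤ) + ((2 * κ + 1 : ℕ) : ℤ) = 2 * κ by push_cast; ring] at h1'
  have h2 := (polyChain_altChain.rem_convOp (by norm_num) (hw.mono (show κ ≤ 2 * κ + 1 by omega))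
    hκ).const_smul (1 / 32 : ℂ)
  have h3 := ((rem_cube hκ4 (signOp V).toContinuousLinearMap).sub h2).comp_mul
    (show (0 : ℝ) < 2 by norm_num)
  have h4 := h1'.add h3.comp_sq
  refine h4.congr ?_
  filter_upwards [eventually_pos, eventually_lt (show (0 : ℝ) < 1 / 2 by norm_num)] with s hs hs1
  rw [scaled_M_eq σ hw hs hs1]
  have hS : ∑ l ∈ Finset.Ico (-1) (2 * κ : ℤ), s ^ l • sixteenCoeff V σ l =
      s ^ (-1 : ℤ) • ∑ j ∈ Finset.range (2 * κ + 1), s ^ j • sixteenOsc V σ j +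
        ∑ i ∈ Finset.range κ, (2 * s ^ 2) ^ i • sixteenSmooth V i := by
    have := sum_Ico_int 1 (2 * κ) (fun l => s ^ l • sixteenCoeff V σ l)
    push_cast at this
    rw [this, ← sum_range_odd κ (fun i => (2 * s ^ 2) ^ i • sixteenSmooth V i), Finset.smul_sum,
      ← Finset.sum_add_distrib]
    refine Finset.sum_congr rfl fun j _ => ?_
    have hz : s ^ ((j : ℤ) - 1) = s ^ (-1 : ℤ) * s ^ j := by
      rw [sub_eq_add_neg, add_comm, zpow_add₀ hs.ne', zpow_natCast]
    have hj : ((j : ℤ) - 1 + 1).toNat = j := by omega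
    rw [sixteenCoeff, hj, smul_add, smul_smul, ← hz]
    congr 1
    split_ifs with ho
    · obtain ⟨i, rfl⟩ := ho
      have e1 : (((2 * i + 1 : ℕ) : ℤ) - 1) / 2 = i := by push_cast; omega
      have e2 : (2 * i + 1 - 1) / 2 = i := by omega
      rw [e1, e2, smul_smul]
      congr 1
      push_cast
      rw [add_sub_cancel_right, mul_pow, Int.toNat_natCast, ← pow_mul, mul_comm,
        show s ^ (2 * (i : ℤ)) = s ^ (2 * i) by exact_mod_cast zpow_natCast s (2 * i)]
    · simp
  rw [hS]
  simp only [sixteenOsc, sixteenSmooth, smul_sub, Finset.smul_sum, Finset.sum_sub_distrib]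
  have e5 : ∀ (r : ℝ) (c : ℂ) (A : Op), r • c • A = c • r • A := fun r c A => smul_comm r c A
  simp only [e5]
  abel

/-! ### Matrix entries -/

theorem HasKernel.apply_single {K : ℤ → ℤ → ℂ} {T : Op} (h : HasKernel K T) (n m : ℤ) :
    T (lp.single 2 m 1) n = K n m := by
  classical
  refine (h (lp.single 2 m 1) n).unique ?_
  have := hasSum_single (f := fun k => K n k * (lp.single 2 m (1 : ℂ) : L2) k) m
    (fun k hk => by simp [lp.single_apply, Pi.single_eq_of_ne hk])
  simpa [lp.single_apply] using this

theorem op_ext {T T' : Op} (h : ∀ n m : ℤ, T (lp.single 2 m 1) n = T' (lp.single 2 m 1) n) :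
    T = T' := by
  classical
  refine ContinuousLinearMap.ext fun f => ?_
  have h1 := lp.hasSum_single (by norm_num : (2 : ENNReal) ≠ ⊤) f
  have h2 := h1.mapL T
  have h3 := h1.mapL T'
  have e : ∀ m : ℤ, T (lp.single 2 m (f m)) = T' (lp.single 2 m (f m)) := by
    intro m
    have : (lp.single 2 m (f m) : L2) = f m • lp.single 2 m (1 : ℂ) := by
      rw [← lp.single_smul, smul_eq_mul, mul_one]
    rw [this, map_smul, map_smul]
    congr 1
    ext n
    exact h n m
  simp only [e] at h2
  exact h2.unique h3

theorem adjoint_apply_single (T : Op) (n m : ℤ) :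
    ContinuousLinearMap.adjoint T (lp.single 2 m 1) n =
      starRingEnd ℂ (T (lp.single 2 n 1) m) := by
  classical
  have h1 := lp.inner_single_left (𝕜 := ℂ) (G := fun _ : ℤ => ℂ) n (1 : ℂ)
    (ContinuousLinearMap.adjoint T (lp.single 2 m 1))
  have h2 := lp.inner_single_right (𝕜 := ℂ) (G := fun _ : ℤ => ℂ) m (1 : ℂ)
    (T (lp.single 2 n 1))
  rw [ContinuousLinearMap.adjoint_inner_right] at h1
  have h3 := h1.symm.trans h2
  simpa using h3

theorem HasKernel.isSelfAdjoint {K : ℤ → ℤ → ℂ} {T : Op} (h : HasKernel K T)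
    (hK : ∀ n m, starRingEnd ℂ (K m n) = K n m) : IsSelfAdjoint T := by
  rw [ContinuousLinearMap.isSelfAdjoint_iff']
  refine op_ext fun n m => ?_
  rw [adjoint_apply_single, h.apply_single, h.apply_single, hK]

theorem isSelfAdjoint_convOp {w : ℤ → ℝ} {g : ℕ → ℂ} {p : ℕ} (hw : WSum w p) (hg : PolyBdd g p)
    (hr : ∀ N, starRingEnd ℂ (g N) = g N) : IsSelfAdjoint (convOp w g) := by
  refine (convOp_hasKernel hw hg).isSelfAdjoint fun n m => ?_
  rw [convKernel, convKernel, map_mul, map_mul, hr, Complex.conj_ofReal, Complex.conj_ofReal,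
    ← neg_sub n m, Int.natAbs_neg]
  ring

/-- Multiplication by `U` as a bounded operator. -/
abbrev UOp (V : ℤ → ℝ) : Op := (signOp V).toContinuousLinearMap

theorem signV_sq (V : ℤ → ℝ) (n : ℤ) : signV V n * signV V n = 1 := by
  unfold signV
  split <;> simp

theorem UOp_apply (V : ℤ → ℝ) (f : L2) (n : ℤ) : UOp V f n = signV V n * f n := rfl

theorem UOp_mul_self (V : ℤ → ℝ) : UOp V * UOp V = 1 := by
  ext f n
  change signV V n * (signV V n * f n) = f n
  rw [← mul_assoc, signV_sq, one_mul]

theorem isSelfAdjoint_UOp (V : ℤ → ℝ) : IsSelfAdjoint (UOp V) := by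
  classical
  rw [ContinuousLinearMap.isSelfAdjoint_iff']
  refine op_ext fun n m => ?_
  rw [adjoint_apply_single, UOp_apply, UOp_apply, map_mul]
  have h : ∀ k, starRingEnd ℂ (signV V k) = signV V k := by
    intro k
    unfold signV
    split <;> simp
  rw [h]
  by_cases hnm : n = m
  · subst hnm
    simp
  · simp [lp.single_apply, Pi.single_eq_of_ne hnm, Pi.single_eq_of_ne (Ne.symm hnm)]

/-! ### Moment vectors and polynomial kernels -/

theorem memℓp_moment {w : ℕ → ℤ → ℝ} (hw : ∀ k n, w k n = (n : ℝ) ^ k * w 0 n) {p k : ℕ}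
    (hs : WSum (w 0) p) (hk : k ≤ p) : Memℓp (fun n => (w k n : ℂ)) 2 := by
  refine memℓp_two_iff.2 (Summable.of_nonneg_of_le (fun n => by positivity) (fun n => ?_)
    (hs.mono hk))
  rw [Complex.norm_real, Real.norm_eq_abs, sq_abs, hw k n, mul_pow, ← pow_mul, mul_comm k 2]
  refine mul_le_mul_of_nonneg_right ?_ (sq_nonneg _)
  rw [pow_mul, pow_mul, ← sq_abs (n : ℝ)]
  gcongr
  linarith [abs_nonneg (n : ℝ)]

theorem toL2_apply {w : ℤ → ℝ} (h : Memℓp (fun n => (w n : ℂ)) 2) (n : ℤ) : toL2 w n = w n := by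
  rw [toL2, dif_pos h]

theorem hasSum_inner_toL2 {w : ℤ → ℝ} (h : Memℓp (fun n => (w n : ℂ)) 2) (f : L2) :
    HasSum (fun n => (w n : ℂ) * f n) ⟪toL2 w, f⟫_ℂ := by
  have := lp.hasSum_inner (𝕜 := ℂ) (toL2 w) f
  have e : (fun n => (w n : ℂ) * f n) = fun n => ⟪toL2 w n, f n⟫_ℂ := by
    funext n
    rw [toL2_apply h]
    simp [mul_comm]
  rw [e]
  exact this

theorem rankOne_hasKernel {x y : ℤ → ℝ} (hx : Memℓp (fun n => (x n : ℂ)) 2)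
    (hy : Memℓp (fun n => (y n : ℂ)) 2) :
    HasKernel (fun n m => (x n : ℂ) * (y m : ℂ))
      (InnerProductSpace.rankOne ℂ (toL2 x) (toL2 y)) := by
  intro f n
  have h := (hasSum_inner_toL2 hy f).mul_left (x n : ℂ)
  have e : (InnerProductSpace.rankOne ℂ (toL2 x) (toL2 y) f : L2) n = (x n : ℂ) * ⟪toL2 y, f⟫_ℂ := by
    rw [InnerProductSpace.rankOne_apply, lp.coeFn_smul, Pi.smul_apply, toL2_apply hx, smul_eq_mul,
      mul_comm]
  rw [e]
  simpa only [mul_assoc] using h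

theorem HasKernel.sum {ι : Type*} (s : Finset ι) {K : ι → ℤ → ℤ → ℂ} {T : ι → Op}
    (h : ∀ i ∈ s, HasKernel (K i) (T i)) :
    HasKernel (fun n m => ∑ i ∈ s, K i n m) (∑ i ∈ s, T i) := by
  classical
  induction s using Finset.induction_on with
  | empty => intro f n; simp
  | insert a s ha ih =>
    simp only [Finset.sum_insert ha]
    exact (h a (Finset.mem_insert_self a s)).add
      (ih fun i hi => h i (Finset.mem_insert_of_mem hi))

/-- An even power of |n-m| is a polynomial in n and m, so the binomial theorem writes the operator
as a finite sum of products of moment vectors. -/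
theorem convOp_even_pow {w : ℕ → ℤ → ℝ} (hw : ∀ k n, w k n = (n : ℝ) ^ k * w 0 n) {q : ℕ}
    (hs : WSum (w 0) (2 * q)) :
    convOp (w 0) (fun N => (N : ℂ) ^ (2 * q)) = ∑ a ∈ Finset.range (2 * q + 1),
      ((-1) ^ a * ((2 * q).choose a : ℂ)) •
        InnerProductSpace.rankOne ℂ (toL2 (w (2 * q - a))) (toL2 (w a)) := by
  have h := HasKernel.sum (Finset.range (2 * q + 1))
    (K := fun a n m => ((-1) ^ a * ((2 * q).choose a : ℂ)) * ((w (2 * q - a) n : ℂ) * (w a m : ℂ)))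
    (fun a ha => HasKernel.smul ((-1) ^ a * ((2 * q).choose a : ℂ)) (rankOne_hasKernel
      (memℓp_moment hw hs (Nat.sub_le _ a))
      (memℓp_moment hw hs (Nat.lt_succ_iff.1 (Finset.mem_range.1 ha)))))
  refine kernelOp_eq ?_
  convert h using 1
  funext n m
  have e : (((n - m).natAbs : ℂ)) ^ (2 * q) = (-(m : ℂ) + n) ^ (2 * q) := by
    have : ((n - m).natAbs : ℂ) ^ 2 = ((n - m : ℤ) : ℂ) ^ 2 := by
      rw [← Int.cast_natCast, ← Int.cast_pow, Int.natAbs_sq, Int.cast_pow]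
    rw [pow_mul, this, ← pow_mul]
    push_cast
    ring
  rw [convKernel, e, add_pow, Finset.mul_sum, Finset.sum_mul]
  refine Finset.sum_congr rfl fun a _ => ?_
  rw [hw a m, hw (2 * q - a) n, neg_pow]
  push_cast
  ring

theorem polyBdd_pow (q : ℕ) : PolyBdd (fun N => (N : ℂ) ^ q) q :=
  ⟨1, zero_le_one, fun N => by
    rw [norm_pow, one_mul, Complex.norm_natCast]
    gcongr
    linarith [(Nat.cast_nonneg N : (0 : ℝ) ≤ N)]⟩

theorem mul_rankOne_mul {X Y : Op} (hY : IsSelfAdjoint Y) (x y : L2) :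
    X * InnerProductSpace.rankOne ℂ x y * Y = InnerProductSpace.rankOne ℂ (X x) (Y y) := by
  ext1 f
  simp only [mul_apply_eq_comp, InnerProductSpace.rankOne_apply, map_smul]
  rw [← ContinuousLinearMap.adjoint_inner_left, hY.adjoint_eq]

/-- In the binomial sum the term with indices (2q - a, a) survives only if a ≥ j and 2q - a ≥ i.
When 2q = i + j this leaves a = j alone, and when 2q < i + j nothing. -/
theorem block_even_pow {w : ℕ → ℤ → ℝ} (hw : ∀ k n, w k n = (n : ℝ) ^ k * w 0 n) {q : ℕ}
    (hs : WSum (w 0) (2 * q)) {X Y : Op} (hY : IsSelfAdjoint Y) {i j : ℕ}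
    (hX0 : ∀ a < i, X (toL2 (w a)) = 0) (hY0 : ∀ a < j, Y (toL2 (w a)) = 0) (hij : 2 * q ≤ i + j) :
    X * convOp (w 0) (fun N => (N : ℂ) ^ (2 * q)) * Y = if 2 * q = i + j then
      ((-1) ^ j * ((2 * q).choose j : ℂ)) •
        InnerProductSpace.rankOne ℂ (X (toL2 (w i))) (Y (toL2 (w j))) else 0 := by
  rw [convOp_even_pow hw hs, Finset.mul_sum, Finset.sum_mul]
  simp only [mul_smul_comm, smul_mul_assoc, mul_rankOne_mul hY]
  split_ifs with h
  · rw [Finset.sum_eq_single j]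
    · rw [show 2 * q - j = i by omega]
    · intro a ha haj
      rcases lt_or_gt_of_ne haj with h1 | h1
      · rw [hY0 a h1]
        simp
      · rw [hX0 (2 * q - a) (by have := Finset.mem_range.1 ha; omega)]
        simp
    · intro hj
      simp only [Finset.mem_range] at hj
      omega
  · refine Finset.sum_eq_zero fun a ha => ?_
    by_cases h1 : a < j
    · rw [hY0 a h1]
      simp
    · rw [hX0 (2 * q - a) (by have := Finset.mem_range.1 ha; omega)]
      simp

/-- Blocks of an operator whose kernel is an even polynomial of degree `2k`. -/
theorem block_even_poly {w : ℕ → ℤ → ℝ} (hw : ∀ k n, w k n = (n : ℝ) ^ k * w 0 n) {k : ℕ}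
    (hs : WSum (w 0) (2 * k)) {X Y : Op} (hY : IsSelfAdjoint Y) {i j : ℕ}
    (hX0 : ∀ a < i, X (toL2 (w a)) = 0) (hY0 : ∀ a < j, Y (toL2 (w a)) = 0) (hij : 2 * k ≤ i + j)
    (c : ℕ → ℂ) :
    X * convOp (w 0) (fun N : ℕ => ∑ q ∈ Finset.range (k + 1), c q * (N : ℂ) ^ (2 * q)) * Y =
      if 2 * k = i + j then (c k * ((-1) ^ j * ((2 * k).choose j : ℂ))) •
        InnerProductSpace.rankOne ℂ (X (toL2 (w i))) (Y (toL2 (w j))) else 0 := by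
  have hb : ∀ q ∈ Finset.range (k + 1), PolyBdd (fun N : ℕ => (N : ℂ) ^ (2 * q)) (2 * k) :=
    fun q hq => (polyBdd_pow (2 * q)).mono (by have := Finset.mem_range.1 hq; omega)
  rw [convOp_sum hs _ (fun q hq => (hb q hq).smul (c q)), Finset.mul_sum, Finset.sum_mul]
  rw [Finset.sum_congr rfl fun q hq => by
    rw [convOp_smul hs (c q) (hb q hq), mul_smul_comm, smul_mul_assoc, block_even_pow hw
      (hs.mono (by have := Finset.mem_range.1 hq; omega)) hY hX0 hY0
      (by have := Finset.mem_range.1 hq; omega)]]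
  rw [Finset.sum_range_succ, Finset.sum_eq_zero, zero_add]
  · split_ifs with h
    · rw [smul_smul]
    · simp
  · intro q hq
    rw [if_neg (by have := Finset.mem_range.1 hq; omega), smul_zero]

theorem vk_eq (V : ℤ → ℝ) (k : ℕ) (n : ℤ) : vk V k n = (n : ℝ) ^ k * vk V 0 n := by
  simp [vk]

theorem vkt_eq (V : ℤ → ℝ) (k : ℕ) (n : ℤ) : vkt V k n = (n : ℝ) ^ k * vkt V 0 n := by
  simp only [vkt, vk]
  ring

/-! ### The coefficients at `0` -/

/-- Leading coefficients of the polynomial kernels at `0`. -/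
theorem zeroFn_zero (σ : ℤˣ) (N : ℕ) : zeroFn σ 0 N = (sI σ - 1) / 32 := by
  simp only [zeroFn, hChain_zero_zero, Nat.factorial]
  push_cast
  ring

/-- In odd order the oscillating factor contributes σi·σi = -1. At orders 1 and 5 this cancels the
contribution of the decaying exponential; at order 3 the factor e = ∓1 makes the two add up instead,
with a result independent of the sign. -/
theorem zeroFn_one (σ : ℤˣ) (N : ℕ) : zeroFn σ 1 N = 0 := by
  simp only [zeroFn, hChain_one_zero, Nat.factorial]
  push_cast
  linear_combination (N / 16 : ℂ) * sI_sq σ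

theorem zeroFn_two (σ : ℤˣ) (N : ℕ) : zeroFn σ 2 N = (sI σ + 1) * (1 - 4 * (N : ℂ) ^ 2) / 64 := by
  simp only [zeroFn, hChain_add_two_zero, hChain_zero_zero, Nat.factorial]
  push_cast
  ring

theorem zeroFn_three (σ : ℤˣ) (N : ℕ) : zeroFn σ 3 N = ((N : ℂ) ^ 3 - N) / 12 := by
  simp only [zeroFn, hChain_add_two_zero, hChain_one_zero, Nat.factorial]
  push_cast
  linear_combination ((4 - 4 * (N : ℂ) ^ 2) * N / 96) * sI_sq σ

theorem zeroFn_four (σ : ℤˣ) (N : ℕ) :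
    zeroFn σ 4 N = (sI σ - 1) * (9 - 40 * (N : ℂ) ^ 2 + 16 * (N : ℂ) ^ 4) / 768 := by
  simp only [zeroFn, hChain_add_two_zero, hChain_zero_zero, Nat.factorial]
  push_cast
  ring

theorem zeroFn_five (σ : ℤˣ) (N : ℕ) : zeroFn σ 5 N = 0 := by
  simp only [zeroFn, hChain_add_two_zero, hChain_one_zero, Nat.factorial]
  push_cast
  linear_combination ((16 - 4 * (N : ℂ) ^ 2) * (4 - 4 * (N : ℂ) ^ 2) * N / 1920) * sI_sq σ

theorem zeroFn_six (σ : ℤˣ) (N : ℕ) : zeroFn σ 6 N = (sI σ + 1) *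
    (225 - 1036 * (N : ℂ) ^ 2 + 560 * (N : ℂ) ^ 4 - 64 * (N : ℂ) ^ 6) / 23040 := by
  simp only [zeroFn, hChain_add_two_zero, hChain_zero_zero, Nat.factorial]
  push_cast
  ring

theorem conj_natCast_poly (N : ℕ) :
    starRingEnd ℂ (((N : ℂ) ^ 3 - N) / 12) = ((N : ℂ) ^ 3 - N) / 12 := by
  have : ((N : ℂ) ^ 3 - N) / 12 = ((((N : ℝ) ^ 3 - N) / 12 : ℝ) : ℂ) := by push_cast; rfl
  rw [this, Complex.conj_ofReal]

theorem T0_eq (V : ℤ → ℝ) (σ : ℤˣ) : T0 V = UOp V + convOp (vk V 0) (zeroFn σ 3) := by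
  rw [T0, sandwich, convOp]
  congr 2
  funext n m
  rw [convKernel, zeroFn_three, G0]
  have h : ((|n - m| : ℤ) : ℂ) = ((n - m).natAbs : ℂ) := by
    rw [← Int.natCast_natAbs, Int.cast_natCast]
  rw [h]

theorem zeroCoeff_zero (V : ℤ → ℝ) (σ : ℤˣ) : zeroCoeff V σ 0 = T0 V := by
  rw [zeroCoeff, if_pos rfl, T0_eq V σ, add_comm]
  rfl

theorem isSelfAdjoint_T0 {V : ℤ → ℝ} (hw : WSum (vk V 0) 3) : IsSelfAdjoint (T0 V) := by
  rw [T0_eq V 1]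
  refine (isSelfAdjoint_UOp V).add (isSelfAdjoint_convOp hw (polyBdd_zeroFn 1 3) fun N => ?_)
  rw [zeroFn_three, conj_natCast_poly]

theorem zeroCoeff_eq_convOp (V : ℤ → ℝ) (σ : ℤˣ) {l : ℤ} (hl : l ≠ 0) :
    zeroCoeff V σ l = convOp (vk V 0) (zeroFn σ (l + 3).toNat) := by
  rw [zeroCoeff, if_neg hl, add_zero]

theorem zeroCoeff_neg_two (V : ℤ → ℝ) (σ : ℤˣ) : zeroCoeff V σ (-2) = 0 := by
  rw [zeroCoeff_eq_convOp V σ (by norm_num)]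
  have : zeroFn σ ((-2 : ℤ) + 3).toNat = fun _ => 0 := funext fun N => zeroFn_one σ N
  rw [this, convOp_zero]

theorem zeroCoeff_two (V : ℤ → ℝ) (σ : ℤˣ) : zeroCoeff V σ 2 = 0 := by
  rw [zeroCoeff_eq_convOp V σ (by norm_num)]
  have : zeroFn σ ((2 : ℤ) + 3).toNat = fun _ => 0 := funext fun N => zeroFn_five σ N
  rw [this, convOp_zero]

/-- Leading coefficient of the polynomial kernel of `zeroCoeff V σ (2k - 3)`. -/
def zeroLead (σ : ℤˣ) : ℕ → ℂ
  | 0 => (sI σ - 1) / 32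
  | 1 => -(sI σ + 1) / 16
  | 2 => (sI σ - 1) / 48
  | 3 => -(sI σ + 1) / 360
  | _ => 0

theorem zeroFn_even_poly (σ : ℤˣ) {k : ℕ} (hk : k ≤ 3) : ∃ c : ℕ → ℂ, c k = zeroLead σ k ∧
    zeroFn σ (2 * k) = fun N : ℕ => ∑ q ∈ Finset.range (k + 1), c q * (N : ℂ) ^ (2 * q) := by
  interval_cases k
  · exact ⟨fun _ => (sI σ - 1) / 32, rfl, funext fun N => by simp [zeroFn_zero]⟩
  -- `Fin.ofNat` wraps indices around, but only indices q ≤ k enter the sum.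
  · refine ⟨![(sI σ + 1) / 64, -(sI σ + 1) / 16] ∘ (Fin.ofNat 2), rfl, funext fun N => ?_⟩
    simp [Finset.sum_range_succ, zeroFn_two, Fin.ofNat]
    ring
  · refine ⟨![9 * (sI σ - 1) / 768, -40 * (sI σ - 1) / 768, (sI σ - 1) / 48] ∘ (Fin.ofNat 3), rfl,
      funext fun N => ?_⟩
    simp [Finset.sum_range_succ, zeroFn_four, Fin.ofNat]
    ring
  · refine ⟨![225 * (sI σ + 1) / 23040, -1036 * (sI σ + 1) / 23040, 560 * (sI σ + 1) / 23040,
      -(sI σ + 1) / 360] ∘ (Fin.ofNat 4), rfl, funext fun N => ?_⟩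
    simp [Finset.sum_range_succ, zeroFn_six, Fin.ofNat]
    ring

theorem zeroCoeff_block {V : ℤ → ℝ} (σ : ℤˣ) {k : ℕ} (hk : k ≤ 3) (hw : WSum (vk V 0) (2 * k))
    {X Y : Op} (hY : IsSelfAdjoint Y) {i j : ℕ} (hX0 : ∀ a < i, X (toL2 (vk V a)) = 0)
    (hY0 : ∀ a < j, Y (toL2 (vk V a)) = 0) (hij : 2 * k ≤ i + j) {l : ℤ} (hl : l = 2 * k - 3) :
    X * zeroCoeff V σ l * Y = if 2 * k = i + j then
      (zeroLead σ k * ((-1) ^ j * ((2 * k).choose j : ℂ))) •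
        InnerProductSpace.rankOne ℂ (X (toL2 (vk V i))) (Y (toL2 (vk V j))) else 0 := by
  obtain ⟨c, hc, h⟩ := zeroFn_even_poly σ hk
  rw [zeroCoeff_eq_convOp V σ (by omega), show (l + 3).toNat = 2 * k by omega, h,
    block_even_poly (vk_eq V) hw hY hX0 hY0 hij, hc]

/-! ### The coefficients at `16` -/

theorem altChain_zero_zero (N : ℕ) :
    altChain 0 N 0 = (((2 * Real.sqrt 2 - 3) ^ N / Real.sqrt 2 : ℝ) : ℂ) := by
  have h2 : Real.sqrt (1 - (-1) * (1 - 0) ^ 2) = Real.sqrt 2 := by norm_num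
  have h3 : (Real.sqrt 2 : ℂ) ^ 2 = 2 := by exact_mod_cast Real.sq_sqrt (by norm_num : (0 : ℝ) ≤ 2)
  have e : (2 * (Real.sqrt 2 : ℂ) - 3) = (-1) * ((Real.sqrt 2 : ℂ) + -1 * ((1 - 0 : ℝ) : ℂ)) ^ 2 := by
    push_cast
    linear_combination h3
  simp only [altChain, hChain, h2]
  push_cast
  rw [e, mul_pow, ← pow_mul]
  push_cast
  ring

/-- The sign disappears because σi·(-σi) = 1; this is why T̃₀ does not depend on the boundary value
chosen. -/
theorem sixteenOsc_one (V : ℤ → ℝ) (σ : ℤˣ) {p : ℕ} (hw : WSum (vkt V 0) (p + 1)) :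
    sixteenOsc V σ 1 = convOp (vkt V 0) (fun N => (N : ℂ) / 16) := by
  have b : PolyBdd (fun N => hChain 1 (sI (-σ)) 1 (2 * N) 0 / ((Nat.factorial 1 : ℕ) : ℂ)) (p + 1) :=
    (polyBdd_coeff (polyChain_sI_double (-σ)) (by norm_num) 1).mono (by omega)
  rw [sixteenOsc, ← convOp_smul hw _ b]
  congr 1
  funext N
  rw [hChain_one_zero, sI_neg]
  push_cast [Nat.factorial]
  linear_combination (-(N : ℂ) / 16) * sI_sq σ

theorem polyBdd_altChain (i : ℕ) : PolyBdd (fun N => altChain i N 0 / (i.factorial : ℂ)) i :=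
  polyBdd_coeff polyChain_altChain (by norm_num) i

theorem polyBdd_div (q : ℕ) (c : ℂ) : PolyBdd (fun N => (N : ℂ) ^ q / c) q := by
  simpa [div_eq_inv_mul] using (polyBdd_pow q).smul c⁻¹

theorem sixteenCoeff_zero {V : ℤ → ℝ} (σ : ℤˣ) (hw : WSum (vkt V 0) 1) :
    sixteenCoeff V σ 0 = T0t V := by
  have b1 : PolyBdd (fun N => (N : ℂ) / 16) 1 := by simpa using polyBdd_div 1 16
  have b2 := (polyBdd_altChain 0).mono (Nat.zero_le 1)
  rw [sixteenCoeff, show ((0 : ℤ) + 1).toNat = 1 from rfl, if_pos (by decide),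
    show ((0 : ℤ) / 2).toNat = 0 from rfl, pow_zero, one_smul, sixteenOsc_one V σ hw, sixteenSmooth,
    ← convOp_smul hw _ b2, T0t, sandwich]
  simp only [pow_zero, Nat.choose_zero_right, Nat.cast_one, mul_one, one_smul]
  rw [add_comm, sub_add_eq_add_sub, add_sub_assoc, ← convOp_sub hw b1 (b2.smul _), convOp]
  congr 2
  funext n m
  rw [convKernel, G0t, altChain_zero_zero]
  have h : ((|n - m| : ℤ) : ℝ) = ((n - m).natAbs : ℝ) := by
    rw [← Int.natCast_natAbs, Int.cast_natCast]
  rw [h]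
  have hs : (Real.sqrt 2 : ℂ) ≠ 0 := by
    exact_mod_cast (Real.sqrt_pos.2 (by norm_num : (0 : ℝ) < 2)).ne'
  push_cast
  simp only [Nat.factorial]
  field_simp
  push_cast
  ring

theorem T0t_eq {V : ℤ → ℝ} : T0t V = UOp V + convOp (vkt V 0) (fun N =>
    (((2 * Real.sqrt 2 * N - (2 * Real.sqrt 2 - 3) ^ N) / (32 * Real.sqrt 2) : ℝ) : ℂ)) := by
  rw [T0t, sandwich, convOp]
  congr 2
  funext n m
  rw [convKernel, G0t]
  have h : ((|n - m| : ℤ) : ℝ) = ((n - m).natAbs : ℝ) := by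
    rw [← Int.natCast_natAbs, Int.cast_natCast]
  rw [h]

theorem polyBdd_G0t : PolyBdd (fun N =>
    (((2 * Real.sqrt 2 * N - (2 * Real.sqrt 2 - 3) ^ N) / (32 * Real.sqrt 2) : ℝ) : ℂ)) 1 := by
  have b1 : PolyBdd (fun N => (N : ℂ) / 16) 1 := by simpa using polyBdd_div 1 16
  have b2 := (polyBdd_altChain 0).mono (Nat.zero_le 1)
  convert b1.sub (b2.smul (1 / 32)) using 2 with N
  rw [altChain_zero_zero]
  have hs : (Real.sqrt 2 : ℂ) ≠ 0 := by
    exact_mod_cast (Real.sqrt_pos.2 (by norm_num : (0 : ℝ) < 2)).ne'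
  push_cast [Nat.factorial]
  field_simp
  ring

theorem isSelfAdjoint_T0t {V : ℤ → ℝ} (hw : WSum (vkt V 0) 1) : IsSelfAdjoint (T0t V) := by
  rw [T0t_eq]
  exact (isSelfAdjoint_UOp V).add (isSelfAdjoint_convOp hw polyBdd_G0t fun N => Complex.conj_ofReal _)

theorem sixteenCoeff_block_neg_one {V : ℤ → ℝ} (σ : ℤˣ) (hw : WSum (vkt V 0) 0)
    {X Y : Op} (hY : IsSelfAdjoint Y) {i j : ℕ} (hX0 : ∀ a < i, X (toL2 (vkt V a)) = 0)
    (hY0 : ∀ a < j, Y (toL2 (vkt V a)) = 0) :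
    X * sixteenCoeff V σ (-1) * Y = if 0 = i + j then
      (sI σ / 64) • InnerProductSpace.rankOne ℂ (X (toL2 (vkt V i))) (Y (toL2 (vkt V j))) else 0 := by
  rw [sixteenCoeff, show ((-1 : ℤ) + 1).toNat = 0 from rfl, if_neg (by decide), add_zero, sixteenOsc]
  have := block_even_poly (k := 0) (vkt_eq V) hw hY hX0 hY0 (by omega) (fun _ => 1)
  simp only [zero_add, Finset.sum_range_one, mul_zero, pow_zero, mul_one] at this
  simp only [hChain_zero_zero, Nat.factorial, Nat.cast_one, div_one, mul_smul_comm, smul_mul_assoc]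
  rw [this]
  split_ifs with h
  · obtain ⟨rfl, rfl⟩ : i = 0 ∧ j = 0 := by omega
    simp
  · simp

theorem sixteenCoeff_block_one {V : ℤ → ℝ} (σ : ℤˣ) (hw : WSum (vkt V 0) 2)
    {X Y : Op} (hY : IsSelfAdjoint Y) {i j : ℕ} (hX0 : ∀ a < i, X (toL2 (vkt V a)) = 0)
    (hY0 : ∀ a < j, Y (toL2 (vkt V a)) = 0) (hij : 2 ≤ i + j) :
    X * sixteenCoeff V σ 1 * Y = if 2 = i + j then
      (-sI σ / 8 * ((-1) ^ j * (Nat.choose 2 j : ℂ))) •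
        InnerProductSpace.rankOne ℂ (X (toL2 (vkt V i))) (Y (toL2 (vkt V j))) else 0 := by
  rw [sixteenCoeff, show ((1 : ℤ) + 1).toNat = 2 from rfl, if_neg (by decide), add_zero, sixteenOsc]
  -- 1/2 and -8 are the coefficients of (1 - 16N²)/2, the second Taylor coefficient with 2N in place
  -- of N.
  have := block_even_poly (k := 1) (vkt_eq V) hw hY hX0 hY0 (by omega)
    (![1 / 2, -8] ∘ (Fin.ofNat 2))
  have e : (fun N => hChain 1 (sI (-σ)) 2 (2 * N) 0 / ((Nat.factorial 2 : ℕ) : ℂ)) = fun N : ℕ =>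
      ∑ q ∈ Finset.range (1 + 1), (![1 / 2, -8] ∘ (Fin.ofNat 2)) q * (N : ℂ) ^ (2 * q) := by
    funext N
    simp [Finset.sum_range_succ, hChain_add_two_zero, hChain_zero_zero, Fin.ofNat, Nat.factorial]
    ring
  rw [e, mul_smul_comm, smul_mul_assoc, this]
  simp only [mul_one]
  split_ifs with h
  · rw [smul_smul]
    congr 1
    simp [Fin.ofNat]
    ring
  · simp

/-! ### Projections and compactness -/

theorem starProjection_mul_of_le {A B : Submodule ℂ L2} [A.HasOrthogonalProjection]
    [B.HasOrthogonalProjection] (h : A ≤ B) :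
    A.starProjection * B.starProjection = A.starProjection :=
  Submodule.starProjection_comp_starProjection_of_le h

theorem mul_starProjection_of_le {A B : Submodule ℂ L2} [A.HasOrthogonalProjection]
    [B.HasOrthogonalProjection] (h : A ≤ B) :
    B.starProjection * A.starProjection = A.starProjection := by
  ext1 x
  exact Submodule.starProjection_eq_self_iff.2 (h (Submodule.starProjection_apply_mem A x))

theorem starProjection_mul_self (A : Submodule ℂ L2) [A.HasOrthogonalProjection] :
    A.starProjection * A.starProjection = A.starProjection :=
  starProjection_mul_of_le le_rfl

theorem _root_.IsCompactOperator.op_mul_left {A : Op} (h : IsCompactOperator A) (B : Op) :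
    IsCompactOperator (B * A) := h.clm_comp B

theorem _root_.IsCompactOperator.op_mul_right {A : Op} (h : IsCompactOperator A) (B : Op) :
    IsCompactOperator (A * B) := h.comp_clm B

theorem mem_perp_iff {w : ℕ → ℤ → ℝ} {N : ℕ} {f : L2} :
    f ∈ perp w N ↔ ∀ k < N, ⟪toL2 (w k), f⟫_ℂ = 0 := by
  rw [perp, Submodule.mem_orthogonal]
  constructor
  · intro h k hk
    exact h _ (Submodule.subset_span ⟨k, hk, rfl⟩)
  · intro h u hu
    induction hu using Submodule.span_induction with
    | mem x hx =>
      obtain ⟨k, hk, rfl⟩ := hx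
      exact h k hk
    | zero => simp
    | add x y _ _ hx hy => rw [inner_add_left, hx, hy, add_zero]
    | smul a x _ hx => rw [inner_smul_left, hx, mul_zero]

theorem perp_antitone {w : ℕ → ℤ → ℝ} {N N' : ℕ} (h : N ≤ N') : perp w N' ≤ perp w N :=
  fun _ hf => mem_perp_iff.2 fun k hk => mem_perp_iff.1 hf k (hk.trans_le h)

theorem mem_perpKer_iff {w : ℕ → ℤ → ℝ} {N : ℕ} {T : Op} {f : L2} :
    f ∈ perpKer w N T ↔ f ∈ perp w N ∧ T f = 0 := Iff.rfl

theorem perp_starProjection_toL2 (w : ℕ → ℤ → ℝ) {N k : ℕ} (hk : k < N) :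
    (perp w N).starProjection (toL2 (w k)) = 0 := by
  have : toL2 (w k) ∈ Submodule.span ℂ ((fun k => toL2 (w k)) '' Set.Iio N) :=
    Submodule.subset_span ⟨k, hk, rfl⟩
  exact Submodule.starProjection_orthogonal_apply_eq_zero this

theorem apply_toL2_eq_zero {w : ℕ → ℤ → ℝ} {A : Submodule ℂ L2} [A.HasOrthogonalProjection] {N : ℕ}
    (h : A ≤ perp w N) {k : ℕ} (hk : k < N) : A.starProjection (toL2 (w k)) = 0 := by
  rw [← starProjection_mul_of_le h, mul_apply_eq_comp, perp_starProjection_toL2 w hk, map_zero]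

/-- The complement is the projection onto the span of finitely many vectors. -/
theorem isCompactOperator_one_sub_perp (w : ℕ → ℤ → ℝ) (N : ℕ) :
    IsCompactOperator ((1 : Op) - (perp w N).starProjection) := by
  set S := Submodule.span ℂ ((fun k => toL2 (w k)) '' Set.Iio N) with hS
  have hfin : FiniteDimensional ℂ S := FiniteDimensional.span_of_finite ℂ ((Set.finite_Iio N).image _)
  have e : (1 : Op) - (perp w N).starProjection = S.starProjection := by
    have h := Submodule.starProjection_orthogonal' S
    have h' : (perp w N).starProjection = Sᗮ.starProjection := rfl
    rw [h', h]
    exact sub_sub_cancel _ _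
  rw [e]
  have hp : ProperSpace S := FiniteDimensional.proper ℂ S
  have hl : LocallyCompactSpace S := inferInstance
  exact (isCompactOperator_of_locallyCompactSpace_rng S.subtypeL).comp_clm
    S.orthogonalProjectionOnto

/-- A projection `S` with `P (U + K) S = 0`, `1 - P` and `K` compact, is compact. -/
theorem isCompactOperator_of_compression {U K P S : Op} (hU : U * U = 1) (hK : IsCompactOperator K)
    (hP : IsCompactOperator ((1 : Op) - P)) (h : P * (U + K) * S = 0) : IsCompactOperator S := by
  have e : S = U * ((1 - P) * ((U + K) * S)) - U * (K * S) := by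
    have h1 : (1 - P) * ((U + K) * S) = (U + K) * S := by
      rw [sub_mul, one_mul, ← mul_assoc P, h, sub_zero]
    rw [h1, ← mul_sub, add_mul, add_sub_cancel_right, ← mul_assoc, hU, one_mul]
  rw [e]
  exact ((hP.op_mul_right ((U + K) * S)).op_mul_left U).sub ((hK.op_mul_right S).op_mul_left U)

theorem isCompactOperator_rankOne (x y : L2) :
    IsCompactOperator (InnerProductSpace.rankOne ℂ x y) := by
  have : InnerProductSpace.rankOne ℂ x y =
      (ContinuousLinearMap.toSpanSingleton ℂ x) ∘L (innerSL ℂ y) := by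
    ext1 f
    simp
  rw [this]
  exact (isCompactOperator_of_locallyCompactSpace_rng
    (ContinuousLinearMap.toSpanSingleton ℂ x)).comp_clm _

/-! ### The blocks at `0` -/

/-- The orthogonal blocks at the threshold `0`. -/
def zeroBlock (V : ℤ → ℝ) : Fin 5 → Op :=
  ![1 - Q V, Q V - S0 V, S0 V - S1 V, S1 V - S2 V, S2 V]

/-- The scaling exponents of the blocks at `0`. -/
def zeroDeg : Fin 5 → ℤ := ![3, 1, 0, -1, -3]

/-- Number of vanishing moments on the blocks at `0`. -/
def zeroOrd : Fin 5 → ℕ := ![0, 1, 2, 2, 3]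

theorem S2_le_S1 (V : ℤ → ℝ) :
    perpKer (vk V) 3 (Q V * T0 V) ≤ perpKer (vk V) 2 (S0 V * T0 V) := by
  intro f hf
  obtain ⟨h1, h2⟩ := mem_perpKer_iff.1 hf
  refine mem_perpKer_iff.2 ⟨perp_antitone (by norm_num) h1, ?_⟩
  have : S0 V = S0 V * Q V := (starProjection_mul_of_le (perp_antitone (by norm_num))).symm
  rw [this, mul_assoc, mul_apply_eq_comp, h2, map_zero]

theorem S1_le_S0 (V : ℤ → ℝ) : perpKer (vk V) 2 (S0 V * T0 V) ≤ perp (vk V) 2 := inf_le_left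

theorem S2_le_perp (V : ℤ → ℝ) : perpKer (vk V) 3 (Q V * T0 V) ≤ perp (vk V) 3 := inf_le_left

theorem S0_le_Q (V : ℤ → ℝ) : perp (vk V) 2 ≤ perp (vk V) 1 := perp_antitone (by norm_num)

theorem Q_mul_Q (V : ℤ → ℝ) : Q V * Q V = Q V := starProjection_mul_self _
theorem S0_mul_S0 (V : ℤ → ℝ) : S0 V * S0 V = S0 V := starProjection_mul_self _
theorem S1_mul_S1 (V : ℤ → ℝ) : S1 V * S1 V = S1 V := starProjection_mul_self _
theorem S2_mul_S2 (V : ℤ → ℝ) : S2 V * S2 V = S2 V := starProjection_mul_self _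
theorem Q_mul_S0 (V : ℤ → ℝ) : Q V * S0 V = S0 V := mul_starProjection_of_le (S0_le_Q V)
theorem S0_mul_Q (V : ℤ → ℝ) : S0 V * Q V = S0 V := starProjection_mul_of_le (S0_le_Q V)
theorem S0_mul_S1 (V : ℤ → ℝ) : S0 V * S1 V = S1 V := mul_starProjection_of_le (S1_le_S0 V)
theorem S1_mul_S0 (V : ℤ → ℝ) : S1 V * S0 V = S1 V := starProjection_mul_of_le (S1_le_S0 V)
theorem S1_mul_S2 (V : ℤ → ℝ) : S1 V * S2 V = S2 V := mul_starProjection_of_le (S2_le_S1 V)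
theorem S2_mul_S1 (V : ℤ → ℝ) : S2 V * S1 V = S2 V := starProjection_mul_of_le (S2_le_S1 V)
theorem Q_mul_S1 (V : ℤ → ℝ) : Q V * S1 V = S1 V := by
  rw [← S0_mul_S1, ← mul_assoc, Q_mul_S0]
theorem S1_mul_Q (V : ℤ → ℝ) : S1 V * Q V = S1 V := by
  rw [← S1_mul_S0, mul_assoc, S0_mul_Q]
theorem S0_mul_S2 (V : ℤ → ℝ) : S0 V * S2 V = S2 V := by
  rw [← S1_mul_S2, ← mul_assoc, S0_mul_S1]
theorem S2_mul_S0 (V : ℤ → ℝ) : S2 V * S0 V = S2 V := by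
  rw [← S2_mul_S1, mul_assoc, S1_mul_S0]
theorem Q_mul_S2 (V : ℤ → ℝ) : Q V * S2 V = S2 V := by
  rw [← S0_mul_S2, ← mul_assoc, Q_mul_S0]
theorem S2_mul_Q (V : ℤ → ℝ) : S2 V * Q V = S2 V := by
  rw [← S2_mul_S0, mul_assoc, S0_mul_Q]

theorem isSelfAdjoint_Q (V : ℤ → ℝ) : IsSelfAdjoint (Q V) := isSelfAdjoint_starProjection _
theorem isSelfAdjoint_S0 (V : ℤ → ℝ) : IsSelfAdjoint (S0 V) := isSelfAdjoint_starProjection _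
theorem isSelfAdjoint_S1 (V : ℤ → ℝ) : IsSelfAdjoint (S1 V) := isSelfAdjoint_starProjection _
theorem isSelfAdjoint_S2 (V : ℤ → ℝ) : IsSelfAdjoint (S2 V) := isSelfAdjoint_starProjection _

theorem zeroBlock_mul (V : ℤ → ℝ) (i j : Fin 5) :
    zeroBlock V i * zeroBlock V j = if i = j then zeroBlock V i else 0 := by
  fin_cases i <;> fin_cases j <;>
    simp [zeroBlock, mul_sub, sub_mul, Q_mul_Q, S0_mul_S0, S1_mul_S1, S2_mul_S2, Q_mul_S0, S0_mul_Q,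
      S0_mul_S1, S1_mul_S0, S1_mul_S2, S2_mul_S1, Q_mul_S1, S1_mul_Q, S0_mul_S2, S2_mul_S0,
      Q_mul_S2, S2_mul_Q]

theorem zeroBlock_sum (V : ℤ → ℝ) : ∑ i, zeroBlock V i = 1 := by
  simp [zeroBlock, Fin.sum_univ_five]

theorem isSelfAdjoint_zeroBlock (V : ℤ → ℝ) (i : Fin 5) : IsSelfAdjoint (zeroBlock V i) := by
  have h1 : IsSelfAdjoint (1 : Op) := IsSelfAdjoint.one _
  fin_cases i
  · exact h1.sub (isSelfAdjoint_Q V)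
  · exact (isSelfAdjoint_Q V).sub (isSelfAdjoint_S0 V)
  · exact (isSelfAdjoint_S0 V).sub (isSelfAdjoint_S1 V)
  · exact (isSelfAdjoint_S1 V).sub (isSelfAdjoint_S2 V)
  · exact isSelfAdjoint_S2 V

theorem zeroBlock_toL2 (V : ℤ → ℝ) (i : Fin 5) : ∀ a < zeroOrd i,
    zeroBlock V i (toL2 (vk V a)) = 0 := by
  have hQ : ∀ a < 1, Q V (toL2 (vk V a)) = 0 := fun a ha => apply_toL2_eq_zero le_rfl ha
  have h0 : ∀ a < 2, S0 V (toL2 (vk V a)) = 0 := fun a ha => apply_toL2_eq_zero le_rfl ha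
  have h1 : ∀ a < 2, S1 V (toL2 (vk V a)) = 0 := fun a ha => apply_toL2_eq_zero (S1_le_S0 V) ha
  have h2 : ∀ a < 3, S2 V (toL2 (vk V a)) = 0 := fun a ha => apply_toL2_eq_zero (S2_le_perp V) ha
  fin_cases i
  · intro a ha
    exact absurd ha (Nat.not_lt_zero a)
  · intro a ha
    change Q V _ - S0 V _ = 0
    rw [hQ a ha, h0 a (lt_trans ha (by norm_num [zeroOrd])), sub_zero]
  · intro a ha
    change S0 V _ - S1 V _ = 0
    rw [h0 a ha, h1 a ha, sub_zero]
  · intro a ha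
    change S1 V _ - S2 V _ = 0
    rw [h1 a ha, h2 a (lt_trans ha (by norm_num [zeroOrd])), sub_zero]
  · exact h2

theorem S0_T0_S1 (V : ℤ → ℝ) : S0 V * T0 V * S1 V = 0 := by
  ext1 f
  exact (mem_perpKer_iff.1 (Submodule.starProjection_apply_mem
    (perpKer (vk V) 2 (S0 V * T0 V)) f)).2

theorem Q_T0_S2 (V : ℤ → ℝ) : Q V * T0 V * S2 V = 0 := by
  ext1 f
  exact (mem_perpKer_iff.1 (Submodule.starProjection_apply_mem
    (perpKer (vk V) 3 (Q V * T0 V)) f)).2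

theorem adjoint_block_eq_zero {X T Y : Op} (hX : IsSelfAdjoint X) (hT : IsSelfAdjoint T)
    (hY : IsSelfAdjoint Y) (h : X * T * Y = 0) : Y * T * X = 0 := by
  have := congrArg star h
  rwa [star_mul, star_mul, hX.star_eq, hT.star_eq, hY.star_eq, star_zero, ← mul_assoc] at this

theorem S1_T0_S0 {V : ℤ → ℝ} (hw : WSum (vk V 0) 3) : S1 V * T0 V * S0 V = 0 :=
  adjoint_block_eq_zero (isSelfAdjoint_S0 V) (isSelfAdjoint_T0 hw) (isSelfAdjoint_S1 V) (S0_T0_S1 V)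

theorem S2_T0_Q {V : ℤ → ℝ} (hw : WSum (vk V 0) 3) : S2 V * T0 V * Q V = 0 :=
  adjoint_block_eq_zero (isSelfAdjoint_Q V) (isSelfAdjoint_T0 hw) (isSelfAdjoint_S2 V) (Q_T0_S2 V)

theorem mul_T0_mul_eq_zero {T P R X Y : Op} (h : P * T * R = 0) (hX : X * P = X) (hY : R * Y = Y) :
    X * T * Y = 0 := by
  rw [← hX, ← hY]
  calc X * P * T * (R * Y) = X * (P * T * R) * Y := by simp only [mul_assoc]
    _ = 0 := by rw [h, mul_zero, zero_mul]

/-- Besides the defining relations S₀T₀S₁ = 0 and QT₀S₂ = 0, only their adjoints are needed. -/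
theorem zeroBlock_T0 {V : ℤ → ℝ} (hw : WSum (vk V 0) 3) (i j : Fin 5)
    (hij : zeroDeg i + zeroDeg j < 0) : zeroBlock V i * T0 V * zeroBlock V j = 0 := by
  have a1 : zeroBlock V 1 * Q V = zeroBlock V 1 := by simp [zeroBlock, sub_mul, Q_mul_Q, S0_mul_Q]
  have a2 : zeroBlock V 2 * S0 V = zeroBlock V 2 := by simp [zeroBlock, sub_mul, S0_mul_S0, S1_mul_S0]
  have a3 : zeroBlock V 3 * S0 V = zeroBlock V 3 := by simp [zeroBlock, sub_mul, S1_mul_S0, S2_mul_S0]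
  have a3' : zeroBlock V 3 * S1 V = zeroBlock V 3 := by simp [zeroBlock, sub_mul, S1_mul_S1, S2_mul_S1]
  have a4 : zeroBlock V 4 * S0 V = zeroBlock V 4 := by simp [zeroBlock, S2_mul_S0]
  have a4' : zeroBlock V 4 * S1 V = zeroBlock V 4 := by simp [zeroBlock, S2_mul_S1]
  have a4'' : zeroBlock V 4 * S2 V = zeroBlock V 4 := by simp [zeroBlock, S2_mul_S2]
  have b1 : Q V * zeroBlock V 1 = zeroBlock V 1 := by simp [zeroBlock, mul_sub, Q_mul_Q, Q_mul_S0]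
  have b2 : S0 V * zeroBlock V 2 = zeroBlock V 2 := by simp [zeroBlock, mul_sub, S0_mul_S0, S0_mul_S1]
  have b3 : S1 V * zeroBlock V 3 = zeroBlock V 3 := by simp [zeroBlock, mul_sub, S1_mul_S1, S1_mul_S2]
  have b4 : S1 V * zeroBlock V 4 = zeroBlock V 4 := by simp [zeroBlock, S1_mul_S2]
  have b4' : S2 V * zeroBlock V 4 = zeroBlock V 4 := by simp [zeroBlock, S2_mul_S2]
  fin_cases i <;> fin_cases j <;> first
    | (exfalso; revert hij; decide)
    | exact mul_T0_mul_eq_zero (S0_T0_S1 V) a2 b3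
    | exact mul_T0_mul_eq_zero (S0_T0_S1 V) a2 b4
    | exact mul_T0_mul_eq_zero (S0_T0_S1 V) a3 b3
    | exact mul_T0_mul_eq_zero (S0_T0_S1 V) a3 b4
    | exact mul_T0_mul_eq_zero (S0_T0_S1 V) a4 b4
    | exact mul_T0_mul_eq_zero (S0_T0_S1 V) a4 b3
    | exact mul_T0_mul_eq_zero (Q_T0_S2 V) a1 b4'
    | exact mul_T0_mul_eq_zero (S1_T0_S0 hw) a3' b2
    | exact mul_T0_mul_eq_zero (S1_T0_S0 hw) a4' b2
    | exact mul_T0_mul_eq_zero (S2_T0_Q hw) a4'' b1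

/-- The degrees are chosen to make this true. At l = -3, -1, 1 the condition reads d_i + d_j < 6, 2,
-2, and it forces more than 0, 2, 4 vanishing moments in total; l = 0 is covered by the kernel
conditions, and l = ±2 contributes nothing. -/
theorem zeroBlock_vanish {V : ℤ → ℝ} (σ : ℤˣ) (hw : WSum (vk V 0) 6) {K : ℤ} (i j : Fin 5) :
    ∀ l ∈ Finset.Ico (-3) K, 2 * l + zeroDeg i + zeroDeg j < 0 →
      zeroBlock V i * zeroCoeff V σ l * zeroBlock V j = 0 := by
  intro l hl hneg
  have hl3 := (Finset.mem_Ico.1 hl).1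
  have hd : ∀ i, -3 ≤ zeroDeg i := by decide
  have hlt : l < 3 := by linarith [hd i, hd j]
  have key : ∀ k : ℕ, k ≤ 2 → l = 2 * k - 3 → 2 * k < zeroOrd i + zeroOrd j →
      zeroBlock V i * zeroCoeff V σ l * zeroBlock V j = 0 := by
    intro k hk hlk hlt
    rw [zeroCoeff_block σ (by omega) (hw.mono (by omega)) (isSelfAdjoint_zeroBlock V j)
      (zeroBlock_toL2 V i) (zeroBlock_toL2 V j) hlt.le hlk, if_neg hlt.ne]
  have ho0 : zeroDeg i + zeroDeg j < 6 → 0 < zeroOrd i + zeroOrd j := by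
    clear * -
    revert i j
    decide
  have ho1 : zeroDeg i + zeroDeg j < 2 → 2 < zeroOrd i + zeroOrd j := by
    clear * -
    revert i j
    decide
  have ho2 : zeroDeg i + zeroDeg j < -2 → 4 < zeroOrd i + zeroOrd j := by
    clear * -
    revert i j
    decide
  interval_cases l
  · exact key 0 (by norm_num) (by norm_num) (ho0 (by linarith))
  · rw [zeroCoeff_neg_two]
    simp
  · exact key 1 (by norm_num) (by norm_num) (ho1 (by linarith))
  · rw [zeroCoeff_zero]
    exact zeroBlock_T0 (hw.mono (by norm_num)) i j (by linarith)
  · exact key 2 (by norm_num) (by norm_num) (ho2 (by linarith))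
  · rw [zeroCoeff_two]
    simp

/-! ### Invertibility of the leading coefficient at 0. -/

theorem eq_zero_of_sum_sq {a b c d r : ℝ} (hr : 0 < r)
    (h : a ^ 2 + b ^ 2 + r * (c ^ 2 + d ^ 2) = 0) : a = 0 ∧ b = 0 ∧ c = 0 ∧ d = 0 := by
  have h' : a ^ 2 + b ^ 2 + r * c ^ 2 + r * d ^ 2 = 0 := by rw [← h]; ring
  have n0 := sq_nonneg a
  have n1 := sq_nonneg b
  have n2 := mul_nonneg hr.le (sq_nonneg c)
  have n3 := mul_nonneg hr.le (sq_nonneg d)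
  refine ⟨?_, ?_, ?_, ?_⟩
  · exact pow_eq_zero_iff two_ne_zero |>.1 (by linarith)
  · exact pow_eq_zero_iff two_ne_zero |>.1 (by linarith)
  · have : r * c ^ 2 = 0 := by linarith
    exact pow_eq_zero_iff two_ne_zero |>.1 ((mul_eq_zero.1 this).resolve_left hr.ne')
  · have : r * d ^ 2 = 0 := by linarith
    exact pow_eq_zero_iff two_ne_zero |>.1 ((mul_eq_zero.1 this).resolve_left hr.ne')

/-- x₀, …, x₃ are the pairings of a null vector with the leading moment vectors, and a, b its
off-diagonal T₀ terms; the equations are the block equations paired with the vector itself. -/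
theorem zero_scalar_system (σ : ℤˣ) {x0 x1 x2 x3 a b : ℂ}
    (h0 : (zeroLead σ 0 * x0 + zeroLead σ 1 * x2) * conj x0 + a = 0)
    (h1 : (-2 * zeroLead σ 1 * x1 - 4 * zeroLead σ 2 * x3) * conj x1 + b = 0)
    (h2 : (6 * zeroLead σ 2 * x2 + zeroLead σ 1 * x0) * conj x2 + conj b = 0)
    (h3 : (-20 * zeroLead σ 3 * x3 - 4 * zeroLead σ 2 * x1) * conj x3 + conj a = 0) :
    x0 = 0 ∧ x1 = 0 ∧ x2 = 0 ∧ x3 = 0 := by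
  obtain ⟨s, hs, hσ⟩ : ∃ s : ℝ, s ^ 2 = 1 ∧ sI σ = (s : ℂ) * Complex.I :=
    ⟨_, units_cast_real_sq σ, rfl⟩
  simp only [zeroLead, hσ] at h0 h1 h2 h3
  obtain ⟨p0, q0⟩ := x0
  obtain ⟨p1, q1⟩ := x1
  obtain ⟨p2, q2⟩ := x2
  obtain ⟨p3, q3⟩ := x3
  obtain ⟨ar, ai⟩ := a
  obtain ⟨br, bi⟩ := b
  simp [Complex.ext_iff] at h0 h1 h2 h3 ⊢
  obtain ⟨h0r, h0i⟩ := h0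
  obtain ⟨h1r, h1i⟩ := h1
  obtain ⟨h2r, h2i⟩ := h2
  obtain ⟨h3r, h3i⟩ := h3
  -- Imaginary part of the sum of the four equations: a and b occur together with their conjugates
  -- and drop out, leaving |x₀ - 2x₂|² + 4|x₁ - (2/3)x₃|².
  have hS : (p0 - 2 * p2) ^ 2 + (q0 - 2 * q2) ^ 2 +
      4 * ((p1 - 2 / 3 * p3) ^ 2 + (q1 - 2 / 3 * q3) ^ 2) = 0 := by
    linear_combination (32 * s) * h0i + (32 * s) * h1i + (32 * s) * h2i + (32 * s) * h3i -
      ((p0 - 2 * p2) ^ 2 + (q0 - 2 * q2) ^ 2 +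
      4 * ((p1 - 2 / 3 * p3) ^ 2 + (q1 - 2 / 3 * q3) ^ 2)) * hs
  obtain ⟨e0, e1, e2, e3⟩ := eq_zero_of_sum_sq (by norm_num) hS
  rw [sub_eq_zero] at e0 e1 e2 e3
  subst e0 e1 e2 e3
  -- The squares only give two relations. The real parts of the equations containing a and its
  -- conjugate, subtracted from each other, supply the rest.
  have hA : p2 ^ 2 + q2 ^ 2 + 4 / 9 * (p3 ^ 2 + q3 ^ 2) = 0 := by
    linear_combination 4 * h3r - 4 * h0r
  obtain ⟨z2, z2', z3, z3'⟩ := eq_zero_of_sum_sq (by norm_num) hA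
  simp [z2, z2', z3, z3']

/-- Every block except the middle one carries a single moment vector, the image of the first v_k
that need not be annihilated. Entries of odd total degree do not occur, and the entries (0,1) and
(3,4) vanish because M_{-2} = M_2 = 0. -/
theorem zero_leading_eq {V : ℤ → ℝ} (σ : ℤˣ) (hw : WSum (vk V 0) 6) {X : Fin 5 → Op}
    (hX : X = zeroBlock V) {y0 y1 y2 y3 : L2}
    (h0 : y0 = X 0 (toL2 (vk V 0))) (h1 : y1 = X 1 (toL2 (vk V 1)))
    (h2 : y2 = X 3 (toL2 (vk V 2))) (h3 : y3 = X 4 (toL2 (vk V 3))) :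
    leading X zeroDeg (zeroCoeff V σ) =
      X 2 * T0 V * X 2 + (X 0 * T0 V * X 4 + X 4 * T0 V * X 0 + X 1 * T0 V * X 3 +
        X 3 * T0 V * X 1) +
      (zeroLead σ 0 • InnerProductSpace.rankOne ℂ y0 y0 +
        zeroLead σ 1 • InnerProductSpace.rankOne ℂ y0 y2 +
        zeroLead σ 1 • InnerProductSpace.rankOne ℂ y2 y0 +
        (-2 * zeroLead σ 1) • InnerProductSpace.rankOne ℂ y1 y1 +
        (-4 * zeroLead σ 2) • InnerProductSpace.rankOne ℂ y1 y3 +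
        (-4 * zeroLead σ 2) • InnerProductSpace.rankOne ℂ y3 y1 +
        (6 * zeroLead σ 2) • InnerProductSpace.rankOne ℂ y2 y2 +
        (-20 * zeroLead σ 3) • InnerProductSpace.rankOne ℂ y3 y3) := by
  subst hX
  have key : ∀ (k : ℕ) (i j : Fin 5), k ≤ 3 → 2 * k = zeroOrd i + zeroOrd j →
      zeroBlock V i * zeroCoeff V σ (2 * k - 3) * zeroBlock V j =
      (zeroLead σ k * ((-1) ^ zeroOrd j * ((2 * k).choose (zeroOrd j) : ℂ))) •
        InnerProductSpace.rankOne ℂ (zeroBlock V i (toL2 (vk V (zeroOrd i))))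
          (zeroBlock V j (toL2 (vk V (zeroOrd j)))) := by
    intro k i j hk hij
    rw [zeroCoeff_block σ hk (hw.mono (by omega)) (isSelfAdjoint_zeroBlock V j)
      (zeroBlock_toL2 V i) (zeroBlock_toL2 V j) hij.le rfl, if_pos hij]
  have k00 := key 0 0 0 (by norm_num) rfl
  have k03 := key 1 0 3 (by norm_num) rfl
  have k30 := key 1 3 0 (by norm_num) rfl
  have k11 := key 1 1 1 (by norm_num) rfl
  have k14 := key 2 1 4 (by norm_num) rfl
  have k41 := key 2 4 1 (by norm_num) rfl
  have k33 := key 2 3 3 (by norm_num) rfl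
  have k44 := key 3 4 4 (by norm_num) rfl
  simp [zeroOrd, ← h0, ← h1, ← h2, ← h3, Nat.choose] at k00 k03 k30 k11 k14 k41 k33 k44
  have d0 : zeroDeg 0 = 3 := rfl
  have d1 : zeroDeg 1 = 1 := rfl
  have d2 : zeroDeg 2 = 0 := rfl
  have d3 : zeroDeg 3 = -1 := rfl
  have d4 : zeroDeg 4 = -3 := rfl
  simp only [leading, Fin.sum_univ_five, d0, d1, d2, d3, d4]
  norm_num [Int.even_iff, zeroCoeff_zero, zeroCoeff_neg_two, zeroCoeff_two]
  norm_num at k00 k03 k30 k11 k14 k41 k33 k44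
  rw [k00, k03, k30, k11, k14, k41, k33, k44]
  module

theorem isCompactOperator_convOp_zeroFn {V : ℤ → ℝ} (σ : ℤˣ) (hw : WSum (vk V 0) 3) :
    IsCompactOperator (convOp (vk V 0) (zeroFn σ 3)) :=
  isCompactOperator_convOp hw (polyBdd_zeroFn σ 3)

theorem isCompactOperator_S1 {V : ℤ → ℝ} (hw : WSum (vk V 0) 3) : IsCompactOperator (S1 V) := by
  have h := S0_T0_S1 V
  rw [T0_eq V 1] at h
  exact isCompactOperator_of_compression (UOp_mul_self V) (isCompactOperator_convOp_zeroFn 1 hw)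
    (isCompactOperator_one_sub_perp (vk V) 2) h

theorem isCompactOperator_S2 {V : ℤ → ℝ} (hw : WSum (vk V 0) 3) : IsCompactOperator (S2 V) := by
  rw [← S1_mul_S2]
  exact (isCompactOperator_S1 hw).op_mul_right _

theorem isCompactOperator_zeroBlock {V : ℤ → ℝ} (hw : WSum (vk V 0) 3) {i : Fin 5} (hi : i ≠ 2) :
    IsCompactOperator (zeroBlock V i) := by
  fin_cases i
  · exact isCompactOperator_one_sub_perp (vk V) 1
  · have e : Q V - S0 V = Q V * (1 - S0 V) := by rw [mul_sub, mul_one, Q_mul_S0]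
    change IsCompactOperator (Q V - S0 V)
    rw [e]
    exact (isCompactOperator_one_sub_perp (vk V) 2).op_mul_left _
  · exact absurd rfl hi
  · exact (isCompactOperator_S1 hw).sub (isCompactOperator_S2 hw)
  · exact isCompactOperator_S2 hw

/-- Compactness of `X T X - U` when `1 - X` and `T - U` are compact. -/
theorem isCompactOperator_diag {U K X : Op} (hK : IsCompactOperator K)
    (hX : IsCompactOperator ((1 : Op) - X)) : IsCompactOperator (X * (U + K) * X - U) := by
  have e : X * (U + K) * X - U = K - (1 - X) * ((U + K) * X) - (U + K) * (1 - X) := by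
    noncomm_ring
  rw [e]
  exact (hK.sub (hX.op_mul_right _)).sub (hX.op_mul_left _)

theorem sum_blocks_apply {n : ℕ} {X : Fin n → Op} (h : ∑ i, X i = 1) (x : L2) : ∑ i, X i x = x := by
  have := congrArg (fun T : Op => T x) h
  simpa using this

/-- All blocks but the middle one are compact, so L differs from U by a compact operator and
injectivity suffices. For a null vector x the scalar system kills the leading moments; then X_i x
has one vanishing moment more than its block guarantees, and this traps it in the next smaller
space. -/
theorem isUnit_zero_leading {V : ℤ → ℝ} (σ : ℤˣ) (hw : WSum (vk V 0) 6)
    (hS3 : ∀ f ∈ perp (vk V) 4, T0 V f = 0 → f = 0) :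
    IsUnit (leading (zeroBlock V) zeroDeg (zeroCoeff V σ)) := by
  have hw3 := hw.mono (show 3 ≤ 6 by norm_num)
  set X := zeroBlock V with hX
  have hXX : ∀ i j z, X i (X j z) = if i = j then X i z else 0 := by
    intro i j z
    have := congrArg (fun T : Op => T z) (zeroBlock_mul V i j)
    simp only [mul_apply_eq_comp] at this
    rw [hX, this]
    split_ifs <;> rfl
  have hsa : ∀ i u v, ⟪X i u, v⟫_ℂ = ⟪u, X i v⟫_ℂ := by
    intro i u v
    rw [← ContinuousLinearMap.adjoint_inner_right, (isSelfAdjoint_zeroBlock V i).adjoint_eq]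
  have hTsa : ∀ u v, ⟪T0 V u, v⟫_ℂ = ⟪u, T0 V v⟫_ℂ := by
    intro u v
    rw [← ContinuousLinearMap.adjoint_inner_right, (isSelfAdjoint_T0 hw3).adjoint_eq]
  have hc : ∀ i, i ≠ 2 → IsCompactOperator (X i) := fun i hi => isCompactOperator_zeroBlock hw3 hi
  rw [zero_leading_eq σ hw hX rfl rfl rfl rfl]
  set y0 := X 0 (toL2 (vk V 0)) with hy0
  set y1 := X 1 (toL2 (vk V 1)) with hy1
  set y2 := X 3 (toL2 (vk V 2)) with hy2
  set y3 := X 4 (toL2 (vk V 3)) with hy3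
  set L := X 2 * T0 V * X 2 + (X 0 * T0 V * X 4 + X 4 * T0 V * X 0 + X 1 * T0 V * X 3 +
        X 3 * T0 V * X 1) +
      (zeroLead σ 0 • InnerProductSpace.rankOne ℂ y0 y0 +
        zeroLead σ 1 • InnerProductSpace.rankOne ℂ y0 y2 +
        zeroLead σ 1 • InnerProductSpace.rankOne ℂ y2 y0 +
        (-2 * zeroLead σ 1) • InnerProductSpace.rankOne ℂ y1 y1 +
        (-4 * zeroLead σ 2) • InnerProductSpace.rankOne ℂ y1 y3 +
        (-4 * zeroLead σ 2) • InnerProductSpace.rankOne ℂ y3 y1 +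
        (6 * zeroLead σ 2) • InnerProductSpace.rankOne ℂ y2 y2 +
        (-20 * zeroLead σ 3) • InnerProductSpace.rankOne ℂ y3 y3) with hL
  have hcpt : IsCompactOperator (L - UOp V) := by
    have hr : ∀ (c : ℂ) (x y : L2), IsCompactOperator (c • InnerProductSpace.rankOne ℂ x y) :=
      fun c x y => (isCompactOperator_rankOne x y).smul c
    have h1 : ∀ i j, i ≠ 2 → IsCompactOperator (X i * T0 V * X j) := fun i j hi =>
      ((hc i hi).op_mul_right _).op_mul_right _
    have hX2 : IsCompactOperator ((1 : Op) - X 2) := by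
      have : (1 : Op) - X 2 = X 0 + X 1 + X 3 + X 4 := by
        rw [← zeroBlock_sum V, Fin.sum_univ_five]
        abel
      rw [this]
      exact (((hc 0 (by decide)).add (hc 1 (by decide))).add (hc 3 (by decide))).add
        (hc 4 (by decide))
    have h2 : IsCompactOperator (X 2 * T0 V * X 2 - UOp V) := by
      rw [T0_eq V σ]
      exact isCompactOperator_diag (isCompactOperator_convOp_zeroFn σ hw3) hX2
    rw [hL, add_assoc, add_sub_right_comm]
    exact h2.add ((((h1 0 4 (by decide)).add (h1 4 0 (by decide))).add (h1 1 3 (by decide)) |>.add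
      (h1 3 1 (by decide))).add ((((((((hr _ _ _).add (hr _ _ _)).add (hr _ _ _)).add
        (hr _ _ _)).add (hr _ _ _)).add (hr _ _ _)).add (hr _ _ _)).add (hr _ _ _)))
  have hLU : L = UOp V + (L - UOp V) := by abel
  rw [hLU]
  refine isUnit_of_injective (UOp_mul_self V) hcpt fun x hx => ?_
  rw [← hLU] at hx
  set ξ0 := ⟪y0, x⟫_ℂ with hξ0
  set ξ1 := ⟪y1, x⟫_ℂ with hξ1
  set ξ2 := ⟪y2, x⟫_ℂ with hξ2
  set ξ3 := ⟪y3, x⟫_ℂ with hξ3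
  have hLx : L x = X 2 (T0 V (X 2 x)) + (X 0 (T0 V (X 4 x)) + X 4 (T0 V (X 0 x)) +
      X 1 (T0 V (X 3 x)) + X 3 (T0 V (X 1 x))) +
      ((zeroLead σ 0 * ξ0 + zeroLead σ 1 * ξ2) • y0 +
        (-2 * zeroLead σ 1 * ξ1 - 4 * zeroLead σ 2 * ξ3) • y1 +
        (6 * zeroLead σ 2 * ξ2 + zeroLead σ 1 * ξ0) • y2 +
        (-20 * zeroLead σ 3 * ξ3 - 4 * zeroLead σ 2 * ξ1) • y3) := by
    simp only [hL, add_apply, smul_apply,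
      mul_apply_eq_comp, InnerProductSpace.rankOne_apply, ← hξ0, ← hξ1, ← hξ2, ← hξ3]
    module
  rw [hx] at hLx
  have r0 : (zeroLead σ 0 * ξ0 + zeroLead σ 1 * ξ2) • y0 + X 0 (T0 V (X 4 x)) = 0 := by
    have := congrArg (X 0) hLx
    simp [hXX, hy0, hy1, hy2, hy3] at this
    rw [add_comm]
    exact this.symm
  have r1 : (-2 * zeroLead σ 1 * ξ1 - 4 * zeroLead σ 2 * ξ3) • y1 + X 1 (T0 V (X 3 x)) = 0 := by
    have := congrArg (X 1) hLx
    simp [hXX, hy0, hy1, hy2, hy3] at this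
    rw [add_comm]
    simpa using this.symm
  have r2 : X 2 (T0 V (X 2 x)) = 0 := by
    have := congrArg (X 2) hLx
    simp [hXX, hy0, hy1, hy2, hy3] at this
    exact this.symm
  have r3 : (6 * zeroLead σ 2 * ξ2 + zeroLead σ 1 * ξ0) • y2 + X 3 (T0 V (X 1 x)) = 0 := by
    have := congrArg (X 3) hLx
    simp [hXX, hy0, hy1, hy2, hy3] at this
    rw [add_comm]
    exact this.symm
  have r4 : (-20 * zeroLead σ 3 * ξ3 - 4 * zeroLead σ 2 * ξ1) • y3 + X 4 (T0 V (X 0 x)) = 0 := by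
    have := congrArg (X 4) hLx
    simp [hXX, hy0, hy1, hy2, hy3] at this
    rw [add_comm]
    simpa using this.symm
  -- Self-adjointness of T₀ makes the opposite off-diagonal terms complex conjugates, which is the
  -- form required by the scalar system.
  have hcj : ∀ y, ⟪x, y⟫_ℂ = conj ⟪y, x⟫_ℂ := fun y => (inner_conj_symm x y).symm
  have hsym : ∀ i j, ⟪x, X i (T0 V (X j x))⟫_ℂ = conj ⟪x, X j (T0 V (X i x))⟫_ℂ := by
    intro i j
    rw [hcj, ← hsa, hsa i, ← hTsa, ← hsa]
  obtain ⟨z0, z1, z2, z3⟩ := zero_scalar_system σ (x0 := ξ0) (x1 := ξ1) (x2 := ξ2) (x3 := ξ3)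
    (a := ⟪x, X 0 (T0 V (X 4 x))⟫_ℂ) (b := ⟪x, X 1 (T0 V (X 3 x))⟫_ℂ)
    (by
      have := congrArg (fun y => ⟪x, y⟫_ℂ) r0
      beta_reduce at this
      rwa [inner_add_right, inner_smul_right, hcj y0, inner_zero_right] at this)
    (by
      have := congrArg (fun y => ⟪x, y⟫_ℂ) r1
      beta_reduce at this
      rwa [inner_add_right, inner_smul_right, hcj y1, inner_zero_right] at this)
    (by
      have := congrArg (fun y => ⟪x, y⟫_ℂ) r3
      beta_reduce at this
      rw [← hsym]
      rwa [inner_add_right, inner_smul_right, hcj y2, inner_zero_right] at this)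
    (by
      have := congrArg (fun y => ⟪x, y⟫_ℂ) r4
      beta_reduce at this
      rw [← hsym]
      rwa [inner_add_right, inner_smul_right, hcj y3, inner_zero_right] at this)
  rw [z0, z2] at r0
  rw [z1, z3] at r1
  simp only [mul_zero, add_zero, sub_zero, zero_smul, zero_add] at r0 r1
  have mom : ∀ i k, k < zeroOrd i → ⟪toL2 (vk V k), X i x⟫_ℂ = 0 := by
    intro i k hk
    rw [← hsa, hX, zeroBlock_toL2 V i k hk, inner_zero_left]
  have m0 : ⟪toL2 (vk V 0), X 0 x⟫_ℂ = 0 := by rw [← hsa]; exact z0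
  have m1 : ⟪toL2 (vk V 1), X 1 x⟫_ℂ = 0 := by rw [← hsa]; exact z1
  have m2 : ⟪toL2 (vk V 2), X 3 x⟫_ℂ = 0 := by rw [← hsa]; exact z2
  have m3 : ⟪toL2 (vk V 3), X 4 x⟫_ℂ = 0 := by rw [← hsa]; exact z3
  have lt_cases : ∀ {n k : ℕ}, k < n + 1 → k < n ∨ k = n := fun h => Nat.lt_succ_iff_lt_or_eq.1 h
  have p0 : X 0 x = 0 := by
    have hm : X 0 x ∈ perp (vk V) 1 := mem_perp_iff.2 fun k hk => by
      obtain rfl : k = 0 := by omega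
      exact m0
    have h1 : Q V (X 0 x) = X 0 x := Submodule.starProjection_eq_self_iff.2 hm
    have h2 : Q V = X 1 + X 2 + X 3 + X 4 := by simp [hX, zeroBlock]
    rw [← h1, h2]
    simp [hXX]
  have p1 : X 1 x = 0 := by
    have hm : X 1 x ∈ perp (vk V) 2 := mem_perp_iff.2 fun k hk => by
      rcases lt_cases hk with hk | rfl
      · exact mom 1 k hk
      · exact m1
    have h1 : S0 V (X 1 x) = X 1 x := Submodule.starProjection_eq_self_iff.2 hm
    have h2 : S0 V = X 2 + X 3 + X 4 := by simp [hX, zeroBlock]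
    rw [← h1, h2]
    simp [hXX]
  have hTb : ∀ i j, zeroDeg i + zeroDeg j < 0 → X i (T0 V (X j x)) = 0 := by
    intro i j hij
    exact congrArg (fun T : Op => T x) (zeroBlock_T0 hw3 i j hij)
  -- With y₀ gone from the first block equation, every component of T₀X₄x vanishes, so T₀X₄x = 0
  -- with four vanishing moments, as `hS3` requires.
  have p4 : X 4 x = 0 := by
    refine hS3 _ (mem_perp_iff.2 fun k hk => ?_) ?_
    · rcases lt_cases hk with hk | rfl
      · exact mom 4 k hk
      · exact m3
    · rw [← sum_blocks_apply (zeroBlock_sum V) (T0 V (X 4 x)), Fin.sum_univ_five, ← hX, r0,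
        hTb 1 4 (by decide), hTb 2 4 (by decide), hTb 3 4 (by decide), hTb 4 4 (by decide)]
      simp
  -- X₃x has three vanishing moments and QT₀X₃x = 0, so it lies in the range of S₂, which is
  -- orthogonal to that of X₃.
  have p3 : X 3 x = 0 := by
    have hm : X 3 x ∈ perpKer (vk V) 3 (Q V * T0 V) := by
      refine mem_perpKer_iff.2 ⟨mem_perp_iff.2 fun k hk => ?_, ?_⟩
      · rcases lt_cases hk with hk | rfl
        · exact mom 3 k hk
        · exact m2
      · have h2 : Q V = X 1 + X 2 + X 3 + X 4 := by simp [hX, zeroBlock]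
        rw [mul_apply_eq_comp, h2]
        simp only [add_apply]
        rw [r1, hTb 2 3 (by decide), hTb 3 3 (by decide), hTb 4 3 (by decide)]
        simp
    have h1 : S2 V (X 3 x) = X 3 x := Submodule.starProjection_eq_self_iff.2 hm
    have h2 : S2 V = X 4 := rfl
    rw [← h1, h2]
    simp [hXX]
  have p2 : X 2 x = 0 := by
    have hm : X 2 x ∈ perpKer (vk V) 2 (S0 V * T0 V) := by
      refine mem_perpKer_iff.2 ⟨mem_perp_iff.2 fun k hk => mom 2 k hk, ?_⟩
      have h2 : S0 V = X 2 + X 3 + X 4 := by simp [hX, zeroBlock]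
      rw [mul_apply_eq_comp, h2]
      simp only [add_apply]
      rw [r2, hTb 3 2 (by decide), hTb 4 2 (by decide)]
      simp
    have h1 : S1 V (X 2 x) = X 2 x := Submodule.starProjection_eq_self_iff.2 hm
    have h2 : S1 V = X 3 + X 4 := by simp [hX, zeroBlock]
    rw [← h1, h2]
    simp [hXX]
  rw [← sum_blocks_apply (zeroBlock_sum V) x, Fin.sum_univ_five, ← hX, p0, p1, p2, p3, p4]
  simp

/-! ### The blocks at `16` -/

/-- The orthogonal blocks at the threshold `16`. -/
def sixteenBlock (V : ℤ → ℝ) : Fin 4 → Op :=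
  ![1 - Qt V, Qt V - S0t V, S0t V - S1t V, S1t V]

/-- The scaling exponents of the blocks at `16`. -/
def sixteenDeg : Fin 4 → ℤ := ![1, 0, -1, -2]

/-- Number of vanishing moments on the blocks at `16`. -/
def sixteenOrd : Fin 4 → ℕ := ![0, 1, 1, 2]

theorem S1t_le_S0t (V : ℤ → ℝ) :
    perpKer (vkt V) 2 (T0t V) ≤ perpKer (vkt V) 1 (Qt V * T0t V) := by
  intro f hf
  obtain ⟨h1, h2⟩ := mem_perpKer_iff.1 hf
  refine mem_perpKer_iff.2 ⟨perp_antitone (by norm_num) h1, ?_⟩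
  rw [mul_apply_eq_comp, h2, map_zero]

theorem S0t_le_Qt (V : ℤ → ℝ) : perpKer (vkt V) 1 (Qt V * T0t V) ≤ perp (vkt V) 1 := inf_le_left

theorem S1t_le_perp (V : ℤ → ℝ) : perpKer (vkt V) 2 (T0t V) ≤ perp (vkt V) 2 := inf_le_left

theorem Qt_mul_Qt (V : ℤ → ℝ) : Qt V * Qt V = Qt V := starProjection_mul_self _
theorem S0t_mul_S0t (V : ℤ → ℝ) : S0t V * S0t V = S0t V := starProjection_mul_self _
theorem S1t_mul_S1t (V : ℤ → ℝ) : S1t V * S1t V = S1t V := starProjection_mul_self _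
theorem Qt_mul_S0t (V : ℤ → ℝ) : Qt V * S0t V = S0t V := mul_starProjection_of_le (S0t_le_Qt V)
theorem S0t_mul_Qt (V : ℤ → ℝ) : S0t V * Qt V = S0t V := starProjection_mul_of_le (S0t_le_Qt V)
theorem S0t_mul_S1t (V : ℤ → ℝ) : S0t V * S1t V = S1t V := mul_starProjection_of_le (S1t_le_S0t V)
theorem S1t_mul_S0t (V : ℤ → ℝ) : S1t V * S0t V = S1t V := starProjection_mul_of_le (S1t_le_S0t V)
theorem Qt_mul_S1t (V : ℤ → ℝ) : Qt V * S1t V = S1t V := by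
  rw [← S0t_mul_S1t, ← mul_assoc, Qt_mul_S0t]
theorem S1t_mul_Qt (V : ℤ → ℝ) : S1t V * Qt V = S1t V := by
  rw [← S1t_mul_S0t, mul_assoc, S0t_mul_Qt]

theorem isSelfAdjoint_Qt (V : ℤ → ℝ) : IsSelfAdjoint (Qt V) := isSelfAdjoint_starProjection _
theorem isSelfAdjoint_S0t (V : ℤ → ℝ) : IsSelfAdjoint (S0t V) := isSelfAdjoint_starProjection _
theorem isSelfAdjoint_S1t (V : ℤ → ℝ) : IsSelfAdjoint (S1t V) := isSelfAdjoint_starProjection _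

theorem sixteenBlock_mul (V : ℤ → ℝ) (i j : Fin 4) :
    sixteenBlock V i * sixteenBlock V j = if i = j then sixteenBlock V i else 0 := by
  fin_cases i <;> fin_cases j <;>
    simp [sixteenBlock, mul_sub, sub_mul, Qt_mul_Qt, S0t_mul_S0t, S1t_mul_S1t, Qt_mul_S0t, S0t_mul_Qt,
      S0t_mul_S1t, S1t_mul_S0t, Qt_mul_S1t, S1t_mul_Qt]

theorem sixteenBlock_sum (V : ℤ → ℝ) : ∑ i, sixteenBlock V i = 1 := by
  simp [sixteenBlock, Fin.sum_univ_four]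

theorem isSelfAdjoint_sixteenBlock (V : ℤ → ℝ) (i : Fin 4) : IsSelfAdjoint (sixteenBlock V i) := by
  have h1 : IsSelfAdjoint (1 : Op) := IsSelfAdjoint.one _
  fin_cases i
  · exact h1.sub (isSelfAdjoint_Qt V)
  · exact (isSelfAdjoint_Qt V).sub (isSelfAdjoint_S0t V)
  · exact (isSelfAdjoint_S0t V).sub (isSelfAdjoint_S1t V)
  · exact isSelfAdjoint_S1t V

theorem sixteenBlock_toL2 (V : ℤ → ℝ) (i : Fin 4) : ∀ a < sixteenOrd i,
    sixteenBlock V i (toL2 (vkt V a)) = 0 := by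
  have hQ : ∀ a < 1, Qt V (toL2 (vkt V a)) = 0 := fun a ha => apply_toL2_eq_zero le_rfl ha
  have h0 : ∀ a < 1, S0t V (toL2 (vkt V a)) = 0 := fun a ha => apply_toL2_eq_zero (S0t_le_Qt V) ha
  have h1 : ∀ a < 2, S1t V (toL2 (vkt V a)) = 0 := fun a ha => apply_toL2_eq_zero (S1t_le_perp V) ha
  fin_cases i
  · intro a ha
    exact absurd ha (Nat.not_lt_zero a)
  · intro a ha
    change Qt V _ - S0t V _ = 0
    rw [hQ a ha, h0 a ha, sub_zero]
  · intro a ha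
    change S0t V _ - S1t V _ = 0
    rw [h0 a ha, h1 a (lt_trans ha (by norm_num [sixteenOrd])), sub_zero]
  · exact h1

theorem Qt_T0t_S0t (V : ℤ → ℝ) : Qt V * T0t V * S0t V = 0 := by
  ext1 f
  exact (mem_perpKer_iff.1 (Submodule.starProjection_apply_mem
    (perpKer (vkt V) 1 (Qt V * T0t V)) f)).2

theorem T0t_S1t (V : ℤ → ℝ) : 1 * T0t V * S1t V = 0 := by
  rw [one_mul]
  ext1 f
  exact (mem_perpKer_iff.1 (Submodule.starProjection_apply_mem (perpKer (vkt V) 2 (T0t V)) f)).2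

theorem S0t_T0t_Qt {V : ℤ → ℝ} (hw : WSum (vkt V 0) 1) : S0t V * T0t V * Qt V = 0 :=
  adjoint_block_eq_zero (isSelfAdjoint_Qt V) (isSelfAdjoint_T0t hw) (isSelfAdjoint_S0t V)
    (Qt_T0t_S0t V)

theorem S1t_T0t {V : ℤ → ℝ} (hw : WSum (vkt V 0) 1) : S1t V * T0t V * 1 = 0 :=
  adjoint_block_eq_zero (IsSelfAdjoint.one _) (isSelfAdjoint_T0t hw) (isSelfAdjoint_S1t V)
    (T0t_S1t V)

theorem sixteenBlock_T0t {V : ℤ → ℝ} (hw : WSum (vkt V 0) 1) (i j : Fin 4)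
    (hij : sixteenDeg i + sixteenDeg j < 0) : sixteenBlock V i * T0t V * sixteenBlock V j = 0 := by
  have a1 : sixteenBlock V 1 * Qt V = sixteenBlock V 1 := by
    simp [sixteenBlock, sub_mul, Qt_mul_Qt, S0t_mul_Qt]
  have a2 : sixteenBlock V 2 * Qt V = sixteenBlock V 2 := by
    simp [sixteenBlock, sub_mul, S0t_mul_Qt, S1t_mul_Qt]
  have a2' : sixteenBlock V 2 * S0t V = sixteenBlock V 2 := by
    simp [sixteenBlock, sub_mul, S0t_mul_S0t, S1t_mul_S0t]
  have a3 : sixteenBlock V 3 * S1t V = sixteenBlock V 3 := by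
    simp [sixteenBlock, S1t_mul_S1t]
  have b1 : Qt V * sixteenBlock V 1 = sixteenBlock V 1 := by
    simp [sixteenBlock, mul_sub, Qt_mul_Qt, Qt_mul_S0t]
  have b2 : S0t V * sixteenBlock V 2 = sixteenBlock V 2 := by
    simp [sixteenBlock, mul_sub, S0t_mul_S0t, S0t_mul_S1t]
  have b3 : S1t V * sixteenBlock V 3 = sixteenBlock V 3 := by
    simp [sixteenBlock, S1t_mul_S1t]
  have l3 : ∀ X, X * T0t V * sixteenBlock V 3 = 0 := fun X =>
    mul_T0_mul_eq_zero (T0t_S1t V) (mul_one X) b3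
  have r3 : ∀ X, sixteenBlock V 3 * T0t V * X = 0 := fun X =>
    mul_T0_mul_eq_zero (S1t_T0t hw) a3 (one_mul X)
  fin_cases i <;> fin_cases j <;> first
    | (exfalso; revert hij; decide)
    | exact l3 _
    | exact r3 _
    | exact mul_T0_mul_eq_zero (Qt_T0t_S0t V) a1 b2
    | exact mul_T0_mul_eq_zero (Qt_T0t_S0t V) a2 b2
    | exact mul_T0_mul_eq_zero (S0t_T0t_Qt hw) a2' b1

/-- Same count as at 0: at l = -1 and l = 1 the degree conditions d_i + d_j < 2 and < -2 force more
than 0 and 2 vanishing moments; l = 0 uses the kernel conditions. -/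
theorem sixteenBlock_vanish {V : ℤ → ℝ} (σ : ℤˣ) (hw : WSum (vkt V 0) 2) {K : ℤ} (i j : Fin 4) :
    ∀ l ∈ Finset.Ico (-1) K, 2 * l + sixteenDeg i + sixteenDeg j < 0 →
      sixteenBlock V i * sixteenCoeff V σ l * sixteenBlock V j = 0 := by
  intro l hl hneg
  have hl3 := (Finset.mem_Ico.1 hl).1
  have hd : ∀ i, -2 ≤ sixteenDeg i := by decide
  have hlt : l < 2 := by linarith [hd i, hd j]
  have ho0 : sixteenDeg i + sixteenDeg j < 2 → 0 < sixteenOrd i + sixteenOrd j := by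
    clear * -
    revert i j
    decide
  have ho1 : sixteenDeg i + sixteenDeg j < -2 → 2 < sixteenOrd i + sixteenOrd j := by
    clear * -
    revert i j
    decide
  interval_cases l
  · have := ho0 (by linarith)
    rw [sixteenCoeff_block_neg_one σ (hw.mono (by norm_num)) (isSelfAdjoint_sixteenBlock V j)
      (sixteenBlock_toL2 V i) (sixteenBlock_toL2 V j), if_neg this.ne]
  · rw [sixteenCoeff_zero σ (hw.mono (by norm_num))]
    exact sixteenBlock_T0t (hw.mono (by norm_num)) i j (by linarith)
  · have := ho1 (by linarith)
    rw [sixteenCoeff_block_one σ hw (isSelfAdjoint_sixteenBlock V j)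
      (sixteenBlock_toL2 V i) (sixteenBlock_toL2 V j) this.le, if_neg this.ne]

/-! ### Invertibility of the leading coefficient at 16. -/

theorem sixteen_leading_eq {V : ℤ → ℝ} (σ : ℤˣ) (hw : WSum (vkt V 0) 2) {X : Fin 4 → Op}
    (hX : X = sixteenBlock V) {y0 y1 : L2}
    (h0 : y0 = X 0 (toL2 (vkt V 0))) (h1 : y1 = X 2 (toL2 (vkt V 1))) :
    leading X sixteenDeg (sixteenCoeff V σ) =
      X 1 * T0t V * X 1 + (X 0 * T0t V * X 2 + X 2 * T0t V * X 0 +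
        X 3 * sixteenCoeff V σ 2 * X 3) +
      ((sI σ / 64) • InnerProductSpace.rankOne ℂ y0 y0 +
        (sI σ / 4) • InnerProductSpace.rankOne ℂ y1 y1) := by
  subst hX
  have key : ∀ (i j : Fin 4), 2 ≤ sixteenOrd i + sixteenOrd j → _ := fun i j hij =>
    sixteenCoeff_block_one σ hw (isSelfAdjoint_sixteenBlock V j)
      (sixteenBlock_toL2 V i) (sixteenBlock_toL2 V j) hij
  have k00 := sixteenCoeff_block_neg_one σ (hw.mono (by norm_num)) (isSelfAdjoint_sixteenBlock V 0)
      (sixteenBlock_toL2 V 0) (sixteenBlock_toL2 V 0)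
  have k22 := key 2 2 (by decide)
  have k13 := key 1 3 (by decide)
  have k31 := key 3 1 (by decide)
  simp [sixteenOrd, ← h0, ← h1] at k00 k22 k13 k31
  have d0 : sixteenDeg 0 = 1 := rfl
  have d1 : sixteenDeg 1 = 0 := rfl
  have d2 : sixteenDeg 2 = -1 := rfl
  have d3 : sixteenDeg 3 = -2 := rfl
  simp only [leading, Fin.sum_univ_four, d0, d1, d2, d3]
  norm_num [Int.even_iff, sixteenCoeff_zero σ (hw.mono (show 1 ≤ 2 by norm_num))]
  rw [k00, k22, k13, k31]
  module

theorem isCompactOperator_S0t {V : ℤ → ℝ} (hw : WSum (vkt V 0) 1) : IsCompactOperator (S0t V) := by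
  have h := Qt_T0t_S0t V
  rw [T0t_eq] at h
  exact isCompactOperator_of_compression (UOp_mul_self V) (isCompactOperator_convOp hw polyBdd_G0t)
    (isCompactOperator_one_sub_perp (vkt V) 1) h

theorem isCompactOperator_S1t {V : ℤ → ℝ} (hw : WSum (vkt V 0) 1) : IsCompactOperator (S1t V) := by
  rw [← S0t_mul_S1t]
  exact (isCompactOperator_S0t hw).op_mul_right _

theorem isCompactOperator_sixteenBlock {V : ℤ → ℝ} (hw : WSum (vkt V 0) 1) {i : Fin 4}
    (hi : i ≠ 1) : IsCompactOperator (sixteenBlock V i) := by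
  fin_cases i
  · exact isCompactOperator_one_sub_perp (vkt V) 1
  · exact absurd rfl hi
  · exact (isCompactOperator_S0t hw).sub (isCompactOperator_S1t hw)
  · exact isCompactOperator_S1t hw

/-- The sum of the equations contains a plus its conjugate, which is real; its imaginary part is a
positive combination of |x₀|² and |x₁|². -/
theorem sixteen_scalar_system (σ : ℤˣ) {x0 x1 a : ℂ} (h0 : sI σ / 64 * x0 * conj x0 + a = 0)
    (h1 : sI σ / 4 * x1 * conj x1 + conj a = 0) : x0 = 0 ∧ x1 = 0 := by
  obtain ⟨s, hs, hσ⟩ : ∃ s : ℝ, s ^ 2 = 1 ∧ sI σ = (s : ℂ) * Complex.I :=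
    ⟨_, units_cast_real_sq σ, rfl⟩
  simp only [hσ] at h0 h1
  obtain ⟨p0, q0⟩ := x0
  obtain ⟨p1, q1⟩ := x1
  obtain ⟨ar, ai⟩ := a
  simp [Complex.ext_iff] at h0 h1 ⊢
  have hS : p0 ^ 2 + q0 ^ 2 + 16 * (p1 ^ 2 + q1 ^ 2) = 0 := by
    linear_combination (64 * s) * h0.2 + (64 * s) * h1.2 -
      (p0 ^ 2 + q0 ^ 2 + 16 * (p1 ^ 2 + q1 ^ 2)) * hs
  obtain ⟨e0, e1, e2, e3⟩ := eq_zero_of_sum_sq (by norm_num) hS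
  exact ⟨⟨e0, e1⟩, e2, e3⟩

/-- As at 0, except for the last block: its equation involves the s² coefficient instead of T̃₀, and
is settled by the definiteness in `hpos`. -/
theorem isUnit_sixteen_leading {V : ℤ → ℝ} (σ : ℤˣ) (hw : WSum (vkt V 0) 2)
    (hpos : ∀ f ∈ perpKer (vkt V) 2 (T0t V), ⟪f, sixteenCoeff V σ 2 f⟫_ℂ = 0 → f = 0) :
    IsUnit (leading (sixteenBlock V) sixteenDeg (sixteenCoeff V σ)) := by
  have hw1 := hw.mono (show 1 ≤ 2 by norm_num)
  set X := sixteenBlock V with hX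
  have hXX : ∀ i j z, X i (X j z) = if i = j then X i z else 0 := by
    intro i j z
    have := congrArg (fun T : Op => T z) (sixteenBlock_mul V i j)
    simp only [mul_apply_eq_comp] at this
    rw [hX, this]
    split_ifs <;> rfl
  have hsa : ∀ i u v, ⟪X i u, v⟫_ℂ = ⟪u, X i v⟫_ℂ := by
    intro i u v
    rw [← ContinuousLinearMap.adjoint_inner_right, (isSelfAdjoint_sixteenBlock V i).adjoint_eq]
  have hTsa : ∀ u v, ⟪T0t V u, v⟫_ℂ = ⟪u, T0t V v⟫_ℂ := by
    intro u v
    rw [← ContinuousLinearMap.adjoint_inner_right, (isSelfAdjoint_T0t hw1).adjoint_eq]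
  have hc : ∀ i, i ≠ 1 → IsCompactOperator (X i) := fun i hi => isCompactOperator_sixteenBlock hw1 hi
  rw [sixteen_leading_eq σ hw hX rfl rfl]
  set y0 := X 0 (toL2 (vkt V 0)) with hy0
  set y1 := X 2 (toL2 (vkt V 1)) with hy1
  set L := X 1 * T0t V * X 1 + (X 0 * T0t V * X 2 + X 2 * T0t V * X 0 +
        X 3 * sixteenCoeff V σ 2 * X 3) +
      ((sI σ / 64) • InnerProductSpace.rankOne ℂ y0 y0 +
        (sI σ / 4) • InnerProductSpace.rankOne ℂ y1 y1) with hL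
  have hcpt : IsCompactOperator (L - UOp V) := by
    have hr : ∀ (c : ℂ) (x y : L2), IsCompactOperator (c • InnerProductSpace.rankOne ℂ x y) :=
      fun c x y => (isCompactOperator_rankOne x y).smul c
    have h1 : ∀ i j (A : Op), i ≠ 1 → IsCompactOperator (X i * A * X j) := fun i j A hi =>
      ((hc i hi).op_mul_right _).op_mul_right _
    have hX2 : IsCompactOperator ((1 : Op) - X 1) := by
      have : (1 : Op) - X 1 = X 0 + X 2 + X 3 := by
        rw [← sixteenBlock_sum V, Fin.sum_univ_four]
        abel
      rw [this]
      exact ((hc 0 (by decide)).add (hc 2 (by decide))).add (hc 3 (by decide))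
    have h2 : IsCompactOperator (X 1 * T0t V * X 1 - UOp V) := by
      rw [T0t_eq]
      exact isCompactOperator_diag (isCompactOperator_convOp hw1 polyBdd_G0t) hX2
    rw [hL, add_assoc, add_sub_right_comm]
    exact h2.add ((((h1 0 2 _ (by decide)).add (h1 2 0 _ (by decide))).add
      (h1 3 3 _ (by decide))).add ((hr _ _ _).add (hr _ _ _)))
  have hLU : L = UOp V + (L - UOp V) := by abel
  rw [hLU]
  refine isUnit_of_injective (UOp_mul_self V) hcpt fun x hx => ?_
  rw [← hLU] at hx
  set ξ0 := ⟪y0, x⟫_ℂ with hξ0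
  set ξ1 := ⟪y1, x⟫_ℂ with hξ1
  have hLx : L x = X 1 (T0t V (X 1 x)) + (X 0 (T0t V (X 2 x)) + X 2 (T0t V (X 0 x)) +
      X 3 (sixteenCoeff V σ 2 (X 3 x))) +
      ((sI σ / 64 * ξ0) • y0 + (sI σ / 4 * ξ1) • y1) := by
    simp only [hL, add_apply, smul_apply,
      mul_apply_eq_comp, InnerProductSpace.rankOne_apply, ← hξ0, ← hξ1]
    module
  rw [hx] at hLx
  have r0 : (sI σ / 64 * ξ0) • y0 + X 0 (T0t V (X 2 x)) = 0 := by
    have := congrArg (X 0) hLx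
    simp [hXX, hy0, hy1] at this
    rw [add_comm]
    exact this.symm
  have r1 : X 1 (T0t V (X 1 x)) = 0 := by
    have := congrArg (X 1) hLx
    simp [hXX, hy0, hy1] at this
    exact this.symm
  have r2 : (sI σ / 4 * ξ1) • y1 + X 2 (T0t V (X 0 x)) = 0 := by
    have := congrArg (X 2) hLx
    simp [hXX, hy0, hy1] at this
    rw [add_comm]
    exact this.symm
  have r3 : X 3 (sixteenCoeff V σ 2 (X 3 x)) = 0 := by
    have := congrArg (X 3) hLx
    simp [hXX, hy0, hy1] at this
    exact this.symm
  have hcj : ∀ y, ⟪x, y⟫_ℂ = conj ⟪y, x⟫_ℂ := fun y => (inner_conj_symm x y).symm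
  have hsym : ∀ i j, ⟪x, X i (T0t V (X j x))⟫_ℂ = conj ⟪x, X j (T0t V (X i x))⟫_ℂ := by
    intro i j
    rw [hcj, ← hsa, hsa i, ← hTsa, ← hsa]
  obtain ⟨z0, z1⟩ := sixteen_scalar_system σ (x0 := ξ0) (x1 := ξ1)
    (a := ⟪x, X 0 (T0t V (X 2 x))⟫_ℂ)
    (by
      have := congrArg (fun y => ⟪x, y⟫_ℂ) r0
      beta_reduce at this
      rwa [inner_add_right, inner_smul_right, hcj y0, inner_zero_right] at this)
    (by
      have := congrArg (fun y => ⟪x, y⟫_ℂ) r2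
      beta_reduce at this
      rw [← hsym]
      rwa [inner_add_right, inner_smul_right, hcj y1, inner_zero_right] at this)
  rw [z0] at r0
  simp only [mul_zero, zero_smul, zero_add] at r0
  have mom : ∀ i k, k < sixteenOrd i → ⟪toL2 (vkt V k), X i x⟫_ℂ = 0 := by
    intro i k hk
    rw [← hsa, hX, sixteenBlock_toL2 V i k hk, inner_zero_left]
  have m0 : ⟪toL2 (vkt V 0), X 0 x⟫_ℂ = 0 := by rw [← hsa]; exact z0
  have m1 : ⟪toL2 (vkt V 1), X 2 x⟫_ℂ = 0 := by rw [← hsa]; exact z1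
  have hTb : ∀ i j, sixteenDeg i + sixteenDeg j < 0 → X i (T0t V (X j x)) = 0 := by
    intro i j hij
    exact congrArg (fun T : Op => T x) (sixteenBlock_T0t hw1 i j hij)
  have hQ : Qt V = X 1 + X 2 + X 3 := by simp [hX, sixteenBlock]
  have p0 : X 0 x = 0 := by
    have hm : X 0 x ∈ perp (vkt V) 1 := mem_perp_iff.2 fun k hk => by
      obtain rfl : k = 0 := by omega
      exact m0
    have h1 : Qt V (X 0 x) = X 0 x := Submodule.starProjection_eq_self_iff.2 hm
    rw [← h1, hQ]
    simp [hXX]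
  have p2 : X 2 x = 0 := by
    have hm : X 2 x ∈ perpKer (vkt V) 2 (T0t V) := by
      refine mem_perpKer_iff.2 ⟨mem_perp_iff.2 fun k hk => ?_, ?_⟩
      · rcases Nat.lt_succ_iff_lt_or_eq.1 hk with hk | rfl
        · exact mom 2 k hk
        · exact m1
      · rw [← sum_blocks_apply (sixteenBlock_sum V) (T0t V (X 2 x)), Fin.sum_univ_four, ← hX, r0,
          hTb 1 2 (by decide), hTb 2 2 (by decide), hTb 3 2 (by decide)]
        simp
    have h1 : S1t V (X 2 x) = X 2 x := Submodule.starProjection_eq_self_iff.2 hm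
    have h2 : S1t V = X 3 := rfl
    rw [← h1, h2]
    simp [hXX]
  have p1 : X 1 x = 0 := by
    have hm : X 1 x ∈ perpKer (vkt V) 1 (Qt V * T0t V) := by
      refine mem_perpKer_iff.2 ⟨mem_perp_iff.2 fun k hk => mom 1 k hk, ?_⟩
      rw [mul_apply_eq_comp, hQ]
      simp only [add_apply]
      rw [r1, hTb 2 1 (by decide), hTb 3 1 (by decide)]
      simp
    have h1 : S0t V (X 1 x) = X 1 x := Submodule.starProjection_eq_self_iff.2 hm
    have h2 : S0t V = X 2 + X 3 := by simp [hX, sixteenBlock]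
    rw [← h1, h2]
    simp [hXX]
  have p3 : X 3 x = 0 := by
    refine hpos _ (Submodule.starProjection_apply_mem _ x) ?_
    rw [hsa, r3, inner_zero_right]
  rw [← sum_blocks_apply (sixteenBlock_sum V) x, Fin.sum_univ_four, ← hX, p0, p1, p2, p3]
  simp

/-! ### Convolution of sequences -/

/-- `∑ (1+|m|)^p ‖g(m)‖ < ∞`. -/
def GSum (g : ℤ → ℂ) (p : ℕ) : Prop := Summable fun m : ℤ => (1 + |(m : ℝ)|) ^ p * ‖g m‖

theorem GSum.mono {g : ℤ → ℂ} {p q : ℕ} (h : GSum g q) (hpq : p ≤ q) : GSum g p := by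
  refine Summable.of_nonneg_of_le (fun n => by positivity) (fun n => ?_) h
  gcongr
  linarith [abs_nonneg (n : ℝ)]

/-- Arithmetic-geometric mean: half of the decay comes from the weight, the other half from f being
square-summable. -/
theorem WSum.gSum {w : ℤ → ℝ} {p : ℕ} (hw : WSum w p) (f : L2) : GSum (fun n => w n * f n) p := by
  refine Summable.of_nonneg_of_le (fun n => by positivity) (fun n => ?_) (hw.add (l2_summable f))
  rw [norm_mul, Complex.norm_real, Real.norm_eq_abs, mul_comm 2 p, pow_mul, ← sq_abs (w n)]
  nlinarith [sq_nonneg ((1 + |(n : ℝ)|) ^ p * |w n| - ‖f n‖),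
    sq_nonneg ((1 + |(n : ℝ)|) ^ p * |w n| + ‖f n‖)]

/-- `∑ₘ f(|n-m|) g(m)`. -/
def conv (f : ℕ → ℂ) (g : ℤ → ℂ) (n : ℤ) : ℂ := ∑' m : ℤ, f (n - m).natAbs * g m

theorem norm_conv_term_le {f : ℕ → ℂ} {g : ℤ → ℂ} {p : ℕ} {C : ℝ} (hC : 0 ≤ C)
    (hf : ∀ N, ‖f N‖ ≤ C * (1 + N) ^ p) (n m : ℤ) :
    ‖f (n - m).natAbs * g m‖ ≤ C * (1 + |(n : ℝ)|) ^ p * ((1 + |(m : ℝ)|) ^ p * ‖g m‖) := by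
  rw [norm_mul]
  calc ‖f (n - m).natAbs‖ * ‖g m‖
      ≤ (C * ((1 + |(n : ℝ)|) * (1 + |(m : ℝ)|)) ^ p) * ‖g m‖ := by
        refine mul_le_mul_of_nonneg_right ((hf _).trans ?_) (norm_nonneg _)
        exact mul_le_mul_of_nonneg_left
          (pow_le_pow_left₀ (by positivity) (one_add_natAbs_sub_le n m) p) hC
    _ = _ := by rw [mul_pow]; ring

theorem summable_conv {f : ℕ → ℂ} {g : ℤ → ℂ} {p : ℕ} (hf : PolyBdd f p) (hg : GSum g p) (n : ℤ) :
    Summable fun m : ℤ => f (n - m).natAbs * g m := by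
  obtain ⟨C, hC, hf⟩ := hf
  exact Summable.of_norm_bounded (hg.mul_left _) (norm_conv_term_le hC hf n)

theorem norm_conv_le {f : ℕ → ℂ} {g : ℤ → ℂ} {p : ℕ} (hf : PolyBdd f p) (hg : GSum g p) :
    ∃ C : ℝ, ∀ n, ‖conv f g n‖ ≤ C * (1 + |(n : ℝ)|) ^ p := by
  obtain ⟨C, hC, hf⟩ := hf
  refine ⟨C * ∑' m : ℤ, (1 + |(m : ℝ)|) ^ p * ‖g m‖, fun n => ?_⟩
  refine (tsum_of_norm_bounded (hg.mul_left _).hasSum (norm_conv_term_le hC hf n)).trans (le_of_eq ?_)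
  rw [tsum_mul_left]
  ring

theorem lap_natAbs {f r : ℕ → ℂ} (h0 : 2 * f 1 - 2 * f 0 = r 0)
    (h1 : ∀ N, f (N + 2) + f N - 2 * f (N + 1) = r (N + 1)) (n : ℤ) :
    lap (fun k => f k.natAbs) n = r n.natAbs := by
  rw [lap]
  rcases lt_trichotomy n 0 with h | rfl | h
  · obtain ⟨N, rfl⟩ : ∃ N : ℕ, n = -((N : ℤ) + 1) := ⟨(-n - 1).toNat, by omega⟩
    have e1 : (-((N : ℤ) + 1) + 1).natAbs = N := by omega
    have e2 : (-((N : ℤ) + 1) - 1).natAbs = N + 2 := by omega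
    have e3 : (-((N : ℤ) + 1)).natAbs = N + 1 := by omega
    rw [e1, e2, e3, ← h1]
    ring
  · simp only [zero_add, zero_sub, Int.natAbs_one, Int.natAbs_neg, Int.natAbs_zero]
    rw [← h0]
    ring
  · obtain ⟨N, rfl⟩ : ∃ N : ℕ, n = (N : ℤ) + 1 := ⟨(n - 1).toNat, by omega⟩
    have e1 : ((N : ℤ) + 1 + 1).natAbs = N + 2 := by omega
    have e2 : ((N : ℤ) + 1 - 1).natAbs = N := by omega
    have e3 : ((N : ℤ) + 1).natAbs = N + 1 := by omega
    rw [e1, e2, e3, ← h1]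

/-- Difference equations for a convolution reduce to a recurrence for the kernel on N ≥ 1 and one
condition at the origin. -/
theorem lap_conv {f r : ℕ → ℂ} {g : ℤ → ℂ} {p : ℕ} (hf : PolyBdd f p) (hg : GSum g p)
    (h0 : 2 * f 1 - 2 * f 0 = r 0) (h1 : ∀ N, f (N + 2) + f N - 2 * f (N + 1) = r (N + 1)) :
    lap (conv f g) = conv r g := by
  funext n
  have hs := fun k => (summable_conv hf hg k).hasSum
  have h := ((hs (n + 1)).add (hs (n - 1))).sub ((hs n).mul_left 2)
  refine h.tsum_eq.symm.trans (tsum_congr fun m => ?_)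
  rw [← lap_natAbs h0 h1, lap, show n + 1 - m = n - m + 1 by ring, show n - 1 - m = n - m - 1 by ring]
  ring

theorem conv_add {f f' : ℕ → ℂ} {g : ℤ → ℂ} {p : ℕ} (hf : PolyBdd f p) (hf' : PolyBdd f' p)
    (hg : GSum g p) (n : ℤ) : conv (fun N => f N + f' N) g n = conv f g n + conv f' g n := by
  rw [conv, conv, conv, ← (summable_conv hf hg n).tsum_add (summable_conv hf' hg n)]
  exact tsum_congr fun m => by ring

theorem conv_mul_left (c : ℂ) (f : ℕ → ℂ) (g : ℤ → ℂ) (n : ℤ) :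
    conv (fun N => c * f N) g n = c * conv f g n := by
  rw [conv, conv, ← tsum_mul_left]
  exact tsum_congr fun m => by ring

theorem conv_delta (g : ℤ → ℂ) (n : ℤ) : conv (fun N => if N = 0 then 1 else 0) g n = g n := by
  rw [conv, tsum_eq_single n]
  · simp
  · intro m hm
    rw [if_neg (by omega), zero_mul]

theorem convOp_apply {w : ℤ → ℝ} {f : ℕ → ℂ} {p : ℕ} (hw : WSum w p) (hf : PolyBdd f p) (x : L2)
    (n : ℤ) : convOp w f x n = w n * conv f (fun m => w m * x m) n := by
  refine (convOp_hasKernel hw hf x n).unique ?_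
  have := ((summable_conv hf (hw.gSum x) n).hasSum).mul_left (w n : ℂ)
  have e : (fun m => convKernel w f n m * x m) =
      fun m => (w n : ℂ) * (f (n - m).natAbs * ((w m : ℂ) * x m)) := by
    funext m
    rw [convKernel]
    ring
  rw [e]
  exact this

/-! ### Decay of convolutions -/

/-- Convolution with an even kernel that is an odd polynomial on the half-lines differs from a
polynomial by a decaying tail. -/
theorem norm_conv_sub_poly_le {f : ℕ → ℂ} {q : ℤ → ℂ} {g : ℤ → ℂ} {p j : ℕ} {C : ℝ} (hC : 0 ≤ C)
    (hf : ∀ N, ‖f N‖ ≤ C * (1 + N) ^ p) (hq : ∀ N : ℕ, q N = f N) (hq' : ∀ N : ℕ, q (-N) = -f N)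
    (hg : GSum g (p + j)) :
    ∃ D : ℝ, ∀ n : ℤ, ‖conv f g n - (if 0 ≤ n then 1 else -1) * ∑' m, q (n - m) * g m‖ *
      (1 + |(n : ℝ)|) ^ j ≤ D := by
  have hqf : ∀ k : ℤ, q k = f k.natAbs ∨ q k = -f k.natAbs := by
    intro k
    rcases Int.natAbs_eq k with h | h
    · left; conv_lhs => rw [h]
      exact hq _
    · right; conv_lhs => rw [h]
      exact hq' _
  have hqn : ∀ k : ℤ, ‖q k‖ = ‖f k.natAbs‖ := by
    intro k
    rcases hqf k with h | h <;> simp [h]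
  refine ⟨2 * C * ∑' m : ℤ, (1 + |(m : ℝ)|) ^ (p + j) * ‖g m‖, fun n => ?_⟩
  have hs1 := summable_conv ⟨C, hC, hf⟩ (hg.mono (Nat.le_add_right p j)) n
  have hs2 : Summable fun m : ℤ => q (n - m) * g m := by
    refine Summable.of_norm (hs1.norm.congr fun m => ?_)
    rw [norm_mul, norm_mul, hqn]
  have hb : ∀ m : ℤ, ‖f (n - m).natAbs * g m - (if 0 ≤ n then 1 else -1) * (q (n - m) * g m)‖ *
      (1 + |(n : ℝ)|) ^ j ≤ 2 * C * ((1 + |(m : ℝ)|) ^ (p + j) * ‖g m‖) := by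
    intro m
    have e : f (n - m).natAbs * g m - (if 0 ≤ n then 1 else -1) * (q (n - m) * g m) =
        (f (n - m).natAbs - (if 0 ≤ n then 1 else -1) * q (n - m)) * g m := by ring
    rw [e, norm_mul]
    -- The kernel and the polynomial differ only when m lies farther out than n on the same
    -- half-line. Then |n| and |n-m| are both at most |m|, so all growth and the extra weight in n
    -- can be charged to g(m).
    have tail : (|(n : ℝ)| ≤ |(m : ℝ)|) → (((n - m).natAbs : ℝ) ≤ |(m : ℝ)|) →
        ‖f (n - m).natAbs - (if 0 ≤ n then 1 else -1) * q (n - m)‖ * ‖g m‖ * (1 + |(n : ℝ)|) ^ j ≤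
          2 * C * ((1 + |(m : ℝ)|) ^ (p + j) * ‖g m‖) := by
      intro h1 h2
      have h3 : ‖f (n - m).natAbs - (if 0 ≤ n then 1 else -1) * q (n - m)‖ ≤
          2 * (C * (1 + |(m : ℝ)|) ^ p) := by
        have h4 : ‖f (n - m).natAbs‖ ≤ C * (1 + |(m : ℝ)|) ^ p := by
          refine (hf _).trans ?_
          gcongr
        have h5 : ‖(if 0 ≤ n then (1 : ℂ) else -1) * q (n - m)‖ ≤ C * (1 + |(m : ℝ)|) ^ p := by
          rw [norm_mul, hqn]
          split_ifs <;> simpa using h4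
        linarith [norm_sub_le (f (n - m).natAbs) ((if 0 ≤ n then (1 : ℂ) else -1) * q (n - m))]
      calc _ ≤ 2 * (C * (1 + |(m : ℝ)|) ^ p) * ‖g m‖ * (1 + |(m : ℝ)|) ^ j := by gcongr
        _ = _ := by rw [pow_add]; ring
    have hpos : 0 ≤ 2 * C * ((1 + |(m : ℝ)|) ^ (p + j) * ‖g m‖) := by positivity
    have hna : ((n - m).natAbs : ℝ) = |(n : ℝ) - m| := by
      rw [Nat.cast_natAbs]
      push_cast
      rfl
    by_cases hn : 0 ≤ n
    · by_cases hm : m ≤ n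
      · have : q (n - m) = f (n - m).natAbs := by
          have h6 : (n - m) = ((n - m).natAbs : ℤ) := by omega
          conv_lhs => rw [h6]
          exact hq _
        rw [if_pos hn, this]
        simpa using hpos
      · have hnr : (0 : ℝ) ≤ n := by exact_mod_cast hn
        have hmr : (n : ℝ) < m := by exact_mod_cast not_le.1 hm
        refine tail ?_ ?_
        · rw [abs_of_nonneg hnr, abs_of_nonneg (by linarith)]
          exact hmr.le
        · rw [hna, abs_of_nonpos (by linarith), abs_of_nonneg (by linarith)]
          linarith
    · by_cases hm : n ≤ m
      · have : q (n - m) = -f (n - m).natAbs := by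
          have h6 : (n - m) = -((n - m).natAbs : ℤ) := by omega
          conv_lhs => rw [h6]
          exact hq' _
        rw [if_neg hn, this]
        simpa using hpos
      · have hnr : (n : ℝ) < 0 := by exact_mod_cast not_le.1 hn
        have hmr : (m : ℝ) < n := by exact_mod_cast not_le.1 hm
        refine tail ?_ ?_
        · rw [abs_of_neg hnr, abs_of_neg (by linarith)]
          linarith
        · rw [hna, abs_of_nonneg (by linarith), abs_of_neg (by linarith)]
          linarith
  have hn0 : 0 < (1 + |(n : ℝ)|) ^ j := by positivity
  rw [← le_div_iff₀ hn0, conv, ← tsum_mul_left, ← hs1.tsum_sub (hs2.mul_left _), mul_div_right_comm,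
    ← tsum_mul_left]
  refine tsum_of_norm_bounded ((hg.mul_left _).hasSum) fun m => ?_
  rw [div_mul_eq_mul_div, le_div_iff₀ hn0]
  exact hb m

/-- Peetre's inequality 1 + |n| ≤ (1 + |n-m|)(1 + |m|) distributes the weight over the kernel and g.
-/
theorem norm_conv_decay_le {f : ℕ → ℂ} {g : ℤ → ℂ} {j : ℕ} {C : ℝ}
    (hf : ∀ N : ℕ, ‖f N‖ * (1 + N) ^ j ≤ C) (hg : GSum g j) :
    ∃ D : ℝ, ∀ n : ℤ, ‖conv f g n‖ * (1 + |(n : ℝ)|) ^ j ≤ D := by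
  refine ⟨C * ∑' m : ℤ, (1 + |(m : ℝ)|) ^ j * ‖g m‖, fun n => ?_⟩
  have hn0 : 0 < (1 + |(n : ℝ)|) ^ j := by positivity
  rw [← le_div_iff₀ hn0, mul_div_right_comm, ← tsum_mul_left]
  refine tsum_of_norm_bounded ((hg.mul_left _).hasSum) fun m => ?_
  rw [div_mul_eq_mul_div, le_div_iff₀ hn0, norm_mul]
  have h1 : 1 + |(n : ℝ)| ≤ (1 + ((n - m).natAbs : ℝ)) * (1 + |(m : ℝ)|) := by
    have hna : ((n - m).natAbs : ℝ) = |(n : ℝ) - m| := by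
      rw [Nat.cast_natAbs]
      push_cast
      rfl
    rw [hna]
    nlinarith [abs_sub_abs_le_abs_sub (n : ℝ) m, mul_nonneg (abs_nonneg ((n : ℝ) - m)) (abs_nonneg (m : ℝ))]
  calc ‖f (n - m).natAbs‖ * ‖g m‖ * (1 + |(n : ℝ)|) ^ j
      ≤ ‖f (n - m).natAbs‖ * ‖g m‖ * ((1 + ((n - m).natAbs : ℝ)) * (1 + |(m : ℝ)|)) ^ j := by gcongr
    _ = (‖f (n - m).natAbs‖ * (1 + ((n - m).natAbs : ℝ)) ^ j) * ((1 + |(m : ℝ)|) ^ j * ‖g m‖) := by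
      rw [mul_pow]; ring
    _ ≤ C * ((1 + |(m : ℝ)|) ^ j * ‖g m‖) :=
      mul_le_mul_of_nonneg_right (hf _) (by positivity)

theorem exists_geometric_decay {ρ : ℝ} (hρ : |ρ| < 1) (j : ℕ) :
    ∃ C : ℝ, ∀ N : ℕ, ‖(ρ : ℂ) ^ N‖ * (1 + N) ^ j ≤ C := by
  have h := tendsto_pow_const_mul_const_pow_of_abs_lt_one j (show |(|ρ|)| < 1 by rwa [abs_abs])
  obtain ⟨C, hC⟩ := h.bddAbove_range
  have hC' : ∀ N : ℕ, (N : ℝ) ^ j * |ρ| ^ N ≤ C := fun N => hC ⟨N, rfl⟩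
  refine ⟨max 1 (2 ^ j * C), fun N => ?_⟩
  rw [norm_pow, Complex.norm_real, Real.norm_eq_abs]
  rcases Nat.eq_zero_or_pos N with rfl | hN
  · simp
  · refine le_max_of_le_right ?_
    have h1 : (1 : ℝ) ≤ N := by exact_mod_cast hN
    calc |ρ| ^ N * (1 + N) ^ j ≤ |ρ| ^ N * (2 * N) ^ j := by gcongr; linarith
      _ = 2 ^ j * ((N : ℝ) ^ j * |ρ| ^ N) := by rw [mul_pow]; ring
      _ ≤ _ := by
        have := hC' N
        gcongr

/-- Growth |n|^k places φ in W_{k+1/2}: linearly growing solutions correspond to W_{3/2} and bounded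
ones to W_{1/2}. -/
theorem memW_of_growth {φ : ℤ → ℂ} {C : ℝ} {k : ℕ} (h : ∀ n, ‖φ n‖ ≤ C * (1 + |(n : ℝ)|) ^ k)
    {σ : ℝ} (hσ : (k : ℝ) + 1 / 2 ≤ σ) : MemW σ φ := by
  intro s hs
  have h1 := (summable_bracket_rpow (b := 2 * s - 2 * k) (by linarith)).mul_left (C ^ 2 * 2 ^ (2 * k))
  refine Summable.of_nonneg_of_le (fun n => ?_) (fun n => ?_) h1
  · have := one_le_bracket n
    positivity
  have hb := one_le_bracket n
  have h2 : 1 + |(n : ℝ)| ≤ 2 * bracket n := by linarith [abs_le_bracket n]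
  have h3 : (1 + |(n : ℝ)|) ^ (2 * k) ≤ 2 ^ (2 * k) * bracket n ^ (2 * k) := by
    rw [← mul_pow]
    exact pow_le_pow_left₀ (by positivity) h2 _
  have h4 : bracket n ^ (-(2 * s - 2 * k)) = bracket n ^ (2 * k) * bracket n ^ (2 * -s) := by
    rw [← Real.rpow_natCast, ← Real.rpow_add (by linarith)]
    congr 1
    push_cast
    ring
  have h5 : ‖φ n‖ ^ 2 ≤ C ^ 2 * (1 + |(n : ℝ)|) ^ (2 * k) := by
    rw [mul_comm 2 k, pow_mul, ← mul_pow]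
    exact pow_le_pow_left₀ (norm_nonneg _) (h n) 2
  rw [h4]
  calc bracket n ^ (2 * -s) * ‖φ n‖ ^ 2
      ≤ bracket n ^ (2 * -s) * (C ^ 2 * (2 ^ (2 * k) * bracket n ^ (2 * k))) := by
        refine mul_le_mul_of_nonneg_left (h5.trans ?_) (Real.rpow_nonneg (by linarith) _)
        exact mul_le_mul_of_nonneg_left h3 (sq_nonneg C)
    _ = _ := by ring

theorem summable_of_decay {a : ℤ → ℂ} {C : ℝ} (h : ∀ n, ‖a n‖ * (1 + |(n : ℝ)|) ^ 2 ≤ C) :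
    Summable a := by
  have h1 := (summable_bracket_rpow (b := 2) (by norm_num)).mul_left C
  refine Summable.of_norm_bounded h1 fun n => ?_
  have hb := one_le_bracket n
  have hC : 0 ≤ C := le_trans (by positivity) (h n)
  rw [Real.rpow_neg (by linarith), ← div_eq_mul_inv, le_div_iff₀ (by positivity)]
  refine le_trans ?_ (h n)
  refine mul_le_mul_of_nonneg_left ?_ (norm_nonneg _)
  rw [show (2 : ℝ) = ((2 : ℕ) : ℝ) by norm_num, Real.rpow_natCast]
  exact pow_le_pow_left₀ (by linarith) (bracket_le n) 2

theorem memℓp_of_decay {φ : ℤ → ℂ} {C : ℝ} (h : ∀ n, ‖φ n‖ * (1 + |(n : ℝ)|) ≤ C) :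
    Memℓp φ 2 := by
  refine memℓp_two_iff.2 ?_
  have h1 : Summable fun n => ((‖φ n‖ ^ 2 : ℝ) : ℂ) := by
    refine summable_of_decay (C := C ^ 2) fun n => ?_
    rw [Complex.norm_real, Real.norm_eq_abs, abs_of_nonneg (by positivity), ← mul_pow]
    exact pow_le_pow_left₀ (by positivity) (h n) 2
  exact_mod_cast h1

theorem GSum.summable_moment {g : ℤ → ℂ} {p k : ℕ} (hg : GSum g p) (hk : k ≤ p) :
    Summable fun m : ℤ => (m : ℂ) ^ k * g m := by
  refine Summable.of_norm_bounded (hg.mono hk) fun m => ?_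
  rw [norm_mul, norm_pow, Complex.norm_intCast]
  gcongr
  linarith [abs_nonneg (m : ℝ)]

/-! ### Solutions of the threshold equations -/

theorem mem_span_of_perp_starProjection_eq_zero {w : ℕ → ℤ → ℝ} {N : ℕ} {y : L2}
    (h : (perp w N).starProjection y = 0) :
    y ∈ Submodule.span ℂ ((fun k => toL2 (w k)) '' Set.Iio N) := by
  have hfin : FiniteDimensional ℂ (Submodule.span ℂ ((fun k => toL2 (w k)) '' Set.Iio N)) :=
    FiniteDimensional.span_of_finite ℂ ((Set.finite_Iio N).image _)
  have h1 := Submodule.sub_starProjection_mem_orthogonal (K := perp w N) y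
  rw [h, sub_zero, perp, Submodule.orthogonal_orthogonal] at h1
  exact h1

theorem signV_mul_sq (V : ℤ → ℝ) (n : ℤ) : signV V n * (vk V 0 n : ℂ) ^ 2 = V n := by
  rw [← Complex.ofReal_pow, vk_zero_sq, signV]
  split_ifs with h
  · rw [abs_of_nonneg h, one_mul]
  · rw [abs_of_neg (not_le.1 h)]
    push_cast
    ring

theorem moment_eq_zero {w : ℕ → ℤ → ℝ} (hw : ∀ k n, w k n = (n : ℝ) ^ k * w 0 n) {p N k : ℕ}
    (hs : WSum (w 0) p) (hkp : k ≤ p) {f : L2} (hf : f ∈ perp w N) (hk : k < N) :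
    ∑' n : ℤ, (n : ℂ) ^ k * ((w 0 n : ℂ) * f n) = 0 := by
  have h := (hasSum_inner_toL2 (memℓp_moment hw hs hkp) f).tsum_eq
  rw [mem_perp_iff.1 hf k hk] at h
  rw [← h]
  refine tsum_congr fun n => ?_
  rw [hw k n]
  push_cast
  ring

/-- The sign of the half-line containing `n`. -/
def halfSign (n : ℤ) : ℂ := if 0 ≤ n then 1 else -1

theorem norm_halfSign_mul (n : ℤ) (z : ℂ) : ‖halfSign n * z‖ = ‖z‖ := by
  unfold halfSign
  split_ifs <;> simp

/-! #### Threshold `0` -/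

/-- The kernel `(N³ - N)/12`. -/
def zeroKer (N : ℕ) : ℂ := ((N : ℂ) ^ 3 - N) / 12

theorem polyBdd_zeroKer : PolyBdd zeroKer 3 := by
  convert polyBdd_zeroFn 1 3 using 1
  funext N
  rw [zeroFn_three, zeroKer]

theorem T0_apply {V : ℤ → ℝ} (hw : WSum (vk V 0) 3) (f : L2) (n : ℤ) :
    T0 V f n = signV V n * f n + vk V 0 n * conv zeroKer (fun m => vk V 0 m * f m) n := by
  have e : zeroFn 1 3 = zeroKer := funext fun N => zeroFn_three 1 N
  rw [T0_eq V 1, e, add_apply, lp.coeFn_add, Pi.add_apply, convOp_apply hw polyBdd_zeroKer]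
  rfl

theorem lap_lap_conv_zeroKer {g : ℤ → ℂ} (hg : GSum g 3) (n : ℤ) :
    lap (lap (conv zeroKer g)) n = g n := by
  have b1 : PolyBdd (fun N : ℕ => (N : ℂ) / 2) 1 := by simpa using polyBdd_div 1 2
  rw [lap_conv (r := fun N => (N : ℂ) / 2) polyBdd_zeroKer hg (by norm_num [zeroKer]) (fun N => by
      simp only [zeroKer]
      push_cast
      ring),
    lap_conv (r := fun N => if N = 0 then 1 else 0) b1 (hg.mono (by norm_num)) (by norm_num)
      (fun N => by
        rw [if_neg (by omega)]
        push_cast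
        ring), conv_delta]

/-- Birman-Schwinger: T₀f = (a + bn)v means f = Uvφ with φ = a + bn - G₀vf. Since Δ² annihilates
affine sequences, Δ²G₀ = 1 and V = Uv², φ solves Hφ = 0, and φ determines f. -/
theorem zero_solves {V : ℤ → ℝ} (hw : WSum (vk V 0) 3) {f : L2} {a b : ℂ}
    (hT : ∀ n : ℤ, T0 V f n = (a + b * n) * vk V 0 n) :
    Solves V 0 (fun n => a + b * n - conv zeroKer (fun m => vk V 0 m * f m) n) ∧
      ((fun n : ℤ => a + b * n - conv zeroKer (fun m => vk V 0 m * f m) n) = 0 → f = 0) := by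
  set u := conv zeroKer (fun m => vk V 0 m * f m) with hu
  have hf : ∀ n : ℤ, f n = signV V n * (vk V 0 n * (a + b * n - u n)) := by
    intro n
    have h := hT n
    rw [T0_apply hw, ← hu] at h
    linear_combination signV V n * h - f n * signV_sq V n
  constructor
  · intro n
    have e1 : lap (fun n : ℤ => a + b * n - u n) = fun n => -lap u n := by
      funext n
      simp only [lap]
      push_cast
      ring
    have e2 : lap (fun n => -lap u n) n = -lap (lap u) n := by
      simp only [lap]
      ring
    rw [e1, e2, hu, lap_lap_conv_zeroKer (hw.gSum f), ← hu]
    have := hf n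
    have h3 := signV_mul_sq V n
    push_cast
    linear_combination (-(vk V 0 n : ℂ)) * this - (a + b * n - u n) * h3
  · intro h
    ext n
    rw [hf n, congrFun h n]
    simp

/-- Expanding (n-m)³ - (n-m) in powers of n identifies the asymptotics of G₀vf: its coefficients are
moments of g, so each vanishing moment removes a power of n. -/
theorem zero_tail {g : ℤ → ℂ} (hg : GSum g 4) : ∃ D : ℝ, ∀ n : ℤ, ‖conv zeroKer g n - halfSign n *
    (((n : ℂ) ^ 3 * (∑' m : ℤ, (m : ℂ) ^ 0 * g m) - 3 * n ^ 2 * (∑' m : ℤ, (m : ℂ) ^ 1 * g m) +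
      3 * n * (∑' m : ℤ, (m : ℂ) ^ 2 * g m) - (∑' m : ℤ, (m : ℂ) ^ 3 * g m) -
      n * (∑' m : ℤ, (m : ℂ) ^ 0 * g m) + (∑' m : ℤ, (m : ℂ) ^ 1 * g m)) / 12)‖ *
    (1 + |(n : ℝ)|) ^ 1 ≤ D := by
  obtain ⟨C, hC, hf⟩ := polyBdd_zeroKer
  obtain ⟨D, hD⟩ := norm_conv_sub_poly_le (q := fun k => ((k : ℂ) ^ 3 - k) / 12) (j := 1) hC hf
    (fun N => by simp [zeroKer]) (fun N => by simp only [zeroKer]; push_cast; ring) hg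
  refine ⟨D, fun n => ?_⟩
  have h := fun k (hk : k ≤ 3) => (hg.summable_moment (hk.trans (by norm_num : 3 ≤ 4))).hasSum
  have hs := ((((((h 0 (by norm_num)).mul_left ((n : ℂ) ^ 3)).sub ((h 1 (by norm_num)).mul_left
    (3 * (n : ℂ) ^ 2))).add ((h 2 (by norm_num)).mul_left (3 * (n : ℂ)))).sub
    (h 3 le_rfl)).sub ((h 0 (by norm_num)).mul_left (n : ℂ))).add (h 1 (by norm_num))
  have hs' := hs.div_const 12
  convert hD n using 3
  rw [halfSign, ← hs'.tsum_eq]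
  congr 2
  refine tsum_congr fun m => ?_
  push_cast
  ring

/-- Two vanishing moments remove n³ and n², so the solution attached to f grows at most linearly. -/
theorem eq_zero_of_zeroRegular {V : ℤ → ℝ} (hw : WSum (vk V 0) 4) (h : ¬ HasSolW V 0 (3 / 2))
    {f : L2} (hf : f ∈ perpKer (vk V) 2 (S0 V * T0 V)) : f = 0 := by
  have hw3 := hw.mono (show 3 ≤ 4 by norm_num)
  obtain ⟨hp, hT⟩ := mem_perpKer_iff.1 hf
  have hspan := mem_span_of_perp_starProjection_eq_zero (w := vk V) (N := 2) (y := T0 V f) hT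
  have hset : (fun k => toL2 (vk V k)) '' Set.Iio 2 = {toL2 (vk V 0), toL2 (vk V 1)} := by
    have : Set.Iio 2 = ({0, 1} : Set ℕ) := by
      ext k
      simp only [Set.mem_Iio, Set.mem_insert_iff, Set.mem_singleton_iff]
      omega
    rw [this, Set.image_pair]
  rw [hset, Submodule.mem_span_pair] at hspan
  obtain ⟨a, b, hab⟩ := hspan
  have hTn : ∀ n : ℤ, T0 V f n = (a + b * n) * vk V 0 n := by
    intro n
    rw [← hab, lp.coeFn_add, Pi.add_apply, lp.coeFn_smul, lp.coeFn_smul, Pi.smul_apply, Pi.smul_apply,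
      toL2_apply (memℓp_moment (vk_eq V) hw (by norm_num)),
      toL2_apply (memℓp_moment (vk_eq V) hw (by norm_num)), vk_eq V 1 n]
    push_cast
    simp only [smul_eq_mul]
    ring
  obtain ⟨hsol, hz⟩ := zero_solves hw3 hTn
  by_contra hne
  refine h ⟨_, fun h0 => hne (hz h0), ?_, hsol⟩
  have hg := hw.gSum f
  obtain ⟨D, hD⟩ := zero_tail hg
  have m0 := moment_eq_zero (vk_eq V) hw (k := 0) (by norm_num) hp (by norm_num)
  have m1 := moment_eq_zero (vk_eq V) hw (k := 1) (by norm_num) hp (by norm_num)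
  simp only [m0, m1] at hD
  set μ2 := ∑' m : ℤ, (m : ℂ) ^ 2 * (vk V 0 m * f m)
  set μ3 := ∑' m : ℤ, (m : ℂ) ^ 3 * (vk V 0 m * f m)
  refine memW_of_growth (k := 1) (C := ‖a‖ + ‖b‖ + D + ‖μ2‖ + ‖μ3‖) (fun n => ?_) (by norm_num)
  have h1 := hD n
  have hn := abs_nonneg (n : ℝ)
  set u := conv zeroKer (fun m => vk V 0 m * f m) n
  set P := ((n : ℂ) ^ 3 * 0 - 3 * n ^ 2 * 0 + 3 * n * μ2 - μ3 - n * 0 + 0) / 12 with hP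
  have hPn : ‖P‖ ≤ |(n : ℝ)| * ‖μ2‖ + ‖μ3‖ := by
    have e : P = (n : ℂ) * μ2 * (1 / 4) - μ3 * (1 / 12) := by rw [hP]; ring
    rw [e]
    refine (norm_sub_le _ _).trans ?_
    rw [norm_mul, norm_mul, norm_mul, Complex.norm_intCast]
    norm_num
    have := mul_nonneg hn (norm_nonneg μ2)
    linarith [norm_nonneg μ3]
  have hX : ‖u - halfSign n * P‖ ≤ D := by
    have := norm_nonneg (u - halfSign n * P)
    nlinarith
  have e : a + b * n - u = a + b * n - halfSign n * P - (u - halfSign n * P) := by ring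
  rw [e]
  have h2 := norm_sub_le (a + b * n - halfSign n * P) (u - halfSign n * P)
  have h3 := norm_sub_le (a + b * n) (halfSign n * P)
  have h4 := norm_add_le a (b * n)
  rw [norm_mul, Complex.norm_intCast] at h4
  rw [norm_halfSign_mul] at h3
  have hD0 := (norm_nonneg _).trans hX
  rw [pow_one]
  have n1 := mul_nonneg hn (norm_nonneg a)
  have n2 := mul_nonneg hn (norm_nonneg μ3)
  have n3 := mul_nonneg hn hD0
  nlinarith [norm_nonneg b, norm_nonneg μ2]

theorem T0_eq_smul_of_Q {V : ℤ → ℝ} (hw : WSum (vk V 0) 4) {f : L2} (hT : (Q V * T0 V) f = 0) :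
    ∃ a : ℂ, ∀ n : ℤ, T0 V f n = (a + 0 * n) * vk V 0 n := by
  have hspan := mem_span_of_perp_starProjection_eq_zero (w := vk V) (N := 1) (y := T0 V f) hT
  have hset : (fun k => toL2 (vk V k)) '' Set.Iio 1 = {toL2 (vk V 0)} := by
    have : Set.Iio 1 = ({0} : Set ℕ) := by
      ext k
      simp
    rw [this, Set.image_singleton]
  rw [hset, Submodule.mem_span_singleton] at hspan
  obtain ⟨a, ha⟩ := hspan
  refine ⟨a, fun n => ?_⟩
  rw [← ha, lp.coeFn_smul, Pi.smul_apply, toL2_apply (memℓp_moment (vk_eq V) hw (by norm_num))]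
  simp

/-- QT₀f = 0 excludes the affine slope and the third vanishing moment excludes the linear term of
the tail, so the solution is bounded. -/
theorem eq_zero_of_no_half_solution {V : ℤ → ℝ} (hw : WSum (vk V 0) 4) (h : ¬ HasSolW V 0 (1 / 2))
    {f : L2} (hf : f ∈ perpKer (vk V) 3 (Q V * T0 V)) : f = 0 := by
  obtain ⟨hp, hT⟩ := mem_perpKer_iff.1 hf
  obtain ⟨a, hTn⟩ := T0_eq_smul_of_Q hw hT
  obtain ⟨hsol, hz⟩ := zero_solves (hw.mono (by norm_num)) hTn
  by_contra hne
  refine h ⟨_, fun h0 => hne (hz h0), ?_, hsol⟩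
  obtain ⟨D, hD⟩ := zero_tail (hw.gSum f)
  have m0 := moment_eq_zero (vk_eq V) hw (k := 0) (by norm_num) hp (by norm_num)
  have m1 := moment_eq_zero (vk_eq V) hw (k := 1) (by norm_num) hp (by norm_num)
  have m2 := moment_eq_zero (vk_eq V) hw (k := 2) (by norm_num) hp (by norm_num)
  simp only [m0, m1, m2] at hD
  set μ3 := ∑' m : ℤ, (m : ℂ) ^ 3 * (vk V 0 m * f m)
  refine memW_of_growth (k := 0) (C := ‖a‖ + D + ‖μ3‖) (fun n => ?_) (by norm_num)
  have h1 := hD n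
  have hn := abs_nonneg (n : ℝ)
  set u := conv zeroKer (fun m => vk V 0 m * f m) n
  set P := ((n : ℂ) ^ 3 * 0 - 3 * n ^ 2 * 0 + 3 * n * 0 - μ3 - n * 0 + 0) / 12 with hP
  have hPn : ‖P‖ ≤ ‖μ3‖ := by
    have e : P = -(μ3 * (1 / 12)) := by rw [hP]; ring
    rw [e, norm_neg, norm_mul]
    norm_num
    linarith [norm_nonneg μ3]
  have hX : ‖u - halfSign n * P‖ ≤ D := by
    have := norm_nonneg (u - halfSign n * P)
    nlinarith
  have e : a + 0 * n - u = a - halfSign n * P - (u - halfSign n * P) := by ring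
  rw [e, pow_zero, mul_one]
  have h2 := norm_sub_le (a - halfSign n * P) (u - halfSign n * P)
  have h3 := norm_sub_le a (halfSign n * P)
  rw [norm_halfSign_mul] at h3
  linarith

/-- Four vanishing moments remove the whole polynomial part; the remaining tail decays like 1/|n|
and is square-summable. -/
theorem eq_zero_of_no_l2_solution {V : ℤ → ℝ} (hw : WSum (vk V 0) 4) (h : ¬ HasSolL2 V 0)
    {f : L2} (hp : f ∈ perp (vk V) 4) (hT : T0 V f = 0) : f = 0 := by
  have hTn : ∀ n : ℤ, T0 V f n = ((0 : ℂ) + 0 * n) * vk V 0 n := by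
    intro n
    rw [hT]
    simp
  obtain ⟨hsol, hz⟩ := zero_solves (hw.mono (by norm_num)) hTn
  by_contra hne
  refine h ⟨_, fun h0 => hne (hz h0), ?_, hsol⟩
  obtain ⟨D, hD⟩ := zero_tail (hw.gSum f)
  have m := fun k (hk : k < 4) => moment_eq_zero (vk_eq V) hw (k := k) hk.le hp hk
  simp only [m 0 (by norm_num), m 1 (by norm_num), m 2 (by norm_num), m 3 (by norm_num)] at hD
  refine memℓp_of_decay (C := D) fun n => ?_
  simpa using hD n

/-! #### Threshold `16` -/

/-- The root of `ρ + ρ⁻¹ = -6` in the unit disc. -/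
abbrev rho : ℝ := 2 * Real.sqrt 2 - 3

theorem sqrt_two_sq : Real.sqrt 2 ^ 2 = 2 := Real.sq_sqrt (by norm_num)

theorem abs_rho_lt_one : |rho| < 1 := by
  have h := sqrt_two_sq
  have h0 := Real.sqrt_nonneg 2
  rw [abs_lt, rho]
  constructor <;> nlinarith

theorem rho_sq : rho ^ 2 = -6 * rho - 1 := by
  rw [rho]
  linear_combination 4 * sqrt_two_sq

/-- The kernel of `G̃₀` as a function of the distance. -/
def sixteenKer (N : ℕ) : ℂ :=
  (((2 * Real.sqrt 2 * N - rho ^ N) / (32 * Real.sqrt 2) : ℝ) : ℂ)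

theorem T0t_apply {V : ℤ → ℝ} (hw : WSum (vkt V 0) 1) (f : L2) (n : ℤ) :
    T0t V f n = signV V n * f n + vkt V 0 n * conv sixteenKer (fun m => vkt V 0 m * f m) n := by
  rw [T0t_eq, add_apply, lp.coeFn_add, Pi.add_apply, convOp_apply hw polyBdd_G0t]
  rfl

theorem sqrt_two_ne_zero' : (Real.sqrt 2 : ℂ) ≠ 0 := by
  exact_mod_cast (Real.sqrt_pos.2 (by norm_num : (0 : ℝ) < 2)).ne'

theorem sqrt_two_sq' : (Real.sqrt 2 : ℂ) ^ 2 = 2 := by exact_mod_cast sqrt_two_sq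

theorem inv_sqrt_two : (Real.sqrt 2 : ℂ)⁻¹ = Real.sqrt 2 / 2 := by
  have := sqrt_two_ne_zero'
  field_simp
  exact sqrt_two_sq'.symm

theorem sixteenKer_eq (N : ℕ) : sixteenKer N = N / 16 - (Real.sqrt 2 / 64) * (rho : ℂ) ^ N := by
  have h := inv_sqrt_two
  have h0 := sqrt_two_ne_zero'
  rw [sixteenKer]
  push_cast
  rw [div_eq_mul_inv, mul_inv, h]
  linear_combination (N / 32 : ℂ) * sqrt_two_sq'

theorem rho_pow_add_two (N : ℕ) : (rho : ℂ) ^ (N + 2) = -6 * (rho : ℂ) ^ (N + 1) - (rho : ℂ) ^ N := by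
  have h : (rho : ℂ) ^ 2 = -6 * (rho : ℂ) - 1 := by exact_mod_cast rho_sq
  rw [pow_add, h, pow_succ]
  ring

theorem rho_cast : (rho : ℂ) = 2 * (Real.sqrt 2 : ℂ) - 3 := by
  rw [rho]
  push_cast
  ring

theorem polyBdd_sixteenKer : PolyBdd sixteenKer 1 := polyBdd_G0t

theorem polyBdd_rho (p : ℕ) : PolyBdd (fun N => (rho : ℂ) ^ N) p := by
  refine PolyBdd.mono (p := 0) ⟨1, zero_le_one, fun N => ?_⟩ (Nat.zero_le p)
  rw [norm_pow, Complex.norm_real, Real.norm_eq_abs, pow_zero, mul_one]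
  exact pow_le_one₀ (abs_nonneg _) abs_rho_lt_one.le

/-- `Δ(Δ + 8)`, the conjugate of `Δ² - 16` by `(-1)^n`. -/
def altOp (x : ℤ → ℂ) (n : ℤ) : ℂ := lap (fun k => lap x k + 8 * x k) n

/-- Conjugation by (-1)^n sends Δ to -(Δ + 4), hence Δ² - 16 to Δ(Δ + 8). -/
theorem altOp_spec (x : ℤ → ℂ) (n : ℤ) :
    lap (lap (fun k => (-1) ^ k * x k)) n - 16 * ((-1) ^ n * x n) = (-1) ^ n * altOp x n := by
  have h : ∀ k : ℤ, (-1 : ℂ) ^ (k + 1) = -(-1) ^ k := fun k => by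
    rw [zpow_add_one₀ (by norm_num)]
    ring
  have h' : ∀ k : ℤ, (-1 : ℂ) ^ (k - 1) = -(-1) ^ k := fun k => by
    rw [zpow_sub_one₀ (by norm_num)]
    norm_num
  simp only [altOp, lap, h, h']
  ring

theorem lap_add_conv {f r : ℕ → ℂ} {g : ℤ → ℂ} {p : ℕ} (hf : PolyBdd f p) (hr : PolyBdd r p)
    (hg : GSum g p)
    (h0 : 2 * f 1 - 2 * f 0 + 8 * f 0 = r 0)
    (h1 : ∀ N, f (N + 2) + f N - 2 * f (N + 1) + 8 * f (N + 1) = r (N + 1)) :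
    (fun k => lap (conv f g) k + 8 * conv f g k) = conv r g := by
  have e := lap_conv (r := fun N => r N - 8 * f N) hf hg (by linear_combination h0)
    (fun N => by linear_combination h1 N)
  funext k
  rw [e, ← conv_mul_left, ← conv_add (hr.sub (hf.smul 8)) (hf.smul 8) hg]
  congr 1
  funext N
  ring

/-- Since ρ + ρ⁻¹ = -6, the geometric part satisfies (Δ + 8)ρ^N = 0 away from the origin, and its
coefficient is such that Δ + 8 turns the kernel into N/2, whose Laplacian is the delta sequence. -/
theorem altOp_conv_sixteenKer {g : ℤ → ℂ} (hg : GSum g 1) (n : ℤ) :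
    altOp (conv sixteenKer g) n = g n := by
  have b1 : PolyBdd (fun N : ℕ => (N : ℂ) / 2) 1 := by simpa using polyBdd_div 1 2
  have e := lap_add_conv (r := fun N => (N : ℂ) / 2) polyBdd_sixteenKer b1 hg
    (by
      simp only [sixteenKer_eq, rho_cast]
      push_cast
      linear_combination (-1 / 16 : ℂ) * sqrt_two_sq')
    (fun N => by
      simp only [sixteenKer_eq, rho_pow_add_two]
      push_cast
      ring)
  rw [altOp, e, lap_conv (r := fun N => if N = 0 then 1 else 0) b1 hg (by norm_num)
      (fun N => by
        rw [if_neg (by omega)]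
        push_cast
        ring), conv_delta]

theorem vkt_sq (V : ℤ → ℝ) (n : ℤ) : (vkt V 0 n : ℂ) ^ 2 = (vk V 0 n : ℂ) ^ 2 := by
  rw [vkt, ← Complex.ofReal_pow, mul_pow, neg_one_zpow_sq, one_mul, Complex.ofReal_pow]

/-- The Birman-Schwinger argument of `zero_solves` after conjugation by (-1)^n; here Δ(Δ + 8)
annihilates constants. -/
theorem sixteen_solves {V : ℤ → ℝ} (hw : WSum (vkt V 0) 1) {f : L2} {a : ℂ}
    (hT : ∀ n : ℤ, T0t V f n = a * vkt V 0 n) :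
    Solves V 16 (fun n => (-1) ^ n * (a - conv sixteenKer (fun m => vkt V 0 m * f m) n)) ∧
      ((fun n : ℤ => (-1 : ℂ) ^ n * (a - conv sixteenKer (fun m => vkt V 0 m * f m) n)) = 0 →
        f = 0) := by
  set u := conv sixteenKer (fun m => vkt V 0 m * f m) with hu
  have hf : ∀ n : ℤ, f n = signV V n * (vkt V 0 n * (a - u n)) := by
    intro n
    have h := hT n
    rw [T0t_apply hw, ← hu] at h
    linear_combination signV V n * h - f n * signV_sq V n
  constructor
  · intro n
    have e1 := altOp_spec (fun n => a - u n) n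
    have e2 : altOp (fun n => a - u n) n = -altOp u n := by
      simp only [altOp, lap]
      ring
    rw [e2, hu, altOp_conv_sixteenKer (hw.gSum f), ← hu] at e1
    have := hf n
    have h3 := signV_mul_sq V n
    rw [← vkt_sq] at h3
    push_cast
    linear_combination e1 - (-1 : ℂ) ^ n * vkt V 0 n * this - (-1 : ℂ) ^ n * (a - u n) * h3
  · intro h
    ext n
    have h1 := congrFun h n
    have h2 : a - u n = 0 := by
      have : (-1 : ℂ) ^ n ≠ 0 := zpow_ne_zero _ (by norm_num)
      exact (mul_eq_zero.1 h1).resolve_left this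
    rw [hf n, h2]
    simp

theorem sixteen_tail {g : ℤ → ℂ} {j : ℕ} (hg : GSum g (1 + j)) : ∃ D : ℝ, ∀ n : ℤ,
    ‖conv sixteenKer g n - halfSign n *
      (((n : ℂ) * (∑' m : ℤ, (m : ℂ) ^ 0 * g m) - (∑' m : ℤ, (m : ℂ) ^ 1 * g m)) / 16)‖ *
      (1 + |(n : ℝ)|) ^ j ≤ D := by
  have b1 : PolyBdd (fun N : ℕ => (N : ℂ) / 16) 1 := by simpa using polyBdd_div 1 16
  obtain ⟨C, hC, hf⟩ := b1
  obtain ⟨D, hD⟩ := norm_conv_sub_poly_le (q := fun k => (k : ℂ) / 16) (j := j) hC hf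
    (fun N => by simp) (fun N => by push_cast; ring) hg
  obtain ⟨C', hC'⟩ := exists_geometric_decay abs_rho_lt_one j
  obtain ⟨D', hD'⟩ := norm_conv_decay_le hC' (hg.mono (by omega))
  refine ⟨D + ‖(Real.sqrt 2 / 64 : ℂ)‖ * D', fun n => ?_⟩
  have h := fun k (hk : k ≤ 1) => (hg.summable_moment (hk.trans (by omega : 1 ≤ 1 + j))).hasSum
  have hs := (((h 0 (by norm_num)).mul_left (n : ℂ)).sub (h 1 le_rfl)).div_const 16
  have hsum : ((n : ℂ) * (∑' m : ℤ, (m : ℂ) ^ 0 * g m) - (∑' m : ℤ, (m : ℂ) ^ 1 * g m)) / 16 =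
      ∑' m : ℤ, ((n - m : ℤ) : ℂ) / 16 * g m := by
    rw [← hs.tsum_eq]
    refine tsum_congr fun m => ?_
    push_cast
    ring
  have hg1 := hg.mono (show 1 ≤ 1 + j by omega)
  have hsplit : conv sixteenKer g n = conv (fun N => (N : ℂ) / 16) g n -
      (Real.sqrt 2 / 64) * conv (fun N => (rho : ℂ) ^ N) g n := by
    have e : sixteenKer = fun N : ℕ => (N : ℂ) / 16 + -(Real.sqrt 2 / 64 : ℂ) * (rho : ℂ) ^ N := by
      funext N
      rw [sixteenKer_eq]
      ring
    rw [e, conv_add ⟨C, hC, hf⟩ ((polyBdd_rho 1).smul _) hg1, conv_mul_left]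
    ring
  rw [hsum, hsplit]
  have hDn := hD n
  have hDn' := mul_le_mul_of_nonneg_left (hD' n) (norm_nonneg (Real.sqrt 2 / 64 : ℂ))
  have e : ∀ A B S : ℂ, A - B - S = (A - S) - B := fun A B S => by ring
  rw [e]
  calc _ ≤ (‖conv (fun N => (N : ℂ) / 16) g n - halfSign n * ∑' m : ℤ, ((n - m : ℤ) : ℂ) / 16 * g m‖ +
        ‖(Real.sqrt 2 / 64 : ℂ) * conv (fun N => (rho : ℂ) ^ N) g n‖) * (1 + |(n : ℝ)|) ^ j := by
        gcongr
        exact norm_sub_le _ _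
    _ ≤ _ := by
      rw [add_mul, norm_mul, mul_assoc]
      exact add_le_add hDn hDn'

theorem eq_zero_of_sixteenRegular {V : ℤ → ℝ} (hw : WSum (vkt V 0) 1) (h : ¬ HasSolW V 16 (1 / 2))
    {f : L2} (hf : f ∈ perpKer (vkt V) 1 (Qt V * T0t V)) : f = 0 := by
  obtain ⟨hp, hT⟩ := mem_perpKer_iff.1 hf
  have hspan := mem_span_of_perp_starProjection_eq_zero (w := vkt V) (N := 1) (y := T0t V f) hT
  have hset : (fun k => toL2 (vkt V k)) '' Set.Iio 1 = {toL2 (vkt V 0)} := by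
    have : Set.Iio 1 = ({0} : Set ℕ) := by
      ext k
      simp
    rw [this, Set.image_singleton]
  rw [hset, Submodule.mem_span_singleton] at hspan
  obtain ⟨a, ha⟩ := hspan
  have hTn : ∀ n : ℤ, T0t V f n = a * vkt V 0 n := by
    intro n
    rw [← ha, lp.coeFn_smul, Pi.smul_apply, toL2_apply (memℓp_moment (vkt_eq V) hw (by norm_num))]
    simp
  obtain ⟨hsol, hz⟩ := sixteen_solves hw hTn
  by_contra hne
  refine h ⟨_, fun h0 => hne (hz h0), ?_, hsol⟩
  obtain ⟨D, hD⟩ := sixteen_tail (j := 0) (hw.gSum f)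
  have m0 := moment_eq_zero (vkt_eq V) hw (k := 0) (by norm_num) hp (by norm_num)
  simp only [m0] at hD
  set μ1 := ∑' m : ℤ, (m : ℂ) ^ 1 * (vkt V 0 m * f m)
  refine memW_of_growth (k := 0) (C := ‖a‖ + D + ‖μ1‖) (fun n => ?_) (by norm_num)
  have h1 := hD n
  set u := conv sixteenKer (fun m => vkt V 0 m * f m) n
  set P := ((n : ℂ) * 0 - μ1) / 16 with hP
  have hPn : ‖P‖ ≤ ‖μ1‖ := by
    have e : P = -(μ1 * (1 / 16)) := by rw [hP]; ring
    rw [e, norm_neg, norm_mul]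
    norm_num
    linarith [norm_nonneg μ1]
  rw [pow_zero, mul_one] at h1
  have e : a - u = a - halfSign n * P - (u - halfSign n * P) := by ring
  rw [norm_mul, norm_zpow, norm_neg, norm_one, one_zpow, one_mul, e, pow_zero, mul_one]
  have h2 := norm_sub_le (a - halfSign n * P) (u - halfSign n * P)
  have h3 := norm_sub_le a (halfSign n * P)
  rw [norm_halfSign_mul] at h3
  linarith

/-- With two vanishing moments the linear part of the tail is gone, so the convolution decays as
fast as the weights permit. -/
theorem sixteen_decay {V : ℤ → ℝ} {j : ℕ} (hw : WSum (vkt V 0) (1 + j)) {f : L2}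
    (hp : f ∈ perp (vkt V) 2) : ∃ D : ℝ, ∀ n : ℤ,
      ‖conv sixteenKer (fun m => vkt V 0 m * f m) n‖ * (1 + |(n : ℝ)|) ^ j ≤ D := by
  obtain ⟨D, hD⟩ := sixteen_tail (j := j) (hw.gSum f)
  have m0 := moment_eq_zero (vkt_eq V) hw (k := 0) (by omega) hp (by norm_num)
  have m1 := moment_eq_zero (vkt_eq V) hw (k := 1) (by omega) hp (by norm_num)
  refine ⟨D, fun n => ?_⟩
  have := hD n
  rw [m0, m1] at this
  simpa using this

theorem eq_zero_of_no_l2_solution_sixteen {V : ℤ → ℝ} (hw : WSum (vkt V 0) 2)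
    (h : ¬ HasSolL2 V 16) {f : L2} (hf : f ∈ perpKer (vkt V) 2 (T0t V)) : f = 0 := by
  obtain ⟨hp, hT⟩ := mem_perpKer_iff.1 hf
  have hTn : ∀ n : ℤ, T0t V f n = (0 : ℂ) * vkt V 0 n := by
    intro n
    have : T0t V f = 0 := hT
    rw [this]
    simp
  obtain ⟨hsol, hz⟩ := sixteen_solves (hw.mono (by norm_num)) hTn
  by_contra hne
  refine h ⟨_, fun h0 => hne (hz h0), ?_, hsol⟩
  obtain ⟨D, hD⟩ := sixteen_decay (j := 1) hw hp
  refine memℓp_of_decay (C := D) fun n => ?_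
  rw [norm_mul, norm_zpow, norm_neg, norm_one, one_zpow, one_mul, zero_sub, norm_neg]
  simpa using hD n

/-! ### Positivity on the eigenspace at `16` -/

theorem tsum_mul_conj_shift (x y : ℤ → ℂ) (k : ℤ) :
    ∑' n, y n * conj (x (n + k)) = ∑' n, y (n - k) * conj (x n) := by
  rw [← (Equiv.addRight k).tsum_eq (fun n => y (n - k) * conj (x n))]
  refine tsum_congr fun n => ?_
  simp

theorem tsum_lap_symm {x y : ℤ → ℂ} (h : ∀ k, Summable fun n => y n * conj (x (n + k))) :
    ∑' n, y n * conj (lap x n) = ∑' n, lap y n * conj (x n) := by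
  have h0 : Summable fun n => y n * conj (x n) := by simpa using h 0
  have hs : ∀ k, Summable fun n => y (n - k) * conj (x n) := by
    intro k
    refine ((Equiv.addRight k).summable_iff.1 ?_)
    refine (h k).congr fun n => ?_
    simp
  have e1 : ∀ n, y n * conj (lap x n) =
      y n * conj (x (n + 1)) + y n * conj (x (n + -1)) - 2 * (y n * conj (x n)) := by
    intro n
    rw [lap, map_sub, map_add, map_mul, Complex.conj_ofNat, ← sub_eq_add_neg]
    ring
  have e2 : ∀ n, lap y n * conj (x n) =
      y (n - 1) * conj (x n) + y (n - -1) * conj (x n) - 2 * (y n * conj (x n)) := by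
    intro n
    rw [lap, sub_neg_eq_add]
    ring
  simp only [e1, e2]
  rw [((h 1).add (h (-1))).tsum_sub (h0.mul_left 2), (h 1).tsum_add (h (-1)),
    ((hs 1).add (hs (-1))).tsum_sub (h0.mul_left 2), (hs 1).tsum_add (hs (-1)),
    tsum_mul_conj_shift, tsum_mul_conj_shift]

theorem summable_shift_of_decay {x y : ℤ → ℂ} {C D : ℝ} {p : ℕ}
    (hx : ∀ n : ℤ, ‖x n‖ * (1 + |(n : ℝ)|) ^ (p + 2) ≤ C)
    (hy : ∀ n : ℤ, ‖y n‖ ≤ D * (1 + |(n : ℝ)|) ^ p) (j k : ℤ) :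
    Summable fun n => y (n + j) * conj (x (n + k)) := by
  have hD : 0 ≤ D := by simpa using (norm_nonneg _).trans (hy 0)
  have hC : 0 ≤ C := le_trans (by positivity) (hx 0)
  have sh : ∀ n i : ℤ, 1 + |((n + i : ℤ) : ℝ)| ≤ (1 + |(i : ℝ)|) * (1 + |(n : ℝ)|) := by
    intro n i
    push_cast
    nlinarith [abs_add_le (n : ℝ) i, mul_nonneg (abs_nonneg (n : ℝ)) (abs_nonneg (i : ℝ))]
  refine summable_of_decay (C := D * (1 + |(j : ℝ)|) ^ p * ((1 + |(k : ℝ)|) ^ (p + 2) * C))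
    fun n => ?_
  have h1 : ‖y (n + j)‖ ≤ D * (1 + |(j : ℝ)|) ^ p * (1 + |(n : ℝ)|) ^ p := by
    refine (hy _).trans ?_
    rw [mul_assoc, ← mul_pow]
    gcongr
    exact sh n j
  have h2 : ‖x (n + k)‖ * (1 + |(n : ℝ)|) ^ (p + 2) ≤ (1 + |(k : ℝ)|) ^ (p + 2) * C := by
    have h3 : 1 + |(n : ℝ)| ≤ (1 + |(k : ℝ)|) * (1 + |((n + k : ℤ) : ℝ)|) := by
      have := sh (n + k) (-k)
      simpa using this
    calc ‖x (n + k)‖ * (1 + |(n : ℝ)|) ^ (p + 2)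
        ≤ ‖x (n + k)‖ * ((1 + |(k : ℝ)|) * (1 + |((n + k : ℤ) : ℝ)|)) ^ (p + 2) := by gcongr
      _ = (1 + |(k : ℝ)|) ^ (p + 2) * (‖x (n + k)‖ * (1 + |((n + k : ℤ) : ℝ)|) ^ (p + 2)) := by
        rw [mul_pow]; ring
      _ ≤ _ := by
        gcongr
        exact hx _
  rw [norm_mul, RCLike.norm_conj]
  calc ‖y (n + j)‖ * ‖x (n + k)‖ * (1 + |(n : ℝ)|) ^ 2
      ≤ (D * (1 + |(j : ℝ)|) ^ p * (1 + |(n : ℝ)|) ^ p) * ‖x (n + k)‖ * (1 + |(n : ℝ)|) ^ 2 := by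
        gcongr
    _ = D * (1 + |(j : ℝ)|) ^ p * (‖x (n + k)‖ * (1 + |(n : ℝ)|) ^ (p + 2)) := by
      rw [pow_add]; ring
    _ ≤ _ := by gcongr

/-- Summation by parts between a rapidly decaying and a polynomially growing sequence; summability
of all shifted products is all that is used. -/
theorem tsum_altOp_symm {x y : ℤ → ℂ}
    (h : ∀ j k, Summable fun n => y (n + j) * conj (x (n + k))) :
    ∑' n, y n * conj (altOp x n) = ∑' n, altOp y n * conj (x n) := by
  have h' : ∀ k, Summable fun n => y n * conj (x (n + k)) := fun k => by simpa using h 0 k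
  have hlapx : ∀ k, Summable fun n => y n * conj (lap x (n + k)) := by
    intro k
    refine (((h' (k + 1)).add (h' (k - 1))).sub ((h' k).mul_left 2)).congr fun n => ?_
    rw [lap, map_sub, map_add, map_mul, Complex.conj_ofNat, add_assoc n k 1, add_sub_assoc n k 1]
    ring
  have hlapy : ∀ k, Summable fun n => lap y n * conj (x (n + k)) := by
    intro k
    refine (((h 1 k).add (h (-1) k)).sub ((h' k).mul_left 2)).congr fun n => ?_
    rw [lap, ← sub_eq_add_neg]
    ring
  have hz : ∀ k, Summable fun n => y n * conj ((fun i => lap x i + 8 * x i) (n + k)) := by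
    intro k
    refine ((hlapx k).add ((h' k).mul_left 8)).congr fun n => ?_
    rw [map_add, map_mul, Complex.conj_ofNat]
    ring
  have hlxy : Summable fun n => lap y n * conj (lap x n) := by
    refine (((hlapy 1).add (hlapy (-1))).sub ((hlapy 0).mul_left 2)).congr fun n => ?_
    rw [add_zero, lap, lap, map_sub, map_add, map_mul, Complex.conj_ofNat, ← sub_eq_add_neg]
    ring
  have hly0 : Summable fun n => lap y n * conj (x n) := by simpa using hlapy 0
  have hlly : Summable fun n => lap (lap y) n * conj (x n) := by
    have e : ∀ j, Summable fun n => lap y (n + j) * conj (x n) := by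
      intro j
      refine (((h (j + 1) 0).add (h (j - 1) 0)).sub ((h j 0).mul_left 2)).congr fun n => ?_
      rw [lap, add_zero, add_assoc n j 1, add_sub_assoc n j 1]
      ring
    refine (((e 1).add (e (-1))).sub (hly0.mul_left 2)).congr fun n => ?_
    have h2 : lap (lap y) n = lap y (n + 1) + lap y (n + -1) - 2 * lap y n := rfl
    rw [h2]
    ring
  have e1 : ∑' n, y n * conj (altOp x n) = ∑' n, lap y n * conj (lap x n + 8 * x n) :=
    tsum_lap_symm hz
  have e2 : ∑' n, lap y n * conj (lap x n + 8 * x n) =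
      ∑' n, lap y n * conj (lap x n) + 8 * ∑' n, lap y n * conj (x n) := by
    rw [← tsum_mul_left, ← hlxy.tsum_add (hly0.mul_left 8)]
    refine tsum_congr fun n => ?_
    rw [map_add, map_mul, Complex.conj_ofNat]
    ring
  rw [e1, e2, tsum_lap_symm hlapy, ← tsum_mul_left, ← hlly.tsum_add (hly0.mul_left 8)]
  refine tsum_congr fun n => ?_
  simp only [altOp, lap]
  ring

/-- The kernel of the second-order coefficient at `16`. -/
def sixteenKerTwo (N : ℕ) : ℂ :=
  (N - 4 * (N : ℂ) ^ 3) / 24 - (1 / 16) * ((rho : ℂ) ^ N * (N + Real.sqrt 2 / 4))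

theorem altChain_one_zero (N : ℕ) :
    altChain 1 N 0 = (rho : ℂ) ^ N * (N + Real.sqrt 2 / 4) := by
  have h2 : Real.sqrt (1 - (-1) * (1 - 0) ^ 2) = Real.sqrt 2 := by norm_num
  have e : (rho : ℂ) = (-1) * ((Real.sqrt 2 : ℂ) + -1 * ((1 - 0 : ℝ) : ℂ)) ^ 2 := by
    rw [rho_cast]
    push_cast
    linear_combination sqrt_two_sq'
  simp only [altChain, hChain, h2]
  rw [e, mul_pow, ← pow_mul]
  have h3 : (Real.sqrt 2 : ℂ) ^ 3 = 2 * Real.sqrt 2 := by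
    rw [pow_succ, sqrt_two_sq']
  rw [sqrt_two_sq', h3]
  push_cast
  have h4 := inv_sqrt_two
  rw [div_eq_mul_inv (_ * _) (2 * (Real.sqrt 2 : ℂ)), mul_inv, h4]
  ring

theorem polyBdd_sixteenKerTwo : PolyBdd sixteenKerTwo 3 := by
  have b1 : PolyBdd (fun N : ℕ => (N : ℂ)) 3 := by
    simpa using (polyBdd_pow 1).mono (show 1 ≤ 3 by norm_num)
  have b3 := (polyBdd_altChain 1).mono (show 1 ≤ 3 by norm_num)
  refine Eq.subst (motive := fun f => PolyBdd f 3) ?_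
    (((b1.sub ((polyBdd_pow 3).smul 4)).smul (1 / 24)).sub (b3.smul (1 / 16)))
  funext N
  rw [sixteenKerTwo, altChain_one_zero]
  simp only [Nat.factorial]
  push_cast
  ring

/-- The constant -6 is the s² coefficient of y³ = (1 - 2s²)³. The sign enters only through σi·(-σi)
= 1, so this operator is the same for both boundary values. -/
theorem sixteenCoeff_two_apply {V : ℤ → ℝ} (σ : ℤˣ) (hw : WSum (vkt V 0) 3) (f : L2) (n : ℤ) :
    sixteenCoeff V σ 2 f n = -6 * (signV V n * f n) +
      vkt V 0 n * conv sixteenKerTwo (fun m => vkt V 0 m * f m) n := by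
  have b0 : PolyBdd (fun N => hChain 1 (sI (-σ)) 3 (2 * N) 0 / ((Nat.factorial 3 : ℕ) : ℂ)) 3 :=
    polyBdd_coeff (polyChain_sI_double (-σ)) (by norm_num) 3
  have b3 := (polyBdd_altChain 1).mono (show 1 ≤ 3 by norm_num)
  have e : sixteenCoeff V σ 2 = (-6 : ℂ) • UOp V + convOp (vkt V 0) sixteenKerTwo := by
    have ek : sixteenKerTwo = fun N =>
        (sI σ / 64) * (hChain 1 (sI (-σ)) 3 (2 * N) 0 / ((Nat.factorial 3 : ℕ) : ℂ)) -
          (1 / 16) * (altChain 1 N 0 / ((Nat.factorial 1 : ℕ) : ℂ)) := by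
      funext N
      rw [sixteenKerTwo, altChain_one_zero, hChain_add_two_zero, hChain_one_zero, sI_neg]
      push_cast [Nat.factorial]
      linear_combination ((N : ℂ) - 4 * N ^ 3) / 24 * sI_sq σ
    rw [ek, convOp_sub hw (b0.smul _) (b3.smul _), convOp_smul hw _ b0, convOp_smul hw _ b3,
      sixteenCoeff, show ((2 : ℤ) + 1).toNat = 3 from rfl, if_pos (by decide),
      show ((2 : ℤ) / 2).toNat = 1 from rfl, sixteenOsc, sixteenSmooth, ← coe_smul_op]
    norm_num [Nat.choose]
    module
  rw [e, add_apply, lp.coeFn_add, Pi.add_apply, convOp_apply hw polyBdd_sixteenKerTwo]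
  rfl

/-- This is the s² term of (Δ² - 16y⁴)(y³R₀) = y³ at y = 1 - 2s²: 16 - 16y⁴ contributes 128 times
the zeroth kernel, and y³ contributes -6. -/
theorem altOp_conv_sixteenKerTwo {g : ℤ → ℂ} (hg : GSum g 3) (n : ℤ) :
    altOp (conv sixteenKerTwo g) n = -128 * conv sixteenKer g n - 6 * g n := by
  have b1 : PolyBdd (fun N : ℕ => (N : ℂ)) 3 := by
    simpa using (polyBdd_pow 1).mono (show 1 ≤ 3 by norm_num)
  have br : PolyBdd (fun N : ℕ => -(2 * (N : ℂ) + 4 * (N : ℂ) ^ 3) / 3 -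
      (Real.sqrt 2 / 4) * (rho : ℂ) ^ N) 3 := by
    refine Eq.subst (motive := fun f => PolyBdd f 3) ?_
      ((((b1.smul 2).add ((polyBdd_pow 3).smul 4)).smul (-1 / 3)).sub
        ((polyBdd_rho 3).smul (Real.sqrt 2 / 4)))
    funext N
    ring
  have hr2 := sqrt_two_sq'
  have e := lap_add_conv polyBdd_sixteenKerTwo br hg
    (by
      simp only [sixteenKerTwo, rho_cast]
      push_cast
      linear_combination (-1 / 16 : ℂ) * hr2)
    (fun N => by
      have hp : (rho : ℂ) ^ N = -6 * (rho : ℂ) ^ (N + 1) - (rho : ℂ) ^ (N + 2) := by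
        rw [rho_pow_add_two]; ring
      have hq : (rho : ℂ) ^ (N + 2) = (2 * (Real.sqrt 2 : ℂ) - 3) * (rho : ℂ) ^ (N + 1) := by
        rw [pow_succ _ (N + 1), ← rho_cast]; ring
      simp only [sixteenKerTwo]
      rw [hp, hq]
      push_cast
      ring)
  have bK := polyBdd_sixteenKer.mono (show 1 ≤ 3 by norm_num)
  have bd : PolyBdd (fun N : ℕ => if N = 0 then (1 : ℂ) else 0) 3 := by
    refine PolyBdd.mono (p := 0) ⟨1, zero_le_one, fun N => ?_⟩ (Nat.zero_le 3)
    beta_reduce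
    split_ifs <;> simp
  rw [altOp, e, lap_conv (r := fun N => -128 * sixteenKer N + -6 * if N = 0 then 1 else 0) br hg
    (by
      simp only [sixteenKer_eq, rho_cast]
      push_cast
      norm_num
      linear_combination (-1 : ℂ) * hr2)
    (fun N => by
      simp only [sixteenKer_eq, rho_pow_add_two]
      rw [if_neg (by omega)]
      push_cast
      ring),
    conv_add (bK.smul _) (bd.smul _) hg, conv_mul_left, conv_mul_left, conv_delta]
  ring

/-- For f in the range of S̃₁ put g = ṽf and u = G̃₀g, so that Uf = -ṽu. With P = Δ(Δ + 8) one has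
Pu = g and Pψ = -128u - 6g, so summation by parts turns the quadratic form into -128‖u‖². Its
vanishing gives u = 0 and hence f = 0. -/
theorem sixteen_positivity {V : ℤ → ℝ} (σ : ℤˣ) (hw : WSum (vkt V 0) 6) :
    ∀ f ∈ perpKer (vkt V) 2 (T0t V), ⟪f, sixteenCoeff V σ 2 f⟫_ℂ = 0 → f = 0 := by
  intro f hf hin
  obtain ⟨hp, hT⟩ := mem_perpKer_iff.1 hf
  set g : ℤ → ℂ := fun m => vkt V 0 m * f m with hg
  set u := conv sixteenKer g with hu
  set ψ := conv sixteenKerTwo g with hψ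
  have hgs : GSum g 6 := hw.gSum f
  have hUf : ∀ n, signV V n * f n = -(vkt V 0 n * u n) := by
    intro n
    have h := T0t_apply (hw.mono (by norm_num)) f n
    have h0 : T0t V f = 0 := hT
    rw [h0] at h
    have h1 : (0 : ℂ) = signV V n * f n + vkt V 0 n * u n := h
    linear_combination -h1
  -- ψ may grow like |n|³, so u must decay with two powers more, 5 = 3 + 2, for the shifted products
  -- to be summable.
  obtain ⟨C, hC⟩ := sixteen_decay (j := 5) hw hp
  obtain ⟨D, hD⟩ := norm_conv_le polyBdd_sixteenKerTwo (hgs.mono (show 3 ≤ 6 by norm_num))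
  have hS := summable_shift_of_decay (x := u) (y := ψ) (p := 3) hC hD
  have hparts := tsum_altOp_symm hS
  have ha1 : ∀ n, altOp u n = g n := altOp_conv_sixteenKer (hgs.mono (by norm_num))
  have ha2 : ∀ n, altOp ψ n = -128 * u n - 6 * g n :=
    altOp_conv_sixteenKerTwo (hgs.mono (by norm_num))
  simp only [ha1, ha2] at hparts
  have hss : ∀ n, conj (signV V n) = signV V n := by
    intro k
    unfold signV
    split <;> simp
  have hcg : ∀ n, conj (g n) = vkt V 0 n * conj (f n) := by
    intro n
    rw [hg, map_mul, Complex.conj_ofReal]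
  have hreal : ∀ n, u n * conj (g n) = g n * conj (u n) := by
    intro n
    have h1 := hUf n
    have h2 := congrArg conj (hUf n)
    rw [map_mul, map_neg, map_mul, Complex.conj_ofReal, hss] at h2
    rw [hcg, hg]
    linear_combination (conj (f n)) * h1 - f n * h2
  have hu2 : Summable fun n => u n * conj (u n) := by
    have hu0 : ∀ n, ‖u n‖ ≤ C * (1 + |(n : ℝ)|) ^ 0 := by
      intro n
      rw [pow_zero, mul_one]
      refine le_trans ?_ (hC n)
      refine le_mul_of_one_le_right (norm_nonneg _) (one_le_pow₀ ?_)
      linarith [abs_nonneg (n : ℝ)]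
    have hu2' : ∀ n : ℤ, ‖u n‖ * (1 + |(n : ℝ)|) ^ (0 + 2) ≤ C := by
      intro n
      refine le_trans ?_ (hC n)
      gcongr
      · linarith [abs_nonneg (n : ℝ)]
      · norm_num
    simpa using summable_shift_of_decay (x := u) (y := u) (p := 0) hu2' hu0 0 0
  have hug : Summable fun n => u n * conj (g n) := by
    have h1 : Summable fun n => (f n : ℂ) * conj (f n) := by
      refine Summable.of_norm ?_
      refine (l2_summable f).congr fun n => ?_
      rw [norm_mul, RCLike.norm_conj, sq]
    refine Summable.of_norm (h1.norm.congr fun n => ?_)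
    have e : u n * conj (g n) = -(signV V n * (f n * conj (f n))) := by
      rw [hcg]
      linear_combination (conj (f n)) * hUf n
    rw [e, norm_neg, norm_signV_mul]
  -- g is the five-point stencil of P applied to u, so the sum splits into shifted products of ψ and
  -- u.
  have hψg : Summable fun n => ψ n * conj (g n) := by
    have e : ∀ n, u (n + 2) + u (n + -2) + 4 * u (n + 1) + 4 * u (n + -1) - 10 * u (n + 0) = g n := by
      intro n
      rw [← ha1 n]
      simp only [altOp, lap, add_zero]
      rw [show n + 1 + 1 = n + 2 by ring, show n + 1 - 1 = n by ring, show n - 1 + 1 = n by ring,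
        show n - 1 - 1 = n + -2 by ring, show n + -1 = n - 1 by ring]
      ring
    refine ((((hS 0 2).add (hS 0 (-2))).add ((hS 0 1).mul_left 4)).add
      ((hS 0 (-1)).mul_left 4) |>.sub ((hS 0 0).mul_left 10)).congr fun n => ?_
    rw [← e n]
    simp only [map_sub, map_add, map_mul, Complex.conj_ofNat, add_zero]
    ring
  have hsum := lp.hasSum_inner (𝕜 := ℂ) f (sixteenCoeff V σ 2 f)
  rw [hin] at hsum
  have hterm : ∀ n, ⟪f n, sixteenCoeff V σ 2 f n⟫_ℂ = 6 * (u n * conj (g n)) + ψ n * conj (g n) := by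
    intro n
    rw [RCLike.inner_apply, sixteenCoeff_two_apply σ (hw.mono (by norm_num)), hUf n, hcg]
    ring
  have h0 : 6 * ∑' n, u n * conj (g n) + ∑' n, ψ n * conj (g n) = 0 := by
    rw [← tsum_mul_left, ← (hug.mul_left 6).tsum_add hψg, ← hsum.tsum_eq]
    exact tsum_congr fun n => (hterm n).symm
  have hgu : Summable fun n => g n * conj (u n) := hug.congr hreal
  have h1 : ∑' n, (-128 * u n - 6 * g n) * conj (u n) =
      -128 * ∑' n, u n * conj (u n) - 6 * ∑' n, u n * conj (g n) := by
    rw [← tsum_mul_left, ← tsum_mul_left, ← (hu2.mul_left (-128)).tsum_sub (hug.mul_left 6)]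
    refine tsum_congr fun n => ?_
    rw [hreal]
    ring
  -- The terms ±6∑ u ḡ cancel and only -128∑ |u|² remains.
  rw [hparts, h1] at h0
  have h2 : ∑' n, u n * conj (u n) = 0 := by linear_combination (-1 / 128 : ℂ) * h0
  have h3 : ∑' n, ‖u n‖ ^ 2 = 0 := by
    have e : ∀ n, u n * conj (u n) = ((‖u n‖ ^ 2 : ℝ) : ℂ) := fun n => by
      rw [Complex.mul_conj, Complex.normSq_eq_norm_sq]
    simp only [e] at h2
    rw [← Complex.ofReal_tsum] at h2
    exact_mod_cast h2
  have hsn : Summable fun n => ‖u n‖ ^ 2 := by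
    refine hu2.norm.congr fun n => ?_
    rw [norm_mul, RCLike.norm_conj, sq]
  have hu0 : ∀ n, u n = 0 := by
    intro n
    have h4 := (hasSum_zero_iff_of_nonneg (fun n => sq_nonneg ‖u n‖)).1 (h3 ▸ hsn.hasSum)
    have h5 := congrFun h4 n
    simpa using h5
  ext n
  have h6 := hUf n
  rw [hu0 n, mul_zero, neg_zero] at h6
  have h7 := norm_signV_mul V n (f n)
  rw [h6, norm_zero] at h7
  simpa using norm_eq_zero.1 h7.symm

/-! ### The shape of the coefficients -/

section Shape

section Normed

variable {R : Type*} [NormedRing R] [NormedAlgebra ℝ R] {ι : Type*}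

/-- The sums `∑ p_k A_{kl} p_l` over the pairs `(k, l)` in `S`. -/
def shape (p : ι → R) (S : Finset (ι × ι)) : Submodule ℝ R where
  carrier := {x | ∃ A : ι × ι → R, x = ∑ kl ∈ S, p kl.1 * A kl * p kl.2}
  add_mem' := by
    rintro _ _ ⟨A, rfl⟩ ⟨B, rfl⟩
    exact ⟨A + B, by simp [mul_add, add_mul, Finset.sum_add_distrib]⟩
  zero_mem' := ⟨0, by simp⟩
  smul_mem' := by
    rintro r _ ⟨A, rfl⟩
    exact ⟨r • A, by simp [Finset.smul_sum]⟩

theorem mul_mul_mem_shape [DecidableEq ι] (p : ι → R) {S : Finset (ι × ι)} {kl : ι × ι}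
    (h : kl ∈ S) (A : R) : p kl.1 * A * p kl.2 ∈ shape p S := by
  refine ⟨Pi.single kl A, ?_⟩
  rw [Finset.sum_eq_single_of_mem kl h]
  · simp
  · intro b _ hb
    simp [Pi.single_eq_of_ne hb]

/-- Blocks with d_i + d_j > 2e carry a coefficient of negative index and vanish. Any other block
(i,j) is absorbed by a term p_k A p_l with k ≤ i and l ≤ j, because the projections p are nested.
The shape thus becomes a finite check on degrees. -/
theorem gradedCoeff_mem_shape [Fintype ι] [DecidableEq ι] [LinearOrder ι] {X p : ι → R}
    (hp : ∀ k i, k ≤ i → p k * X i = X i ∧ X i * p k = X i) {b : ι} (hb : ∀ i, b < i → X i = 0)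
    {d : ι → ℤ} {c : ℤ → R} (hc : ∀ m < 0, c m = 0) {e : ℤ} {S : Finset (ι × ι)}
    (h : ∀ i j, i ≤ b → j ≤ b → d i + d j ≤ 2 * e →
      (∃ kl ∈ S, kl.1 ≤ i ∧ kl.2 ≤ j) ∨ X i * c (2 * e - d i - d j) * X j = 0) :
    gradedCoeff X d c e ∈ shape p S := by
  refine Submodule.sum_mem _ fun i _ => Submodule.sum_mem _ fun j _ => ?_
  by_cases hi : i ≤ b
  swap
  · simp [hb i (not_le.1 hi)]
  by_cases hj : j ≤ b
  swap
  · simp [hb j (not_le.1 hj)]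
  by_cases hd : d i + d j ≤ 2 * e
  swap
  · simp [hc (2 * e - d i - d j) (by omega)]
  rcases h i j hi hj hd with ⟨kl, hkl, h1, h2⟩ | h0
  · have := mul_mul_mem_shape p hkl (X i * c (2 * e - d i - d j) * X j)
    rw [← (hp _ _ h1).1, ← (hp _ _ h2).2]
    simpa only [mul_assoc] using this
  · rw [h0]
    exact Submodule.zero_mem _

end Normed

variable {R : Type*} [NormedRing R] {ι : Type*}

theorem gradedCoeff_eq_single [Fintype ι] {X : ι → R} {d : ι → ℤ} {c : ℤ → R}
    (hc : ∀ m < 0, c m = 0) {e : ℤ} (k : ι)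
    (h : ∀ i j, (i = k ∧ j = k) ∨ X i = 0 ∨ X j = 0 ∨ 2 * e < d i + d j) :
    gradedCoeff X d c e = X k * c (2 * e - d k - d k) * X k := by
  have h0 : ∀ i j, ¬(i = k ∧ j = k) → X i * c (2 * e - d i - d j) * X j = 0 := by
    intro i j hij
    rcases h i j with h | h | h | h
    · exact absurd h hij
    · simp [h]
    · simp [h]
    · simp [hc _ (show 2 * e - d i - d j < 0 by omega)]
  rw [gradedCoeff, Finset.sum_eq_single k, Finset.sum_eq_single k]
  · exact fun j _ hj => h0 k j fun h => hj h.2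
  · simp
  · exact fun i _ hi => Finset.sum_eq_zero fun j _ => h0 i j fun h => hi h.1
  · simp

variable [Fintype ι] [DecidableEq ι]

/-- If block k does not couple to the others at leading order, its row of L reduces to the diagonal
entry. -/
theorem mul_leading {X : ι → R} (hX : ∀ i j, X i * X j = if i = j then X i else 0)
    {d : ι → ℤ} {Mc : ℤ → R} {k : ι}
    (h : ∀ j, j ≠ k → Even (d k + d j) → X k * Mc (-(d k + d j) / 2) * X j = 0) :
    X k * leading X d Mc = X k * Mc (-d k) * X k := by
  simp only [leading, Finset.mul_sum]
  rw [Finset.sum_eq_single k, Finset.sum_eq_single k]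
  · rw [if_pos (by simp), ← mul_assoc, ← mul_assoc, hX, if_pos rfl]
    congr 3
    omega
  · intro j _ hj
    split_ifs with he
    · rw [h j hj he, mul_zero]
    · exact mul_zero _
  · simp
  · intro i _ hi
    refine Finset.sum_eq_zero fun j _ => ?_
    split_ifs
    · rw [← mul_assoc, ← mul_assoc, hX, if_neg hi.symm, zero_mul, zero_mul]
    · exact mul_zero _
  · simp

theorem leading_mul {X : ι → R} (hX : ∀ i j, X i * X j = if i = j then X i else 0)
    {d : ι → ℤ} {Mc : ℤ → R} {k : ι}
    (h : ∀ j, j ≠ k → Even (d k + d j) → X j * Mc (-(d k + d j) / 2) * X k = 0) :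
    leading X d Mc * X k = X k * Mc (-d k) * X k := by
  simp only [leading, Finset.sum_mul]
  rw [Finset.sum_eq_single k, Finset.sum_eq_single k]
  · rw [if_pos (by simp), mul_assoc, mul_assoc, hX, if_pos rfl, ← mul_assoc]
    congr 3
    omega
  · intro j _ hj
    split_ifs
    · rw [mul_assoc, hX, if_neg hj, mul_zero]
    · exact zero_mul _
  · simp
  · intro i _ hi
    refine Finset.sum_eq_zero fun j _ => ?_
    split_ifs with he
    · rw [mul_assoc, hX]
      split_ifs with hj
      · subst hj
        rw [add_comm] at he ⊢
        exact h i hi he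
      · exact mul_zero _
    · exact zero_mul _
  · simp

theorem inverse_mul_eq {L L' X : R} (hL : IsUnit L) (hL' : IsUnit L') (h : L * X = X * L') :
    Ring.inverse L * X = X * Ring.inverse L' := by
  calc Ring.inverse L * X = Ring.inverse L * (X * L') * Ring.inverse L' := by
        rw [mul_assoc, mul_assoc, Ring.mul_inverse_cancel _ hL', mul_one]
    _ = X * Ring.inverse L' := by
        rw [← h, ← mul_assoc, Ring.inverse_mul_cancel _ hL, one_mul]

/-- Two leading coefficients that decouple the same block and agree on it have the same inverse
there; applied to the two signs this gives sign-independent coefficients. -/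
theorem compress_inverse_eq {L L' X : R} (hL : IsUnit L) (hL' : IsUnit L')
    (h : L * X = X * L') (h' : L' * X = X * L') :
    X * Ring.inverse L * X = X * Ring.inverse L' * X := by
  rw [mul_assoc, inverse_mul_eq hL hL' h, mul_assoc, inverse_mul_eq hL' hL' h']

end Shape

/-! ### From remainders to expansions of the inverse -/

/-- The conclusion holds for all small μ₀, so that several expansions can share one interval. -/
theorem eventually_inverseExpansion {N E : ℝ → Op} {ℓ : ℕ}
    (hu : ∀ᶠ μ in 𝓝[>] (0 : ℝ), IsUnit (N μ)) (h : Rem ℓ (fun μ => Ring.inverse (N μ) - E μ)) :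
    ∀ᶠ μ₀ in 𝓝[>] (0 : ℝ), InverseExpansion μ₀ N E ℓ := by
  obtain ⟨C, hC⟩ := h
  obtain ⟨ε, hε, hsub⟩ := mem_nhdsGT_iff_exists_Ioo_subset.1 (hu.and hC)
  filter_upwards [eventually_lt hε] with μ₀ hμ₀
  refine ⟨fun μ => Ring.inverse (N μ) - E μ, deriv fun μ => Ring.inverse (N μ) - E μ, 2 * C, fun μ hμ => ?_⟩
  obtain ⟨h1, h2, h3, h4⟩ := hsub ⟨hμ.1, hμ.2.trans hμ₀⟩
  refine ⟨h1, (add_sub_cancel (E μ) _).symm, h2.hasDerivAt, ?_⟩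
  rw [zpow_natCast] at h3 h4
  linarith

/-- The projections at `0`, from the coarsest to the finest. -/
def zeroProj (V : ℤ → ℝ) : Fin 5 → Op := ![1, Q V, S0 V, S1 V, S2 V]

theorem zeroProj_mul (V : ℤ → ℝ) (k i : Fin 5) (h : k ≤ i) :
    zeroProj V k * zeroBlock V i = zeroBlock V i ∧ zeroBlock V i * zeroProj V k = zeroBlock V i := by
  fin_cases i <;> fin_cases k <;> first
    | exact absurd h (by decide)
    | simp [zeroProj, zeroBlock, mul_sub, sub_mul, Q_mul_Q, S0_mul_S0, S1_mul_S1, S2_mul_S2,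
      Q_mul_S0, S0_mul_Q, S0_mul_S1, S1_mul_S0, S1_mul_S2, S2_mul_S1, Q_mul_S1, S1_mul_Q, S0_mul_S2,
      S2_mul_S0, Q_mul_S2, S2_mul_Q]

/-- The projections at `16`, from the coarsest to the finest. -/
def sixteenProj (V : ℤ → ℝ) : Fin 4 → Op := ![1, Qt V, S0t V, S1t V]

theorem sixteenProj_mul (V : ℤ → ℝ) (k i : Fin 4) (h : k ≤ i) :
    sixteenProj V k * sixteenBlock V i = sixteenBlock V i ∧
      sixteenBlock V i * sixteenProj V k = sixteenBlock V i := by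
  fin_cases i <;> fin_cases k <;> first
    | exact absurd h (by decide)
    | simp [sixteenProj, sixteenBlock, mul_sub, sub_mul, Qt_mul_Qt, S0t_mul_S0t, S1t_mul_S1t,
      Qt_mul_S0t, S0t_mul_Qt, S0t_mul_S1t, S1t_mul_S0t, Qt_mul_S1t, S1t_mul_Qt]

/-- With t = √(μ/2), so μ = 2t², scaling on both sides of M and again on both sides of the inverse
loses 2δ orders in y. Hence K = 4 + 2δ terms of M are needed for a remainder μ⁴; the factor (1/2)^e
converts y^e into μ^e. -/
theorem zero_inverse_expansion {V : ℤ → ℝ} (σ : ℤˣ) {K δ : ℕ} (hK : K = 4 + 2 * δ)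
    (hw : WSum (vk V 0) (K + 3)) (hδ : ∀ i, zeroBlock V i = 0 ∨ -(δ : ℤ) ≤ zeroDeg i)
    (hL : IsUnit (leading (zeroBlock V) zeroDeg (zeroCoeff V σ))) :
    ∃ c : ℤ → Op, (∀ m < 0, c m = 0) ∧
      c 0 = Ring.inverse (leading (zeroBlock V) zeroDeg (zeroCoeff V σ)) ∧
      (∀ᶠ μ in 𝓝[>] (0 : ℝ), IsUnit (M V σ μ)) ∧
      Rem 4 (fun μ => Ring.inverse (M V σ μ) - ∑ e ∈ Finset.Ico (-(δ : ℤ)) 4,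
        μ ^ e • ((1 / 2 : ℝ) ^ e • gradedCoeff (zeroBlock V) zeroDeg c e)) := by
  have hM : Rem (2 * (K : ℤ)) (fun t => M V σ (2 * t ^ 2) -
      ∑ l ∈ Finset.Ico (-3) (K : ℤ), t ^ (2 * l) • zeroCoeff V σ l) := by
    refine (zero_expansion σ hw (by omega)).comp_sq.congr (Eventually.of_forall fun t => ?_)
    simp only [zpow_mul]
    norm_cast
  obtain ⟨c, hc, hc0, hu, hr⟩ := graded_inverse (zeroBlock_mul V) (zeroBlock_sum V) hM
    (zeroBlock_vanish σ (hw.mono (by omega))) (by decide) hδ (k := 7 + 2 * δ)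
    (by subst hK; push_cast; ring) hL (ρ := fun _ => 1)
    ((ExpLead.const _ (by rw [mul_one, one_mul])).congr
      (Eventually.of_forall fun _ => (one_smul ℝ _).symm))
  have hlim : Tendsto (fun μ : ℝ => Real.sqrt (1 / 2 * μ)) (𝓝[>] 0) (𝓝[>] 0) :=
    tendsto_sqrt_nhdsGT.comp (tendsto_const_mul_nhdsGT (by norm_num))
  have hsq : ∀ μ : ℝ, 0 < μ → 2 * Real.sqrt (1 / 2 * μ) ^ 2 = μ := by
    intro μ hμ
    rw [Real.sq_sqrt (by positivity)]
    ring
  refine ⟨c, hc, hc0, ?_, ?_⟩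
  · filter_upwards [hlim.eventually hu, eventually_pos] with μ h hμ
    rwa [hsq μ hμ] at h
  · have e1 : 2 * (K : ℤ) - 4 * δ = 2 * 4 := by subst hK; push_cast; ring
    have e2 : (K : ℤ) - 2 * δ = 4 := by subst hK; push_cast; ring
    rw [e1, e2] at hr
    have hr : Rem (2 * 4) (fun t : ℝ => (1 : ℝ) • Ring.inverse (M V σ (2 * t ^ 2)) -
        ∑ e ∈ Finset.Ico (-(δ : ℤ)) 4, t ^ (2 * e) • gradedCoeff (zeroBlock V) zeroDeg c e) := hr
    refine (hr.comp_sqrt.comp_mul (c := 1 / 2) (by norm_num)).congr ?_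
    filter_upwards [eventually_pos] with μ hμ
    rw [hsq μ hμ, one_smul]
    congr 1
    refine Finset.sum_congr rfl fun e _ => ?_
    rw [smul_smul, mul_comm, ← mul_zpow, zpow_mul]
    norm_cast
    rw [Real.sq_sqrt (by positivity)]

/-- The scalar y³ with y = 1 - 2t⁴ involves only even powers of t, so it respects the parity. -/
theorem expLead_cube {R : Type*} [NormedRing R] [NormedAlgebra ℝ R] (J : R) (k : ℕ) :
    ExpLead J k 1 (fun t => ((1 - 2 * (t ^ 2) ^ 2) ^ 3 : ℝ) • (1 : R)) := by
  have h1 : ExpLead J k 1 (fun t => (1 - 2 * (t ^ 2) ^ 2 : ℝ) • (1 : R)) := by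
    have := (ExpLead.const (J := J) (c := 1) k (by simp)).add
      (ExpLead.zpow_smul (J := J) (c := (-2 : ℝ) • (1 : R)) k (j := 4) (by norm_num)
        (by norm_num [zpow_ofNat]))
    rw [add_zero] at this
    refine this.congr (Eventually.of_forall fun t => ?_)
    change 1 + t ^ (4 : ℤ) • (-2 : ℝ) • (1 : R) = (1 - 2 * (t ^ 2) ^ 2 : ℝ) • (1 : R)
    rw [smul_smul, sub_smul, one_smul, sub_eq_add_neg, ← neg_smul]
    congr 2
    norm_cast
    push_cast
    ring
  have h3 := (h1.mul h1).mul h1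
  rw [one_mul, one_mul] at h3
  refine h3.congr (Eventually.of_forall fun t => ?_)
  simp only [smul_mul_assoc, one_mul, smul_smul]
  congr 1
  ring

theorem inverse_smul_op {r : ℝ} (hr : r ≠ 0) (A : Op) :
    r • Ring.inverse (r • A) = Ring.inverse A ∧ (IsUnit (r • A) → IsUnit A) := by
  have key : IsUnit (r • A) ↔ IsUnit A := by
    have := isUnit_smul_iff (Units.mk0 r hr) A
    simpa [Units.smul_def] using this
  refine ⟨?_, key.1⟩
  by_cases hA : IsUnit A
  · obtain ⟨u, rfl⟩ := hA
    have h1 : r • Ring.inverse (r • (u : Op)) * u = 1 := by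
      have := Ring.inverse_mul_cancel _ (key.2 u.isUnit)
      rwa [mul_smul_comm, ← smul_mul_assoc] at this
    rw [Ring.inverse_unit]
    exact Units.eq_inv_of_mul_eq_one_right h1
  · rw [Ring.inverse_non_unit _ hA, Ring.inverse_non_unit _ (fun h => hA (key.1 h)), smul_zero]

/-- Here t² = s = √μ/2 and 2y = 2 - μ, so integer powers of s become powers of √μ. The remainder
order 2(2κ) - 4δ = 4 in t is order one in μ. -/
theorem sixteen_inverse_expansion {V : ℤ → ℝ} (σ : ℤˣ) {κ δ : ℕ} (hκ : κ = 1 + δ) (hκ4 : κ ≤ 4)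
    (hw : WSum (vkt V 0) (2 * κ + 1))
    (hδ : ∀ i, sixteenBlock V i = 0 ∨ -(δ : ℤ) ≤ sixteenDeg i)
    (hL : IsUnit (leading (sixteenBlock V) sixteenDeg (sixteenCoeff V σ))) :
    ∃ c : ℤ → Op, (∀ m < 0, c m = 0) ∧
      c 0 = Ring.inverse (leading (sixteenBlock V) sixteenDeg (sixteenCoeff V σ)) ∧
      (∀ᶠ μ in 𝓝[>] (0 : ℝ), IsUnit (M V σ (2 - μ))) ∧
      Rem 1 (fun μ => Ring.inverse (M V σ (2 - μ)) - ∑ e ∈ Finset.Ico (-(δ : ℤ)) 2,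
        Real.sqrt μ ^ e • ((1 / 2 : ℝ) ^ e • gradedCoeff (sixteenBlock V) sixteenDeg c e)) := by
  have hM : Rem (2 * (2 * (κ : ℤ))) (fun t => (1 - 2 * (t ^ 2) ^ 2) ^ 3 • M V σ (2 - 4 * (t ^ 2) ^ 2) -
      ∑ l ∈ Finset.Ico (-1) (2 * (κ : ℤ)), t ^ (2 * l) • sixteenCoeff V σ l) := by
    refine (sixteen_expansion σ hw (by omega) hκ4).comp_sq.congr (Eventually.of_forall fun t => ?_)
    simp only [zpow_mul]
    norm_cast
  obtain ⟨c, hc, hc0, hu, hr⟩ := graded_inverse (sixteenBlock_mul V) (sixteenBlock_sum V) hM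
    (sixteenBlock_vanish σ (hw.mono (by omega))) (by decide) hδ (k := 3 + 2 * δ)
    (by subst hκ; push_cast; ring) hL (expLead_cube _ _)
  have hlim : Tendsto (fun μ : ℝ => Real.sqrt (1 / 2 * Real.sqrt μ)) (𝓝[>] 0) (𝓝[>] 0) :=
    tendsto_sqrt_nhdsGT.comp ((tendsto_const_mul_nhdsGT (by norm_num)).comp tendsto_sqrt_nhdsGT)
  have hsq : ∀ μ : ℝ, 0 < μ → Real.sqrt (1 / 2 * Real.sqrt μ) ^ 2 = 1 / 2 * Real.sqrt μ :=
    fun μ hμ => Real.sq_sqrt (by positivity)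
  have hsq2 : ∀ μ : ℝ, 0 < μ → (1 / 2 * Real.sqrt μ) ^ 2 = μ / 4 := by
    intro μ hμ
    rw [mul_pow, Real.sq_sqrt hμ.le]
    ring
  refine ⟨c, hc, hc0, ?_, ?_⟩
  · filter_upwards [hlim.eventually hu, eventually_pos, eventually_lt one_pos] with μ h hμ h1
    rw [hsq μ hμ, hsq2 μ hμ] at h
    have := (inverse_smul_op (pow_ne_zero 3 (by linarith : (1 - 2 * (μ / 4) : ℝ) ≠ 0)) _).2 h
    rwa [show 4 * (μ / 4) = μ by ring] at this
  · have e1 : 2 * (2 * (κ : ℤ)) - 4 * δ = 2 * (2 * 1) := by subst hκ; push_cast; ring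
    have e2 : 2 * (κ : ℤ) - 2 * δ = 2 := by subst hκ; push_cast; ring
    rw [e1, e2] at hr
    have hr : Rem (2 * (2 * 1)) (fun t : ℝ => (1 - 2 * (t ^ 2) ^ 2) ^ 3 •
        Ring.inverse ((1 - 2 * (t ^ 2) ^ 2) ^ 3 • M V σ (2 - 4 * (t ^ 2) ^ 2)) -
        ∑ e ∈ Finset.Ico (-(δ : ℤ)) 2, t ^ (2 * e) •
          gradedCoeff (sixteenBlock V) sixteenDeg c e) := hr
    refine ((hr.comp_sqrt.comp_mul (c := 1 / 2) (by norm_num)).comp_sqrt).congr ?_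
    filter_upwards [eventually_pos, eventually_lt one_pos] with μ hμ h1
    rw [hsq μ hμ, hsq2 μ hμ, (inverse_smul_op (pow_ne_zero 3
      (by linarith : (1 - 2 * (μ / 4) : ℝ) ≠ 0)) _).1, show 4 * (μ / 4) = μ by ring]
    congr 1
    refine Finset.sum_congr rfl fun e _ => ?_
    rw [smul_smul, mul_comm, ← mul_zpow, zpow_mul]
    norm_cast
    rw [mul_comm (Real.sqrt μ), hsq μ hμ]

theorem starProjection_eq_zero {A : Submodule ℂ L2} [A.HasOrthogonalProjection]
    (h : ∀ f ∈ A, f = 0) : A.starProjection = 0 := by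
  ext1 f
  exact h _ (A.starProjection_apply_mem f)

theorem eq_zero_or_le {n : ℕ} {X : Fin n → Op} {b : Fin n} (hb : ∀ i, b < i → X i = 0)
    {d : Fin n → ℤ} {δ : ℤ} (h : ∀ i ≤ b, -δ ≤ d i) (i : Fin n) : X i = 0 ∨ -δ ≤ d i := by
  rcases lt_or_ge b i with hi | hi
  · exact Or.inl (hb i hi)
  · exact Or.inr (h i hi)

/-- The scaled coefficient of `μ^e` in the inverse. -/
def halfCoeff {n : ℕ} (X : Fin n → Op) (d : Fin n → ℤ) (c : ℤ → Op) (e : ℤ) : Op :=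
  (1 / 2 : ℝ) ^ e • gradedCoeff X d c e

theorem halfCoeff_mem_shape {n : ℕ} {X p : Fin n → Op}
    (hp : ∀ k i, k ≤ i → p k * X i = X i ∧ X i * p k = X i) {b : Fin n} (hb : ∀ i, b < i → X i = 0)
    (d : Fin n → ℤ) {c : ℤ → Op} (hc : ∀ m < 0, c m = 0) (e : ℤ) (S : Finset (Fin n × Fin n))
    (h : ∀ i j, i ≤ b → j ≤ b → d i + d j ≤ 2 * e → ∃ kl ∈ S, kl.1 ≤ i ∧ kl.2 ≤ j) :
    ∃ A : Fin n × Fin n → Op, halfCoeff X d c e = ∑ kl ∈ S, p kl.1 * A kl * p kl.2 :=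
  (shape p S).smul_mem _ (gradedCoeff_mem_shape hp hb hc fun i j hi hj hd => Or.inl (h i j hi hj hd))

/-! ### The threshold `0` -/

theorem zeroBlock_eq_zero_of_S2 {V : ℤ → ℝ} (h2 : S2 V = 0) : ∀ i, 3 < i → zeroBlock V i = 0 := by
  intro i hi
  obtain rfl : i = 4 := by omega
  exact h2

theorem zeroBlock_eq_zero_of_S1 {V : ℤ → ℝ} (h1 : S1 V = 0) : ∀ i, 2 < i → zeroBlock V i = 0 := by
  have h2 : S2 V = 0 := by rw [← S2_mul_S1, h1, mul_zero]
  intro i hi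
  obtain rfl | rfl : i = 3 ∨ i = 4 := by omega
  · simp [zeroBlock, h1, h2]
  · exact h2

/-- The middle block has degree 0 and all others odd degree, so no power of y links them at leading
order. -/
theorem zero_row_two {V : ℤ → ℝ} (σ : ℤˣ) :
    (∀ j, j ≠ 2 → Even (zeroDeg 2 + zeroDeg j) → zeroBlock V 2 *
      zeroCoeff V σ (-(zeroDeg 2 + zeroDeg j) / 2) * zeroBlock V j = 0) ∧
    ∀ j, j ≠ 2 → Even (zeroDeg 2 + zeroDeg j) → zeroBlock V j *
      zeroCoeff V σ (-(zeroDeg 2 + zeroDeg j) / 2) * zeroBlock V 2 = 0 := by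
  have h : ∀ j, j ≠ 2 → ¬Even (zeroDeg 2 + zeroDeg j) := by decide
  exact ⟨fun j hj he => absurd he (h j hj), fun j hj he => absurd he (h j hj)⟩

/-- The only even-degree partner of block 0 left when S₁ = 0 is block 1, and their entry comes from
M_{-2} = 0. -/
theorem zero_row_zero {V : ℤ → ℝ} (σ : ℤˣ) (hb : ∀ i, 2 < i → zeroBlock V i = 0) :
    (∀ j, j ≠ 0 → Even (zeroDeg 0 + zeroDeg j) → zeroBlock V 0 *
      zeroCoeff V σ (-(zeroDeg 0 + zeroDeg j) / 2) * zeroBlock V j = 0) ∧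
    ∀ j, j ≠ 0 → Even (zeroDeg 0 + zeroDeg j) → zeroBlock V j *
      zeroCoeff V σ (-(zeroDeg 0 + zeroDeg j) / 2) * zeroBlock V 0 = 0 := by
  have h : ∀ j, j ≠ 0 → Even (zeroDeg 0 + zeroDeg j) →
      2 < j ∨ -(zeroDeg 0 + zeroDeg j) / 2 = -2 := by decide
  constructor
  all_goals
    intro j hj he
    rcases h j hj he with h | h
    · simp [hb j h]
    · rw [h, zeroCoeff_neg_two, mul_zero, zero_mul]

theorem zero_regular_expansion {V : ℤ → ℝ} (hw : WSum (vk V 0) 7) (h : ZeroRegular V) :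
    ∀ᶠ μ₀ in 𝓝[>] (0 : ℝ),
      ∃ A01 : Op, ∀ σ : ℤˣ, ∃ A11 A21 A22 A23 A3 : Op,
        InverseExpansion μ₀ (fun μ => M V σ μ)
          (fun μ => S0 V * A01 * S0 V
            + μ • (Q V * A11 * Q V)
            + μ ^ 2 • (Q V * A21 * Q V + S0 V * A22 + A23 * S0 V)
            + μ ^ 3 • A3) 4 := by
  have hz : ∀ f ∈ perpKer (vk V) 2 (S0 V * T0 V), f = 0 := fun f hf =>
    eq_zero_of_zeroRegular (hw.mono (by norm_num)) h hf
  have h1 : S1 V = 0 := starProjection_eq_zero hz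
  have hb := zeroBlock_eq_zero_of_S1 h1
  have hL : ∀ σ, IsUnit (leading (zeroBlock V) zeroDeg (zeroCoeff V σ)) := fun σ =>
    isUnit_zero_leading σ (hw.mono (by norm_num)) fun f hf hT => hz f <| mem_perpKer_iff.2
      ⟨perp_antitone (by norm_num) hf, by rw [mul_apply_eq_comp, hT, map_zero]⟩
  have hX := zeroBlock_mul V
  set X := zeroBlock V
  -- The witness for A₀₁ is built from the sign 1; `compress_inverse_eq` shows below that the sign σ
  -- gives the same operator.
  refine (eventually_all.2 fun σ : ℤˣ => ?_).mono fun μ₀ h =>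
    ⟨X 2 * Ring.inverse (leading X zeroDeg (zeroCoeff V 1)) * X 2, h⟩
  obtain ⟨c, hc, hc0, hu, hr⟩ := zero_inverse_expansion (K := 4) (δ := 0) σ rfl hw
    (eq_zero_or_le hb (by decide)) (hL σ)
  have e0 : halfCoeff X zeroDeg c 0 = S0 V *
      (X 2 * Ring.inverse (leading X zeroDeg (zeroCoeff V 1)) * X 2) * S0 V := by
    have hs0 : S0 V * X 2 = X 2 ∧ X 2 * S0 V = X 2 := zeroProj_mul V 2 2 le_rfl
    have hd : ∀ i j : Fin 5, (i = 2 ∧ j = 2) ∨ 2 < i ∨ 2 < j ∨ 2 * 0 < zeroDeg i + zeroDeg j := by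
      decide
    have hrow := fun σ => mul_leading hX (zero_row_two (V := V) σ).1
    have hcol := fun σ => leading_mul hX (zero_row_two (V := V) σ).2
    have hd2 : zeroDeg 2 = 0 := rfl
    simp only [hd2, neg_zero, zeroCoeff_zero] at hrow hcol
    rw [halfCoeff, gradedCoeff_eq_single hc 2 fun i j => ?_]
    · simp only [hd2, mul_zero, sub_zero, zpow_zero, one_smul, hc0]
      rw [compress_inverse_eq (hL σ) (hL 1) ((hcol σ).trans (hrow 1).symm)
        ((hcol 1).trans (hrow 1).symm)]
      calc _ = (S0 V * X 2) * Ring.inverse (leading X zeroDeg (zeroCoeff V 1)) * (X 2 * S0 V) := by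
            rw [hs0.1, hs0.2]
        _ = _ := by simp only [mul_assoc]
    · rcases hd i j with h | h | h | h
      · exact Or.inl h
      · exact Or.inr (Or.inl (hb i h))
      · exact Or.inr (Or.inr (Or.inl (hb j h)))
      · exact Or.inr (Or.inr (Or.inr h))
  obtain ⟨A1, hA1⟩ := halfCoeff_mem_shape (X := X) (zeroProj_mul V) hb zeroDeg hc 1 {(1, 1)} (by decide)
  -- At order μ² the degrees alone would also allow the blocks (0,1) and (1,0). They have total
  -- degree exactly 4, so their coefficient is the block of L⁻¹ itself, which vanishes because L
  -- commutes with X₀.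
  obtain ⟨A2, hA2⟩ : ∃ A : Fin 5 × Fin 5 → Op, halfCoeff X zeroDeg c 2 =
      ∑ kl ∈ {(1, 1), (2, 0), (0, 2)}, zeroProj V kl.1 * A kl * zeroProj V kl.2 := by
    refine (shape (zeroProj V) _).smul_mem _ (gradedCoeff_mem_shape (zeroProj_mul V) hb hc ?_)
    have hd : ∀ i j : Fin 5, i ≤ 2 → j ≤ 2 → zeroDeg i + zeroDeg j ≤ 2 * 2 →
        (∃ kl ∈ ({(1, 1), (2, 0), (0, 2)} : Finset (Fin 5 × Fin 5)), kl.1 ≤ i ∧ kl.2 ≤ j) ∨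
          (i = 0 ∧ j = 1) ∨ (i = 1 ∧ j = 0) := by decide
    have hcomm := inverse_mul_eq (hL σ) (hL σ) ((leading_mul hX (zero_row_zero σ hb).2).trans
      (mul_leading hX (zero_row_zero σ hb).1).symm)
    rw [← hc0] at hcomm
    have h01 : X 0 * X 1 = 0 := hX 0 1
    have h10 : X 1 * X 0 = 0 := hX 1 0
    intro i j hi hj hij
    rcases hd i j hi hj hij with h | ⟨rfl, rfl⟩ | ⟨rfl, rfl⟩
    · exact Or.inl h
    · right
      change X 0 * c 0 * X 1 = 0
      rw [← hcomm, mul_assoc, h01, mul_zero]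
    · right
      change X 1 * c 0 * X 0 = 0
      rw [mul_assoc, hcomm, ← mul_assoc, h10, zero_mul]
  refine (eventually_inverseExpansion (ℓ := 4) hu (hr.congr (Eventually.of_forall fun μ => ?_))).mono
    fun μ₀ h => ⟨A1 (1, 1), A2 (1, 1), A2 (2, 0), A2 (0, 2), halfCoeff X zeroDeg c 3, h⟩
  change _ - ∑ e ∈ Finset.Ico (-0) (4 : ℤ), μ ^ e • halfCoeff X zeroDeg c e = _
  have hI : Finset.Ico (-0) (4 : ℤ) = {0, 1, 2, 3} := by decide
  rw [hI]
  simp [e0, hA1, hA2, zeroProj]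
  norm_cast
  simp only [add_assoc]

/-- S₂ = 0 leaves degrees at least -1, so δ = 1 and the inverse is no more singular than μ^{-1}. -/
theorem zero_firstKind_expansion {V : ℤ → ℝ} (hw : WSum (vk V 0) 9) (h : ZeroFirstKind V)
    (σ : ℤˣ) :
    ∀ᶠ μ₀ in 𝓝[>] (0 : ℝ), ∃ Am1 A01 A02 A11 A12 A13 A21 A22 A3 : Op,
      InverseExpansion μ₀ (fun μ => M V σ μ)
        (fun μ => μ⁻¹ • (S1 V * Am1 * S1 V)
          + (S0 V * A01 * Q V + Q V * A02 * S0 V)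
          + μ • (S0 V * A11 + A12 * S0 V + Q V * A13 * Q V)
          + μ ^ 2 • (Q V * A21 + A22 * Q V)
          + μ ^ 3 • A3) 4 := by
  have hz : ∀ f ∈ perpKer (vk V) 3 (Q V * T0 V), f = 0 := fun f hf =>
    eq_zero_of_no_half_solution (hw.mono (by norm_num)) h.2 hf
  have hb := zeroBlock_eq_zero_of_S2 (starProjection_eq_zero hz : S2 V = 0)
  have hL : IsUnit (leading (zeroBlock V) zeroDeg (zeroCoeff V σ)) :=
    isUnit_zero_leading σ (hw.mono (by norm_num)) fun f hf hT => hz f <| mem_perpKer_iff.2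
      ⟨perp_antitone (by norm_num) hf, by rw [mul_apply_eq_comp, hT, map_zero]⟩
  obtain ⟨c, hc, -, hu, hr⟩ := zero_inverse_expansion (K := 6) (δ := 1) σ rfl hw
    (eq_zero_or_le hb (by decide)) hL
  have key := halfCoeff_mem_shape (zeroProj_mul V) hb zeroDeg hc
  obtain ⟨Am1, hAm1⟩ := key (-1) {(3, 3)} (by decide)
  obtain ⟨A0, hA0⟩ := key 0 {(2, 1), (1, 2)} (by decide)
  obtain ⟨A1, hA1⟩ := key 1 {(2, 0), (0, 2), (1, 1)} (by decide)
  obtain ⟨A2, hA2⟩ := key 2 {(1, 0), (0, 1)} (by decide)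
  refine (eventually_inverseExpansion (ℓ := 4) hu (hr.congr (Eventually.of_forall fun μ => ?_))).mono
    fun μ₀ h => ⟨Am1 (3, 3), A0 (2, 1), A0 (1, 2), A1 (2, 0), A1 (0, 2), A1 (1, 1), A2 (1, 0),
      A2 (0, 1), halfCoeff (zeroBlock V) zeroDeg c 3, h⟩
  change _ - ∑ e ∈ Finset.Ico (-1) (4 : ℤ), μ ^ e • halfCoeff (zeroBlock V) zeroDeg c e = _
  have hI : Finset.Ico (-1) (4 : ℤ) = {-1, 0, 1, 2, 3} := by decide
  rw [hI]
  simp [hAm1, hA0, hA1, hA2, zeroProj]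
  norm_cast
  simp only [add_assoc]

/-- All five blocks may be present, so δ = 3 and the inverse may reach μ^{-3}; invertibility of L
rests on the absence of ℓ² solutions. -/
theorem zero_secondKind_expansion {V : ℤ → ℝ} (hw : WSum (vk V 0) 13) (h : ZeroSecondKind V)
    (σ : ℤˣ) :
    ∀ᶠ μ₀ in 𝓝[>] (0 : ℝ),
      ∃ Am3 Am21 Am22 Am11 Am12 Am13 A01 A02 A03 A04 A11 A12 A13 A21 A22 A3 : Op,
        InverseExpansion μ₀ (fun μ => M V σ μ)
          (fun μ => (μ ^ 3)⁻¹ • (S2 V * Am3 * S2 V)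
            + (μ ^ 2)⁻¹ • (S2 V * Am21 * S0 V + S0 V * Am22 * S2 V)
            + μ⁻¹ • (S2 V * Am11 * Q V + Q V * Am12 * S2 V + S0 V * Am13 * S0 V)
            + (S2 V * A01 + A02 * S2 V + Q V * A03 * S0 V + S0 V * A04 * Q V)
            + μ • (S0 V * A11 + A12 * S0 V + Q V * A13 * Q V)
            + μ ^ 2 • (Q V * A21 + A22 * Q V)
            + μ ^ 3 • A3) 4 := by
  have hb : ∀ i, 4 < i → zeroBlock V i = 0 := fun i hi => absurd hi (by omega)
  have hL : IsUnit (leading (zeroBlock V) zeroDeg (zeroCoeff V σ)) :=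
    isUnit_zero_leading σ (hw.mono (by norm_num)) fun f hf hT =>
      eq_zero_of_no_l2_solution (hw.mono (by norm_num)) h.2 hf hT
  obtain ⟨c, hc, -, hu, hr⟩ := zero_inverse_expansion (K := 10) (δ := 3) σ rfl hw
    (eq_zero_or_le hb (by decide)) hL
  have key := halfCoeff_mem_shape (zeroProj_mul V) hb zeroDeg hc
  obtain ⟨Am3, hAm3⟩ := key (-3) {(4, 4)} (by decide)
  obtain ⟨Am2, hAm2⟩ := key (-2) {(4, 2), (2, 4)} (by decide)
  obtain ⟨Am1, hAm1⟩ := key (-1) {(4, 1), (1, 4), (2, 2)} (by decide)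
  obtain ⟨A0, hA0⟩ := key 0 {(4, 0), (0, 4), (1, 2), (2, 1)} (by decide)
  obtain ⟨A1, hA1⟩ := key 1 {(2, 0), (0, 2), (1, 1)} (by decide)
  obtain ⟨A2, hA2⟩ := key 2 {(1, 0), (0, 1)} (by decide)
  refine (eventually_inverseExpansion (ℓ := 4) hu (hr.congr (Eventually.of_forall fun μ => ?_))).mono
    fun μ₀ h => ⟨Am3 (4, 4), Am2 (4, 2), Am2 (2, 4), Am1 (4, 1), Am1 (1, 4), Am1 (2, 2), A0 (4, 0),
      A0 (0, 4), A0 (1, 2), A0 (2, 1), A1 (2, 0), A1 (0, 2), A1 (1, 1), A2 (1, 0), A2 (0, 1),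
      halfCoeff (zeroBlock V) zeroDeg c 3, h⟩
  change _ - ∑ e ∈ Finset.Ico (-3) (4 : ℤ), μ ^ e • halfCoeff (zeroBlock V) zeroDeg c e = _
  have hI : Finset.Ico (-3) (4 : ℤ) = {-3, -2, -1, 0, 1, 2, 3} := by decide
  rw [hI]
  have z2 : μ ^ (-2 : ℤ) = (μ ^ 2)⁻¹ := by rw [zpow_neg]; norm_cast
  have z3 : μ ^ (-3 : ℤ) = (μ ^ 3)⁻¹ := by rw [zpow_neg]; norm_cast
  simp [hAm3, hAm2, hAm1, hA0, hA1, hA2, zeroProj, z2, z3]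
  norm_cast
  simp only [add_assoc]

/-! ### The threshold `16` -/

theorem sixteenBlock_eq_zero_of_S1t {V : ℤ → ℝ} (h1 : S1t V = 0) :
    ∀ i, 2 < i → sixteenBlock V i = 0 := by
  intro i hi
  obtain rfl : i = 3 := by omega
  exact h1

theorem sixteenBlock_eq_zero_of_S0t {V : ℤ → ℝ} (h0 : S0t V = 0) :
    ∀ i, 1 < i → sixteenBlock V i = 0 := by
  have h1 : S1t V = 0 := by rw [← S1t_mul_S0t, h0, mul_zero]
  intro i hi
  obtain rfl | rfl : i = 2 ∨ i = 3 := by omega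
  · simp [sixteenBlock, h0, h1]
  · exact h1

theorem sixteen_block_one_three {V : ℤ → ℝ} (σ : ℤˣ) (hw : WSum (vkt V 0) 2) :
    sixteenBlock V 1 * sixteenCoeff V σ 1 * sixteenBlock V 3 = 0 ∧
      sixteenBlock V 3 * sixteenCoeff V σ 1 * sixteenBlock V 1 = 0 := by
  constructor
  · rw [sixteenCoeff_block_one σ hw (isSelfAdjoint_sixteenBlock V 3) (sixteenBlock_toL2 V 1)
      (sixteenBlock_toL2 V 3) (by decide), if_neg (by decide)]
  · rw [sixteenCoeff_block_one σ hw (isSelfAdjoint_sixteenBlock V 1) (sixteenBlock_toL2 V 3)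
      (sixteenBlock_toL2 V 1) (by decide), if_neg (by decide)]

/-- Blocks 1 and 3 couple at leading order only to each other, through the s¹ coefficient, and three
vanishing moments kill that quadratic kernel. -/
theorem sixteen_row {V : ℤ → ℝ} (σ : ℤˣ) (hw : WSum (vkt V 0) 2) {k : Fin 4} (hk : k = 1 ∨ k = 3) :
    (∀ j, j ≠ k → Even (sixteenDeg k + sixteenDeg j) → sixteenBlock V k *
      sixteenCoeff V σ (-(sixteenDeg k + sixteenDeg j) / 2) * sixteenBlock V j = 0) ∧
    ∀ j, j ≠ k → Even (sixteenDeg k + sixteenDeg j) → sixteenBlock V j *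
      sixteenCoeff V σ (-(sixteenDeg k + sixteenDeg j) / 2) * sixteenBlock V k = 0 := by
  have h : ∀ k j : Fin 4, (k = 1 ∨ k = 3) → j ≠ k → Even (sixteenDeg k + sixteenDeg j) →
      ((k = 1 ∧ j = 3) ∨ (k = 3 ∧ j = 1)) ∧ -(sixteenDeg k + sixteenDeg j) / 2 = 1 := by decide
  obtain ⟨h13, h31⟩ := sixteen_block_one_three σ hw
  constructor
  all_goals
    intro j hj he
    obtain ⟨⟨rfl, rfl⟩ | ⟨rfl, rfl⟩, h2⟩ := h k j hk hj he
    all_goals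
      rw [h2]
      assumption

theorem sixteenCoeff_two_eq {V : ℤ → ℝ} (hw : WSum (vkt V 0) 3) (σ τ : ℤˣ) :
    sixteenCoeff V σ 2 = sixteenCoeff V τ 2 := by
  ext f n
  rw [sixteenCoeff_two_apply σ hw, sixteenCoeff_two_apply τ hw]

theorem sixteen_compress_inverse {V : ℤ → ℝ} (hw : WSum (vkt V 0) 3)
    (hL : ∀ σ, IsUnit (leading (sixteenBlock V) sixteenDeg (sixteenCoeff V σ))) {k : Fin 4}
    (hk : k = 1 ∨ k = 3) (σ τ : ℤˣ) :
    sixteenBlock V k * Ring.inverse (leading (sixteenBlock V) sixteenDeg (sixteenCoeff V σ)) *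
        sixteenBlock V k =
      sixteenBlock V k * Ring.inverse (leading (sixteenBlock V) sixteenDeg (sixteenCoeff V τ)) *
        sixteenBlock V k := by
  have hw2 := hw.mono (show 2 ≤ 3 by norm_num)
  have hrow := fun σ => mul_leading (sixteenBlock_mul V) (sixteen_row (V := V) σ hw2 hk).1
  have hcol := fun σ => leading_mul (sixteenBlock_mul V) (sixteen_row (V := V) σ hw2 hk).2
  have hind : sixteenCoeff V σ (-sixteenDeg k) = sixteenCoeff V τ (-sixteenDeg k) := by
    rcases hk with rfl | rfl
    · exact (sixteenCoeff_zero σ (hw.mono (by norm_num))).trans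
        (sixteenCoeff_zero τ (hw.mono (by norm_num))).symm
    · exact sixteenCoeff_two_eq hw σ τ
  refine compress_inverse_eq (hL σ) (hL τ) ?_ ((hcol τ).trans (hrow τ).symm)
  rw [hcol, hrow, hind]

theorem sixteenProj_compress (V : ℤ → ℝ) (k : Fin 4) (A : Op) :
    sixteenProj V k * (sixteenBlock V k * A * sixteenBlock V k) * sixteenProj V k =
      sixteenBlock V k * A * sixteenBlock V k := by
  obtain ⟨h1, h2⟩ := sixteenProj_mul V k k le_rfl
  rw [mul_assoc, mul_assoc, h2, ← mul_assoc, ← mul_assoc, h1]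

theorem sixteen_regular_expansion {V : ℤ → ℝ} (hw : WSum (vkt V 0) 3) (h : SixteenRegular V) :
    ∀ᶠ μ₀ in 𝓝[>] (0 : ℝ), ∃ B01 : Op, ∀ σ : ℤˣ, ∃ B1 : Op,
      InverseExpansion μ₀ (fun μ => M V σ (2 - μ))
        (fun μ => Qt V * B01 * Qt V + Real.sqrt μ • B1) 1 := by
  have hz : ∀ f ∈ perpKer (vkt V) 1 (Qt V * T0t V), f = 0 := fun f hf =>
    eq_zero_of_sixteenRegular (hw.mono (by norm_num)) h hf
  have hb := sixteenBlock_eq_zero_of_S0t (starProjection_eq_zero hz : S0t V = 0)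
  have hL : ∀ σ, IsUnit (leading (sixteenBlock V) sixteenDeg (sixteenCoeff V σ)) := fun σ =>
    isUnit_sixteen_leading σ (hw.mono (by norm_num)) fun f hf _ => hz f (S1t_le_S0t V hf)
  refine (eventually_all.2 fun σ : ℤˣ => ?_).mono fun μ₀ h => ⟨sixteenBlock V 1 *
    Ring.inverse (leading (sixteenBlock V) sixteenDeg (sixteenCoeff V 1)) * sixteenBlock V 1, h⟩
  obtain ⟨c, hc, hc0, hu, hr⟩ := sixteen_inverse_expansion (κ := 1) (δ := 0) σ rfl (by norm_num) hw
    (eq_zero_or_le hb (by decide)) (hL σ)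
  have e0 : halfCoeff (sixteenBlock V) sixteenDeg c 0 = Qt V * (sixteenBlock V 1 *
      Ring.inverse (leading (sixteenBlock V) sixteenDeg (sixteenCoeff V 1)) *
        sixteenBlock V 1) * Qt V := by
    have hd : ∀ i j : Fin 4, (i = 1 ∧ j = 1) ∨ 1 < i ∨ 1 < j ∨
        2 * 0 < sixteenDeg i + sixteenDeg j := by decide
    refine Eq.trans ?_ (sixteenProj_compress V 1 _).symm
    rw [← sixteen_compress_inverse hw hL (Or.inl rfl) σ, ← hc0, halfCoeff,
      gradedCoeff_eq_single hc 1 fun i j => (hd i j).imp_right (Or.imp (hb i) (Or.imp_left (hb j))),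
      zpow_zero, one_smul]
    rfl
  refine (eventually_inverseExpansion (ℓ := 1) hu (hr.congr (Eventually.of_forall fun μ => ?_))).mono
    fun μ₀ h => ⟨halfCoeff (sixteenBlock V) sixteenDeg c 1, h⟩
  change _ - ∑ e ∈ Finset.Ico (-0) (2 : ℤ), Real.sqrt μ ^ e •
    halfCoeff (sixteenBlock V) sixteenDeg c e = _
  have hI : Finset.Ico (-0) (2 : ℤ) = {0, 1} := by decide
  rw [hI]
  simp [e0]

theorem sixteen_resonance_expansion {V : ℤ → ℝ} (hw : WSum (vkt V 0) 5) (h : SixteenResonance V)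
    (σ : ℤˣ) :
    ∀ᶠ μ₀ in 𝓝[>] (0 : ℝ), ∃ Bm1 B01 B02 B03 B1 : Op,
      InverseExpansion μ₀ (fun μ => M V σ (2 - μ))
        (fun μ => (Real.sqrt μ)⁻¹ • (S0t V * Bm1 * S0t V)
          + (S0t V * B01 + B02 * S0t V + Qt V * B03 * Qt V)
          + Real.sqrt μ • B1) 1 := by
  have hz : ∀ f ∈ perpKer (vkt V) 2 (T0t V), f = 0 := fun f hf =>
    eq_zero_of_no_l2_solution_sixteen (hw.mono (by norm_num)) h.2 hf
  have hb := sixteenBlock_eq_zero_of_S1t (starProjection_eq_zero hz : S1t V = 0)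
  have hL := isUnit_sixteen_leading σ (hw.mono (by norm_num)) fun f hf _ => hz f hf
  obtain ⟨c, hc, -, hu, hr⟩ := sixteen_inverse_expansion (κ := 2) (δ := 1) σ rfl (by norm_num) hw
    (eq_zero_or_le hb (by decide)) hL
  have key := halfCoeff_mem_shape (sixteenProj_mul V) hb sixteenDeg hc
  obtain ⟨Bm1, hBm1⟩ := key (-1) {(2, 2)} (by decide)
  obtain ⟨B0, hB0⟩ := key 0 {(2, 0), (0, 2), (1, 1)} (by decide)
  refine (eventually_inverseExpansion (ℓ := 1) hu (hr.congr (Eventually.of_forall fun μ => ?_))).mono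
    fun μ₀ h => ⟨Bm1 (2, 2), B0 (2, 0), B0 (0, 2), B0 (1, 1),
      halfCoeff (sixteenBlock V) sixteenDeg c 1, h⟩
  change _ - ∑ e ∈ Finset.Ico (-1) (2 : ℤ), Real.sqrt μ ^ e •
    halfCoeff (sixteenBlock V) sixteenDeg c e = _
  have hI : Finset.Ico (-1) (2 : ℤ) = {-1, 0, 1} := by decide
  rw [hI]
  simp [hBm1, hB0, sixteenProj]
  simp only [add_assoc]

theorem sixteen_eigenvalue_expansion {V : ℤ → ℝ} (hw : WSum (vkt V 0) 7) :
    ∀ᶠ μ₀ in 𝓝[>] (0 : ℝ), ∃ Bm2 : Op, ∀ σ : ℤˣ, ∃ Bm11 Bm12 B01 B02 B1 : Op,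
      InverseExpansion μ₀ (fun μ => M V σ (2 - μ))
        (fun μ => μ⁻¹ • (S1t V * Bm2 * S1t V)
          + (Real.sqrt μ)⁻¹ • (S0t V * Bm11 * Qt V + Qt V * Bm12 * S0t V)
          + (Qt V * B01 + B02 * Qt V)
          + Real.sqrt μ • B1) 1 := by
  have hb : ∀ i, 3 < i → sixteenBlock V i = 0 := fun i hi => absurd hi (by omega)
  have hL : ∀ σ, IsUnit (leading (sixteenBlock V) sixteenDeg (sixteenCoeff V σ)) := fun σ =>
    isUnit_sixteen_leading σ (hw.mono (by norm_num)) (sixteen_positivity σ (hw.mono (by norm_num)))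
  -- The factor 4 is (1/2)^{-2}, from s = √μ/2.
  refine (eventually_all.2 fun σ : ℤˣ => ?_).mono fun μ₀ h => ⟨(4 : ℝ) • (sixteenBlock V 3 *
    Ring.inverse (leading (sixteenBlock V) sixteenDeg (sixteenCoeff V 1)) * sixteenBlock V 3), h⟩
  obtain ⟨c, hc, hc0, hu, hr⟩ := sixteen_inverse_expansion (κ := 3) (δ := 2) σ rfl (by norm_num) hw
    (eq_zero_or_le hb (by decide)) (hL σ)
  have e2 : halfCoeff (sixteenBlock V) sixteenDeg c (-2) = S1t V * ((4 : ℝ) • (sixteenBlock V 3 *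
      Ring.inverse (leading (sixteenBlock V) sixteenDeg (sixteenCoeff V 1)) *
        sixteenBlock V 3)) * S1t V := by
    have hd : ∀ i j : Fin 4, (i = 3 ∧ j = 3) ∨ 3 < i ∨ 3 < j ∨
        2 * -2 < sixteenDeg i + sixteenDeg j := by decide
    rw [mul_smul_comm, smul_mul_assoc]
    refine Eq.trans ?_ (congrArg ((4 : ℝ) • ·) (sixteenProj_compress V 3 _).symm)
    rw [← sixteen_compress_inverse (hw.mono (by norm_num)) hL (Or.inr rfl) σ, ← hc0, halfCoeff,
      gradedCoeff_eq_single hc 3 fun i j => (hd i j).imp_right (Or.imp (hb i) (Or.imp_left (hb j)))]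
    congr 1
    norm_num [zpow_neg, zpow_ofNat]
  have key := halfCoeff_mem_shape (sixteenProj_mul V) hb sixteenDeg hc
  obtain ⟨Bm1, hBm1⟩ := key (-1) {(2, 1), (1, 2)} (by decide)
  obtain ⟨B0, hB0⟩ := key 0 {(1, 0), (0, 1)} (by decide)
  refine (eventually_inverseExpansion (ℓ := 1) hu (hr.congr ?_)).mono
    fun μ₀ h => ⟨Bm1 (2, 1), Bm1 (1, 2), B0 (1, 0), B0 (0, 1),
      halfCoeff (sixteenBlock V) sixteenDeg c 1, h⟩
  filter_upwards [eventually_pos] with μ hμ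
  change _ - ∑ e ∈ Finset.Ico (-2) (2 : ℤ), Real.sqrt μ ^ e •
    halfCoeff (sixteenBlock V) sixteenDeg c e = _
  have hI : Finset.Ico (-2) (2 : ℤ) = {-2, -1, 0, 1} := by decide
  have z2 : Real.sqrt μ ^ (-2 : ℤ) = μ⁻¹ := by
    rw [zpow_neg, zpow_ofNat, Real.sq_sqrt hμ.le]
  rw [hI, Finset.sum_insert (by decide), e2, z2]
  simp [hBm1, hB0, sixteenProj]
  simp only [add_assoc]

end BiLap

end

/-! ### The six cases on a common interval. -/

open BiLap
theorem theorem1p3 (V : ℤ → ℝ) (β : ℝ) (hβ : 0 < β)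
    (hV : ∃ C : ℝ, ∀ n : ℤ, |V n| ≤ C * bracket n ^ (-β)) :
    ∃ μ₀ ∈ Set.Ioo (0 : ℝ) 1,
      (ZeroRegular V → 15 < β →
        ∃ A01 : Op, ∀ σ : ℤˣ, ∃ A11 A21 A22 A23 A3 : Op,
          InverseExpansion μ₀ (fun μ => M V σ μ)
            (fun μ => S0 V * A01 * S0 V
              + μ • (Q V * A11 * Q V)
              + μ ^ 2 • (Q V * A21 * Q V + S0 V * A22 + A23 * S0 V)
              + μ ^ 3 • A3) 4) ∧
      (ZeroFirstKind V → 19 < β →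
        ∀ σ : ℤˣ, ∃ Am1 A01 A02 A11 A12 A13 A21 A22 A3 : Op,
          InverseExpansion μ₀ (fun μ => M V σ μ)
            (fun μ => μ⁻¹ • (S1 V * Am1 * S1 V)
              + (S0 V * A01 * Q V + Q V * A02 * S0 V)
              + μ • (S0 V * A11 + A12 * S0 V + Q V * A13 * Q V)
              + μ ^ 2 • (Q V * A21 + A22 * Q V)
              + μ ^ 3 • A3) 4) ∧
      (ZeroSecondKind V → 27 < β →
        ∀ σ : ℤˣ, ∃ Am3 Am21 Am22 Am11 Am12 Am13 A01 A02 A03 A04 A11 A12 A13 A21 A22 A3 : Op,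
          InverseExpansion μ₀ (fun μ => M V σ μ)
            (fun μ => (μ ^ 3)⁻¹ • (S2 V * Am3 * S2 V)
              + (μ ^ 2)⁻¹ • (S2 V * Am21 * S0 V + S0 V * Am22 * S2 V)
              + μ⁻¹ • (S2 V * Am11 * Q V + Q V * Am12 * S2 V + S0 V * Am13 * S0 V)
              + (S2 V * A01 + A02 * S2 V + Q V * A03 * S0 V + S0 V * A04 * Q V)
              + μ • (S0 V * A11 + A12 * S0 V + Q V * A13 * Q V)
              + μ ^ 2 • (Q V * A21 + A22 * Q V)
              + μ ^ 3 • A3) 4) ∧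
      (SixteenRegular V → 7 < β →
        ∃ B01 : Op, ∀ σ : ℤˣ, ∃ B1 : Op,
          InverseExpansion μ₀ (fun μ => M V σ (2 - μ))
            (fun μ => Qt V * B01 * Qt V + Real.sqrt μ • B1) 1) ∧
      (SixteenResonance V → 11 < β →
        ∀ σ : ℤˣ, ∃ Bm1 B01 B02 B03 B1 : Op,
          InverseExpansion μ₀ (fun μ => M V σ (2 - μ))
            (fun μ => (Real.sqrt μ)⁻¹ • (S0t V * Bm1 * S0t V)
              + (S0t V * B01 + B02 * S0t V + Qt V * B03 * Qt V)
              + Real.sqrt μ • B1) 1) ∧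
      (SixteenEigenvalue V → 15 < β →
        ∃ Bm2 : Op, ∀ σ : ℤˣ, ∃ Bm11 Bm12 B01 B02 B1 : Op,
          InverseExpansion μ₀ (fun μ => M V σ (2 - μ))
            (fun μ => μ⁻¹ • (S1t V * Bm2 * S1t V)
              + (Real.sqrt μ)⁻¹ • (S0t V * Bm11 * Qt V + Qt V * Bm12 * S0t V)
              + (Qt V * B01 + B02 * Qt V)
              + Real.sqrt μ • B1) 1) := by
  have hwp : ∀ {p : ℕ}, 2 * (p : ℝ) + 1 < β → WSum (vk V 0) p := fun hp => wSum_vk hV hp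
  -- A case whose hypotheses fail holds for every μ₀, so all six become statements about small μ₀
  -- and can be intersected.
  have imp : ∀ {P R : Prop} {S : ℝ → Prop}, (P → R → ∀ᶠ μ₀ in 𝓝[>] (0 : ℝ), S μ₀) →
      ∀ᶠ μ₀ in 𝓝[>] (0 : ℝ), P → R → S μ₀ := by
    intro P R S h
    by_cases hP : P
    · by_cases hR : R
      · exact (h hP hR).mono fun _ hS _ _ => hS
      · exact Eventually.of_forall fun _ _ h => absurd h hR
    · exact Eventually.of_forall fun _ h => absurd h hP
  obtain ⟨μ₀, h0, h1, h⟩ := (eventually_pos.and ((eventually_lt one_pos).and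
    ((imp fun h (hb : 15 < β) => zero_regular_expansion (V := V) (hwp (by norm_num; linarith)) h).and
    ((imp fun h (hb : 19 < β) => eventually_all.2 fun σ => zero_firstKind_expansion (V := V)
      (hwp (by norm_num; linarith)) h σ).and
    ((imp fun h (hb : 27 < β) => eventually_all.2 fun σ => zero_secondKind_expansion (V := V)
      (hwp (by norm_num; linarith)) h σ).and
    ((imp fun h (hb : 7 < β) => sixteen_regular_expansion (V := V) (hwp (by norm_num; linarith)).vkt h).and
    ((imp fun h (hb : 11 < β) => eventually_all.2 fun σ => sixteen_resonance_expansion (V := V)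
      (hwp (by norm_num; linarith)).vkt h σ).and
    (imp fun (_ : SixteenEigenvalue V) (hb : 15 < β) => sixteen_eigenvalue_expansion (V := V)
      (hwp (by norm_num; linarith)).vkt)))))))).exists
  exact ⟨μ₀, ⟨h0, h1⟩, h⟩
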